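/- Proposition (the-lower-bound). Let $A:\mathbb R^3\to\mathbb R^3$ and $V:\mathbb R^3\to\mathbb R$ satisfy $A_k\in L^2_{\rm loc}(\mathbb R^3)$ for $k=1,2,3$, $V\in L^1_{\rm loc}(\mathbb R^3)$, and suppose that for every $\varepsilon>0$ there is $C_\varepsilon$ with $$|\langle\varphi,V\varphi\rangle|\le \varepsilon\|\nabla\varphi\|^2+C_\varepsilon\|\varphi\|^2\qquad\text{for all }\varphi\in C_0^\infty(\mathbb R^3),\qquad \langle\varphi,V\varphi\rangle:=\int V|\varphi|^2\,dx .$$ Let $D_A=-i\nabla+A$ and $H^1_A(\mathbb R^3)=\{\varphi\in L^2(\mathbb R^3): D_A\varphi\in L^2(\mathbb R^3)\}$ (distributional derivatives). The form $\langle\varphi,V\varphi\rangle$ extends from its core $C_0^\infty(\mathbb R^3)$ continuously to $H^1_A(\mathbb R^3)$, and $\langle\varphi,(D_A^2+V)\varphi\rangle:=\|D_A\varphi\|^2+\langle\varphi,V\varphi\rangle$ on $H^1_A(\mathbb R^3)$. For $\alpha>0$ let $$E_P(A,V,\alpha)=\inf\Big\{\langle\varphi,(D_A^2+V)\varphi\rangle-\alpha\iint\frac{|\varphi(x)|^2|\varphi(y)|^2}{|x-y|}\,dx\,dy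 \;:\; \varphi\in H^1_A(\mathbb R^3),\ \|\varphi\|=1\Big\}.$$ Let $\mathcal F$ be the symmetric Fock space over $L^2(\mathbb R^3)$, let $\mathcal F_0\subset\mathcal F$ be the space of vectors $(\eta^{(n)})_{n\ge0}$ with only finitely many non-zero components, each $\eta^{(n)}$ being continuous with compact support on $\mathbb R^{3n}$, and let $\mathcal Q=H^1_A(\mathbb R^3)\otimes\mathcal F_0\subset L^2(\mathbb R^3)\otimes\mathcal F$ (algebraic tensor product). With $(a(k)\eta)^{(n)}(k_1,\dots,k_n)=\sqrt{n+1}\,\eta^{(n+1)}(k,k_1,\dots,k_n)$ set, for $\psi\in\mathcal Q$, $$H(\psi)=\langle\psi,(D_A^2+V)\psi\rangle+\int\|a(k)\psi\|^2\,dk+\frac{\sqrt\alpha}{\sqrt2\,\pi}\int\frac{dk}{|k|}\big(\langle\psi,e^{ikx}a(k)\psi\rangle+\langle e^{ikx}a(k)\psi,\psi\rangle\big),$$ and $E(A,V,\alpha)=\inf\{H(\psi):\psi\in\mathcal Q,\ \|\psi\|=1\}$. Then there are constants $C$ and $\alpha_0$, independent of $A$ and $V$, such that for all $\alpha\ge\alpha_0$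 and all $A,V$ as above, with $\beta=1-\alpha^{-1/5}$, the infima $E(A,V,\alpha)$ and $E_P(A,\beta^{-1}V,\alpha\beta^{-2})$ are finite and $$E(A,V,\alpha)\ \ge\ \beta\,E_P(A,\beta^{-1}V,\alpha\beta^{-2})-C\,\alpha^{9/5}.$$ -/

import Mathlib

open MeasureTheory Filter Topology
open scoped ContDiff ComplexConjugate

/-- Physical space (and momentum space) `ℝ³` with its Euclidean norm and Lebesgue measure. -/
abbrev E3 : Type := EuclideanSpace ℝ (Fin 3)

namespace Polaron

/-- Complex-valued test functions, `C₀^∞(ℝ³)`: smooth with compact support. -/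
abbrev TestFn : Type := {u : E3 → ℂ // ContDiff ℝ ∞ u ∧ HasCompactSupport u}

/-- The classical partial derivative `∂_j u`. -/
noncomputable def pderiv (j : Fin 3) (u : E3 → ℂ) (x : E3) : ℂ :=
  fderiv ℝ u x (EuclideanSpace.single j 1)

/-- Standing assumptions on the potentials: `A ∈ L²_loc`, `V ∈ L¹_loc`, and `V` is infinitesimally
form bounded with respect to `-Δ` on `C₀^∞(ℝ³)`. -/
structure Admissible (A : E3 → E3) (V : E3 → ℝ) : Prop where
  memLp_A : ∀ K : Set E3, IsCompact K → ∀ j : Fin 3,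
    MemLp (fun x => A x j) 2 (volume.restrict K)
  locallyIntegrable_V : LocallyIntegrable V volume
  form_bound : ∀ ε : ℝ, 0 < ε → ∃ C : ℝ, ∀ u : TestFn,
    |∫ x, V x * ‖u.1 x‖ ^ 2| ≤ ε * (∑ j, ∫ x, ‖pderiv j u.1 x‖ ^ 2) + C * ∫ x, ‖u.1 x‖ ^ 2

/-- `g = (-i∂_j + A_j) φ` in the sense of distributions. -/
def IsCovDeriv (A : E3 → E3) (j : Fin 3) (φ g : E3 → ℂ) : Prop :=
  ∀ u : TestFn, ∫ x, g x * u.1 x =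
    ∫ x, φ x * (Complex.I * pderiv j u.1 x + (A x j : ℂ) * u.1 x)

/-- `φ ∈ H¹_A(ℝ³)`, i.e. `φ ∈ L²` and `D_A φ ∈ L²`. -/
def MemH1A (A : E3 → E3) (φ : E3 → ℂ) : Prop :=
  MemLp φ 2 volume ∧ ∀ j, ∃ g : E3 → ℂ, MemLp g 2 volume ∧ IsCovDeriv A j φ g

open Classical in
/-- The `j`-th component of `D_A φ` for `φ ∈ H¹_A` (unique up to a null set). -/
noncomputable def covDeriv (A : E3 → E3) (j : Fin 3) (φ : E3 → ℂ) : E3 → ℂ :=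
  if h : ∃ g : E3 → ℂ, MemLp g 2 volume ∧ IsCovDeriv A j φ g then h.choose else 0

/-- `‖D_A φ‖²`. -/
noncomputable def kineticForm (A : E3 → E3) (φ : E3 → ℂ) : ℝ :=
  ∑ j, ∫ x, ‖covDeriv A j φ x‖ ^ 2

/-- The squared norm `‖φ‖² + ‖D_A φ‖²` of `H¹_A`. -/
noncomputable def h1NormSq (A : E3 → E3) (φ : E3 → ℂ) : ℝ :=
  (∫ x, ‖φ x‖ ^ 2) + kineticForm A φ

/-- Test functions converging to `φ` in the norm of `H¹_A`. -/
noncomputable def coreFilter (A : E3 → E3) (φ : E3 → ℂ) : Filter TestFn :=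
  comap (fun u : TestFn => h1NormSq A (fun x => u.1 x - φ x)) (𝓝 0)

/-- `⟨φ, V φ⟩` for `φ ∈ H¹_A`: the continuous extension to `H¹_A` of the form `u ↦ ∫ V |u|²`
on the form core `C₀^∞`. (For `φ ∈ H¹_A` the function `V |φ|²` need not be integrable, since only
the form of `V`, not that of `|V|`, is assumed to be bounded.) -/
noncomputable def potentialForm (A : E3 → E3) (V : E3 → ℝ) (φ : E3 → ℂ) : ℝ :=
  limUnder (coreFilter A φ) (fun u : TestFn => ∫ x, V x * ‖u.1 x‖ ^ 2)

/-- The quadratic form `⟨φ, (D_A² + V) φ⟩` on `H¹_A`. -/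
noncomputable def schrodingerForm (A : E3 → E3) (V : E3 → ℝ) (φ : E3 → ℂ) : ℝ :=
  kineticForm A φ + potentialForm A V φ

/-! ### The Pekar functional -/

/-- The Pekar functional with coupling constant `α`. -/
noncomputable def pekarFunctional (A : E3 → E3) (V : E3 → ℝ) (α : ℝ) (φ : E3 → ℂ) : ℝ :=
  schrodingerForm A V φ - α * ∫ x, ∫ y, ‖φ x‖ ^ 2 * ‖φ y‖ ^ 2 / ‖x - y‖

/-- The values of the Pekar functional on the `L²`-unit sphere of `H¹_A`. -/
def pekarValues (A : E3 → E3) (V : E3 → ℝ) (α : ℝ) : Set ℝ :=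
  {e | ∃ φ : E3 → ℂ, MemH1A A φ ∧ ∫ x, ‖φ x‖ ^ 2 = 1 ∧ e = pekarFunctional A V α φ}

/-- The Pekar energy `E_P(A, V, α)`. -/
noncomputable def pekarEnergy (A : E3 → E3) (V : E3 → ℝ) (α : ℝ) : ℝ :=
  sInf (pekarValues A V α)

/-! ### The Fröhlich model

A vector of `L²(ℝ³) ⊗ 𝓕` is given by its components `ψ n x K`, where `n` is the number of
phonons, `x` the electron position and `K = (k₁, …, kₙ)` the phonon momenta. -/

/-- Component functions of a Fock space vector. -/
abbrev FockFn : Type := (n : ℕ) → (Fin n → E3) → ℂ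

/-- Component functions of a vector of `L²(ℝ³) ⊗ 𝓕`. -/
abbrev StateFn : Type := (n : ℕ) → E3 → (Fin n → E3) → ℂ

/-- The space `𝓕₀`: finitely many non-zero components, each of them symmetric, continuous and
of compact support. -/
structure IsFockCore (η : FockFn) : Prop where
  continuous : ∀ n, Continuous (η n)
  hasCompactSupport : ∀ n, HasCompactSupport (η n)
  symmetric : ∀ n (σ : Equiv.Perm (Fin n)) (K : Fin n → E3), η n (K ∘ σ) = η n K
  finite : ∃ N : ℕ, ∀ n, N ≤ n → η n = 0

/-- The form domain `𝓠 = H¹_A ⊗ 𝓕₀` (algebraic tensor product: finite sums of `φ ⊗ η`). -/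
def MemQ (A : E3 → E3) (ψ : StateFn) : Prop :=
  ∃ (m : ℕ) (φ : Fin m → E3 → ℂ) (η : Fin m → FockFn),
    (∀ i, MemH1A A (φ i)) ∧ (∀ i, IsFockCore (η i)) ∧
      ∀ n x K, ψ n x K = ∑ i, φ i x * η i n K

/-- The inner product of `L²(ℝ³) ⊗ 𝓕`, antilinear in the first argument. -/
noncomputable def innerState (ψ χ : StateFn) : ℂ :=
  ∑' n, ∫ x, ∫ K, conj (ψ n x K) * χ n x K

/-- The squared norm of `L²(ℝ³) ⊗ 𝓕`. -/
noncomputable def normSqState (ψ : StateFn) : ℝ :=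
  ∑' n, ∫ x, ∫ K, ‖ψ n x K‖ ^ 2

/-- The annihilation operator `a(k)`. -/
noncomputable def annihilate (k : E3) (ψ : StateFn) : StateFn :=
  fun n x K => (Real.sqrt (n + 1) : ℂ) * ψ (n + 1) x (Fin.cons k K)

/-- The multiplication operator `e^{ikx}`. -/
noncomputable def planeWave (k : E3) (ψ : StateFn) : StateFn :=
  fun n x K => Complex.exp (Complex.I * (inner ℝ k x : ℝ)) * ψ n x K

/-- `⟨ψ, (D_A² + V) ψ⟩`, the form of `(D_A² + V) ⊗ 1`. -/
noncomputable def electronForm (A : E3 → E3) (V : E3 → ℝ) (ψ : StateFn) : ℝ :=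
  ∑' n, ∫ K, schrodingerForm A V (fun x => ψ n x K)

/-- The form `N(ψ) = ∫ ‖a(k) ψ‖² dk` of the number operator. -/
noncomputable def numberForm (ψ : StateFn) : ℝ :=
  ∫ k, normSqState (annihilate k ψ)

/-- The electron-phonon interaction `W(ψ)`. -/
noncomputable def interactionForm (ψ : StateFn) : ℝ :=
  1 / (Real.sqrt 2 * Real.pi) * ∫ k : E3, 1 / ‖k‖ *
    (innerState ψ (planeWave k (annihilate k ψ)) +
      innerState (planeWave k (annihilate k ψ)) ψ).re

/-- The Fröhlich form `H(ψ)`. -/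
noncomputable def frohlichForm (A : E3 → E3) (V : E3 → ℝ) (α : ℝ) (ψ : StateFn) : ℝ :=
  electronForm A V ψ + numberForm ψ + Real.sqrt α * interactionForm ψ

/-- The values of the Fröhlich form on the unit sphere of `𝓠`. -/
def frohlichValues (A : E3 → E3) (V : E3 → ℝ) (α : ℝ) : Set ℝ :=
  {e | ∃ ψ : StateFn, MemQ A ψ ∧ normSqState ψ = 1 ∧ e = frohlichForm A V α ψ}

/-- The ground state energy `E(A, V, α)` of the Fröhlich polaron. -/
noncomputable def frohlichEnergy (A : E3 → E3) (V : E3 → ℝ) (α : ℝ) : ℝ :=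
  sInf (frohlichValues A V α)

end Polaron

/-! At strong coupling the phonon field behaves like a classical field. Minimizing over a classical
field turns the interaction into the Coulomb self-attraction of the electron density, and what
remains is the Pekar functional. The proof makes this quantitative in the manner of Lieb and Thomas.
The field is reduced to finitely many modes, of order `α^(9/5)` of them, and each mode is made
classical by coherent states at the price of at most one unit of energy.

Momentum space is split into three regions. For momenta beyond a cutoff of order `α^(6/5)`, `k_a
exp(ikx)` is a commutator of the plane wave with `D_A`. The interaction there is therefore
controlled by the fraction `s = α^(-1/5)` of the kinetic energy together with the phonon number of
that region (`coord_mul_waveFT`, `uv_bound`). This leaves the factor `β = 1 - s` in front of the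
kinetic energy. Momenta near the origin are removed by completing a square (`ir_bound`). The momenta
in between are divided into cubes of side `P = α^(3/5)`. In order to replace the plane waves in a
cube by a single phase, the electron is first confined to balls of radius `L = α^(-9/10)`. Averaging
over the centre of the ball costs an energy of order `L⁻²` (`BlockData.bound`). Once the electron is
confined, `BlockData.modes_le` replaces each cube by one mode, using a fraction `δ` of the field
energy to pay for the error.

For finitely many modes `coherent_modes` reduces the lower bound to a statement about classical
amplitudes `z b`. It rests on a Gaussian average in which anti-normally ordered expressions are
represented exactly. In the classical problem the square is completed in each amplitude
(`BlockData.electron_bound`). The resulting sum over cubes is compared with the Coulomb energy of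
the density by `BlockData.sum_charge_le`, which relies on the identity `lintegral_chargeFT`. The
losses in this step amount to a factor `(1 + δ) / (1 - δ) ≤ β⁻¹` in front of the Coulomb energy.
Extracting `β` from the whole functional gives the Pekar problem with potential `β⁻¹ V` and coupling
`α β⁻²`.

These estimates are carried out for finite sums of test functions tensored with bounded Fock
vectors. Measurable bounded vectors are used because the cube modes are not continuous. Passage to
the form domain needs the density of test functions in `H¹_A` (`exists_test_approx`) and the
continuity of the form of `V` there, which follows from the diamagnetic inequality
(`Admissible.potT_le`, `Admissible.tendsto_potT`); `lower_bound_of_test` combines them. The error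
constants involve only the area of the sphere and one fixed bump function, since `V` is carried
along unchanged and `A` enters only through covariant derivatives. -/

namespace Polaron

/-! ### Coherent states and anti-normal ordering, algebraically -/

section Coherent

variable {D : Type*} [AddCommGroup D] [Module ℂ D]

/-- `a` and `ad` are adjoint to each other with respect to the sesquilinear form `H`. -/
def FormCompat (a ad : D →ₗ[ℂ] D) (H : D →ₗ⋆[ℂ] D →ₗ[ℂ] ℂ) : Prop :=
  (∀ ψ χ, H (ad ψ) χ = H ψ (a χ)) ∧ ∀ ψ χ, H (a ψ) χ = H ψ (ad χ)

/-- Moving `a` past one factor `ad` leaves one copy of the remaining power, as in differentiating a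
monomial; `e` plays the role of a vacuum. At `n = 0` the truncated exponent is harmless because its
coefficient vanishes. -/
lemma annih_creation_pow (a ad : D →ₗ[ℂ] D) (ccr : ∀ ψ, a (ad ψ) = ad (a ψ) + ψ)
    (n : ℕ) (e : D) (he : a e = 0) : a ((ad ^ n) e) = (n : ℂ) • (ad ^ (n - 1)) e := by
  induction n with
  | zero => simp [he]
  | succ n ih =>
    rw [pow_succ', Module.End.mul_apply, ccr, ih]
    rcases n with _ | n
    · simp
    · simp only [Nat.add_sub_cancel, map_smul]
      rw [← Module.End.mul_apply, ← pow_succ']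
      push_cast
      module

lemma annih_pow_creation_pow (a ad : D →ₗ[ℂ] D) (ccr : ∀ ψ, a (ad ψ) = ad (a ψ) + ψ)
    (n : ℕ) (e : D) (he : a e = 0) : (a ^ n) ((ad ^ n) e) = (n.factorial : ℂ) • e := by
  induction n with
  | zero => simp
  | succ n ih =>
    rw [pow_succ, Module.End.mul_apply, annih_creation_pow a ad ccr _ _ he, map_smul,
      Nat.add_sub_cancel, ih, smul_smul, Nat.factorial_succ]
    push_cast
    ring_nf

/-- A vector annihilated by a power of `a` is a finite sum of excited vacua. -/
lemma exists_number_decomposition (a ad : D →ₗ[ℂ] D) (ccr : ∀ ψ, a (ad ψ) = ad (a ψ) + ψ)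
    (N : ℕ) (ψ : D) (h : (a ^ N) ψ = 0) :
    ∃ e : ℕ → D, (∀ n, a (e n) = 0) ∧ ψ = ∑ n ∈ Finset.range N, (ad ^ n) (e n) := by
  induction N generalizing ψ with
  | zero => exact ⟨fun _ => 0, by simp, by simpa using h⟩
  | succ N ih =>
    have hv : a ((N.factorial : ℂ)⁻¹ • (a ^ N) ψ) = 0 := by
      rw [map_smul, ← Module.End.mul_apply, ← pow_succ', h, smul_zero]
    -- The top component is stripped off: `a ^ N` sends `(ad ^ N) v` to `N! v`, so with the factor
    -- `1 / N!` the difference is annihilated by `a ^ N`.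
    obtain ⟨e, he, hψ⟩ := ih (ψ - (ad ^ N) ((N.factorial : ℂ)⁻¹ • (a ^ N) ψ)) (by
      rw [map_sub, annih_pow_creation_pow a ad ccr N _ hv, smul_smul, mul_inv_cancel₀, one_smul,
        sub_self]
      exact_mod_cast N.factorial_ne_zero)
    refine ⟨fun n => if n = N then (N.factorial : ℂ)⁻¹ • (a ^ N) ψ else e n, fun n => ?_, ?_⟩
    · dsimp only
      split_ifs
      · exact hv
      · exact he n
    · rw [Finset.sum_range_succ]
      dsimp only
      rw [if_pos rfl, Finset.sum_congr rfl (g := fun n => (ad ^ n) (e n)),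
        ← hψ, sub_add_cancel]
      intro n hn
      rw [if_neg (Finset.mem_range.1 hn).ne]

/-- Sectors of different excitation number are orthogonal for every compatible form, and sector `n`
carries the weight `n!`. These weights are the radial Gaussian moments of
`integral_pow_mul_exp_neg`. -/
lemma form_creation_pow (a ad : D →ₗ[ℂ] D) (ccr : ∀ ψ, a (ad ψ) = ad (a ψ) + ψ)
    (H : D →ₗ⋆[ℂ] D →ₗ[ℂ] ℂ) (hH : FormCompat a ad H) (e e' : D) (he : a e = 0) (he' : a e' = 0)
    (n m : ℕ) : H ((ad ^ n) e) ((ad ^ m) e') = if n = m then (n.factorial : ℂ) * H e e' else 0 := by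
  induction n generalizing m with
  | zero =>
    rcases m with _ | m
    · simp
    · rw [pow_succ', Module.End.mul_apply, ← hH.2]
      simp [he]
  | succ n ih =>
    rw [pow_succ', Module.End.mul_apply, hH.1, annih_creation_pow a ad ccr _ _ he', map_smul, ih]
    rcases m with _ | m
    · simp
    · by_cases h : n = m
      · simp [h, Nat.factorial_succ]
        ring
      · simp [h]

lemma integral_exp_int_mul (n : ℤ) (hn : n ≠ 0) :
    ∫ θ in (0 : ℝ)..2 * Real.pi, Complex.exp ((n * Complex.I) * θ) = 0 := by
  have hc : (n * Complex.I : ℂ) ≠ 0 := by simp [hn]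
  rw [integral_exp_mul_complex hc]
  have : Complex.exp (n * Complex.I * (2 * Real.pi : ℝ)) = 1 := by
    rw [Complex.exp_eq_one_iff]
    exact ⟨n, by push_cast; ring⟩
  rw [this]
  simp

/-- Circular means of `z^{n+p} z̄^{m+q}`. -/
lemma circle_average (r : ℝ) (n m : ℕ) :
    ∫ θ in (0 : ℝ)..2 * Real.pi, (r * Complex.exp (Complex.I * θ)) ^ n *
      (conj (r * Complex.exp (Complex.I * θ))) ^ m =
    if n = m then 2 * Real.pi * ((r ^ 2 : ℝ) : ℂ) ^ n else 0 := by
  have key : ∀ θ : ℝ, (r * Complex.exp (Complex.I * θ)) ^ n *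
      (conj (r * Complex.exp (Complex.I * θ))) ^ m =
      (r : ℂ) ^ (n + m) * Complex.exp ((((n : ℤ) - (m : ℤ) : ℤ) * Complex.I) * θ) := by
    intro θ
    rw [map_mul, Complex.conj_ofReal, ← Complex.exp_conj, mul_pow, mul_pow, ← Complex.exp_nat_mul,
      ← Complex.exp_nat_mul, pow_add]
    rw [show ∀ a b c d : ℂ, a * b * (c * d) = a * c * (b * d) by intros; ring, ← Complex.exp_add]
    congr 2
    simp
    ring
  simp_rw [key]
  rw [intervalIntegral.integral_const_mul]
  split_ifs with h
  · subst h
    simp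
    ring
  · rw [integral_exp_int_mul _ (by omega), mul_zero]

lemma integral_pow_mul_exp_neg (n : ℕ) :
    ∫ t in Set.Ioi (0 : ℝ), t ^ n * Real.exp (-t) = n.factorial := by
  rw [← Real.Gamma_nat_eq_factorial, Real.Gamma_eq_integral (by positivity)]
  refine setIntegral_congr_fun measurableSet_Ioi fun t _ => ?_
  simp [mul_comm]

lemma integrable_pow_mul_exp_neg (n : ℕ) :
    IntegrableOn (fun t : ℝ => t ^ n * Real.exp (-t)) (Set.Ioi 0) := by
  have := Real.GammaIntegral_convergent (s := n + 1) (by positivity)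
  refine this.congr_fun (fun t _ => ?_) measurableSet_Ioi
  simp [mul_comm]

/-- The shifts `p` and `q` accommodate the additional factor `z` in the terms linear in the mode. -/
lemma diagonal_circle_average (N : ℕ) (h : ℕ → ℕ → ℂ) (r : ℝ) (p q : ℕ) :
    ∫ θ in (0 : ℝ)..2 * Real.pi, ∑ n ∈ Finset.range N, ∑ m ∈ Finset.range N,
      (r * Complex.exp (Complex.I * θ)) ^ (n + p) *
      (conj (r * Complex.exp (Complex.I * θ))) ^ (m + q) * h n m =
    ∑ n ∈ Finset.range N, ∑ m ∈ Finset.range N, if n + p = m + q then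
      2 * Real.pi * ((r ^ 2 : ℝ) : ℂ) ^ (n + p) * h n m else 0 := by
  rw [intervalIntegral.integral_finsetSum]
  · refine Finset.sum_congr rfl fun n _ => ?_
    rw [intervalIntegral.integral_finsetSum]
    · refine Finset.sum_congr rfl fun m _ => ?_
      rw [intervalIntegral.integral_mul_const, circle_average]
      split_ifs <;> simp
    · intro m _
      apply Continuous.intervalIntegrable
      fun_prop
  · intro n _
    apply Continuous.intervalIntegrable
    fun_prop

/-- If the circular mean of a polynomial density is nonnegative, so is the mean over the
Gaussian measure. -/
lemma gaussian_average_nonneg (N : ℕ) (h g w : ℕ → ℕ → ℂ)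
    (hpos : ∀ z : ℂ, 0 ≤ (∑ n ∈ Finset.range N, ∑ m ∈ Finset.range N,
      z ^ n * conj z ^ m * (h n m + (‖z‖ ^ 2 : ℝ) * g n m + 2 * (z * w n m))).re) :
    0 ≤ (∑ n ∈ Finset.range N, ((n.factorial : ℂ) * h n n + ((n + 1).factorial : ℂ) * g n n +
      if n + 1 < N then 2 * (((n + 1).factorial : ℂ) * w n (n + 1)) else 0)).re := by
  -- Averaging over the circle of radius `√t` kills all monomials with unequal powers of `z` and its
  -- conjugate: `h` and `g` keep their diagonals, while the extra factor `z` selects the entries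
  -- `(n, n + 1)` of `w`.
  have h1 : ∀ t : ℝ, 0 < t → 0 ≤ (∑ n ∈ Finset.range N, ((t ^ n : ℝ) * h n n +
      (t ^ (n + 1) : ℝ) * g n n +
      if n + 1 < N then 2 * ((t ^ (n + 1) : ℝ) * w n (n + 1)) else 0)).re := by
    intro t ht
    set r := Real.sqrt t
    have hr : r ^ 2 = t := Real.sq_sqrt ht.le
    have h0 : 0 ≤ (∫ θ in (0 : ℝ)..2 * Real.pi, ∑ n ∈ Finset.range N, ∑ m ∈ Finset.range N,
        ((r * Complex.exp (Complex.I * θ)) ^ (n + 0) *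
          (conj (r * Complex.exp (Complex.I * θ))) ^ (m + 0) * (h n m + (t : ℂ) * g n m) +
        (r * Complex.exp (Complex.I * θ)) ^ (n + 1) *
          (conj (r * Complex.exp (Complex.I * θ))) ^ (m + 0) * (2 * w n m))).re := by
      have hint : IntervalIntegrable (fun θ : ℝ => ∑ n ∈ Finset.range N, ∑ m ∈ Finset.range N,
        ((r * Complex.exp (Complex.I * θ)) ^ (n + 0) *
          (conj (r * Complex.exp (Complex.I * θ))) ^ (m + 0) * (h n m + (t : ℂ) * g n m) +
        (r * Complex.exp (Complex.I * θ)) ^ (n + 1) *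
          (conj (r * Complex.exp (Complex.I * θ))) ^ (m + 0) * (2 * w n m))) volume 0
          (2 * Real.pi) := by
        apply Continuous.intervalIntegrable
        fun_prop
      have := Complex.reCLM.intervalIntegral_comp_comm hint
      simp only [Complex.reCLM_apply] at this
      rw [← this]
      refine intervalIntegral.integral_nonneg (by positivity) fun θ _ => ?_
      convert hpos (r * Complex.exp (Complex.I * θ)) using 4 with n _ m
      have : ‖(r * Complex.exp (Complex.I * θ) : ℂ)‖ ^ 2 = t := by
        rw [norm_mul, mul_comm Complex.I, Complex.norm_exp_ofReal_mul_I]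
        simp [hr]
      rw [this]
      ring
    simp only [Finset.sum_add_distrib] at h0
    rw [intervalIntegral.integral_add] at h0
    · rw [diagonal_circle_average, diagonal_circle_average] at h0
      rw [← Finset.sum_add_distrib] at h0
      have h2 : (∑ n ∈ Finset.range N, ((∑ m ∈ Finset.range N, if n + 0 = m + 0 then
          2 * Real.pi * ((r ^ 2 : ℝ) : ℂ) ^ (n + 0) * (h n m + (t : ℂ) * g n m) else 0) +
          (∑ m ∈ Finset.range N, if n + 1 = m + 0 then
          2 * Real.pi * ((r ^ 2 : ℝ) : ℂ) ^ (n + 1) * (2 * w n m) else 0))) =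
          ((2 * Real.pi : ℝ) : ℂ) * ∑ n ∈ Finset.range N, ((t ^ n : ℝ) * h n n +
      (t ^ (n + 1) : ℝ) * g n n +
      if n + 1 < N then 2 * ((t ^ (n + 1) : ℝ) * w n (n + 1)) else 0) := by
        rw [Finset.mul_sum]
        refine Finset.sum_congr rfl fun n hn => ?_
        simp only [add_zero, Finset.sum_ite_eq, hn, if_true, Finset.mem_range, hr]
        split_ifs <;> push_cast <;> ring
      rw [h2, Complex.re_ofReal_mul] at h0
      exact nonneg_of_mul_nonneg_right h0 (by positivity)
    · apply Continuous.intervalIntegrable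
      fun_prop
    · apply Continuous.intervalIntegrable
      fun_prop
  -- Integration against `exp (-t)` turns `t ^ n` into `n!`; circle and radial averages together are
  -- the Gaussian integral over the complex amplitude.
  have h3 : 0 ≤ ∫ t in Set.Ioi (0 : ℝ), ∑ n ∈ Finset.range N,
      (t ^ n * Real.exp (-t) * (h n n).re + t ^ (n + 1) * Real.exp (-t) *
        ((g n n).re + if n + 1 < N then 2 * (w n (n + 1)).re else 0)) := by
    refine setIntegral_nonneg measurableSet_Ioi fun t ht => ?_
    have := mul_nonneg (h1 t ht) (Real.exp_pos (-t)).le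
    refine this.trans_eq ?_
    rw [Complex.re_sum, Finset.sum_mul]
    refine Finset.sum_congr rfl fun n _ => ?_
    split_ifs
    · simp only [Complex.add_re, Complex.re_ofReal_mul]
      rw [show (2 : ℂ) = ((2 : ℝ) : ℂ) by norm_num, Complex.re_ofReal_mul, Complex.re_ofReal_mul]
      ring
    · simp only [Complex.add_re, Complex.re_ofReal_mul, Complex.zero_re]
      ring
  have hI : ∀ n : ℕ, IntegrableOn (fun t : ℝ => t ^ n * Real.exp (-t) * (h n n).re +
      t ^ (n + 1) * Real.exp (-t) *
        ((g n n).re + if n + 1 < N then 2 * (w n (n + 1)).re else 0)) (Set.Ioi 0) := fun n =>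
    ((integrable_pow_mul_exp_neg n).mul_const _).add
      ((integrable_pow_mul_exp_neg (n + 1)).mul_const _)
  rw [integral_finsetSum _ fun n _ => hI n] at h3
  refine h3.trans_eq ?_
  rw [Complex.re_sum]
  refine Finset.sum_congr rfl fun n _ => ?_
  rw [integral_add ((integrable_pow_mul_exp_neg n).mul_const _)
    ((integrable_pow_mul_exp_neg (n + 1)).mul_const _), integral_mul_const, integral_mul_const,
    integral_pow_mul_exp_neg, integral_pow_mul_exp_neg]
  have hc : ∀ k : ℕ, (k : ℂ) = ((k : ℝ) : ℂ) := fun k => by simp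
  split_ifs
  · rw [show (2 : ℂ) = ((2 : ℝ) : ℂ) by norm_num, hc, hc]
    simp only [Complex.add_re, Complex.re_ofReal_mul]
    ring
  · rw [hc, hc]
    simp only [Complex.add_re, Complex.re_ofReal_mul, Complex.zero_re]
    ring

/-- Coherent state inequality for one mode: if the classical form is nonnegative for every value
`z` of the mode, then its anti-normally ordered quantization is nonnegative. -/
theorem coherent_one_mode (a ad : D →ₗ[ℂ] D) (ccr : ∀ ψ, a (ad ψ) = ad (a ψ) + ψ)
    (nil : ∀ ψ, ∃ N : ℕ, (a ^ N) ψ = 0) (H G W : D →ₗ⋆[ℂ] D →ₗ[ℂ] ℂ)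
    (hH : FormCompat a ad H) (hG : FormCompat a ad G) (hW : FormCompat a ad W)
    (hpos : ∀ (z : ℂ) (ψ : D), 0 ≤ (H ψ ψ + (‖z‖ ^ 2 : ℝ) * G ψ ψ + 2 * (z * W ψ ψ)).re) (ψ : D) :
    0 ≤ (H ψ ψ + (G (a ψ) (a ψ) + G ψ ψ + 2 * W ψ (a ψ))).re := by
  obtain ⟨N, hN⟩ := nil ψ
  obtain ⟨e, he, hψ⟩ := exists_number_decomposition a ad ccr N ψ hN
  -- The vector `∑ (conj z) ^ n • e n` is the overlap of `ψ` with the unnormalized coherent state of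
  -- amplitude `z`; the missing normalization is the Gaussian weight of the average.
  have key := gaussian_average_nonneg N (fun n m => H (e n) (e m)) (fun n m => G (e n) (e m))
    (fun n m => W (e n) (e m)) (fun z => by
      convert hpos z (∑ n ∈ Finset.range N, (conj z ^ n) • e n) using 2
      simp only [map_sum, LinearMap.sum_apply, LinearMap.map_smulₛₗ, LinearMap.smul_apply,
        map_smul, smul_eq_mul, map_pow, Complex.conj_conj, Finset.mul_sum]
      simp only [← Finset.sum_add_distrib]
      rw [Finset.sum_comm]
      refine Finset.sum_congr rfl fun n _ => Finset.sum_congr rfl fun m _ => ?_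
      ring)
  have hdiag : ∀ F : D →ₗ⋆[ℂ] D →ₗ[ℂ] ℂ, FormCompat a ad F →
      F ψ ψ = ∑ n ∈ Finset.range N, (n.factorial : ℂ) * F (e n) (e n) := by
    intro F hF
    rw [hψ]
    simp only [map_sum, LinearMap.sum_apply, form_creation_pow a ad ccr F hF _ _ (he _) (he _)]
    refine Finset.sum_congr rfl fun n hn => ?_
    rw [Finset.sum_eq_single n] <;> simp +contextual [hn]
  -- The left side is `G (ad ψ) (ad ψ)`, the anti-normally ordered number operator, which is what
  -- `‖z‖ ^ 2` represents under the Gaussian average. The extra `G ψ ψ` is the energy paid for the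
  -- mode.
  have hGG : G (a ψ) (a ψ) + G ψ ψ =
      ∑ n ∈ Finset.range N, ((n + 1).factorial : ℂ) * G (e n) (e n) := by
    rw [hG.2, ← map_add, ← ccr, ← hG.1, hψ]
    simp only [map_sum, LinearMap.sum_apply]
    simp only [← Module.End.mul_apply, ← pow_succ',
      form_creation_pow a ad ccr G hG _ _ (he _) (he _)]
    refine Finset.sum_congr rfl fun n hn => ?_
    rw [Finset.sum_eq_single n] <;> simp +contextual [hn]
  have hWW : W ψ (a ψ) = ∑ n ∈ Finset.range N,
      if n + 1 < N then ((n + 1).factorial : ℂ) * W (e n) (e (n + 1)) else 0 := by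
    have ha : a ψ = ∑ m ∈ Finset.range N, (m : ℂ) • (ad ^ (m - 1)) (e m) := by
      conv_lhs => rw [hψ, map_sum]
      exact Finset.sum_congr rfl fun m _ => annih_creation_pow a ad ccr m _ (he m)
    rw [ha]
    conv_lhs => rw [hψ]
    simp only [map_sum, LinearMap.sum_apply, map_smul, smul_eq_mul,
      form_creation_pow a ad ccr W hW _ _ (he _) (he _), Finset.mul_sum]
    rw [Finset.sum_comm]
    refine Finset.sum_congr rfl fun n hn => ?_
    split_ifs with h
    · rw [Finset.sum_eq_single (n + 1)]
      · simp [Nat.factorial_succ]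
        ring
      · intro m _ hm
        rcases m with _ | m
        · simp
        · rw [if_neg (by simp; omega), mul_zero]
      · simp [h]
    · refine Finset.sum_eq_zero fun m hm => ?_
      rcases m with _ | m
      · simp
      · rw [if_neg, mul_zero]
        simp only [Finset.mem_range] at hm
        simp only [Nat.add_sub_cancel]
        omega
  rw [hGG, hdiag H hH, hWW]
  convert key using 2
  rw [Finset.mul_sum, ← Finset.sum_add_distrib, ← Finset.sum_add_distrib]
  refine Finset.sum_congr rfl fun n _ => ?_
  split_ifs <;> ring

/-- Coherent state inequality for finitely many independent modes. -/
theorem coherent_modes {ι : Type*} [DecidableEq ι] (a ad : ι → D →ₗ[ℂ] D)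
    (ccr : ∀ b ψ, a b (ad b ψ) = ad b (a b ψ) + ψ)
    (comm : ∀ b c ψ, a b (a c ψ) = a c (a b ψ))
    (comm' : ∀ b c, b ≠ c → ∀ ψ, a b (ad c ψ) = ad c (a b ψ))
    (nil : ∀ b ψ, ∃ N : ℕ, (a b ^ N) ψ = 0) (H G : D →ₗ⋆[ℂ] D →ₗ[ℂ] ℂ)
    (W : ι → D →ₗ⋆[ℂ] D →ₗ[ℂ] ℂ)
    (hH : ∀ b, FormCompat (a b) (ad b) H) (hG : ∀ b, FormCompat (a b) (ad b) G)
    (hW : ∀ b c, FormCompat (a b) (ad b) (W c)) (s : Finset ι)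
    (hpos : ∀ (z : ι → ℂ) (ψ : D),
      0 ≤ (H ψ ψ + ∑ b ∈ s, ((‖z b‖ ^ 2 : ℝ) * G ψ ψ + 2 * (z b * W b ψ ψ))).re) (ψ : D) :
    0 ≤ (H ψ ψ + ∑ b ∈ s, (G (a b ψ) (a b ψ) + G ψ ψ + 2 * W b ψ (a b ψ))).re := by
  induction s using Finset.induction_on generalizing H ψ with
  | empty => simpa using hpos 0 ψ
  | insert b₀ s hb₀ ih =>
    have hne : ∀ b ∈ s, b ≠ b₀ := fun b hb h => hb₀ (h ▸ hb)
    -- `Q` contains the modes of `s` already in quantized form, while `b₀` is still a classical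
    -- parameter. For a fixed value of that parameter the induction hypothesis is used with the
    -- corresponding terms absorbed into `H`.
    let Q : D →ₗ⋆[ℂ] D →ₗ[ℂ] ℂ := H + ∑ b ∈ s, ((G.comp (a b)).compl₂ (a b) + G +
      (2 : ℂ) • (W b).compl₂ (a b))
    have hQ : ∀ ψ χ, Q ψ χ = H ψ χ + ∑ b ∈ s, (G (a b ψ) (a b χ) + G ψ χ + 2 * W b ψ (a b χ)) := by
      intro ψ χ
      simp [Q, LinearMap.add_apply, LinearMap.sum_apply]
    have hQc : FormCompat (a b₀) (ad b₀) Q := by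
      constructor
      · intro ψ χ
        rw [hQ, hQ, (hH b₀).1]
        congr 1
        refine Finset.sum_congr rfl fun b hb => ?_
        rw [comm' b b₀ (hne b hb), (hG b₀).1, (hG b₀).1, (hW b₀ b).1, comm b₀ b]
      · intro ψ χ
        rw [hQ, hQ, (hH b₀).2]
        congr 1
        refine Finset.sum_congr rfl fun b hb => ?_
        rw [comm b b₀, (hG b₀).2, (hG b₀).2, (hW b₀ b).2, comm' b b₀ (hne b hb)]
    have := coherent_one_mode (a b₀) (ad b₀) (ccr b₀) (nil b₀) Q G (W b₀) hQc (hG b₀)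
      (hW b₀ b₀) (fun z χ => by
        have h2 := ih (H + ((‖z‖ ^ 2 : ℝ) : ℂ) • G + (2 * z) • W b₀) (fun b => ⟨fun ψ χ => by
          simp [(hH b).1, (hG b).1, (hW b b₀).1], fun ψ χ => by
          simp [(hH b).2, (hG b).2, (hW b b₀).2]⟩) (fun w χ' => by
            have h3 := hpos (Function.update w b₀ z) χ'
            rw [Finset.sum_insert hb₀] at h3
            refine h3.trans_eq ?_
            congr 1
            rw [Finset.sum_congr rfl (g := fun b => ((‖w b‖ ^ 2 : ℝ) : ℂ) * G χ' χ' +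
              2 * (w b * W b χ' χ')) fun b hb => by rw [Function.update_of_ne (hne b hb)]]
            simp
            ring) χ
        refine h2.trans_eq ?_
        congr 1
        rw [hQ]
        simp
        ring) ψ
    rw [Finset.sum_insert hb₀]
    refine this.trans_eq ?_
    congr 1
    rw [hQ]
    ring

end Coherent


/-! ### Bounded Fock space vectors -/

/-- Fock vectors with finitely many bounded measurable components of bounded support. -/
structure IsNice (η : FockFn) : Prop where
  meas : ∀ n, Measurable (η n)
  bdd : ∀ n, ∃ C : ℝ, ∀ K, ‖η n K‖ ≤ C
  supp : ∃ R : ℝ, ∀ n K i, R < ‖K i‖ → η n K = 0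
  symm : ∀ n (σ : Equiv.Perm (Fin n)) (K : Fin n → E3), η n (K ∘ σ) = η n K
  fin : ∃ N : ℕ, ∀ n, N ≤ n → η n = 0

/-- Bounded measurable one-particle functions of bounded support. -/
structure IsMode (f : E3 → ℂ) : Prop where
  meas : Measurable f
  bdd : ∃ C : ℝ, ∀ k, ‖f k‖ ≤ C
  supp : ∃ R : ℝ, ∀ k, R < ‖k‖ → f k = 0

lemma integrable_of_bdd_of_supp {X E : Type*} [MeasurableSpace X] [NormedAddCommGroup E]
    {μ : Measure X} {f : X → E} {S : Set X} {C : ℝ} (hf : AEStronglyMeasurable f μ) (hS : μ S ≠ ⊤)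
    (hC : ∀ x, ‖f x‖ ≤ C) (h0 : ∀ x, x ∉ S → f x = 0) : Integrable f μ := by
  rw [← integrableOn_iff_integrable_of_support_subset (s := S)
    (fun x hx => by by_contra h; exact hx (h0 x h))]
  exact Measure.integrableOn_of_bounded hS hf (ae_of_all _ hC)

lemma volume_ball_pi_ne_top (n : ℕ) (R : ℝ) :
    volume {K : Fin n → E3 | ∀ i, ‖K i‖ ≤ R} ≠ ⊤ := by
  have : {K : Fin n → E3 | ∀ i, ‖K i‖ ≤ R} = Set.pi Set.univ fun _ => Metric.closedBall 0 R := by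
    ext K
    simp
  rw [this]
  exact (isCompact_univ_pi fun _ => isCompact_closedBall 0 R).measure_lt_top.ne

lemma integrable_of_bdd_pi {n : ℕ} {f : (Fin n → E3) → ℂ} {C R : ℝ} (hf : Measurable f)
    (hC : ∀ x, ‖f x‖ ≤ C) (h0 : ∀ K i, R < ‖K i‖ → f K = 0) : Integrable f :=
  integrable_of_bdd_of_supp hf.aestronglyMeasurable (volume_ball_pi_ne_top n R) hC fun K hK => by
    simp only [Set.mem_ofPred_eq, not_forall, not_le] at hK
    obtain ⟨i, hi⟩ := hK
    exact h0 K i hi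

lemma IsMode.integrable {f : E3 → ℂ} (hf : IsMode f) : Integrable f := by
  obtain ⟨C, hC⟩ := hf.bdd
  obtain ⟨R, hR⟩ := hf.supp
  refine integrable_of_bdd_of_supp hf.meas.aestronglyMeasurable
    (isCompact_closedBall (0 : E3) R).measure_lt_top.ne hC fun k hk => hR k ?_
  simpa using hk

lemma IsMode.mul {f g : E3 → ℂ} (hf : IsMode f) (hg : IsMode g) :
    IsMode fun k => f k * g k := by
  obtain ⟨C, hC⟩ := hf.bdd
  obtain ⟨C', hC'⟩ := hg.bdd
  obtain ⟨R, hR⟩ := hf.supp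
  refine ⟨hf.meas.mul hg.meas, ⟨C * C', fun k => ?_⟩, ⟨R, fun k hk => by simp [hR k hk]⟩⟩
  rw [norm_mul]
  exact mul_le_mul (hC k) (hC' k) (norm_nonneg _) ((norm_nonneg _).trans (hC k))

lemma IsMode.conj {f : E3 → ℂ} (hf : IsMode f) : IsMode fun k => conj (f k) :=
  ⟨Complex.continuous_conj.measurable.comp hf.meas, by simpa using hf.bdd,
    by simpa using hf.supp⟩

lemma IsMode.bdd_mul {f g : E3 → ℂ} (hf : IsMode f) (hg : Measurable g)
    (hgb : ∃ C : ℝ, ∀ k, ‖g k‖ ≤ C) : IsMode fun k => f k * g k := by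
  obtain ⟨C, hC⟩ := hf.bdd
  obtain ⟨C', hC'⟩ := hgb
  obtain ⟨R, hR⟩ := hf.supp
  refine ⟨hf.meas.mul hg, ⟨C * C', fun k => ?_⟩, ⟨R, fun k hk => by simp [hR k hk]⟩⟩
  rw [norm_mul]
  exact mul_le_mul (hC k) (hC' k) (norm_nonneg _) ((norm_nonneg _).trans (hC k))

lemma IsMode.add {f g : E3 → ℂ} (hf : IsMode f) (hg : IsMode g) :
    IsMode fun k => f k + g k := by
  obtain ⟨C, hC⟩ := hf.bdd
  obtain ⟨C', hC'⟩ := hg.bdd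
  obtain ⟨R, hR⟩ := hf.supp
  obtain ⟨R', hR'⟩ := hg.supp
  refine ⟨hf.meas.add hg.meas, ⟨C + C', fun k => (norm_add_le _ _).trans
    (add_le_add (hC k) (hC' k))⟩, ⟨max R R', fun k hk => ?_⟩⟩
  rw [hR k ((le_max_left _ _).trans_lt hk), hR' k ((le_max_right _ _).trans_lt hk), add_zero]

lemma IsMode.sum {ι : Type*} (s : Finset ι) {f : ι → E3 → ℂ} (hf : ∀ i, IsMode (f i)) :
    IsMode fun k => ∑ i ∈ s, f i k := by
  classical
  induction s using Finset.induction_on with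
  | empty => exact ⟨by simp, ⟨0, by simp⟩, ⟨0, by simp⟩⟩
  | insert i s hi ih =>
    simp only [Finset.sum_insert hi]
    exact (hf i).add ih

/-- The space of bounded Fock vectors. -/
def niceFock : Submodule ℂ FockFn where
  carrier := {η | IsNice η}
  zero_mem' := ⟨fun _ => measurable_const, fun _ => ⟨0, by simp⟩, ⟨0, by simp⟩, by simp,
    ⟨0, by simp⟩⟩
  add_mem' := by
    rintro η ζ ⟨h1, h2, ⟨R, hR⟩, h4, ⟨N, hN⟩⟩ ⟨g1, g2, ⟨R', hR'⟩, g4, ⟨N', hN'⟩⟩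
    refine ⟨fun n => (h1 n).add (g1 n), fun n => ?_, ⟨max R R', fun n K i hi => ?_⟩,
      fun n σ K => ?_, ⟨max N N', fun n hn => ?_⟩⟩
    · obtain ⟨C, hC⟩ := h2 n
      obtain ⟨C', hC'⟩ := g2 n
      exact ⟨C + C', fun K => (norm_add_le _ _).trans (add_le_add (hC K) (hC' K))⟩
    · simp [hR n K i ((le_max_left _ _).trans_lt hi), hR' n K i ((le_max_right _ _).trans_lt hi)]
    · simp [h4, g4]
    · simp [hN n ((le_max_left _ _).trans hn), hN' n ((le_max_right _ _).trans hn)]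
  smul_mem' := by
    rintro c η ⟨h1, h2, ⟨R, hR⟩, h4, ⟨N, hN⟩⟩
    refine ⟨fun n => (h1 n).const_smul c, fun n => ?_, ⟨R, fun n K i hi => ?_⟩,
      fun n σ K => ?_, ⟨N, fun n hn => ?_⟩⟩
    · obtain ⟨C, hC⟩ := h2 n
      refine ⟨‖c‖ * C, fun K => ?_⟩
      rw [Pi.smul_apply, Pi.smul_apply, norm_smul]
      exact mul_le_mul_of_nonneg_left (hC K) (norm_nonneg _)
    · simp [hR n K i hi]
    · simp [h4]
    · simp [hN n hn]

lemma isNice (η : niceFock) : IsNice η.1 := η.2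

lemma niceFock.ext' {η ζ : niceFock} (h : ∀ n K, η.1 n K = ζ.1 n K) : η = ζ :=
  Subtype.ext (funext fun n => funext fun K => h n K)

lemma integrable_conj_mul (η ζ : niceFock) (n : ℕ) :
    Integrable fun K => conj (η.1 n K) * ζ.1 n K := by
  obtain ⟨C, hC⟩ := (isNice η).bdd n
  obtain ⟨C', hC'⟩ := (isNice ζ).bdd n
  obtain ⟨R, hR⟩ := (isNice η).supp
  refine integrable_of_bdd_pi (C := C * C') (R := R)
    ((Complex.continuous_conj.measurable.comp ((isNice η).meas n)).mul ((isNice ζ).meas n))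
    (fun K => ?_) fun K i hi => by simp [hR n K i hi]
  rw [norm_mul, RCLike.norm_conj]
  exact mul_le_mul (hC K) (hC' K) (norm_nonneg _) ((norm_nonneg _).trans (hC K))

lemma summable_inner (η ζ : niceFock) :
    Summable fun n => ∫ K, conj (η.1 n K) * ζ.1 n K := by
  obtain ⟨N, hN⟩ := (isNice η).fin
  refine summable_of_ne_finset_zero (s := Finset.range N) fun n hn => ?_
  simp [hN n (by simpa using hn)]

/-- The inner product of Fock space on bounded vectors. -/
noncomputable def ip : niceFock →ₗ⋆[ℂ] niceFock →ₗ[ℂ] ℂ :=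
  LinearMap.mk₂'ₛₗ (starRingEnd ℂ) (RingHom.id ℂ)
    (fun η ζ => ∑' n, ∫ K, conj (η.1 n K) * ζ.1 n K)
    (by
      intro η η' ζ
      rw [← (summable_inner η ζ).tsum_add (summable_inner η' ζ)]
      congr 1 with n
      rw [← integral_add (integrable_conj_mul _ _ n) (integrable_conj_mul _ _ n)]
      congr 1 with K
      simp [add_mul])
    (by
      intro c η ζ
      rw [smul_eq_mul, ← tsum_mul_left]
      congr 1 with n
      rw [← integral_const_mul]
      congr 1 with K
      simp [mul_assoc])
    (by
      intro η ζ ζ'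
      rw [← (summable_inner η ζ).tsum_add (summable_inner η ζ')]
      congr 1 with n
      rw [← integral_add (integrable_conj_mul _ _ n) (integrable_conj_mul _ _ n)]
      congr 1 with K
      simp [mul_add])
    (by
      intro c η ζ
      rw [smul_eq_mul, ← tsum_mul_left]
      congr 1 with n
      rw [← integral_const_mul]
      congr 1 with K
      simp
      ring)

lemma ip_apply (η ζ : niceFock) : ip η ζ = ∑' n, ∫ K, conj (η.1 n K) * ζ.1 n K := rfl

lemma ip_eq_sum (η ζ : niceFock) {N : ℕ} (hN : ∀ n, N ≤ n → η.1 n = 0) :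
    ip η ζ = ∑ n ∈ Finset.range N, ∫ K, conj (η.1 n K) * ζ.1 n K := by
  rw [ip_apply]
  refine tsum_eq_sum fun n hn => ?_
  simp [hN n (by simpa using hn)]

lemma ip_conj_symm (η ζ : niceFock) : conj (ip η ζ) = ip ζ η := by
  rw [ip_apply, ip_apply, Complex.conj_tsum]
  congr 1 with n
  rw [← integral_conj]
  congr 1 with K
  simp [mul_comm]

/-- The squared norm of a bounded Fock vector. -/
noncomputable def nsq (η : niceFock) : ℝ := (ip η η).re

lemma nsq_nonneg (η : niceFock) : 0 ≤ nsq η := by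
  obtain ⟨N, hN⟩ := (isNice η).fin
  rw [nsq, ip_eq_sum η η hN, Complex.re_sum]
  refine Finset.sum_nonneg fun n _ => ?_
  have := Complex.reCLM.integral_comp_comm (integrable_conj_mul η η n)
  simp only [Complex.reCLM_apply] at this
  rw [← this]
  refine integral_nonneg fun K => ?_
  rw [← Complex.normSq_eq_conj_mul_self]
  simp [Complex.normSq_nonneg]

lemma ip_self (η : niceFock) : ip η η = nsq η := by
  rw [nsq]
  exact (Complex.conj_eq_iff_re.1 (ip_conj_symm η η)).symm

/-- Young's inequality in Fock space. -/
lemma young (η ζ : niceFock) {t : ℝ} (ht : 0 < t) :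
    2 * (ip η ζ).re ≤ t * nsq η + t⁻¹ * nsq ζ := by
  have h := nsq_nonneg ((t : ℂ) • η - ζ)
  have h1 : (ip ζ η).re = (ip η ζ).re := by rw [← ip_conj_symm, Complex.conj_re]
  have h2 : nsq ((t : ℂ) • η - ζ) = t ^ 2 * nsq η - 2 * t * (ip η ζ).re + nsq ζ := by
    rw [nsq]
    simp only [map_sub, map_smul, LinearMap.sub_apply, LinearMap.map_smulₛₗ, LinearMap.smul_apply,
      smul_eq_mul, Complex.conj_ofReal, Complex.sub_re, Complex.re_ofReal_mul, h1]
    rw [nsq, nsq]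
    ring
  rw [h2] at h
  have : 0 ≤ t⁻¹ * (t ^ 2 * nsq η - 2 * t * (ip η ζ).re + nsq ζ) := by positivity
  have e : t⁻¹ * (t ^ 2 * nsq η - 2 * t * (ip η ζ).re + nsq ζ) =
      t * nsq η - 2 * (ip η ζ).re + t⁻¹ * nsq ζ := by field_simp
  linarith

/-- The scalar is moved into the first slot, where it enters conjugated; `c` and `-c` together give
the absolute value. -/
lemma young' (c : ℂ) (η ζ : niceFock) {t : ℝ} (ht : 0 < t) :
    2 * |(c * ip η ζ).re| ≤ t * (‖c‖ ^ 2 * nsq η) + t⁻¹ * nsq ζ := by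
  have hn : ∀ c : ℂ, nsq (conj c • η) = ‖c‖ ^ 2 * nsq η := by
    intro c
    rw [nsq, nsq, map_smul, LinearMap.map_smulₛₗ, LinearMap.smul_apply, smul_eq_mul, smul_eq_mul,
      Complex.conj_conj, ← mul_assoc, mul_comm (conj c) c, Complex.mul_conj, Complex.re_ofReal_mul,
      Complex.normSq_eq_norm_sq]
  have hi : ∀ c : ℂ, ip (conj c • η) ζ = c * ip η ζ := by
    intro c
    rw [LinearMap.map_smulₛₗ, LinearMap.smul_apply, smul_eq_mul, Complex.conj_conj]
  have h1 := young (conj c • η) ζ ht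
  have h2 := young (conj (-c) • η) ζ ht
  rw [hn, hi] at h1 h2
  rw [norm_neg, neg_mul, Complex.neg_re] at h2
  rcases abs_cases (c * ip η ζ).re with ⟨h, _⟩ | ⟨h, _⟩ <;> rw [h] <;> linarith

/-! ### Annihilation and creation operators on bounded Fock vectors -/

lemma measurable_cons {n : ℕ} :
    Measurable fun p : E3 × (Fin n → E3) => (Fin.cons p.1 p.2 : Fin (n + 1) → E3) := by
  refine measurable_pi_lambda _ fun i => ?_
  refine Fin.cases ?_ (fun j => ?_) i
  · simpa using measurable_fst
  · exact (measurable_pi_apply j).comp measurable_snd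

/-- The permutation fixes the new slot and acts by `σ` on the others. It is what makes `annK` and
`ann` preserve symmetry. -/
lemma cons_comp_perm {n : ℕ} (k : E3) (K : Fin n → E3) (σ : Equiv.Perm (Fin n)) :
    ∃ τ : Equiv.Perm (Fin (n + 1)), (Fin.cons k (K ∘ σ) : Fin (n + 1) → E3) =
      (Fin.cons k K : Fin (n + 1) → E3) ∘ τ := by
  refine ⟨Equiv.Perm.decomposeFin.symm (0, σ), funext fun i => ?_⟩
  refine Fin.cases ?_ (fun j => ?_) i <;> simp

/-- The annihilation operator `a(k)` on bounded Fock vectors. -/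
noncomputable def annK (k : E3) : niceFock →ₗ[ℂ] niceFock where
  toFun η := ⟨fun n K => (Real.sqrt (n + 1) : ℂ) * η.1 (n + 1) (Fin.cons k K), by
    obtain ⟨R, hR⟩ := (isNice η).supp
    obtain ⟨N, hN⟩ := (isNice η).fin
    refine ⟨fun n => ?_, fun n => ?_, ⟨R, fun n K i hi => ?_⟩, fun n σ K => ?_,
      ⟨N, fun n hn => ?_⟩⟩
    · exact (((isNice η).meas (n + 1)).comp
        (measurable_cons.comp (measurable_const.prodMk measurable_id))).const_mul _
    · obtain ⟨C, hC⟩ := (isNice η).bdd (n + 1)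
      refine ⟨‖(Real.sqrt (n + 1) : ℂ)‖ * C, fun K => ?_⟩
      rw [norm_mul]
      exact mul_le_mul_of_nonneg_left (hC _) (norm_nonneg _)
    · rw [hR (n + 1) (Fin.cons k K) i.succ (by simpa using hi), mul_zero]
    · obtain ⟨τ, hτ⟩ := cons_comp_perm k K σ
      simp only [hτ, (isNice η).symm]
    · funext K
      simp [hN (n + 1) (by omega)]⟩
  map_add' η ζ := niceFock.ext' fun n K => by simp [mul_add]
  map_smul' c η := niceFock.ext' fun n K => by simp; ring

lemma annK_apply (k : E3) (η : niceFock) (n : ℕ) (K : Fin n → E3) :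
    (annK k η).1 n K = (Real.sqrt (n + 1) : ℂ) * η.1 (n + 1) (Fin.cons k K) := rfl

lemma integrable_mode_mul {f : E3 → ℂ} (hf : IsMode f) (η : niceFock) (n : ℕ) (K : Fin n → E3) :
    Integrable fun k => conj (f k) * η.1 (n + 1) (Fin.cons k K) := by
  obtain ⟨C, hC⟩ := (isNice η).bdd (n + 1)
  refine hf.conj.integrable.mul_bdd (c := C) ?_ (ae_of_all _ fun k => hC _)
  exact (((isNice η).meas (n + 1)).comp
        (measurable_cons.comp (measurable_id.prodMk measurable_const))).aestronglyMeasurable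

/-- The annihilation operator `a(f) = ∫ f̄(k) a(k) dk`. -/
noncomputable def ann (f : E3 → ℂ) (hf : IsMode f) : niceFock →ₗ[ℂ] niceFock where
  toFun η := ⟨fun n K => (Real.sqrt (n + 1) : ℂ) * ∫ k, conj (f k) * η.1 (n + 1) (Fin.cons k K), by
    obtain ⟨R, hR⟩ := (isNice η).supp
    obtain ⟨N, hN⟩ := (isNice η).fin
    refine ⟨fun n => ?_, fun n => ?_, ⟨R, fun n K i hi => ?_⟩, fun n σ K => ?_,
      ⟨N, fun n hn => ?_⟩⟩
    · refine Measurable.const_mul (StronglyMeasurable.measurable ?_) _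
      refine StronglyMeasurable.integral_prod_right
        (f := fun (K : Fin n → E3) k => conj (f k) * η.1 (n + 1) (Fin.cons k K)) ?_
      refine Measurable.stronglyMeasurable ?_
      exact (hf.conj.meas.comp measurable_snd).mul
        (((isNice η).meas (n + 1)).comp (measurable_cons.comp measurable_swap))
    · obtain ⟨C, hC⟩ := (isNice η).bdd (n + 1)
      refine ⟨‖(Real.sqrt (n + 1) : ℂ)‖ * ∫ k, ‖f k‖ * C, fun K => ?_⟩
      rw [norm_mul]
      refine mul_le_mul_of_nonneg_left ?_ (norm_nonneg _)
      refine norm_integral_le_of_norm_le (hf.integrable.norm.mul_const C) (ae_of_all _ fun k => ?_)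
      rw [norm_mul, RCLike.norm_conj]
      exact mul_le_mul_of_nonneg_left (hC _) (norm_nonneg _)
    · have : ∀ k, η.1 (n + 1) (Fin.cons k K) = 0 := fun k =>
        hR (n + 1) (Fin.cons k K) i.succ (by simpa using hi)
      simp [this]
    · congr 2 with k
      obtain ⟨τ, hτ⟩ := cons_comp_perm k K σ
      simp only [hτ, (isNice η).symm]
    · funext K
      simp [hN (n + 1) (by omega)]⟩
  map_add' η ζ := niceFock.ext' fun n K => by
    change (Real.sqrt (n + 1) : ℂ) * (∫ k, conj (f k) * (η + ζ).1 (n + 1) (Fin.cons k K)) =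
      (Real.sqrt (n + 1) : ℂ) * (∫ k, conj (f k) * (η).1 (n + 1) (Fin.cons k K)) +
        (Real.sqrt (n + 1) : ℂ) * ∫ k, conj (f k) * (ζ).1 (n + 1) (Fin.cons k K)
    rw [← mul_add, ← integral_add (integrable_mode_mul hf η n K) (integrable_mode_mul hf ζ n K)]
    congr 2 with k
    simp [mul_add]
  map_smul' c η := niceFock.ext' fun n K => by
    change (Real.sqrt (n + 1) : ℂ) * (∫ k, conj (f k) * (c • η).1 (n + 1) (Fin.cons k K)) =
      c * ((Real.sqrt (n + 1) : ℂ) * ∫ k, conj (f k) * (η).1 (n + 1) (Fin.cons k K))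
    rw [mul_left_comm c]
    congr 1
    rw [← integral_const_mul]
    refine integral_congr_ae (ae_of_all _ fun k => ?_)
    simp
    ring

lemma ann_apply {f : E3 → ℂ} (hf : IsMode f) (η : niceFock) (n : ℕ) (K : Fin n → E3) :
    (ann f hf η).1 n K =
      (Real.sqrt (n + 1) : ℂ) * ∫ k, conj (f k) * η.1 (n + 1) (Fin.cons k K) := rfl

/-- Components of `a†(f) η`. -/
noncomputable def creFun (f : E3 → ℂ) (η : FockFn) : FockFn
  | 0 => fun _ => 0
  | n + 1 => fun K => (Real.sqrt (n + 1) : ℂ)⁻¹ * ∑ i, f (K i) * η n (i.removeNth K)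

lemma creFun_symm (f : E3 → ℂ) (η : niceFock) (n : ℕ) (σ : Equiv.Perm (Fin n))
    (K : Fin n → E3) : creFun f η.1 n (K ∘ σ) = creFun f η.1 n K := by
  rcases n with _ | n
  · rfl
  · simp only [creFun]
    congr 1
    refine Fintype.sum_equiv σ _ _ fun i => ?_
    simp only [Function.comp_apply]
    congr 1
    -- Deleting slot `i` of the permuted configuration amounts to deleting slot `σ i` of the
    -- original one, up to the bijection that `σ` induces between the complements of `i` and `σ i`.
    have : ∃ τ : Equiv.Perm (Fin n), i.removeNth (K ∘ σ) = (σ i).removeNth K ∘ τ := by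
      refine ⟨((finSuccAboveEquiv i).trans ((σ.subtypeEquiv (fun j => by simp)).trans
        (finSuccAboveEquiv (σ i)).symm)), funext fun j => ?_⟩
      simp only [Fin.removeNth, Function.comp_apply, Equiv.trans_apply]
      congr 1
      have := (finSuccAboveEquiv (σ i)).apply_symm_apply
        ((σ.subtypeEquiv (p := fun j => j ≠ i) (q := fun j => j ≠ σ i) (fun j => by simp))
          ((finSuccAboveEquiv i) j))
      have h2 := congrArg Subtype.val this
      rw [finSuccAboveEquiv_apply] at h2
      exact h2.symm
    obtain ⟨τ, hτ⟩ := this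
    rw [hτ, (isNice η).symm]

/-- The creation operator `a†(f)`. -/
noncomputable def cre (f : E3 → ℂ) (hf : IsMode f) : niceFock →ₗ[ℂ] niceFock where
  toFun η := ⟨creFun f η.1, by
    obtain ⟨R, hR⟩ := (isNice η).supp
    obtain ⟨R', hR'⟩ := hf.supp
    obtain ⟨N, hN⟩ := (isNice η).fin
    refine ⟨fun n => ?_, fun n => ?_, ⟨max R R', fun n K i hi => ?_⟩, creFun_symm f η,
      ⟨N + 1, fun n hn => ?_⟩⟩
    · rcases n with _ | n
      · exact measurable_const
      · refine Measurable.const_mul (Finset.measurable_sum _ fun i _ => ?_) _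
        refine (hf.meas.comp (measurable_pi_apply i)).mul (((isNice η).meas n).comp ?_)
        exact measurable_pi_lambda _ fun j => measurable_pi_apply _
    · rcases n with _ | n
      · exact ⟨0, by simp [creFun]⟩
      · obtain ⟨C, hC⟩ := (isNice η).bdd n
        obtain ⟨C', hC'⟩ := hf.bdd
        refine ⟨‖(Real.sqrt (n + 1) : ℂ)⁻¹‖ * ∑ i : Fin (n + 1), C' * C, fun K => ?_⟩
        rw [creFun, norm_mul]
        refine mul_le_mul_of_nonneg_left ?_ (norm_nonneg _)
        refine norm_sum_le_of_le _ fun i _ => ?_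
        rw [norm_mul]
        exact mul_le_mul (hC' _) (hC _) (norm_nonneg _) ((norm_nonneg _).trans (hC' 0))
    · rcases n with _ | n
      · rfl
      · simp only [creFun]
        rw [Finset.sum_eq_zero, mul_zero]
        intro j _
        by_cases h : i = j
        · rw [← h, hR' _ ((le_max_right _ _).trans_lt hi), zero_mul]
        · obtain ⟨l, hl⟩ := Fin.exists_succAbove_eq h
          rw [hR n _ l, mul_zero]
          rw [Fin.removeNth, hl]
          exact (le_max_left _ _).trans_lt hi
    · rcases n with _ | n
      · omega
      · funext K
        simp [creFun, hN n (by omega)]⟩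
  map_add' η ζ := niceFock.ext' fun n K => by
    rcases n with _ | n
    · simp [creFun]
    · simp [creFun, mul_add, Finset.sum_add_distrib]
  map_smul' c η := niceFock.ext' fun n K => by
    rcases n with _ | n
    · simp [creFun]
    · simp only [creFun, Submodule.coe_smul, Pi.smul_apply, smul_eq_mul, RingHom.id_apply,
        Finset.mul_sum]
      refine Finset.sum_congr rfl fun i _ => ?_
      ring

lemma cre_zero {f : E3 → ℂ} (hf : IsMode f) (η : niceFock) (K : Fin 0 → E3) :
    (cre f hf η).1 0 K = 0 := rfl

lemma cre_succ {f : E3 → ℂ} (hf : IsMode f) (η : niceFock) (n : ℕ) (K : Fin (n + 1) → E3) :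
    (cre f hf η).1 (n + 1) K =
      (Real.sqrt (n + 1) : ℂ)⁻¹ * ∑ i, f (K i) * η.1 n (i.removeNth K) := rfl


/-- Combined with the symmetry of the components, this allows a momentum integrated in any slot to
be moved to the front. -/
lemma insertNth_eq_cons_comp {n : ℕ} (i : Fin (n + 1)) (k : E3) (K : Fin n → E3) :
    (i.insertNth k K : Fin (n + 1) → E3) = (Fin.cons k K : Fin (n + 1) → E3) ∘ i.cycleRange :=
  (Fin.cons_comp_cycleRange k K i).symm

lemma measurePreserving_insertNth {n : ℕ} (i : Fin (n + 1)) :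
    MeasurePreserving (fun p : E3 × (Fin n → E3) => (i.insertNth p.1 p.2 : Fin (n + 1) → E3)) :=
  (volume_preserving_piFinSuccAbove (fun _ : Fin (n + 1) => E3) i).symm

lemma integral_eq_integral_insertNth {n : ℕ} (i : Fin (n + 1)) (G : (Fin (n + 1) → E3) → ℂ) :
    ∫ K, G K = ∫ p : E3 × (Fin n → E3), G (i.insertNth p.1 p.2) :=
  (((volume_preserving_piFinSuccAbove (fun _ : Fin (n + 1) => E3) i).symm).integral_comp
    (MeasurableEquiv.measurableEmbedding _) G).symm

lemma integrable_insertNth {n : ℕ} (i : Fin (n + 1)) {G : (Fin (n + 1) → E3) → ℂ}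
    (hG : Integrable G) : Integrable fun p : E3 × (Fin n → E3) => G (i.insertNth p.1 p.2) :=
  (measurePreserving_insertNth i).integrable_comp_of_integrable hG

/-- `a†(f)` is the adjoint of `a(f)`. -/
lemma ip_cre {f : E3 → ℂ} (hf : IsMode f) (η ζ : niceFock) :
    ip (cre f hf η) ζ = ip η (ann f hf ζ) := by
  rw [ip_apply, ip_apply, (summable_inner (cre f hf η) ζ).tsum_eq_zero_add]
  simp only [cre_zero, map_zero, zero_mul, integral_zero, zero_add]
  congr 1 with n
  have hint : ∀ i : Fin (n + 1), Integrable fun K : Fin (n + 1) → E3 =>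
      conj (f (K i) * η.1 n (i.removeNth K)) * ζ.1 (n + 1) K := by
    intro i
    obtain ⟨C, hC⟩ := (isNice η).bdd n
    obtain ⟨C', hC'⟩ := hf.bdd
    obtain ⟨D, hD⟩ := (isNice ζ).bdd (n + 1)
    obtain ⟨R, hR⟩ := (isNice ζ).supp
    refine integrable_of_bdd_pi (C := C' * C * D) (R := R) ?_ (fun K => ?_)
      fun K j hj => by rw [hR _ K j hj, mul_zero]
    · refine (Complex.continuous_conj.measurable.comp ?_).mul ((isNice ζ).meas _)
      refine (hf.meas.comp (measurable_pi_apply i)).mul (((isNice η).meas n).comp ?_)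
      exact measurable_pi_lambda _ fun j => measurable_pi_apply _
    · rw [norm_mul, RCLike.norm_conj, norm_mul]
      have h1 := hC (i.removeNth K)
      have h2 := hC' (K i)
      have h3 := hD K
      gcongr
      · exact mul_nonneg ((norm_nonneg _).trans h2) ((norm_nonneg _).trans h1)
      · exact (norm_nonneg _).trans h2
  -- By symmetry all `n + 1` summands of the creation operator contribute the same integral, and `(n
  -- + 1) / √(n + 1)` is the prefactor of the annihilation operator.
  have hterm : ∀ i : Fin (n + 1), ∫ K : Fin (n + 1) → E3,
      conj (f (K i) * η.1 n (i.removeNth K)) * ζ.1 (n + 1) K =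
      ∫ K : Fin n → E3, conj (η.1 n K) * ∫ k, conj (f k) * ζ.1 (n + 1) (Fin.cons k K) := by
    intro i
    rw [integral_eq_integral_insertNth i]
    have h1 := integrable_insertNth i (hint i)
    rw [show (volume : Measure (E3 × (Fin n → E3))) = volume.prod volume from rfl] at h1 ⊢
    rw [integral_prod_symm _ h1]
    refine integral_congr_ae (ae_of_all _ fun K => ?_)
    dsimp only
    rw [← integral_const_mul]
    refine integral_congr_ae (ae_of_all _ fun k => ?_)
    dsimp only
    rw [insertNth_eq_cons_comp i k K, (isNice ζ).symm, ← insertNth_eq_cons_comp i k K]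
    simp
    ring
  have hs : (Real.sqrt (n + 1) : ℂ) ≠ 0 := by
    simp only [ne_eq, Complex.ofReal_eq_zero]
    positivity
  have hs2 : (Real.sqrt (n + 1) : ℂ) * (Real.sqrt (n + 1) : ℂ) = n + 1 := by
    rw [← Complex.ofReal_mul, Real.mul_self_sqrt (by positivity)]
    simp
  calc ∫ K, conj ((cre f hf η).1 (n + 1) K) * ζ.1 (n + 1) K
      = ∫ K, (Real.sqrt (n + 1) : ℂ)⁻¹ * ∑ i, conj (f (K i) * η.1 n (i.removeNth K)) *
          ζ.1 (n + 1) K := by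
        refine integral_congr_ae (ae_of_all _ fun K => ?_)
        dsimp only
        rw [cre_succ, map_mul, map_sum, map_inv₀, Complex.conj_ofReal, mul_assoc, Finset.sum_mul]
    _ = (Real.sqrt (n + 1) : ℂ)⁻¹ * ∑ i : Fin (n + 1),
          ∫ K : Fin n → E3, conj (η.1 n K) * ∫ k, conj (f k) * ζ.1 (n + 1) (Fin.cons k K) := by
        rw [integral_const_mul, integral_finsetSum _ fun i _ => hint i]
        congr 1
        exact Finset.sum_congr rfl fun i _ => hterm i
    _ = ∫ K, conj (η.1 n K) * (ann f hf ζ).1 n K := by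
        rw [Finset.sum_const, Finset.card_univ, Fintype.card_fin, nsmul_eq_mul, ← mul_assoc,
          ← integral_const_mul]
        refine integral_congr_ae (ae_of_all _ fun K => ?_)
        dsimp only
        rw [ann_apply, Nat.cast_succ, ← hs2, ← mul_assoc, ← mul_assoc, ← mul_assoc,
          inv_mul_cancel₀ hs, one_mul]
        ring

lemma ip_ann {f : E3 → ℂ} (hf : IsMode f) (η ζ : niceFock) :
    ip (ann f hf η) ζ = ip η (cre f hf ζ) := by
  rw [← ip_conj_symm, ← ip_cre, ip_conj_symm]

lemma cons_removeNth_succ {n : ℕ} (k : E3) (K : Fin (n + 1) → E3) (j : Fin (n + 1)) :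
    (j.succ.removeNth (Fin.cons k K : Fin (n + 2) → E3) : Fin (n + 1) → E3) =
      Fin.cons k (j.removeNth K) := by
  funext i
  refine Fin.cases ?_ (fun i => ?_) i <;> simp [Fin.removeNth]

/-- Canonical commutation relations. -/
lemma ann_cre {f g : E3 → ℂ} (hf : IsMode f) (hg : IsMode g) (η : niceFock) :
    ann f hf (cre g hg η) = cre g hg (ann f hf η) + (∫ k, conj (f k) * g k) • η := by
  refine niceFock.ext' fun n K => ?_
  have hs : ∀ n : ℕ, (Real.sqrt (n + 1) : ℂ) ≠ 0 := by
    intro n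
    simp only [ne_eq, Complex.ofReal_eq_zero]
    positivity
  rw [ann_apply, ← integral_const_mul]
  have hfg := (hf.conj.mul hg).integrable
  rcases n with _ | n
  · change _ = 0 + (∫ k, conj (f k) * g k) * η.1 0 K
    rw [_root_.zero_add ((∫ k, conj (f k) * g k) * η.1 0 K), ← integral_mul_const]
    refine integral_congr_ae (ae_of_all _ fun k => ?_)
    dsimp only
    rw [cre_succ, Fin.sum_univ_succ, Fin.cons_zero, Finset.univ_eq_empty, Finset.sum_empty,
      add_zero (g k * _)]
    rw [show Fin.removeNth 0 (Fin.cons k K : Fin 1 → E3) = K from Subsingleton.elim _ _]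
    have := hs 0
    field_simp
  · rw [Submodule.coe_add, Pi.add_apply, Pi.add_apply, cre_succ, Submodule.coe_smul,
      Pi.smul_apply, Pi.smul_apply, smul_eq_mul, ← integral_mul_const]
    -- When the created particle sits in slot `0` it is contracted with `f`; the other slots
    -- reproduce `cre` applied after `ann`.
    have h1 : ∀ k, (Real.sqrt ((n + 1 : ℕ) + 1) : ℂ) *
        (conj (f k) * (cre g hg η).1 (n + 1 + 1) (Fin.cons k K)) =
        (∑ i, g (K i) * (conj (f k) * η.1 (n + 1) (Fin.cons k (i.removeNth K)))) +
          conj (f k) * g k * η.1 (n + 1) K := by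
      intro k
      rw [cre_succ, Fin.sum_univ_succ, Fin.cons_zero]
      simp only [Fin.cons_succ, cons_removeNth_succ, Fin.removeNth_zero, Fin.tail_cons]
      have := hs (n + 1)
      rw [show ∀ a b c d : ℂ, a * (b * (a⁻¹ * (c + d))) = (a * a⁻¹) * (b * (c + d)) by
        intros; ring, mul_inv_cancel₀ this, one_mul, mul_add, Finset.mul_sum, add_comm]
      congr 1
      · exact Finset.sum_congr rfl fun i _ => by ring
      · ring
    simp_rw [h1]
    rw [integral_add (integrable_finsetSum _ fun i _ =>
      (integrable_mode_mul hf η n (i.removeNth K)).const_mul _) (hfg.mul_const _),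
      integral_finsetSum _ fun i _ => (integrable_mode_mul hf η n (i.removeNth K)).const_mul _]
    congr 1
    rw [Finset.mul_sum]
    refine Finset.sum_congr rfl fun i _ => ?_
    rw [integral_const_mul, ann_apply]
    have := hs n
    field_simp

lemma ann_comm {f g : E3 → ℂ} (hf : IsMode f) (hg : IsMode g) (η : niceFock) :
    ann f hf (ann g hg η) = ann g hg (ann f hf η) := by
  refine niceFock.ext' fun n K => ?_
  have h : ∀ (f g : E3 → ℂ) (hf : IsMode f) (hg : IsMode g), (ann f hf (ann g hg η)).1 n K =
      (Real.sqrt (n + 1) : ℂ) * (Real.sqrt ((n + 1 : ℕ) + 1) : ℂ) *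
        ∫ k, ∫ l, conj (f k) * conj (g l) * η.1 (n + 2) (Fin.cons l (Fin.cons k K)) := by
    intro f g hf hg
    rw [ann_apply, mul_assoc]
    congr 1
    rw [← integral_const_mul]
    refine integral_congr_ae (ae_of_all _ fun k => ?_)
    dsimp only
    rw [ann_apply, mul_left_comm]
    congr 1
    rw [← integral_const_mul]
    refine integral_congr_ae (ae_of_all _ fun l => ?_)
    dsimp only
    ring
  rw [h f g hf hg, h g f hg hf]
  congr 1
  obtain ⟨C, hC⟩ := (isNice η).bdd (n + 2)
  rw [integral_integral_swap]
  · refine integral_congr_ae (ae_of_all _ fun k => ?_)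
    refine integral_congr_ae (ae_of_all _ fun l => ?_)
    dsimp only
    rw [mul_comm (conj (f l))]
    congr 1
    rw [show (Fin.cons k (Fin.cons l K : Fin (n + 1) → E3) : Fin (n + 2) → E3) =
      (Fin.cons l (Fin.cons k K : Fin (n + 1) → E3) : Fin (n + 2) → E3) ∘ Equiv.swap 0 1 from ?_,
      (isNice η).symm]
    funext i
    refine Fin.cases ?_ (fun i => Fin.cases ?_ (fun i => ?_) i) i
    · simp
    · simp
    · have : Equiv.swap (0 : Fin (n + 2)) 1 i.succ.succ = i.succ.succ :=
        Equiv.swap_apply_of_ne_of_ne (Fin.succ_ne_zero _) (by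
          rw [← Fin.succ_zero_eq_one]
          exact fun h => Fin.succ_ne_zero _ (Fin.succ_injective _ h))
      simp only [Function.comp_apply, this, Fin.cons_succ]
  · refine (hf.conj.integrable.mul_prod hg.conj.integrable).mul_bdd (c := C) ?_
      (ae_of_all _ fun k => hC _)
    have hm : Measurable fun p : E3 × E3 =>
        (Fin.cons p.2 (Fin.cons p.1 K : Fin (n + 1) → E3) : Fin (n + 2) → E3) :=
      measurable_cons.comp (measurable_snd.prodMk
        (measurable_cons.comp (measurable_fst.prodMk measurable_const)))
    exact (((isNice η).meas (n + 2)).comp hm).aestronglyMeasurable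

lemma ann_pow_eq_zero {f : E3 → ℂ} (hf : IsMode f) (η : niceFock) :
    ∃ N : ℕ, (ann f hf ^ N) η = 0 := by
  obtain ⟨N, hN⟩ := (isNice η).fin
  refine ⟨N, ?_⟩
  induction N generalizing η with
  | zero => exact niceFock.ext' fun n K => by simp [hN n (Nat.zero_le _)]
  | succ N ih =>
    rw [pow_succ, Module.End.mul_apply]
    refine ih _ fun n hn => funext fun K => ?_
    rw [ann_apply]
    simp [hN (n + 1) (by omega)]

/-! ### The relation between `a(k)` and `a(f)` -/

/-- Matrix elements of `a(k)` are themselves bounded with bounded support in `k`, so they can be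
integrated against weights with a Coulomb singularity. -/
lemma isMode_ip_annK (η ζ : niceFock) : IsMode fun k => ip η (annK k ζ) := by
  obtain ⟨N, hN⟩ := (isNice η).fin
  obtain ⟨R, hR⟩ := (isNice ζ).supp
  simp only [ip_eq_sum η _ hN]
  refine IsMode.sum _ fun n => ?_
  obtain ⟨C, hC⟩ := (isNice ζ).bdd (n + 1)
  obtain ⟨C', hC'⟩ := (isNice η).bdd n
  obtain ⟨R', hR'⟩ := (isNice η).supp
  have hi : Integrable (η.1 n) := integrable_of_bdd_pi ((isNice η).meas n) hC' (hR' n)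
  refine ⟨?_, ⟨∫ K, ‖η.1 n K‖ * (‖(Real.sqrt (n + 1) : ℂ)‖ * C), fun k => ?_⟩,
    ⟨R, fun k hk => ?_⟩⟩
  · refine StronglyMeasurable.measurable ?_
    refine StronglyMeasurable.integral_prod_right
        (f := fun (k : E3) (K : Fin n → E3) => conj (η.1 n K) * (annK k ζ).1 n K) ?_
    refine Measurable.stronglyMeasurable ?_
    simp only [annK_apply]
    exact (Complex.continuous_conj.measurable.comp (((isNice η).meas n).comp measurable_snd)).mul
        ((((isNice ζ).meas (n + 1)).comp measurable_cons).const_mul _)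
  · refine norm_integral_le_of_norm_le (hi.norm.mul_const _) (ae_of_all _ fun K => ?_)
    rw [norm_mul, RCLike.norm_conj, annK_apply, norm_mul]
    have := hC (Fin.cons k K)
    gcongr
  · refine integral_eq_zero_of_ae (ae_of_all _ fun K => ?_)
    simp [annK_apply, hR (n + 1) (Fin.cons k K) 0 (by simpa using hk)]

/-- Here `a(f)` acquires its meaning as a weak integral of `a(k)`. Only matrix elements are
integrated, so no vector-valued integral enters. -/
lemma ip_ann_eq_integral {f : E3 → ℂ} (hf : IsMode f) (η ζ : niceFock) :
    ip η (ann f hf ζ) = ∫ k, conj (f k) * ip η (annK k ζ) := by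
  obtain ⟨N, hN⟩ := (isNice η).fin
  simp only [ip_eq_sum η _ hN, Finset.mul_sum]
  have hint : ∀ n, Integrable (fun p : E3 × (Fin n → E3) => conj (f p.1) * (conj (η.1 n p.2) *
      (annK p.1 ζ).1 n p.2)) (volume.prod volume) := by
    intro n
    obtain ⟨C, hC⟩ := (isNice ζ).bdd (n + 1)
    obtain ⟨C', hC'⟩ := (isNice η).bdd n
    obtain ⟨R', hR'⟩ := (isNice η).supp
    have hi : Integrable fun K => conj (η.1 n K) := by
      refine integrable_of_bdd_pi (Complex.continuous_conj.measurable.comp ((isNice η).meas n))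
        (C := C') (R := R') (by simpa using hC') (by simpa using hR' n)
    have h := (hf.conj.integrable.mul_prod hi).mul_bdd (c := ‖(Real.sqrt (n + 1) : ℂ)‖ * C)
      (g := fun p => (annK p.1 ζ).1 n p.2) ?_ (ae_of_all _ fun p => ?_)
    · simpa only [mul_assoc] using h
    · simp only [annK_apply]
      exact ((((isNice ζ).meas (n + 1)).comp measurable_cons).const_mul _).aestronglyMeasurable
    · rw [annK_apply, norm_mul]
      exact mul_le_mul_of_nonneg_left (hC _) (norm_nonneg _)
  have h2 := fun n => (hint n).integral_prod_left
  simp only [integral_const_mul] at h2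
  rw [integral_finsetSum _ fun n _ => h2 n]
  refine Finset.sum_congr rfl fun n _ => ?_
  simp only [← integral_const_mul]
  rw [integral_integral_swap (hint n)]
  refine integral_congr_ae (ae_of_all _ fun K => ?_)
  dsimp only
  rw [ann_apply, ← integral_const_mul, ← integral_const_mul]
  refine integral_congr_ae (ae_of_all _ fun k => ?_)
  dsimp only
  rw [annK_apply]
  ring


lemma isMode_ip_annK_annK (η ζ : niceFock) : IsMode fun k => ip (annK k η) (annK k ζ) := by
  obtain ⟨N, hN⟩ := (isNice η).fin
  obtain ⟨R, hR⟩ := (isNice η).supp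
  have hN' : ∀ k n, N ≤ n → (annK k η).1 n = 0 := fun k n hn => funext fun K => by
    rw [annK_apply, hN (n + 1) (by omega)]
    simp
  simp only [fun k => ip_eq_sum (annK k η) (annK k ζ) (hN' k)]
  refine IsMode.sum _ fun n => ?_
  obtain ⟨C, hC⟩ := (isNice ζ).bdd (n + 1)
  obtain ⟨C', hC'⟩ := (isNice η).bdd (n + 1)
  have hm : ∀ η : niceFock, Measurable fun p : E3 × (Fin n → E3) => (annK p.1 η).1 n p.2 := by
    intro η
    simp only [annK_apply]
    exact (((isNice η).meas (n + 1)).comp measurable_cons).const_mul _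
  set S : Set (Fin n → E3) := {K | ∀ i, ‖K i‖ ≤ R}
  have hSm : MeasurableSet S := by
    have : S = ⋂ i, {K | ‖K i‖ ≤ R} := by ext; simp [S]
    rw [this]
    exact MeasurableSet.iInter fun i =>
      measurableSet_le (measurable_norm.comp (measurable_pi_apply i)) measurable_const
  set M := (‖(Real.sqrt (n + 1) : ℂ)‖ * C') * (‖(Real.sqrt (n + 1) : ℂ)‖ * C)
  have hi : Integrable (S.indicator fun _ => M) :=
    (integrable_indicator_iff hSm).2 (integrableOn_const (volume_ball_pi_ne_top n R))
  refine ⟨?_, ⟨∫ K, S.indicator (fun _ => M) K, fun k => ?_⟩, ⟨R, fun k hk => ?_⟩⟩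
  · refine StronglyMeasurable.measurable ?_
    refine StronglyMeasurable.integral_prod_right
        (f := fun (k : E3) (K : Fin n → E3) => conj ((annK k η).1 n K) * (annK k ζ).1 n K) ?_
    exact Measurable.stronglyMeasurable
      ((Complex.continuous_conj.measurable.comp (hm η)).mul (hm ζ))
  · refine norm_integral_le_of_norm_le hi (ae_of_all _ fun K => ?_)
    by_cases hK : K ∈ S
    · rw [Set.indicator_of_mem hK, norm_mul, RCLike.norm_conj, annK_apply, norm_mul, annK_apply,
        norm_mul]
      have h1 := hC (Fin.cons k K)
      have h2 := hC' (Fin.cons k K)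
      have h3 : 0 ≤ C' := (norm_nonneg _).trans h2
      exact mul_le_mul (mul_le_mul_of_nonneg_left h2 (norm_nonneg _))
        (mul_le_mul_of_nonneg_left h1 (norm_nonneg _)) (by positivity) (by positivity)
    · rw [Set.indicator_of_notMem hK]
      simp only [S, Set.mem_ofPred_eq, not_forall, not_le] at hK
      obtain ⟨i, hi⟩ := hK
      rw [annK_apply, hR (n + 1) (Fin.cons k K) i.succ (by simpa using hi)]
      simp
  · refine integral_eq_zero_of_ae (ae_of_all _ fun K => ?_)
    simp [annK_apply, hR (n + 1) (Fin.cons k K) 0 (by simpa using hk)]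

lemma integrable_nsq_annK (η : niceFock) : Integrable fun k => nsq (annK k η) :=
  (isMode_ip_annK_annK η η).integrable.re

lemma IsMode.integrable_norm_sq {f : E3 → ℂ} (hf : IsMode f) : Integrable fun k => ‖f k‖ ^ 2 := by
  have := (hf.conj.mul hf).integrable.re
  refine this.congr (ae_of_all _ fun k => ?_)
  simp only [← Complex.normSq_eq_conj_mul_self, Complex.normSq_eq_norm_sq]
  exact Complex.ofReal_re _

lemma IsMode.integral_conj_mul_self {f : E3 → ℂ} (_hf : IsMode f) :
    ∫ k, conj (f k) * f k = ((∫ k, ‖f k‖ ^ 2 : ℝ) : ℂ) := by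
  rw [← integral_complex_ofReal]
  refine integral_congr_ae (ae_of_all _ fun k => ?_)
  simp only [← Complex.normSq_eq_conj_mul_self, Complex.normSq_eq_norm_sq]

/-- Optimization in `t` replaces the Cauchy–Schwarz inequality. For `c > 0` the value `t = c⁻¹`
suffices; for `c = 0` a sufficiently large `t` contradicts `x > 0`. -/
lemma le_mul_of_forall_young {x c n : ℝ} (hc0 : 0 ≤ c) (hn0 : 0 ≤ n)
    (key : ∀ t : ℝ, 0 < t → 2 * x ≤ t * c * x + t⁻¹ * n) : x ≤ c * n := by
  rcases hc0.eq_or_lt with h | h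
  · rw [← h, zero_mul]
    by_contra hlt
    push Not at hlt
    have := key ((n + 1) / x) (by positivity)
    rw [← h, inv_div] at this
    have h3 : x / (n + 1) * n ≤ x := by
      rw [div_mul_eq_mul_div, div_le_iff₀ (by positivity)]
      nlinarith
    linarith
  · have := key c⁻¹ (by positivity)
    rw [inv_mul_cancel₀ h.ne', inv_inv] at this
    linarith

/-- `‖a(f) η‖² ≤ ‖f‖² ∫_S ‖a(k) η‖² dk` if `f` vanishes outside `S`. -/
lemma nsq_ann_le {f : E3 → ℂ} (hf : IsMode f) {S : Set E3} (hS : MeasurableSet S)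
    (hfS : ∀ k, k ∉ S → f k = 0) (η : niceFock) :
    nsq (ann f hf η) ≤ (∫ k, ‖f k‖ ^ 2) * ∫ k in S, nsq (annK k η) := by
  set χ := ann f hf η with hχ
  set c := ∫ k, ‖f k‖ ^ 2 with hc
  set n := ∫ k in S, nsq (annK k η) with hn
  have hn0 : 0 ≤ n := integral_nonneg fun k => nsq_nonneg _
  have hc0 : 0 ≤ c := integral_nonneg fun k => by positivity
  have hχ0 := nsq_nonneg χ
  have key : ∀ t : ℝ, 0 < t → 2 * nsq χ ≤ t * c * nsq χ + t⁻¹ * n := by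
    intro t ht
    have hint := (hf.conj.mul (isMode_ip_annK χ η)).integrable
    have h1 : nsq χ = ∫ k, (conj (f k) * ip χ (annK k η)).re := by
      conv_lhs => rw [nsq, hχ, ← hχ, ip_ann_eq_integral]
      have := Complex.reCLM.integral_comp_comm hint
      simpa using this.symm
    -- Young's inequality is applied for each `k` with the vector `χ` itself in one slot; its norm
    -- reappears on the right and is absorbed at the end by the choice of `t`.
    have h2 : 2 * nsq χ ≤ ∫ k, (t * nsq χ * ‖f k‖ ^ 2 +
        t⁻¹ * S.indicator (fun k => nsq (annK k η)) k) := by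
      rw [h1, ← integral_const_mul]
      refine integral_mono (hint.re.const_mul 2) ((hf.integrable_norm_sq.const_mul _).add
        (((integrable_nsq_annK η).indicator hS).const_mul _)) fun k => ?_
      dsimp only
      rw [← h1]
      by_cases hk : k ∈ S
      · rw [Set.indicator_of_mem hk]
        have := young' (conj (f k)) χ (annK k η) ht
        rw [RCLike.norm_conj] at this
        have h3 := le_abs_self (conj (f k) * ip χ (annK k η)).re
        linarith
      · rw [Set.indicator_of_notMem hk, hfS k hk]
        simp
    rw [integral_add (hf.integrable_norm_sq.const_mul _)
        (((integrable_nsq_annK η).indicator hS).const_mul _), integral_const_mul,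
        integral_const_mul, integral_indicator hS] at h2
    linarith
  exact le_mul_of_forall_young hc0 hn0 key

lemma nsq_cre {f : E3 → ℂ} (hf : IsMode f) (η : niceFock) :
    nsq (cre f hf η) = nsq (ann f hf η) + (∫ k, ‖f k‖ ^ 2) * nsq η := by
  have : ip (cre f hf η) (cre f hf η) =
      ip (ann f hf η) (ann f hf η) + (∫ k, ‖f k‖ ^ 2 : ℝ) * ip η η := by
    rw [ip_cre, ann_cre, map_add, map_smul, hf.integral_conj_mul_self, smul_eq_mul, ← ip_ann]
  rw [nsq, this, Complex.add_re, Complex.re_ofReal_mul, nsq, nsq]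


/-! ### The Coulomb energy in Fourier space -/

/-- `∫ e^{ikx} ρ(x) dx`. -/
noncomputable def chargeFT (ρ : E3 → ℝ) (k : E3) : ℂ :=
  ∫ x, Complex.exp (Complex.I * (inner ℝ k x : ℝ)) * (ρ x : ℂ)

lemma norm_planeWave (t : ℝ) : ‖Complex.exp (Complex.I * t)‖ = 1 := by
  rw [mul_comm, Complex.norm_exp_ofReal_mul_I]

lemma integrable_planeWave_mul {ρ : E3 → ℂ} (hρ : Integrable ρ) (k : E3) :
    Integrable fun x => Complex.exp (Complex.I * (inner ℝ k x : ℝ)) * ρ x := by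
  refine hρ.bdd_mul (c := 1) (Continuous.aestronglyMeasurable (by fun_prop))
    (ae_of_all _ fun x => (norm_planeWave _).le)

lemma norm_sq_chargeFT (ρ : E3 → ℝ) (k : E3) :
    ((‖chargeFT ρ k‖ ^ 2 : ℝ) : ℂ) = ∫ p : E3 × E3,
      Complex.exp (Complex.I * (inner ℝ k (p.1 - p.2) : ℝ)) * ((ρ p.1 * ρ p.2 : ℝ) : ℂ) := by
  rw [← Complex.normSq_eq_norm_sq, ← Complex.mul_conj, chargeFT, ← integral_conj]
  rw [show (volume : Measure (E3 × E3)) = volume.prod volume from rfl, ← integral_prod_mul]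
  refine integral_congr_ae (ae_of_all _ fun p => ?_)
  dsimp only
  rw [map_mul, ← Complex.exp_conj, map_mul, Complex.conj_I, Complex.conj_ofReal,
    Complex.conj_ofReal, mul_mul_mul_comm, ← Complex.exp_add, inner_sub_right]
  push_cast
  ring_nf

lemma integral_gaussian_planeWave {t : ℝ} (ht : 0 < t) (w : E3) :
    ∫ k : E3, (Real.exp (-t * ‖k‖ ^ 2) : ℂ) * Complex.exp (Complex.I * (inner ℝ k w : ℝ)) =
      (((Real.pi / t) ^ (3 / 2 : ℝ) * Real.exp (-‖w‖ ^ 2 / (4 * t)) : ℝ) : ℂ) := by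
  have h := GaussianFourier.integral_cexp_neg_mul_sq_norm_add (V := E3) (b := (t : ℂ))
    (by simpa using ht) Complex.I w
  have h2 : ∀ k : E3, (Real.exp (-t * ‖k‖ ^ 2) : ℂ) *
      Complex.exp (Complex.I * (inner ℝ k w : ℝ)) =
      Complex.exp (-(t : ℂ) * (‖k‖ : ℂ) ^ 2 + Complex.I * (inner ℝ w k : ℝ)) := by
    intro k
    rw [Complex.exp_add, real_inner_comm]
    push_cast
    rfl
  simp_rw [h2]
  rw [h]
  push_cast
  congr 1
  · rw [Complex.ofReal_cpow (by positivity)]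
    push_cast
    congr 1
    simp
  · congr 1
    rw [Complex.I_sq]
    ring

lemma integrable_exp_neg_mul_norm_sq {t : ℝ} (ht : 0 < t) :
    Integrable fun k : E3 => Real.exp (-t * ‖k‖ ^ 2) := by
  have h := GaussianFourier.integrable_cexp_neg_mul_sq_norm_add (V := E3) (b := (t : ℂ))
    (by simpa using ht) 0 0
  refine h.re.congr (ae_of_all _ fun k => ?_)
  simp only [inner_zero_left, Complex.ofReal_zero, mul_zero, add_zero]
  have : (-(t : ℂ) * (‖k‖ : ℂ) ^ 2) = ((-t * ‖k‖ ^ 2 : ℝ) : ℂ) := by push_cast; ring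
  rw [this]
  exact Complex.exp_ofReal_re _

/-- The Gaussian factor makes the integral over `k` and the two positions absolutely convergent,
which is what permits Fubini. -/
lemma integral_gaussian_mul_chargeFT {ρ : E3 → ℝ} (hρ : Integrable ρ) {t : ℝ} (ht : 0 < t) :
    ∫ k : E3, Real.exp (-t * ‖k‖ ^ 2) * ‖chargeFT ρ k‖ ^ 2 =
      ∫ p : E3 × E3, (Real.pi / t) ^ (3 / 2 : ℝ) * Real.exp (-‖p.1 - p.2‖ ^ 2 / (4 * t)) *
        (ρ p.1 * ρ p.2) := by
  rw [← Complex.ofReal_inj, ← integral_complex_ofReal, ← integral_complex_ofReal]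
  have h1 : ∀ k : E3, ((Real.exp (-t * ‖k‖ ^ 2) * ‖chargeFT ρ k‖ ^ 2 : ℝ) : ℂ) =
      ∫ p : E3 × E3, (Real.exp (-t * ‖k‖ ^ 2) : ℂ) *
        (Complex.exp (Complex.I * (inner ℝ k (p.1 - p.2) : ℝ)) * ((ρ p.1 * ρ p.2 : ℝ) : ℂ)) := by
    intro k
    rw [integral_const_mul, ← norm_sq_chargeFT ρ]
    push_cast
    rfl
  simp_rw [h1]
  rw [integral_integral_swap]
  · refine integral_congr_ae (ae_of_all _ fun p => ?_)
    dsimp only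
    rw [Complex.ofReal_mul (_ * _), ← integral_gaussian_planeWave ht, ← integral_mul_const]
    refine integral_congr_ae (ae_of_all _ fun k => ?_)
    dsimp only
    ring
  · have hg : Integrable fun k : E3 => (Real.exp (-t * ‖k‖ ^ 2) : ℂ) :=
      (integrable_exp_neg_mul_norm_sq ht).ofReal
    have hp : Integrable (fun p : E3 × E3 => ((ρ p.1 * ρ p.2 : ℝ) : ℂ)) :=
      (hρ.mul_prod hρ).ofReal
    have := (hg.mul_prod hp).bdd_mul (c := 1)
      (f := fun q : E3 × (E3 × E3) => Complex.exp (Complex.I * (inner ℝ q.1 (q.2.1 - q.2.2) : ℝ)))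
      (Continuous.aestronglyMeasurable (by fun_prop)) (ae_of_all _ fun x => (norm_planeWave _).le)
    refine this.congr (ae_of_all _ fun q => ?_)
    simp only [Function.uncurry]
    ring

lemma lintegral_exp_neg_mul {c : ℝ} (hc : 0 < c) :
    ∫⁻ t in Set.Ioi (0 : ℝ), ENNReal.ofReal (Real.exp (-t * c)) = ENNReal.ofReal (1 / c) := by
  have h1 : ∀ t : ℝ, Real.exp (-t * c) = Real.exp (-c * t) := fun t => by ring_nf
  simp_rw [h1]
  rw [← ofReal_integral_eq_lintegral_ofReal (exp_neg_integrableOn_Ioi 0 hc)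
    (ae_of_all _ fun t => (Real.exp_pos _).le)]
  congr 1
  have := integral_exp_mul_Ioi (a := -c) (by linarith) 0
  rw [this]
  simp [neg_div_neg_eq]

/-- The substitution `y = t ^ (-1/2)` produces a half-line Gaussian in `y`. Up to a constant this is
the Coulomb potential as the time integral of the heat kernel. -/
lemma lintegral_heat_kernel {r : ℝ} (hr : 0 < r) :
    ∫⁻ t in Set.Ioi (0 : ℝ), ENNReal.ofReal ((Real.pi / t) ^ (3 / 2 : ℝ) *
      Real.exp (-r ^ 2 / (4 * t))) = ENNReal.ofReal (2 * Real.pi ^ 2 / r) := by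
  set g : ℝ → ℝ := fun y => Real.exp (-(r ^ 2 / 4) * y ^ 2) with hg
  have hp : (-1 / 2 : ℝ) ≠ 0 := by norm_num
  have ha : 0 < r ^ 2 / 4 := by positivity
  have hgi : IntegrableOn g (Set.Ioi 0) := (integrable_exp_neg_mul_sq ha).integrableOn
  have h1 := integral_comp_rpow_Ioi g hp
  have h2 := (integrableOn_Ioi_comp_rpow_iff g hp).2 hgi
  rw [hg, integral_gaussian_Ioi] at h1
  have heq : ∀ t ∈ Set.Ioi (0 : ℝ), (Real.pi / t) ^ (3 / 2 : ℝ) * Real.exp (-r ^ 2 / (4 * t)) =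
      2 * Real.pi ^ (3 / 2 : ℝ) *
        ((|(-1 / 2 : ℝ)| * t ^ ((-1 / 2 : ℝ) - 1)) • g (t ^ (-1 / 2 : ℝ))) := by
    intro t ht
    have ht : 0 < t := ht
    rw [hg, Real.div_rpow Real.pi_pos.le ht.le, smul_eq_mul,
      show |(-1 / 2 : ℝ)| = 1 / 2 by norm_num [abs_of_neg]]
    have e1 : (t ^ (-1 / 2 : ℝ)) ^ 2 = t⁻¹ := by
      rw [← Real.rpow_natCast, ← Real.rpow_mul ht.le]
      norm_num [Real.rpow_neg_one]
    have e2 : t ^ ((-1 / 2 : ℝ) - 1) = (t ^ (3 / 2 : ℝ))⁻¹ := by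
      rw [← Real.rpow_neg ht.le]
      norm_num
    simp only [e1, e2]
    rw [show -(r ^ 2 / 4) * t⁻¹ = -r ^ 2 / (4 * t) by field_simp]
    ring
  rw [setLIntegral_congr_fun measurableSet_Ioi fun t ht => by rw [heq t ht]]
  rw [← ofReal_integral_eq_lintegral_ofReal (h2.const_mul _)]
  · rw [integral_const_mul, h1]
    congr 1
    have e3 : Real.pi / (r ^ 2 / 4) = (2 / r) ^ 2 * Real.pi := by
      field_simp
      ring
    rw [e3, Real.sqrt_mul (by positivity), Real.sqrt_sq (by positivity), Real.sqrt_eq_rpow]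
    have e4 : Real.pi ^ (3 / 2 : ℝ) * Real.pi ^ (1 / 2 : ℝ) = Real.pi ^ 2 := by
      rw [← Real.rpow_add Real.pi_pos]
      norm_num
    rw [← e4]
    ring
  · refine (ae_restrict_iff' measurableSet_Ioi).2 (ae_of_all _ fun t ht => ?_)
    have ht : 0 < t := ht
    simp only [Pi.zero_apply, hg]
    positivity

lemma continuous_chargeFT {ρ : E3 → ℝ} (hρ : Integrable ρ) : Continuous (chargeFT ρ) := by
  refine continuous_of_dominated (bound := fun x => |ρ x|) (fun k => ?_) (fun k => ?_) hρ.norm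
    (ae_of_all _ fun x => by fun_prop)
  · exact (integrable_planeWave_mul hρ.ofReal k).aestronglyMeasurable
  · refine ae_of_all _ fun x => ?_
    rw [norm_mul, norm_planeWave, one_mul, Complex.norm_real, Real.norm_eq_abs]

/-- Coulomb energy of a charge distribution, in momentum and position space. -/
lemma lintegral_chargeFT {ρ : E3 → ℝ} (hρ : Integrable ρ) (hm : Measurable ρ)
    (h0 : ∀ x, 0 ≤ ρ x) :
    ∫⁻ k, ENNReal.ofReal (‖chargeFT ρ k‖ ^ 2 / ‖k‖ ^ 2) =
      ∫⁻ p : E3 × E3, ENNReal.ofReal (2 * Real.pi ^ 2 * (ρ p.1 * ρ p.2 / ‖p.1 - p.2‖)) := by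
  have hne : ∀ᵐ k : E3, k ≠ 0 := by
    rw [ae_iff]
    simp
  have hne2 : ∀ᵐ p : E3 × E3, p.1 ≠ p.2 := by
    have hms : MeasurableSet {p : E3 × E3 | p.1 = p.2} :=
      measurableSet_eq_fun measurable_fst measurable_snd
    rw [ae_iff]
    simp only [ne_eq, not_not]
    rw [show (volume : Measure (E3 × E3)) = volume.prod volume from rfl,
      Measure.prod_apply hms, lintegral_eq_zero_iff (measurable_measure_prodMk_left hms)]
    refine ae_of_all _ fun x => ?_
    have : Prod.mk x ⁻¹' {p : E3 × E3 | p.1 = p.2} = {x} := by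
      ext y
      simp [eq_comm]
    simp only [this, Pi.zero_apply, measure_singleton]
  have hmft : Measurable fun k => ‖chargeFT ρ k‖ ^ 2 :=
    ((continuous_chargeFT hρ).norm.pow 2).measurable
  -- `1 / |k|²` is the integral of `exp (-t |k|²)` over `t > 0`. At fixed `t` the Gaussian Fourier
  -- transform passes to position space, where the heat kernel is integrated back. Since everything
  -- is non-negative, no finiteness is required for exchanging the integrals in `t`.
  calc ∫⁻ k, ENNReal.ofReal (‖chargeFT ρ k‖ ^ 2 / ‖k‖ ^ 2)
      = ∫⁻ k, ∫⁻ t in Set.Ioi (0 : ℝ),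
          ENNReal.ofReal (Real.exp (-t * ‖k‖ ^ 2) * ‖chargeFT ρ k‖ ^ 2) := by
        refine lintegral_congr_ae ?_
        filter_upwards [hne] with k hk
        have hk2 : 0 < ‖k‖ ^ 2 := by positivity
        simp_rw [fun t : ℝ => ENNReal.ofReal_mul (p := Real.exp (-t * ‖k‖ ^ 2))
          (q := ‖chargeFT ρ k‖ ^ 2) (Real.exp_pos _).le]
        rw [lintegral_mul_const _ (by fun_prop), lintegral_exp_neg_mul hk2,
          ← ENNReal.ofReal_mul (by positivity)]
        congr 1
        ring
    _ = ∫⁻ t in Set.Ioi (0 : ℝ), ∫⁻ k,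
          ENNReal.ofReal (Real.exp (-t * ‖k‖ ^ 2) * ‖chargeFT ρ k‖ ^ 2) := by
        refine lintegral_lintegral_swap (Measurable.aemeasurable ?_)
        simp only [Function.uncurry_def]
        refine ENNReal.measurable_ofReal.comp (Measurable.mul ?_ (hmft.comp measurable_fst))
        fun_prop
    _ = ∫⁻ t in Set.Ioi (0 : ℝ), ∫⁻ p : E3 × E3, ENNReal.ofReal ((Real.pi / t) ^ (3 / 2 : ℝ) *
          Real.exp (-‖p.1 - p.2‖ ^ 2 / (4 * t)) * (ρ p.1 * ρ p.2)) := by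
        refine setLIntegral_congr_fun measurableSet_Ioi fun t ht => ?_
        have ht : 0 < t := ht
        have hi : Integrable fun p : E3 × E3 => ρ p.1 * ρ p.2 := hρ.mul_prod hρ
        rw [← ofReal_integral_eq_lintegral_ofReal, ← ofReal_integral_eq_lintegral_ofReal,
          integral_gaussian_mul_chargeFT hρ ht]
        · refine hi.bdd_mul (c := (Real.pi / t) ^ (3 / 2 : ℝ))
            (Continuous.aestronglyMeasurable (by fun_prop)) (ae_of_all _ fun p => ?_)
          rw [Real.norm_eq_abs, abs_of_nonneg (by positivity)]
          refine mul_le_of_le_one_right (by positivity) (Real.exp_le_one_iff.2 ?_)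
          rw [neg_div]
          simp only [Left.neg_nonpos_iff]
          positivity
        · refine ae_of_all _ fun p => ?_
          have := h0 p.1
          have := h0 p.2
          simp only [Pi.zero_apply]
          positivity
        · refine (integrable_exp_neg_mul_norm_sq ht).mul_bdd (c := (∫ x, |ρ x|) ^ 2)
            hmft.aestronglyMeasurable (ae_of_all _ fun k => ?_)
          rw [Real.norm_eq_abs, abs_of_nonneg (by positivity)]
          refine pow_le_pow_left₀ (norm_nonneg _) ?_ 2
          refine norm_integral_le_of_norm_le hρ.norm (ae_of_all _ fun x => ?_)
          rw [norm_mul, norm_planeWave, one_mul, Complex.norm_real, Real.norm_eq_abs]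
        · refine ae_of_all _ fun p => ?_
          simp only [Pi.zero_apply]
          positivity
    _ = ∫⁻ p : E3 × E3, ∫⁻ t in Set.Ioi (0 : ℝ), ENNReal.ofReal ((Real.pi / t) ^ (3 / 2 : ℝ) *
          Real.exp (-‖p.1 - p.2‖ ^ 2 / (4 * t)) * (ρ p.1 * ρ p.2)) := by
        refine lintegral_lintegral_swap (Measurable.aemeasurable ?_)
        simp only [Function.uncurry_def]
        fun_prop
    _ = _ := by
        refine lintegral_congr_ae ?_
        filter_upwards [hne2] with p hp
        have hr : 0 < ‖p.1 - p.2‖ := norm_pos_iff.2 (sub_ne_zero.2 hp)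
        have h1 : ∀ t ∈ Set.Ioi (0 : ℝ), ENNReal.ofReal ((Real.pi / t) ^ (3 / 2 : ℝ) *
          Real.exp (-‖p.1 - p.2‖ ^ 2 / (4 * t)) * (ρ p.1 * ρ p.2)) =
          ENNReal.ofReal ((Real.pi / t) ^ (3 / 2 : ℝ) *
          Real.exp (-‖p.1 - p.2‖ ^ 2 / (4 * t))) * ENNReal.ofReal (ρ p.1 * ρ p.2) := by
          intro t ht
          have ht : 0 < t := ht
          exact ENNReal.ofReal_mul (by positivity)
        rw [setLIntegral_congr_fun measurableSet_Ioi h1, lintegral_mul_const _ (by fun_prop),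
          lintegral_heat_kernel hr, ← ENNReal.ofReal_mul (by positivity)]
        congr 1
        ring

/-- An inequality is enough because the momentum cells cover only a part of momentum space and the
integrand is non-negative. -/
lemma setIntegral_chargeFT_le {ρ : E3 → ℝ} (hρ : Integrable ρ) (hm : Measurable ρ)
    (h0 : ∀ x, 0 ≤ ρ x)
    (hC : Integrable fun p : E3 × E3 => ρ p.1 * ρ p.2 / ‖p.1 - p.2‖) (S : Set E3) :
    ∫ k in S, ‖chargeFT ρ k‖ ^ 2 / ‖k‖ ^ 2 ≤
      2 * Real.pi ^ 2 * ∫ x, ∫ y, ρ x * ρ y / ‖x - y‖ := by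
  have h := lintegral_chargeFT hρ hm h0
  have hi : ∫ x, ∫ y, ρ x * ρ y / ‖x - y‖ = ∫ p : E3 × E3, ρ p.1 * ρ p.2 / ‖p.1 - p.2‖ :=
    (integral_prod _ hC).symm
  have hnn : ∀ p : E3 × E3, 0 ≤ ρ p.1 * ρ p.2 / ‖p.1 - p.2‖ := fun p => by
    have := h0 p.1
    have := h0 p.2
    positivity
  rw [← ofReal_integral_eq_lintegral_ofReal (hC.const_mul _) (ae_of_all _ fun p =>
    mul_nonneg (by positivity) (hnn p))] at h
  rw [hi, ← integral_const_mul]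
  have hmft : Measurable fun k => ‖chargeFT ρ k‖ ^ 2 / ‖k‖ ^ 2 :=
    (((continuous_chargeFT hρ).norm.pow 2).measurable).div (by fun_prop)
  rw [integral_eq_lintegral_of_nonneg_ae (ae_of_all _ fun k => by
    simp only [Pi.zero_apply]; positivity) hmft.aestronglyMeasurable]
  refine ENNReal.toReal_le_of_le_ofReal (integral_nonneg fun p =>
    mul_nonneg (by positivity) (hnn p)) ?_
  rw [← h]
  exact setLIntegral_le_lintegral _ _


/-! ### Covariant derivatives -/

/-- `A ∈ L²_loc`. -/
def LocSq (A : E3 → E3) : Prop :=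
  ∀ K : Set E3, IsCompact K → ∀ j : Fin 3, MemLp (fun x => A x j) 2 (volume.restrict K)

/-- The classical covariant derivative of a test function. -/
noncomputable def covT (A : E3 → E3) (j : Fin 3) (u : E3 → ℂ) (x : E3) : ℂ :=
  -Complex.I * pderiv j u x + (A x j : ℂ) * u x

lemma continuous_pderiv (j : Fin 3) {u : E3 → ℂ} (hu : ContDiff ℝ ∞ u) :
    Continuous (pderiv j u) :=
  (hu.continuous_fderiv (by simp)).clm_apply continuous_const

lemma contDiff_pderiv (j : Fin 3) {u : E3 → ℂ} (hu : ContDiff ℝ ∞ u) :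
    ContDiff ℝ ∞ (pderiv j u) :=
  (hu.fderiv_right (m := ∞) (by simp)).clm_apply contDiff_const

lemma hasCompactSupport_pderiv (j : Fin 3) {u : E3 → ℂ} (hu : HasCompactSupport u) :
    HasCompactSupport (pderiv j u) :=
  hu.fderiv_apply (𝕜 := ℝ) _

/-- The partial derivative of a test function is a test function. -/
noncomputable def TestFn.pd (j : Fin 3) (u : TestFn) : TestFn :=
  ⟨pderiv j u.1, contDiff_pderiv j u.2.1, hasCompactSupport_pderiv j u.2.2⟩

lemma TestFn.memLp (u : TestFn) (p : ENNReal) : MemLp u.1 p volume :=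
  u.2.1.continuous.memLp_of_hasCompactSupport u.2.2

lemma TestFn.memLp_pderiv (u : TestFn) (j : Fin 3) (p : ENNReal) :
    MemLp (pderiv j u.1) p volume :=
  (u.pd j).memLp p

/-- A real test function, regarded as complex valued. -/
def TestFn.ofReal (u : E3 → ℝ) (hu : ContDiff ℝ ∞ u) (hu' : HasCompactSupport u) : TestFn :=
  ⟨fun x => (u x : ℂ), Complex.ofRealCLM.contDiff.comp hu,
    hu'.comp_left (g := fun r : ℝ => (r : ℂ)) (by simp)⟩

lemma TestFn.integrable (u : TestFn) : Integrable u.1 :=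
  u.2.1.continuous.integrable_of_hasCompactSupport u.2.2

lemma TestFn.bound (u : TestFn) : ∃ C : ℝ, ∀ x, ‖u.1 x‖ ≤ C :=
  u.2.2.exists_bound_of_continuous u.2.1.continuous

lemma TestFn.differentiable (u : TestFn) : Differentiable ℝ u.1 :=
  u.2.1.differentiable (by simp)

lemma pderiv_add (j : Fin 3) {u v : E3 → ℂ} (hu : Differentiable ℝ u) (hv : Differentiable ℝ v)
    (x : E3) : pderiv j (fun x => u x + v x) x = pderiv j u x + pderiv j v x := by
  rw [pderiv, fderiv_fun_add (hu x) (hv x)]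
  rfl

lemma pderiv_mul (j : Fin 3) {u v : E3 → ℂ} (hu : Differentiable ℝ u) (hv : Differentiable ℝ v)
    (x : E3) : pderiv j (fun x => u x * v x) x = u x * pderiv j v x + pderiv j u x * v x := by
  rw [pderiv, fderiv_fun_mul (hu x) (hv x)]
  simp [pderiv, mul_comm]

lemma pderiv_const_mul (j : Fin 3) (c : ℂ) {u : E3 → ℂ} (hu : Differentiable ℝ u)
    (x : E3) : pderiv j (fun x => c * u x) x = c * pderiv j u x := by
  rw [pderiv, fderiv_const_mul (hu x)]
  simp [pderiv]

lemma memLp_loc_mul {f : E3 → ℝ} {g : E3 → ℂ} {K : Set E3} (hK : IsCompact K)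
    (hf : MemLp f 2 (volume.restrict K)) (hg : AEStronglyMeasurable g volume)
    {C : ℝ} (hC : ∀ x, ‖g x‖ ≤ C) (h0 : ∀ x, x ∉ K → g x = 0) :
    MemLp (fun x => (f x : ℂ) * g x) 2 volume := by
  have h1 : (fun x => (f x : ℂ) * g x) = K.indicator fun x => (f x : ℂ) * g x := by
    funext x
    by_cases hx : x ∈ K
    · rw [Set.indicator_of_mem hx]
    · rw [Set.indicator_of_notMem hx, h0 x hx, mul_zero]
  rw [h1, memLp_indicator_iff_restrict hK.measurableSet]
  refine MemLp.of_le_mul (c := C) hf (hf.ofReal.aestronglyMeasurable.mul hg.restrict)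
    (ae_of_all _ fun x => ?_)
  rw [norm_mul, Complex.norm_real, mul_comm]
  exact mul_le_mul_of_nonneg_right (hC x) (norm_nonneg _)

lemma LocSq.memLp_mul {A : E3 → E3} (hA : LocSq A) (j : Fin 3) (u : TestFn) :
    MemLp (fun x => (A x j : ℂ) * u.1 x) 2 volume := by
  obtain ⟨C, hC⟩ := u.bound
  exact memLp_loc_mul u.2.2 (hA _ u.2.2 j) u.2.1.continuous.aestronglyMeasurable hC
    fun x hx => image_eq_zero_of_notMem_tsupport hx

lemma LocSq.memLp_covT {A : E3 → E3} (hA : LocSq A) (j : Fin 3) (u : TestFn) :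
    MemLp (covT A j u.1) 2 volume :=
  ((u.memLp_pderiv j 2).const_mul _).add (hA.memLp_mul j u)

lemma integrable_mul_of_sq {f g : E3 → ℂ} (hf : MemLp f 2 volume) (hg : MemLp g 2 volume) :
    Integrable fun x => f x * g x :=
  MemLp.integrable_mul hf hg

lemma LocSq.integrable_pairing {A : E3 → E3} (hA : LocSq A) (j : Fin 3) {φ : E3 → ℂ}
    (hφ : MemLp φ 2 volume) (u : TestFn) :
    Integrable fun x => φ x * (Complex.I * pderiv j u.1 x + (A x j : ℂ) * u.1 x) :=
  integrable_mul_of_sq hφ (((u.memLp_pderiv j 2).const_mul _).add (hA.memLp_mul j u))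

lemma integral_mul_pderiv (j : Fin 3) (u v : TestFn) :
    ∫ x, u.1 x * pderiv j v.1 x = -∫ x, pderiv j u.1 x * v.1 x :=
  integral_mul_fderiv_eq_neg_fderiv_mul_of_integrable
    (integrable_mul_of_sq (u.memLp_pderiv j 2) (v.memLp 2))
    (integrable_mul_of_sq (u.memLp 2) (v.memLp_pderiv j 2))
    (integrable_mul_of_sq (u.memLp 2) (v.memLp 2)) (fun x _ => u.differentiable x)
    (fun x _ => v.differentiable x)

lemma LocSq.isCovDeriv_covT {A : E3 → E3} (hA : LocSq A) (j : Fin 3) (u : TestFn) :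
    IsCovDeriv A j u.1 (covT A j u.1) := by
  intro v
  have h1 := integrable_mul_of_sq (u.memLp_pderiv j 2) (v.memLp 2)
  have h2 := integrable_mul_of_sq (u.memLp 2) (v.memLp_pderiv j 2)
  have h3 := integrable_mul_of_sq (hA.memLp_mul j u) (v.memLp 2)
  have e1 : ∀ x, covT A j u.1 x * v.1 x = -Complex.I * (pderiv j u.1 x * v.1 x) +
      (A x j : ℂ) * u.1 x * v.1 x := fun x => by rw [covT]; ring
  have e2 : ∀ x, u.1 x * (Complex.I * pderiv j v.1 x + (A x j : ℂ) * v.1 x) =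
      Complex.I * (u.1 x * pderiv j v.1 x) + (A x j : ℂ) * u.1 x * v.1 x := fun x => by ring
  simp_rw [e1, e2]
  rw [integral_add (h1.const_mul _) h3, integral_add (h2.const_mul _) h3, integral_const_mul,
    integral_const_mul, integral_mul_pderiv]
  ring

lemma IsCovDeriv.unique {A : E3 → E3} {j : Fin 3} {φ g g' : E3 → ℂ} (hg : MemLp g 2 volume)
    (hg' : MemLp g' 2 volume) (h : IsCovDeriv A j φ g) (h' : IsCovDeriv A j φ g') :
    g =ᵐ[volume] g' := by
  refine ae_eq_of_integral_contDiff_smul_eq (hg.locallyIntegrable (by norm_num))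
    (hg'.locallyIntegrable (by norm_num)) fun u hu hu' => ?_
  have := (h (TestFn.ofReal u hu hu')).trans (h' (TestFn.ofReal u hu hu')).symm
  simpa [TestFn.ofReal, mul_comm] using this

lemma IsCovDeriv.congr {A : E3 → E3} {j : Fin 3} {φ φ' g g' : E3 → ℂ} (h : IsCovDeriv A j φ g)
    (hφ : φ =ᵐ[volume] φ') (hg : g =ᵐ[volume] g') : IsCovDeriv A j φ' g' := by
  intro u
  refine (integral_congr_ae ?_).trans ((h u).trans (integral_congr_ae ?_))
  · filter_upwards [hg] with x hx
    rw [hx]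
  · filter_upwards [hφ] with x hx
    rw [hx]

lemma LocSq.isCovDeriv_sum {A : E3 → E3} (hA : LocSq A) (j : Fin 3) {ι : Type*} (s : Finset ι)
    (c : ι → ℂ) {φ g : ι → E3 → ℂ} (hφ : ∀ i, MemLp (φ i) 2 volume)
    (hg : ∀ i, MemLp (g i) 2 volume) (h : ∀ i, IsCovDeriv A j (φ i) (g i)) :
    IsCovDeriv A j (fun x => ∑ i ∈ s, c i * φ i x) (fun x => ∑ i ∈ s, c i * g i x) := by
  intro u
  simp only [Finset.sum_mul, mul_assoc]
  rw [integral_finsetSum _ fun i _ => (integrable_mul_of_sq (hg i) (u.memLp 2)).const_mul _,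
    integral_finsetSum _ fun i _ => (hA.integrable_pairing j (hφ i) u).const_mul _]
  refine Finset.sum_congr rfl fun i _ => ?_
  rw [integral_const_mul, integral_const_mul, h i u]

lemma LocSq.isCovDeriv_sub {A : E3 → E3} (hA : LocSq A) (j : Fin 3) {φ φ' g g' : E3 → ℂ}
    (hφ : MemLp φ 2 volume) (hφ' : MemLp φ' 2 volume) (hg : MemLp g 2 volume)
    (hg' : MemLp g' 2 volume) (h : IsCovDeriv A j φ g) (h' : IsCovDeriv A j φ' g') :
    IsCovDeriv A j (fun x => φ x - φ' x) (fun x => g x - g' x) := by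
  intro u
  simp only [sub_mul]
  rw [integral_sub (integrable_mul_of_sq hg (u.memLp 2)) (integrable_mul_of_sq hg' (u.memLp 2)),
    integral_sub (hA.integrable_pairing j hφ u) (hA.integrable_pairing j hφ' u), h u, h' u]

lemma covDeriv_spec {A : E3 → E3} {φ : E3 → ℂ} (h : MemH1A A φ) (j : Fin 3) :
    MemLp (covDeriv A j φ) 2 volume ∧ IsCovDeriv A j φ (covDeriv A j φ) := by
  rw [covDeriv, dif_pos (h.2 j)]
  exact (h.2 j).choose_spec

lemma covDeriv_ae_eq {A : E3 → E3} {j : Fin 3} {φ g : E3 → ℂ} (hg : MemLp g 2 volume)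
    (h : IsCovDeriv A j φ g) : covDeriv A j φ =ᵐ[volume] g := by
  have hex : ∃ g : E3 → ℂ, MemLp g 2 volume ∧ IsCovDeriv A j φ g := ⟨g, hg, h⟩
  rw [covDeriv, dif_pos hex]
  exact IsCovDeriv.unique hex.choose_spec.1 hg hex.choose_spec.2 h

lemma kineticForm_eq {A : E3 → E3} {φ : E3 → ℂ} {g : Fin 3 → E3 → ℂ}
    (hg : ∀ j, MemLp (g j) 2 volume) (h : ∀ j, IsCovDeriv A j φ (g j)) :
    kineticForm A φ = ∑ j, ∫ x, ‖g j x‖ ^ 2 := by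
  refine Finset.sum_congr rfl fun j _ => integral_congr_ae ?_
  filter_upwards [covDeriv_ae_eq (hg j) (h j)] with x hx
  rw [hx]

lemma LocSq.memH1A {A : E3 → E3} (hA : LocSq A) (u : TestFn) : MemH1A A u.1 :=
  ⟨u.memLp 2, fun j => ⟨_, hA.memLp_covT j u, hA.isCovDeriv_covT j u⟩⟩

lemma memH1A_sum {A : E3 → E3} (hA : LocSq A) {ι : Type*} (s : Finset ι)
    (c : ι → ℂ) {φ : ι → E3 → ℂ} (hφ : ∀ i, MemH1A A (φ i)) :
    MemH1A A (fun x => ∑ i ∈ s, c i * φ i x) :=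
  ⟨memLp_finsetSum _ fun i _ => (hφ i).1.const_mul _, fun j => ⟨_,
    memLp_finsetSum _ fun i _ => ((covDeriv_spec (hφ i) j).1).const_mul _,
    hA.isCovDeriv_sum j s c (fun i => (hφ i).1) (fun i => (covDeriv_spec (hφ i) j).1)
      fun i => (covDeriv_spec (hφ i) j).2⟩⟩

lemma kineticForm_test {A : E3 → E3} (hA : LocSq A) (u : TestFn) :
    kineticForm A u.1 = ∑ j, ∫ x, ‖covT A j u.1 x‖ ^ 2 :=
  kineticForm_eq (fun j => hA.memLp_covT j u) fun j => hA.isCovDeriv_covT j u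

lemma h1NormSq_test_sub {A : E3 → E3} (hA : LocSq A) (u : TestFn) {φ : E3 → ℂ}
    (hφ : MemH1A A φ) : h1NormSq A (fun x => u.1 x - φ x) =
      (∫ x, ‖u.1 x - φ x‖ ^ 2) + ∑ j, ∫ x, ‖covT A j u.1 x - covDeriv A j φ x‖ ^ 2 := by
  rw [h1NormSq, kineticForm_eq (fun j => (hA.memLp_covT j u).sub (covDeriv_spec hφ j).1) fun j =>
    hA.isCovDeriv_sub j (u.memLp 2) hφ.1 (hA.memLp_covT j u) (covDeriv_spec hφ j).1
      (hA.isCovDeriv_covT j u) (covDeriv_spec hφ j).2]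
  rfl


/-! ### Mollification -/

/-- Bump functions of radius `1 / (n + 1)`. -/
noncomputable def bumpSeq (n : ℕ) : ContDiffBump (0 : E3) where
  rIn := 1 / (2 * (n + 1))
  rOut := 1 / (n + 1)
  rIn_pos := by positivity
  rIn_lt_rOut := by
    rw [div_lt_div_iff₀ (by positivity) (by positivity)]
    have : (0 : ℝ) ≤ n := by positivity
    linarith

/-- Normalized bump functions. -/
noncomputable def molKer (n : ℕ) : E3 → ℝ := (bumpSeq n).normed volume

section Moll

variable {F : Type*} [NormedAddCommGroup F] [NormedSpace ℝ F]

/-- Mollification. -/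
noncomputable def moll (n : ℕ) (f : E3 → F) (x : E3) : F := ∫ t, molKer n t • f (x - t)

lemma molKer_nonneg (n : ℕ) (x : E3) : 0 ≤ molKer n x := (bumpSeq n).nonneg_normed x

lemma integral_molKer (n : ℕ) : ∫ x, molKer n x = 1 := (bumpSeq n).integral_normed

lemma contDiff_molKer (n : ℕ) : ContDiff ℝ ∞ (molKer n) := (bumpSeq n).contDiff_normed

lemma hasCompactSupport_molKer (n : ℕ) : HasCompactSupport (molKer n) :=
  (bumpSeq n).hasCompactSupport_normed

lemma molKer_eq_zero {n : ℕ} {x : E3} (hx : 1 ≤ ‖x‖) : molKer n x = 0 := by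
  by_contra h
  have : x ∈ Function.support (molKer n) := h
  rw [molKer, ContDiffBump.support_normed_eq, mem_ball_zero_iff] at this
  have h2 : (bumpSeq n).rOut ≤ 1 := by
    rw [bumpSeq, div_le_one (by positivity)]
    have : (0 : ℝ) ≤ n := by positivity
    linarith
  linarith

lemma integrable_molKer (n : ℕ) : Integrable (molKer n) :=
  (contDiff_molKer n).continuous.integrable_of_hasCompactSupport (hasCompactSupport_molKer n)

lemma integrable_molKer_smul (n : ℕ) {f : E3 → F} (hf : LocallyIntegrable f) (x : E3) :
    Integrable fun t => molKer n t • f (x - t) :=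
  (hasCompactSupport_molKer n).convolutionExists_left (ContinuousLinearMap.lsmul ℝ ℝ)
    (contDiff_molKer n).continuous hf x

lemma moll_eq_convolution (n : ℕ) (f : E3 → F) :
    moll n f = convolution (molKer n) f (ContinuousLinearMap.lsmul ℝ ℝ) volume := rfl

lemma moll_eq_swap (n : ℕ) (f : E3 → F) (x : E3) :
    moll n f x = ∫ t, molKer n (x - t) • f t := by
  rw [moll_eq_convolution, convolution_lsmul_swap]

lemma contDiff_moll [CompleteSpace F] (n : ℕ) {f : E3 → F} (hf : LocallyIntegrable f) :
    ContDiff ℝ ∞ (moll n f) :=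
  (hasCompactSupport_molKer n).contDiff_convolution_left (ContinuousLinearMap.lsmul ℝ ℝ)
    (contDiff_molKer n) hf

lemma moll_eq_zero (n : ℕ) {f : E3 → F} {R : ℝ} (hf : ∀ x, R < ‖x‖ → f x = 0) {x : E3}
    (hx : R + 1 < ‖x‖) : moll n f x = 0 := by
  refine integral_eq_zero_of_ae (ae_of_all _ fun t => ?_)
  dsimp only
  by_cases ht : 1 ≤ ‖t‖
  · rw [molKer_eq_zero ht, zero_smul]
    rfl
  · rw [hf, smul_zero]
    · rfl
    · have := norm_sub_norm_le x t
      push Not at ht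
      linarith

lemma tendsto_moll [CompleteSpace F] {f : E3 → F} (hf : LocallyIntegrable f) :
    ∀ᵐ x, Tendsto (fun n => moll n f x) atTop (𝓝 (f x)) := by
  refine ContDiffBump.ae_convolution_tendsto_right_of_locallyIntegrable (φ := bumpSeq) (K := 2) ?_
    (Eventually.of_forall fun n => ?_) hf
  · exact tendsto_one_div_add_atTop_nhds_zero_nat
  · simp only [bumpSeq]
    apply le_of_eq
    field_simp

lemma norm_moll_le (n : ℕ) (f : E3 → F) (x : E3) :
    ‖moll n f x‖ ≤ moll n (fun x => ‖f x‖) x := by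
  refine (norm_integral_le_integral_norm _).trans_eq (integral_congr_ae (ae_of_all _ fun t => ?_))
  dsimp only
  rw [norm_smul, Real.norm_of_nonneg (molKer_nonneg n t), smul_eq_mul]

lemma norm_moll_le_of_bound (n : ℕ) {f : E3 → F} {C : ℝ} (hC : ∀ x, ‖f x‖ ≤ C) (x : E3) :
    ‖moll n f x‖ ≤ C := by
  refine (norm_integral_le_of_norm_le ((integrable_molKer n).mul_const C)
    (ae_of_all _ fun t => ?_)).trans_eq ?_
  · rw [norm_smul, Real.norm_of_nonneg (molKer_nonneg n t)]
    exact mul_le_mul_of_nonneg_left (hC _) (molKer_nonneg n t)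
  · rw [integral_mul_const, integral_molKer, one_mul]

lemma integrable_moll [CompleteSpace F] (n : ℕ) {f : E3 → F} (hf : Integrable f) :
    Integrable (moll n f) :=
  Integrable.integrable_convolution (ContinuousLinearMap.lsmul ℝ ℝ) (integrable_molKer n) hf

lemma integral_moll (n : ℕ) {f : E3 → ℝ} (hf : Integrable f) : ∫ x, moll n f x = ∫ x, f x := by
  rw [moll_eq_convolution, integral_convolution _ (integrable_molKer n) hf, integral_molKer]
  simp

end Moll

/-- Jensen's inequality for the probability density `molKer n`, obtained by integrating `molKer n t
* ‖f (x - t) - c‖ ^ 2 ≥ 0` with `c` the mean. -/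
lemma norm_sq_moll_le (n : ℕ) {f : E3 → ℂ} (hf : LocallyIntegrable f)
    (hf2 : LocallyIntegrable fun x => ‖f x‖ ^ 2) (x : E3) :
    ‖moll n f x‖ ^ 2 ≤ moll n (fun x => ‖f x‖ ^ 2) x := by
  set c := moll n f x with hc
  have h1 := integrable_molKer_smul n hf x
  have h2 := integrable_molKer_smul n hf2 x
  have h1' : Integrable fun t => 2 * (conj c * molKer n t • f (x - t)).re :=
    ((h1.const_mul (conj c)).re).const_mul 2
  have h3 : 0 ≤ ∫ t, (molKer n t • ‖f (x - t)‖ ^ 2 - 2 * (conj c * molKer n t • f (x - t)).re +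
      molKer n t * ‖c‖ ^ 2) := by
    refine integral_nonneg fun t => ?_
    have h4 : molKer n t • ‖f (x - t)‖ ^ 2 - 2 * (conj c * molKer n t • f (x - t)).re +
      molKer n t * ‖c‖ ^ 2 = molKer n t * ‖f (x - t) - c‖ ^ 2 := by
      rw [← Complex.normSq_eq_norm_sq, ← Complex.normSq_eq_norm_sq, ← Complex.normSq_eq_norm_sq,
        Complex.normSq_apply, Complex.normSq_apply, Complex.normSq_apply]
      simp
      ring
    simp only [Pi.zero_apply]
    rw [h4]
    exact mul_nonneg (molKer_nonneg n t) (by positivity)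
  have h5 : ∫ t, (molKer n t • ‖f (x - t)‖ ^ 2 - 2 * (conj c * molKer n t • f (x - t)).re +
      molKer n t * ‖c‖ ^ 2) = moll n (fun x => ‖f x‖ ^ 2) x - 2 * ‖c‖ ^ 2 + ‖c‖ ^ 2 := by
    have h21 : Integrable fun t => molKer n t • ‖f (x - t)‖ ^ 2 -
        2 * (conj c * molKer n t • f (x - t)).re := h2.sub h1'
    rw [integral_add h21 ((integrable_molKer n).mul_const _), integral_sub h2 h1',
      integral_mul_const, integral_molKer, integral_const_mul, one_mul]
    congr 2
    have := Complex.reCLM.integral_comp_comm (h1.const_mul (conj c))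
    simp only [Complex.reCLM_apply] at this
    rw [this, integral_const_mul]
    change 2 * (conj c * c).re = _
    rw [← Complex.normSq_eq_conj_mul_self, Complex.ofReal_re, Complex.normSq_eq_norm_sq]
  linarith

/-- A dominated convergence theorem with convergent dominating functions. -/
lemma tendsto_integral_zero_of_dominated {X G : ℕ → E3 → ℝ} {G' : E3 → ℝ}
    (hXm : ∀ n, AEStronglyMeasurable (X n) volume) (hG : ∀ n, Integrable (G n))
    (hG' : Integrable G') (h0 : ∀ n x, 0 ≤ X n x) (hG0 : ∀ n x, 0 ≤ G n x) (hG0' : ∀ x, 0 ≤ G' x)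
    (hle : ∀ n x, X n x ≤ 2 * (G n x + G' x)) (hint : ∀ n, ∫ x, G n x = ∫ x, G' x)
    (hGlim : ∀ᵐ x, Tendsto (fun n => G n x) atTop (𝓝 (G' x)))
    (hXlim : ∀ᵐ x, Tendsto (fun n => X n x) atTop (𝓝 0)) :
    Tendsto (fun n => ∫ x, X n x) atTop (𝓝 0) := by
  have hGG : ∀ n, Integrable fun x => G n x - G' x := fun n => (hG n).sub hG'
  have hGp : ∀ n, Integrable fun x => max (G' x - G n x) 0 := fun n => (hG'.sub (hG n)).pos_part
  -- Scheffé's argument: `G n` and `G'` have equal integrals, so their `L¹` distance is twice the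
  -- integral of the positive part of `G' - G n`, which is dominated by `G'`.
  have hpos : Tendsto (fun n => ∫ x, max (G' x - G n x) 0) atTop (𝓝 0) := by
    have := tendsto_integral_of_dominated_convergence (μ := (volume : Measure E3))
      (F := fun n x => max (G' x - G n x) 0) (f := fun _ => 0) G'
      (fun n => (hGp n).aestronglyMeasurable) hG' (fun n => ae_of_all _ fun x => ?_)
      ?_
    · simpa using this
    · rw [Real.norm_of_nonneg (le_max_right _ _)]
      exact max_le (by linarith [hG0 n x]) (hG0' x)
    · filter_upwards [hGlim] with x hx
      have := (tendsto_const_nhds (x := G' x)).sub hx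
      simpa using this.max (tendsto_const_nhds (x := (0 : ℝ)))
  have habs : Tendsto (fun n => ∫ x, |G n x - G' x|) atTop (𝓝 0) := by
    have h2 : ∀ n, ∫ x, |G n x - G' x| = 2 * ∫ x, max (G' x - G n x) 0 := by
      intro n
      have e : ∀ x, |G n x - G' x| = (G n x - G' x) + 2 * max (G' x - G n x) 0 := by
        intro x
        rcases le_total (G n x) (G' x) with h | h
        · rw [abs_of_nonpos (by linarith), max_eq_left (by linarith)]
          ring
        · rw [abs_of_nonneg (by linarith), max_eq_right (by linarith)]
          ring
      simp_rw [e]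
      rw [integral_add (hGG n) ((hGp n).const_mul 2),
        integral_sub (hG n) hG', hint, sub_self, zero_add, integral_const_mul]
    simp_rw [h2]
    simpa using hpos.const_mul 2
  -- After subtraction of `2 |G n - G'|` the sequence lies below the fixed integrable function `4
  -- G'`, and ordinary dominated convergence applies.
  have hY : Tendsto (fun n => ∫ x, max (X n x - 2 * |G n x - G' x|) 0) atTop (𝓝 0) := by
    have := tendsto_integral_of_dominated_convergence (μ := (volume : Measure E3))
      (F := fun n x => max (X n x - 2 * |G n x - G' x|) 0) (f := fun _ => 0) (fun x => 4 * G' x)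
      (fun n => ?_) (hG'.const_mul 4) (fun n => ae_of_all _ fun x => ?_) ?_
    · simpa using this
    · exact ((hXm n).sub ((hGG n).abs.aestronglyMeasurable.const_mul 2)).sup
        aestronglyMeasurable_const
    · rw [Real.norm_of_nonneg (le_max_right _ _)]
      refine max_le ?_ (by linarith [hG0' x])
      have := hle n x
      have := le_abs_self (G n x - G' x)
      linarith
    · filter_upwards [hGlim, hXlim] with x hx hx'
      have h1 : Tendsto (fun n => |G n x - G' x|) atTop (𝓝 0) := by
        simpa using (hx.sub (tendsto_const_nhds (x := G' x))).abs
      simpa using (hx'.sub (h1.const_mul 2)).max (tendsto_const_nhds (x := (0 : ℝ)))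
  have hXi : ∀ n, Integrable (X n) := fun n =>
    (((hG n).add hG').const_mul 2).mono' (hXm n) (ae_of_all _ fun x => by
      rw [Real.norm_of_nonneg (h0 n x)]
      exact hle n x)
  refine squeeze_zero (fun n => integral_nonneg (h0 n)) (fun n => ?_)
    (by simpa using hY.add (habs.const_mul 2))
  have hi1 : Integrable fun x => max (X n x - 2 * |G n x - G' x|) 0 :=
    ((hXi n).sub ((hGG n).abs.const_mul 2)).pos_part
  rw [← integral_const_mul, ← integral_add hi1 ((hGG n).abs.const_mul 2)]
  refine integral_mono (hXi n) (hi1.add ((hGG n).abs.const_mul 2)) fun x => ?_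
  have := le_max_left (X n x - 2 * |G n x - G' x|) 0
  change X n x ≤ max (X n x - 2 * |G n x - G' x|) 0 + 2 * |G n x - G' x|
  linarith

lemma tendsto_moll_L1 {f : E3 → ℂ} (hf : Integrable f) :
    Tendsto (fun n => ∫ x, ‖moll n f x - f x‖) atTop (𝓝 0) := by
  have hl := hf.locallyIntegrable
  refine tendsto_integral_zero_of_dominated (G := fun n => moll n fun x => ‖f x‖)
    (G' := fun x => ‖f x‖) (fun n => ?_) (fun n => integrable_moll n hf.norm) hf.norm
    (fun n x => norm_nonneg _) (fun n x => ?_) (fun x => norm_nonneg _) (fun n x => ?_)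
    (fun n => integral_moll n hf.norm) (tendsto_moll hf.norm.locallyIntegrable) ?_
  · exact ((integrable_moll n hf).sub hf).norm.aestronglyMeasurable
  · exact (norm_nonneg _).trans (norm_moll_le n f x)
  · have h1 := norm_moll_le n f x
    have h2 := norm_sub_le (moll n f x) (f x)
    have h3 := norm_nonneg (f x)
    have h4 := norm_nonneg (moll n f x)
    linarith
  · filter_upwards [tendsto_moll hl] with x hx
    simpa using (hx.sub (tendsto_const_nhds (x := f x))).norm

lemma norm_sub_sq_le (a b : ℂ) : ‖a - b‖ ^ 2 ≤ 2 * (‖a‖ ^ 2 + ‖b‖ ^ 2) := by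
  have h := norm_sub_le a b
  have h1 := norm_nonneg (a - b)
  nlinarith [sq_nonneg (‖a‖ - ‖b‖)]

lemma norm_add_sq_le (a b : ℂ) : ‖a + b‖ ^ 2 ≤ 2 * (‖a‖ ^ 2 + ‖b‖ ^ 2) := by
  simpa using norm_sub_sq_le a (-b)

lemma integrable_norm_sq {f : E3 → ℂ} (hf : MemLp f 2 volume) :
    Integrable fun x => ‖f x‖ ^ 2 :=
  (memLp_two_iff_integrable_sq_norm hf.aestronglyMeasurable).1 hf

lemma tendsto_moll_L2 {f : E3 → ℂ} (hf : MemLp f 2 volume) :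
    Tendsto (fun n => ∫ x, ‖moll n f x - f x‖ ^ 2) atTop (𝓝 0) := by
  have hl := hf.locallyIntegrable (by norm_num)
  have hi : Integrable fun x => ‖f x‖ ^ 2 := integrable_norm_sq hf
  refine tendsto_integral_zero_of_dominated (G := fun n => moll n fun x => ‖f x‖ ^ 2)
    (G' := fun x => ‖f x‖ ^ 2) (fun n => ?_) (fun n => integrable_moll n hi) hi
    (fun n x => by positivity) (fun n x => ?_) (fun x => by positivity) (fun n x => ?_)
    (fun n => integral_moll n hi) (tendsto_moll hi.locallyIntegrable) ?_
  · exact (((contDiff_moll n hl).continuous.aestronglyMeasurable.sub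
      hf.aestronglyMeasurable).norm).pow 2
  · exact (by positivity : (0 : ℝ) ≤ ‖moll n f x‖ ^ 2).trans
      (norm_sq_moll_le n hl hi.locallyIntegrable x)
  · have h1 := norm_sq_moll_le n hl hi.locallyIntegrable x
    have h2 := norm_sub_sq_le (moll n f x) (f x)
    linarith
  · filter_upwards [tendsto_moll hl] with x hx
    simpa using ((hx.sub (tendsto_const_nhds (x := f x))).norm).pow 2

/-- `h` is the weak partial derivative `∂_j φ`. -/
def IsWeakDeriv (j : Fin 3) (φ h : E3 → ℂ) : Prop :=
  ∀ u : TestFn, ∫ x, φ x * pderiv j u.1 x = -∫ x, h x * u.1 x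

/-- The derivative is put on the kernel, and the reflected kernel `molKer n (x - ·)` serves as test
function in the definition of the weak derivative. -/
lemma pderiv_moll (n : ℕ) (j : Fin 3) {φ h : E3 → ℂ} (hφ : LocallyIntegrable φ)
    (hw : IsWeakDeriv j φ h) (x : E3) : pderiv j (moll n φ) x = moll n h x := by
  have hflip : moll n φ = convolution φ (molKer n)
      (ContinuousLinearMap.lsmul ℝ ℝ (E := ℂ)).flip volume :=
    (convolution_flip (ContinuousLinearMap.lsmul ℝ ℝ (E := ℂ))).symm
  have hd := (hasCompactSupport_molKer n).hasFDerivAt_convolution_right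
    (ContinuousLinearMap.lsmul ℝ ℝ (E := ℂ)).flip hφ ((contDiff_molKer n).of_le (by simp)) x
  rw [pderiv, hflip, hd.fderiv, convolution_precompR_apply _ hφ
    ((hasCompactSupport_molKer n).fderiv (𝕜 := ℝ)) ((contDiff_molKer n).continuous_fderiv (by simp)),
    convolution_def]
  set v : E3 := EuclideanSpace.single j 1
  have hsub : ContDiff ℝ ∞ fun y : E3 => x - y := by fun_prop
  have hcs : HasCompactSupport fun y : E3 => molKer n (x - y) :=
    (hasCompactSupport_molKer n).comp_homeomorph (Homeomorph.subLeft x)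
  let u : TestFn := TestFn.ofReal (fun y => molKer n (x - y)) ((contDiff_molKer n).comp hsub) hcs
  have hu : ∀ y, pderiv j u.1 y = -((fderiv ℝ (molKer n) (x - y) v : ℝ) : ℂ) := by
    intro y
    have h1 : HasFDerivAt (fun y : E3 => molKer n (x - y))
        ((fderiv ℝ (molKer n) (x - y)).comp (-ContinuousLinearMap.id ℝ E3)) y := by
      refine HasFDerivAt.comp y (((contDiff_molKer n).differentiable (by simp)) _).hasFDerivAt ?_
      simpa using (hasFDerivAt_id y).const_sub x
    have h2 := Complex.ofRealCLM.hasFDerivAt.comp y h1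
    have h3 : pderiv j u.1 y = (Complex.ofRealCLM.comp
      ((fderiv ℝ (molKer n) (x - y)).comp (-ContinuousLinearMap.id ℝ E3))) v := by
      rw [pderiv, ← h2.fderiv]
      rfl
    rw [h3]
    simp
  have := hw u
  simp only [hu, mul_neg, integral_neg, neg_inj] at this
  rw [moll_eq_swap]
  refine Eq.trans (integral_congr_ae (ae_of_all _ fun t => ?_)) (this.trans
    (integral_congr_ae (ae_of_all _ fun t => ?_)))
  · simp [mul_comm]
  · simp [u, TestFn.ofReal, mul_comm]


/-! ### Density of test functions in `H¹_A` -/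

/-- `φ ∈ H¹_A` with covariant derivatives `g`. -/
structure CovPair (A : E3 → E3) (φ : E3 → ℂ) (g : Fin 3 → E3 → ℂ) : Prop where
  mem : MemLp φ 2 volume
  memD : ∀ j, MemLp (g j) 2 volume
  cov : ∀ j, IsCovDeriv A j φ (g j)

/-- Squared distance in `H¹_A`. -/
noncomputable def pairDist (φ : E3 → ℂ) (g : Fin 3 → E3 → ℂ) (φ' : E3 → ℂ)
    (g' : Fin 3 → E3 → ℂ) : ℝ :=
  (∫ x, ‖φ x - φ' x‖ ^ 2) + ∑ j, ∫ x, ‖g j x - g' j x‖ ^ 2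

lemma integral_norm_sub_sq_le {a b c : E3 → ℂ} (ha : MemLp a 2 volume) (hb : MemLp b 2 volume)
    (hc : MemLp c 2 volume) : ∫ x, ‖a x - c x‖ ^ 2 ≤
      2 * ((∫ x, ‖a x - b x‖ ^ 2) + ∫ x, ‖b x - c x‖ ^ 2) := by
  have h1 : Integrable fun x => ‖a x - b x‖ ^ 2 := integrable_norm_sq (ha.sub hb)
  have h2 : Integrable fun x => ‖b x - c x‖ ^ 2 := integrable_norm_sq (hb.sub hc)
  have h3 : Integrable fun x => ‖a x - c x‖ ^ 2 := integrable_norm_sq (ha.sub hc)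
  rw [← integral_add h1 h2, ← integral_const_mul]
  refine integral_mono h3 ((h1.add h2).const_mul 2) fun x => ?_
  have := norm_add_sq_le (a x - b x) (b x - c x)
  rwa [sub_add_sub_cancel] at this

lemma pairDist_triangle {A : E3 → E3} {φ φ' φ'' : E3 → ℂ} {g g' g'' : Fin 3 → E3 → ℂ}
    (h : CovPair A φ g) (h' : CovPair A φ' g') (h'' : CovPair A φ'' g'') :
    pairDist φ g φ'' g'' ≤ 2 * (pairDist φ g φ' g' + pairDist φ' g' φ'' g'') := by
  have h1 := integral_norm_sub_sq_le h.mem h'.mem h''.mem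
  have h2 := fun j => integral_norm_sub_sq_le (h.memD j) (h'.memD j) (h''.memD j)
  have h3 := Finset.sum_le_sum fun (j : Fin 3) (_ : j ∈ Finset.univ) => h2 j
  rw [← Finset.mul_sum, Finset.sum_add_distrib] at h3
  simp only [pairDist]
  linarith

lemma tendsto_integral_sq_zero {f : ℕ → E3 → ℂ} {b : E3 → ℝ}
    (hm : ∀ n, AEStronglyMeasurable (f n) volume) (hb : Integrable b)
    (hle : ∀ n x, ‖f n x‖ ^ 2 ≤ b x) (hlim : ∀ᵐ x, Tendsto (fun n => f n x) atTop (𝓝 0)) :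
    Tendsto (fun n => ∫ x, ‖f n x‖ ^ 2) atTop (𝓝 0) := by
  have := tendsto_integral_of_dominated_convergence (μ := (volume : Measure E3))
    (F := fun n x => ‖f n x‖ ^ 2) (f := fun _ => 0) b (fun n => (hm n).norm.pow 2) hb
    (fun n => ae_of_all _ fun x => by simpa using hle n x)
    (by
      filter_upwards [hlim] with x hx
      simpa using hx.norm.pow 2)
  simpa using this

/-- Testing `η φ` against `u` is testing `φ` against `η u`; the derivative falling on `η` gives the
additional term. -/
lemma CovPair.testFn_mul {A : E3 → E3} (hA : LocSq A) {φ : E3 → ℂ} {g : Fin 3 → E3 → ℂ}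
    (h : CovPair A φ g) (η : TestFn) : CovPair A (fun x => η.1 x * φ x)
      (fun j x => η.1 x * g j x - Complex.I * pderiv j η.1 x * φ x) := by
  have hb : ∀ (η : TestFn) {f : E3 → ℂ}, MemLp f 2 volume →
      MemLp (fun x => η.1 x * f x) 2 volume := by
    intro η f hf
    obtain ⟨C, hC⟩ := η.bound
    refine MemLp.of_le_mul (c := C) hf
      (η.2.1.continuous.aestronglyMeasurable.mul hf.aestronglyMeasurable) (ae_of_all _ fun x => ?_)
    rw [norm_mul]
    exact mul_le_mul_of_nonneg_right (hC x) (norm_nonneg _)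
  refine ⟨hb η h.mem, fun j => (hb η (h.memD j)).sub ?_, fun j u => ?_⟩
  · simp only [mul_assoc]
    exact (hb (η.pd j) h.mem).const_mul _
  · let w : TestFn := ⟨fun x => η.1 x * u.1 x, η.2.1.mul u.2.1, u.2.2.mul_left⟩
    have h1 := h.cov j w
    have hw : ∀ x, pderiv j w.1 x = η.1 x * pderiv j u.1 x + pderiv j η.1 x * u.1 x :=
      pderiv_mul j η.differentiable u.differentiable
    have i1 : Integrable fun x => g j x * w.1 x := integrable_mul_of_sq (h.memD j) (w.memLp 2)
    have i2 : Integrable fun x => Complex.I * (φ x * (pderiv j η.1 x * u.1 x)) := by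
      let w' : TestFn := ⟨fun x => pderiv j η.1 x * u.1 x,
        (η.pd j).2.1.mul u.2.1, u.2.2.mul_left⟩
      exact (integrable_mul_of_sq h.mem (w'.memLp 2)).const_mul _
    have i3 := hA.integrable_pairing j h.mem w
    have e1 : ∀ x, (η.1 x * g j x - Complex.I * pderiv j η.1 x * φ x) * u.1 x =
        g j x * w.1 x - Complex.I * (φ x * (pderiv j η.1 x * u.1 x)) := fun x => by
      simp only [w]
      ring
    have e2 : ∀ x, η.1 x * φ x * (Complex.I * pderiv j u.1 x + (A x j : ℂ) * u.1 x) =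
        φ x * (Complex.I * pderiv j w.1 x + (A x j : ℂ) * w.1 x) -
          Complex.I * (φ x * (pderiv j η.1 x * u.1 x)) := fun x => by
      rw [hw]
      simp only [w]
      ring
    simp_rw [e1, e2]
    rw [integral_sub i1 i2, integral_sub i3 i2, h1]

lemma pderiv_comp_smul (j : Fin 3) {u : E3 → ℂ} (hu : Differentiable ℝ u) (c : ℝ) (x : E3) :
    pderiv j (fun x => u (c • x)) x = c * pderiv j u (c • x) := by
  have h : HasFDerivAt (fun x : E3 => u (c • x))
      ((fderiv ℝ u (c • x)).comp (c • ContinuousLinearMap.id ℝ E3)) x :=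
    HasFDerivAt.comp x (hu _).hasFDerivAt ((hasFDerivAt_id x).const_smul c)
  rw [pderiv, h.fderiv]
  simp [pderiv]

/-- A cutoff function equal to one on the unit ball. -/
noncomputable def cutoffBump : ContDiffBump (0 : E3) := ⟨1, 2, by norm_num, by norm_num⟩

/-- Cutoff functions on balls of growing radius. -/
noncomputable def cutoff (n : ℕ) : TestFn :=
  TestFn.ofReal (fun x => cutoffBump (((n : ℝ) + 1)⁻¹ • x))
    (cutoffBump.contDiff.comp (contDiff_const_smul _))
    (cutoffBump.hasCompactSupport.comp_homeomorph
      (Homeomorph.smulOfNeZero (((n : ℝ) + 1)⁻¹) (by positivity)))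

lemma norm_cutoff_le (n : ℕ) (x : E3) : ‖(cutoff n).1 x‖ ≤ 1 := by
  simp only [cutoff, TestFn.ofReal, Complex.norm_real]
  rw [Real.norm_of_nonneg cutoffBump.nonneg]
  exact cutoffBump.le_one

lemma cutoff_eventually (x : E3) : ∀ᶠ n : ℕ in atTop, (cutoff n).1 x = 1 := by
  filter_upwards [eventually_ge_atTop ⌈‖x‖⌉₊] with n hn
  have h1 : ‖x‖ ≤ n := (Nat.le_ceil _).trans (by exact_mod_cast hn)
  simp only [cutoff, TestFn.ofReal]
  rw [cutoffBump.one_of_mem_closedBall]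
  · simp
  · simp only [cutoffBump, mem_closedBall_zero_iff, norm_smul, norm_inv]
    rw [Real.norm_of_nonneg (by positivity), inv_mul_le_one₀ (by positivity)]
    linarith

lemma pderiv_cutoff_bound (j : Fin 3) :
    ∃ C : ℝ, 0 ≤ C ∧ ∀ n x, ‖pderiv j (cutoff n).1 x‖ ≤ C * ((n : ℝ) + 1)⁻¹ := by
  let u : TestFn := TestFn.ofReal cutoffBump cutoffBump.contDiff cutoffBump.hasCompactSupport
  obtain ⟨C, hC⟩ := (u.pd j).bound
  refine ⟨C, (norm_nonneg _).trans (hC 0), fun n x => ?_⟩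
  have h := pderiv_comp_smul j u.differentiable (((n : ℝ) + 1)⁻¹) x
  have h2 : pderiv j (cutoff n).1 x = ((((n : ℝ) + 1)⁻¹ : ℝ) : ℂ) *
    pderiv j u.1 (((n : ℝ) + 1)⁻¹ • x) := h
  rw [h2, norm_mul, Complex.norm_real, Real.norm_of_nonneg (by positivity), mul_comm]
  exact mul_le_mul_of_nonneg_right (hC _) (by positivity)

lemma TestFn.exists_radius (u : TestFn) : ∃ R : ℝ, ∀ x, R < ‖x‖ → u.1 x = 0 := by
  obtain ⟨R, hR⟩ := u.2.2.isBounded.subset_closedBall 0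
  refine ⟨R, fun x hx => image_eq_zero_of_notMem_tsupport fun h => ?_⟩
  have := hR h
  rw [mem_closedBall_zero_iff] at this
  linarith

/-- Functions of compact support are dense. -/
lemma exists_compact_approx {A : E3 → E3} (hA : LocSq A) {φ : E3 → ℂ} {g : Fin 3 → E3 → ℂ}
    (h : CovPair A φ g) {ε : ℝ} (hε : 0 < ε) : ∃ φ' g', CovPair A φ' g' ∧
      (∃ R : ℝ, ∀ x, R < ‖x‖ → φ' x = 0 ∧ ∀ j, g' j x = 0) ∧ pairDist φ' g' φ g < ε := by
  have hlim : Tendsto (fun n => pairDist (fun x => (cutoff n).1 x * φ x)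
      (fun j x => (cutoff n).1 x * g j x - Complex.I * pderiv j (cutoff n).1 x * φ x) φ g)
      atTop (𝓝 0) := by
    have e0 : (0 : ℝ) = 0 + ∑ j : Fin 3, 0 := by simp
    rw [e0]
    refine Tendsto.add ?_ (tendsto_finsetSum _ fun j _ => ?_)
    · refine tendsto_integral_sq_zero (b := fun x => 4 * ‖φ x‖ ^ 2) (fun n => ?_)
        ((integrable_norm_sq h.mem).const_mul 4) (fun n x => ?_) (ae_of_all _ fun x => ?_)
      · exact ((h.testFn_mul hA (cutoff n)).mem.sub h.mem).aestronglyMeasurable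
      · have h1 := norm_sub_sq_le ((cutoff n).1 x * φ x) (φ x)
        rw [norm_mul] at h1
        have h2 := norm_cutoff_le n x
        have h3 : (‖(cutoff n).1 x‖ * ‖φ x‖) ^ 2 ≤ ‖φ x‖ ^ 2 := by
          refine pow_le_pow_left₀ (by positivity) ?_ 2
          exact mul_le_of_le_one_left (norm_nonneg _) h2
        linarith
      · refine Tendsto.congr' ?_ tendsto_const_nhds
        filter_upwards [cutoff_eventually x] with n hn
        rw [hn, one_mul, sub_self]
    · obtain ⟨C, hC0, hC⟩ := pderiv_cutoff_bound j
      refine tendsto_integral_sq_zero (b := fun x => 8 * ‖g j x‖ ^ 2 + 2 * (C ^ 2 * ‖φ x‖ ^ 2))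
        (fun n => ?_)
        (((integrable_norm_sq (h.memD j)).const_mul 8).add
          (((integrable_norm_sq h.mem).const_mul _).const_mul 2)) (fun n x => ?_)
        (ae_of_all _ fun x => ?_)
      · exact (((h.testFn_mul hA (cutoff n)).memD j).sub (h.memD j)).aestronglyMeasurable
      · have h1 := norm_sub_sq_le ((cutoff n).1 x * g j x - g j x)
          (Complex.I * pderiv j (cutoff n).1 x * φ x)
        rw [sub_right_comm] at h1
        have h4 := norm_sub_sq_le ((cutoff n).1 x * g j x) (g j x)
        rw [norm_mul] at h4
        have h2 := norm_cutoff_le n x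
        have h3 : (‖(cutoff n).1 x‖ * ‖g j x‖) ^ 2 ≤ ‖g j x‖ ^ 2 := by
          refine pow_le_pow_left₀ (by positivity) ?_ 2
          exact mul_le_of_le_one_left (norm_nonneg _) h2
        have h5 : ‖Complex.I * pderiv j (cutoff n).1 x * φ x‖ ^ 2 ≤ C ^ 2 * ‖φ x‖ ^ 2 := by
          rw [norm_mul, norm_mul, Complex.norm_I, one_mul, mul_pow]
          refine mul_le_mul_of_nonneg_right (pow_le_pow_left₀ (norm_nonneg _) ?_ 2) (by positivity)
          refine (hC n x).trans (mul_le_of_le_one_right hC0 (inv_le_one_of_one_le₀ ?_))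
          have : (0 : ℝ) ≤ n := by positivity
          linarith
        linarith
      · have h1 : Tendsto (fun n => Complex.I * pderiv j (cutoff n).1 x * φ x) atTop (𝓝 0) := by
          have h2 : Tendsto (fun n => pderiv j (cutoff n).1 x) atTop (𝓝 0) := by
            refine squeeze_zero_norm (fun n => hC n x) ?_
            have := tendsto_one_div_add_atTop_nhds_zero_nat (𝕜 := ℝ)
            simpa using this.const_mul C
          simpa using (h2.const_mul Complex.I).mul_const (φ x)
        have h3 : Tendsto (fun n => -(Complex.I * pderiv j (cutoff n).1 x * φ x)) atTop (𝓝 0) := by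
          simpa using h1.neg
        refine h3.congr' ?_
        filter_upwards [cutoff_eventually x] with n hn
        rw [hn]
        ring
  obtain ⟨n, hn⟩ := ((tendsto_order.1 hlim).2 ε hε).exists
  refine ⟨_, _, h.testFn_mul hA (cutoff n), ?_, hn⟩
  obtain ⟨R, hR⟩ := (cutoff n).exists_radius
  have h2 : ∀ j, ∃ R : ℝ, ∀ x, R < ‖x‖ → pderiv j (cutoff n).1 x = 0 := fun j =>
    ((cutoff n).pd j).exists_radius
  choose R' hR' using h2
  refine ⟨max R (∑ j, |R' j|), fun x hx => ⟨?_, fun j => ?_⟩⟩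
  · rw [hR x ((le_max_left _ _).trans_lt hx), zero_mul]
  · rw [hR x ((le_max_left _ _).trans_lt hx), hR' j x ?_]
    · simp
    · refine lt_of_le_of_lt ?_ ((le_max_right _ _).trans_lt hx)
      exact (le_abs_self _).trans (Finset.single_le_sum (f := fun j => |R' j|)
        (fun j _ => abs_nonneg _) (Finset.mem_univ j))

/-! ### Truncation of values -/

/-- `√(1 + c |z|²)`. -/
noncomputable def truncS (c : ℝ) (z : ℂ) : ℝ := Real.sqrt (1 + c * ‖z‖ ^ 2)

/-- The truncation `z / √(1 + c |z|²)`. -/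
noncomputable def trunc (c : ℝ) (z : ℂ) : ℂ := (truncS c z)⁻¹ • z

/-- The real differential of `trunc c`. -/
noncomputable def dtrunc (c : ℝ) (z w : ℂ) : ℂ :=
  ((truncS c z)⁻¹ : ℂ) * w - (c * (conj z * w).re * (truncS c z)⁻¹ ^ 3 : ℝ) * z

lemma one_le_truncS {c : ℝ} (hc : 0 ≤ c) (z : ℂ) : 1 ≤ truncS c z := by
  rw [truncS, Real.one_le_sqrt]
  have : 0 ≤ c * ‖z‖ ^ 2 := by positivity
  linarith

lemma truncS_sq {c : ℝ} (hc : 0 ≤ c) (z : ℂ) : truncS c z ^ 2 = 1 + c * ‖z‖ ^ 2 :=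
  Real.sq_sqrt (by positivity)

lemma contDiff_trunc {c : ℝ} (hc : 0 ≤ c) : ContDiff ℝ ∞ (trunc c) := by
  have h1 : ContDiff ℝ ∞ fun z : ℂ => 1 + c * ‖z‖ ^ 2 :=
    contDiff_const.add (contDiff_const.mul (contDiff_norm_sq ℝ))
  have h2 : ContDiff ℝ ∞ (truncS c) := h1.sqrt fun z => by positivity
  exact (h2.inv fun z => (zero_lt_one.trans_le (one_le_truncS hc z)).ne').smul contDiff_id

lemma fderiv_trunc {c : ℝ} (hc : 0 ≤ c) (z w : ℂ) : fderiv ℝ (trunc c) z w = dtrunc c z w := by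
  have hS := zero_lt_one.trans_le (one_le_truncS hc z)
  have h1 : HasFDerivAt (fun z : ℂ => 1 + c * ‖z‖ ^ 2) (c • (2 • innerSL ℝ z)) z :=
    ((hasStrictFDerivAt_norm_sq z).hasFDerivAt.const_mul c).const_add 1
  have h2 := h1.sqrt (by positivity)
  have h3 := (hasDerivAt_inv hS.ne').comp_hasFDerivAt z h2
  have h4 := h3.smul (hasFDerivAt_id z)
  have h5 : fderiv ℝ (trunc c) z = _ := h4.fderiv
  rw [h5, dtrunc]
  have e1 : √(1 + c * ‖z‖ ^ 2) = truncS c z := rfl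
  simp only [add_apply, smul_apply, ContinuousLinearMap.smulRight_apply, ContinuousLinearMap.id_apply, Function.comp_apply, id,
    innerSL_apply_apply, Complex.inner, smul_eq_mul, nsmul_eq_mul, Complex.real_smul, e1]
  rw [sub_eq_add_neg]
  congr 1
  · push_cast
    rfl
  · rw [← neg_mul, ← Complex.ofReal_neg]
    congr 2
    field_simp
    simp
    left
    ring

lemma norm_trunc_le {c : ℝ} (hc : 0 < c) (z : ℂ) : ‖trunc c z‖ ≤ (Real.sqrt c)⁻¹ := by
  have hS := zero_lt_one.trans_le (one_le_truncS hc.le z)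
  rw [trunc, norm_smul, norm_inv, Real.norm_of_nonneg hS.le, inv_mul_le_iff₀ hS,
    ← div_eq_mul_inv, le_div_iff₀ (by positivity)]
  refine Real.le_sqrt_of_sq_le ?_
  rw [mul_pow, Real.sq_sqrt hc.le]
  linarith

lemma norm_trunc_le' {c : ℝ} (hc : 0 ≤ c) (z : ℂ) : ‖trunc c z‖ ≤ ‖z‖ := by
  have hS := one_le_truncS hc z
  rw [trunc, norm_smul, norm_inv, Real.norm_of_nonneg (by linarith)]
  exact mul_le_of_le_one_left (norm_nonneg _) (inv_le_one_of_one_le₀ hS)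

/-- Both terms are bounded by `‖w‖`, the second because `c ‖z‖² ≤ S²` and `S ≥ 1`. The bound does
not depend on `c`, so it provides a dominating function as `c` tends to zero. -/
lemma norm_dtrunc_le {c : ℝ} (hc : 0 ≤ c) (z w : ℂ) : ‖dtrunc c z w‖ ≤ 2 * ‖w‖ := by
  have hS := one_le_truncS hc z
  have hS2 := truncS_sq hc z
  set S := truncS c z
  have hS0 : 0 < S := by linarith
  have hSi : S⁻¹ ≤ 1 := inv_le_one_of_one_le₀ hS
  refine (norm_sub_le _ _).trans ?_
  have h1 : ‖((S)⁻¹ : ℂ) * w‖ ≤ ‖w‖ := by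
    rw [norm_mul, norm_inv, Complex.norm_real, Real.norm_of_nonneg hS0.le]
    exact mul_le_of_le_one_left (norm_nonneg _) hSi
  have h2 : ‖((c * (conj z * w).re * S⁻¹ ^ 3 : ℝ) : ℂ) * z‖ ≤ ‖w‖ := by
    rw [norm_mul, Complex.norm_real, norm_mul, norm_mul, Real.norm_of_nonneg hc, norm_pow, norm_inv,
      Real.norm_of_nonneg hS0.le]
    have h3 : ‖(conj z * w).re‖ ≤ ‖z‖ * ‖w‖ := by
      refine (Complex.abs_re_le_norm _).trans_eq ?_
      rw [norm_mul, RCLike.norm_conj]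
    have h4 : c * ‖z‖ ^ 2 * S⁻¹ ^ 3 ≤ 1 := by
      have : c * ‖z‖ ^ 2 ≤ S ^ 2 := by linarith
      calc c * ‖z‖ ^ 2 * S⁻¹ ^ 3 ≤ S ^ 2 * S⁻¹ ^ 3 := by gcongr
        _ = S⁻¹ := by field_simp
        _ ≤ 1 := hSi
    calc c * ‖(conj z * w).re‖ * S⁻¹ ^ 3 * ‖z‖ ≤ c * (‖z‖ * ‖w‖) * S⁻¹ ^ 3 * ‖z‖ := by gcongr
      _ = (c * ‖z‖ ^ 2 * S⁻¹ ^ 3) * ‖w‖ := by ring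
      _ ≤ 1 * ‖w‖ := by gcongr
      _ = ‖w‖ := one_mul _
  linarith

lemma continuous_truncS_inv {c : ℝ} (hc : 0 ≤ c) : Continuous fun z : ℂ => (truncS c z)⁻¹ := by
  refine Continuous.inv₀ ?_ fun z => (zero_lt_one.trans_le (one_le_truncS hc z)).ne'
  unfold truncS
  fun_prop

lemma continuous_dtrunc {c : ℝ} (hc : 0 ≤ c) : Continuous fun p : ℂ × ℂ => dtrunc c p.1 p.2 := by
  have h := (continuous_truncS_inv hc).comp (continuous_fst (X := ℂ) (Y := ℂ))
  have h1 : Continuous fun p : ℂ × ℂ => (truncS c p.1)⁻¹ := h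
  have h2 : Continuous fun p : ℂ × ℂ => (((truncS c p.1)⁻¹ : ℝ) : ℂ) :=
    Complex.continuous_ofReal.comp h1
  unfold dtrunc
  simp only [← Complex.ofReal_inv]
  fun_prop

lemma tendsto_truncS_inv (z : ℂ) :
    Tendsto (fun n : ℕ => (truncS (1 / ((n : ℝ) + 1)) z)⁻¹) atTop (𝓝 1) := by
  have h : Continuous fun c : ℝ => truncS c z := by
    unfold truncS
    fun_prop
  have h1 : Tendsto (fun n : ℕ => truncS (1 / ((n : ℝ) + 1)) z) atTop (𝓝 1) := by
    have := (h.tendsto 0).comp (tendsto_one_div_add_atTop_nhds_zero_nat (𝕜 := ℝ))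
    simpa [truncS, Function.comp_def] using this
  simpa using h1.inv₀ one_ne_zero

lemma tendsto_trunc (z : ℂ) :
    Tendsto (fun n : ℕ => trunc (1 / ((n : ℝ) + 1)) z) atTop (𝓝 z) := by
  simpa [trunc] using (tendsto_truncS_inv z).smul_const z

lemma tendsto_dtrunc (z w : ℂ) :
    Tendsto (fun n : ℕ => dtrunc (1 / ((n : ℝ) + 1)) z w) atTop (𝓝 w) := by
  have h1 := tendsto_truncS_inv z
  have h2 : Tendsto (fun n : ℕ => (((truncS (1 / ((n : ℝ) + 1)) z)⁻¹ : ℝ) : ℂ)) atTop (𝓝 1) := by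
    simpa [Function.comp_def] using (Complex.continuous_ofReal.tendsto _).comp h1
  have h3 : Tendsto (fun n : ℕ => 1 / ((n : ℝ) + 1) * (conj z * w).re *
      (truncS (1 / ((n : ℝ) + 1)) z)⁻¹ ^ 3) atTop (𝓝 0) := by
    have := ((tendsto_one_div_add_atTop_nhds_zero_nat (𝕜 := ℝ)).mul_const
      (conj z * w).re).mul (h1.pow 3)
    simpa using this
  have h4 := (h2.mul_const w).sub
    (((Complex.continuous_ofReal.tendsto _).comp h3).mul_const z)
  simp only [one_mul, Complex.ofReal_zero, zero_mul, sub_zero] at h4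
  refine h4.congr fun n => ?_
  rw [dtrunc]
  simp


/-! ### From covariant to weak derivatives and back; the density argument -/

lemma IsCovDeriv.isWeakDeriv {A : E3 → E3} (hA : LocSq A) {j : Fin 3} {φ g : E3 → ℂ}
    (hφ : MemLp φ 2 volume) (hg : MemLp g 2 volume) (h : IsCovDeriv A j φ g) :
    IsWeakDeriv j φ (fun x => Complex.I * (g x - (A x j : ℂ) * φ x)) := by
  intro u
  have h1 := h u
  have i1 := integrable_mul_of_sq hφ (u.memLp_pderiv j 2)
  have i2 : Integrable fun x => φ x * ((A x j : ℂ) * u.1 x) :=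
    integrable_mul_of_sq hφ (hA.memLp_mul j u)
  have i3 := integrable_mul_of_sq hg (u.memLp 2)
  have e1 : ∀ x, φ x * (Complex.I * pderiv j u.1 x + (A x j : ℂ) * u.1 x) =
      Complex.I * (φ x * pderiv j u.1 x) + φ x * ((A x j : ℂ) * u.1 x) := fun x => by ring
  have e2 : ∀ x, Complex.I * (g x - (A x j : ℂ) * φ x) * u.1 x =
      Complex.I * (g x * u.1 x - φ x * ((A x j : ℂ) * u.1 x)) := fun x => by ring
  simp_rw [e1] at h1
  simp_rw [e2]
  rw [integral_add (i1.const_mul _) i2, integral_const_mul] at h1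
  rw [integral_const_mul, integral_sub i3 i2, h1]
  linear_combination (∫ x, φ x * pderiv j u.1 x) * Complex.I_sq

lemma IsWeakDeriv.isCovDeriv {A : E3 → E3} (hA : LocSq A) {j : Fin 3} {φ h : E3 → ℂ}
    (hφ : MemLp φ 2 volume) (hh : LocallyIntegrable h) (hw : IsWeakDeriv j φ h) :
    IsCovDeriv A j φ (fun x => -Complex.I * h x + (A x j : ℂ) * φ x) := by
  intro u
  have h1 := hw u
  have i1 := integrable_mul_of_sq hφ (u.memLp_pderiv j 2)
  have i2 : Integrable fun x => φ x * ((A x j : ℂ) * u.1 x) :=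
    integrable_mul_of_sq hφ (hA.memLp_mul j u)
  have i3 : Integrable fun x => h x * u.1 x := by
    have := hh.integrable_smul_right_of_hasCompactSupport u.2.1.continuous u.2.2
    simpa [smul_eq_mul] using this
  have e1 : ∀ x, φ x * (Complex.I * pderiv j u.1 x + (A x j : ℂ) * u.1 x) =
      Complex.I * (φ x * pderiv j u.1 x) + φ x * ((A x j : ℂ) * u.1 x) := fun x => by ring
  have e2 : ∀ x, (-Complex.I * h x + (A x j : ℂ) * φ x) * u.1 x =
      -Complex.I * (h x * u.1 x) + φ x * ((A x j : ℂ) * u.1 x) := fun x => by ring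
  simp_rw [e1, e2]
  rw [integral_add (i1.const_mul _) i2, integral_add (i3.const_mul _) i2, integral_const_mul,
    integral_const_mul, h1]
  ring

/-- A mollified function of bounded support is a test function. -/
noncomputable def mollTest (n : ℕ) (φ : E3 → ℂ) (hφ : LocallyIntegrable φ) {R : ℝ}
    (hR : ∀ x, R < ‖x‖ → φ x = 0) : TestFn :=
  ⟨moll n φ, contDiff_moll n hφ, HasCompactSupport.intro (isCompact_closedBall (0 : E3) (R + 1))
    fun x hx => moll_eq_zero n hR (by simpa using hx)⟩

lemma dtrunc_sub (c : ℝ) (z w w' : ℂ) : dtrunc c z (w - w') = dtrunc c z w - dtrunc c z w' := by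
  simp only [dtrunc, mul_sub, Complex.sub_re]
  push_cast
  ring

lemma pderiv_trunc {c : ℝ} (hc : 0 ≤ c) (j : Fin 3) {f : E3 → ℂ} (hf : ContDiff ℝ ∞ f) (x : E3) :
    pderiv j (fun x => trunc c (f x)) x = dtrunc c (f x) (pderiv j f x) := by
  have hd : HasFDerivAt (fun x => trunc c (f x)) ((fderiv ℝ (trunc c) (f x)).comp
      (fderiv ℝ f x)) x :=
    HasFDerivAt.comp x ((contDiff_trunc hc).differentiable (by simp) _).hasFDerivAt
      (hf.differentiable (by simp) x).hasFDerivAt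
  rw [pderiv, hd.fderiv, ContinuousLinearMap.comp_apply, fderiv_trunc hc]
  rfl

lemma aestronglyMeasurable_dtrunc {c : ℝ} (hc : 0 ≤ c) {f g : E3 → ℂ}
    (hf : AEStronglyMeasurable f volume) (hg : AEStronglyMeasurable g volume) :
    AEStronglyMeasurable (fun x => dtrunc c (f x) (g x)) volume :=
  Continuous.comp_aestronglyMeasurable (g := fun p : ℂ × ℂ => dtrunc c p.1 p.2)
    (f := fun x => (f x, g x)) (continuous_dtrunc hc) (hf.prodMk hg)

lemma integrable_dtrunc_mul {c : ℝ} (hc : 0 ≤ c) (u : TestFn) {f g : E3 → ℂ}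
    (hf : AEStronglyMeasurable f volume) (hg : Integrable g) :
    Integrable fun x => dtrunc c (f x) (g x) * u.1 x := by
  obtain ⟨C, hC⟩ := u.bound
  have hm := aestronglyMeasurable_dtrunc hc hf hg.aestronglyMeasurable
  refine Integrable.mono' ((hg.norm.const_mul 2).mul_const C)
    (hm.mul u.2.1.continuous.aestronglyMeasurable) (ae_of_all _ fun x => ?_)
  rw [norm_mul]
  exact mul_le_mul (norm_dtrunc_le hc _ _) (hC x) (norm_nonneg _) (by positivity)

/-- The chain rule for the truncation of a function with integrable weak derivative. -/
lemma isWeakDeriv_trunc {c : ℝ} (hc : 0 < c) {j : Fin 3} {φ h : E3 → ℂ} (hφ : Integrable φ)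
    (hh : Integrable h) {R : ℝ} (hR : ∀ x, R < ‖x‖ → φ x = 0) (hw : IsWeakDeriv j φ h) :
    IsWeakDeriv j (fun x => trunc c (φ x)) (fun x => dtrunc c (φ x) (h x)) := by
  intro u
  have hl := hφ.locallyIntegrable
  obtain ⟨C, hC⟩ := u.bound
  have hct := (contDiff_trunc hc.le).continuous
  let v : ℕ → TestFn := fun n => ⟨fun x => trunc c (moll n φ x),
    (contDiff_trunc hc.le).comp (contDiff_moll n hl),
    (mollTest n φ hl hR).2.2.comp_left (g := trunc c) (by simp [trunc])⟩
  have hv : ∀ n x, pderiv j (v n).1 x = dtrunc c (moll n φ x) (moll n h x) := fun n x => by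
    rw [← pderiv_moll n j hl hw x]
    exact pderiv_trunc hc.le j (contDiff_moll n hl) x
  have hparts := fun n => integral_mul_pderiv j (v n) u
  simp only [hv] at hparts
  have hlim1 : Tendsto (fun n => ∫ x, (v n).1 x * pderiv j u.1 x) atTop
      (𝓝 (∫ x, trunc c (φ x) * pderiv j u.1 x)) := by
    refine tendsto_integral_of_dominated_convergence
      (fun x => (Real.sqrt c)⁻¹ * ‖pderiv j u.1 x‖) (fun n => ?_)
      ((u.pd j).integrable.norm.const_mul _) (fun n => ae_of_all _ fun x => ?_) ?_
    · exact ((v n).2.1.continuous.mul (u.pd j).2.1.continuous).aestronglyMeasurable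
    · rw [norm_mul]
      exact mul_le_mul_of_nonneg_right (norm_trunc_le hc _) (norm_nonneg _)
    · filter_upwards [tendsto_moll hl] with x hx
      exact ((hct.tendsto _).comp hx).mul_const _
  have hmm := fun n => (contDiff_moll n hl).continuous.aestronglyMeasurable (μ := volume)
  have hbd : ∀ (f g : E3 → ℂ), AEStronglyMeasurable f volume → Integrable g →
      Integrable fun x => dtrunc c (f x) (g x) * u.1 x := fun f g hf hg =>
    integrable_dtrunc_mul hc.le u hf hg
  have hlim2 : Tendsto (fun n => ∫ x, dtrunc c (moll n φ x) (h x) * u.1 x) atTop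
      (𝓝 (∫ x, dtrunc c (φ x) (h x) * u.1 x)) := by
    refine tendsto_integral_of_dominated_convergence (fun x => 2 * ‖h x‖ * C)
      (fun n => (hbd _ _ (hmm n) hh).aestronglyMeasurable)
      ((hh.norm.const_mul 2).mul_const C) (fun n => ae_of_all _ fun x => ?_) ?_
    · rw [norm_mul]
      exact mul_le_mul (norm_dtrunc_le hc.le _ _) (hC x) (norm_nonneg _) (by positivity)
    · filter_upwards [tendsto_moll hl] with x hx
      have h1 := ((continuous_dtrunc hc.le).tendsto (φ x, h x)).comp
        (hx.prodMk_nhds (tendsto_const_nhds (x := h x)))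
      exact h1.mul_const _
  -- `dtrunc` is additive and uniformly bounded in its last argument, so exchanging the mollified
  -- derivative for `h` costs only the `L¹` distance of the two.
  have hlim3 : Tendsto (fun n => (∫ x, dtrunc c (moll n φ x) (moll n h x) * u.1 x) -
      ∫ x, dtrunc c (moll n φ x) (h x) * u.1 x) atTop (𝓝 0) := by
    have hz : Tendsto (fun n => 2 * C * ∫ x, ‖moll n h x - h x‖) atTop (𝓝 0) := by
      simpa using (tendsto_moll_L1 hh).const_mul (2 * C)
    refine squeeze_zero_norm (fun n => ?_) hz
    rw [← integral_sub (hbd _ _ (hmm n) (integrable_moll n hh)) (hbd _ _ (hmm n) hh),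
      ← integral_const_mul]
    refine norm_integral_le_of_norm_le (((integrable_moll n hh).sub hh).norm.const_mul _)
      (ae_of_all _ fun x => ?_)
    have e : dtrunc c (moll n φ x) (moll n h x) * u.1 x - dtrunc c (moll n φ x) (h x) * u.1 x =
        dtrunc c (moll n φ x) (moll n h x - h x) * u.1 x := by
      rw [dtrunc_sub, sub_mul]
    rw [e, norm_mul]
    calc ‖dtrunc c (moll n φ x) (moll n h x - h x)‖ * ‖u.1 x‖
        ≤ (2 * ‖moll n h x - h x‖) * C := mul_le_mul (norm_dtrunc_le hc.le _ _) (hC x)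
          (norm_nonneg _) (by positivity)
      _ = 2 * C * ‖moll n h x - h x‖ := by ring
  have hlim4 := (hlim3.add hlim2).neg
  simp only [sub_add_cancel, zero_add] at hlim4
  simp only [hparts] at hlim1
  exact tendsto_nhds_unique hlim1 hlim4

lemma integrable_of_memLp_of_supp {f : E3 → ℂ} (hf : MemLp f 2 volume) {R : ℝ}
    (hR : ∀ x, R < ‖x‖ → f x = 0) : Integrable f := by
  rw [← integrableOn_iff_integrable_of_support_subset (s := Metric.closedBall 0 R)]
  · exact (hf.locallyIntegrable (by norm_num)).integrableOn_isCompact (isCompact_closedBall _ _)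
  · intro x hx
    by_contra h
    exact hx (hR x (by simpa using h))

/-- The truncation commutes with phase rotations, hence its differential in the direction `I * a *
z` is multiplication of `trunc c z` by `I * a`. The vector potential therefore drops out of the
covariant derivative of the truncated function. -/
lemma dtrunc_gauge (c : ℝ) (z g : ℂ) (a : ℝ) :
    -Complex.I * dtrunc c z (Complex.I * (g - a * z)) + a * trunc c z =
      -Complex.I * dtrunc c z (Complex.I * g) := by
  have hre : (conj z * (Complex.I * ((a : ℂ) * z))).re = 0 := by
    rw [show conj z * (Complex.I * ((a : ℂ) * z)) = Complex.I * (a : ℂ) * (z * conj z) by ring,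
      Complex.mul_conj]
    simp
  have e : (conj z * (Complex.I * (g - (a : ℂ) * z))).re = (conj z * (Complex.I * g)).re := by
    rw [mul_sub, mul_sub, Complex.sub_re, hre, sub_zero]
  simp only [dtrunc, trunc, e, Complex.real_smul, Complex.ofReal_inv]
  linear_combination ((truncS c z : ℂ)⁻¹ * (a : ℂ) * z) * Complex.I_sq

/-- Truncation of the values preserves `H¹_A`. -/
lemma CovPair.trunc {A : E3 → E3} (hA : LocSq A) {φ : E3 → ℂ} {g : Fin 3 → E3 → ℂ}
    (h : CovPair A φ g) {R : ℝ} (hR : ∀ x, R < ‖x‖ → φ x = 0 ∧ ∀ j, g j x = 0) {c : ℝ}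
    (hc : 0 < c) : CovPair A (fun x => trunc c (φ x))
      (fun j x => -Complex.I * dtrunc c (φ x) (Complex.I * g j x)) := by
  have hRφ : ∀ x, R < ‖x‖ → φ x = 0 := fun x hx => (hR x hx).1
  have hφi := integrable_of_memLp_of_supp h.mem hRφ
  have hm : MemLp (fun x => Polaron.trunc c (φ x)) 2 volume :=
    h.mem.mono ((contDiff_trunc hc.le).continuous.comp_aestronglyMeasurable
      h.mem.aestronglyMeasurable) (ae_of_all _ fun x => norm_trunc_le' hc.le _)
  refine ⟨hm, fun j => ?_, fun j => ?_⟩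
  · refine MemLp.const_mul (MemLp.of_le_mul (c := 2) (h.memD j)
      (aestronglyMeasurable_dtrunc hc.le h.mem.aestronglyMeasurable
        ((h.memD j).aestronglyMeasurable.const_mul _))
      (ae_of_all _ fun x => ?_)) _
    refine (norm_dtrunc_le hc.le _ _).trans_eq ?_
    rw [norm_mul, Complex.norm_I, one_mul]
  · have hw := IsCovDeriv.isWeakDeriv hA h.mem (h.memD j) (h.cov j)
    -- At this stage `A φ` is only a product of two `L²` functions on a ball, hence merely
    -- integrable; this is why the chain rule is stated for integrable weak derivatives.
    have hAφ : Integrable fun x => (A x j : ℂ) * φ x := by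
      have hK := isCompact_closedBall (0 : E3) R
      rw [← integrableOn_iff_integrable_of_support_subset (s := Metric.closedBall 0 R)]
      · exact MemLp.integrable_mul (hA _ hK j).ofReal (h.mem.restrict _)
      · intro x hx
        by_contra hn
        exact hx (by simp [hRφ x (by simpa using hn)])
    have hh : Integrable fun x => Complex.I * (g j x - (A x j : ℂ) * φ x) :=
      ((integrable_of_memLp_of_supp (h.memD j) fun x hx => (hR x hx).2 j).sub hAφ).const_mul _
    have hw2 := isWeakDeriv_trunc hc hφi hh hRφ hw
    have hdi : Integrable fun x =>
        dtrunc c (φ x) (Complex.I * (g j x - (A x j : ℂ) * φ x)) := by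
      refine Integrable.mono' (hh.norm.const_mul 2) (aestronglyMeasurable_dtrunc hc.le
        h.mem.aestronglyMeasurable hh.aestronglyMeasurable)
        (ae_of_all _ fun x => norm_dtrunc_le hc.le _ _)
    refine (hw2.isCovDeriv hA hm hdi.locallyIntegrable).congr (ae_eq_refl _)
      (ae_of_all _ fun x => ?_)
    exact dtrunc_gauge c (φ x) (g j x) (A x j)

/-- Bounded functions of compact support are dense among those of compact support. -/
lemma exists_bounded_approx {A : E3 → E3} (hA : LocSq A) {φ : E3 → ℂ} {g : Fin 3 → E3 → ℂ}
    (h : CovPair A φ g) {R : ℝ} (hR : ∀ x, R < ‖x‖ → φ x = 0 ∧ ∀ j, g j x = 0)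
    {ε : ℝ} (hε : 0 < ε) : ∃ φ' g', CovPair A φ' g' ∧ (∀ x, R < ‖x‖ → φ' x = 0 ∧ ∀ j, g' j x = 0) ∧
      (∃ M : ℝ, ∀ x, ‖φ' x‖ ≤ M) ∧ pairDist φ' g' φ g < ε := by
  have hc : ∀ n : ℕ, (0 : ℝ) < 1 / ((n : ℝ) + 1) := fun n => by positivity
  have hlim : Tendsto (fun n : ℕ => pairDist (fun x => trunc (1 / ((n : ℝ) + 1)) (φ x))
      (fun j x => -Complex.I * dtrunc (1 / ((n : ℝ) + 1)) (φ x) (Complex.I * g j x)) φ g)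
      atTop (𝓝 0) := by
    have e0 : (0 : ℝ) = 0 + ∑ j : Fin 3, 0 := by simp
    rw [e0]
    refine Tendsto.add ?_ (tendsto_finsetSum _ fun j _ => ?_)
    · refine tendsto_integral_sq_zero (b := fun x => 4 * ‖φ x‖ ^ 2) (fun n => ?_)
        ((integrable_norm_sq h.mem).const_mul 4) (fun n x => ?_) (ae_of_all _ fun x => ?_)
      · exact ((h.trunc hA hR (hc n)).mem.sub h.mem).aestronglyMeasurable
      · have h1 := norm_sub_sq_le (trunc (1 / ((n : ℝ) + 1)) (φ x)) (φ x)
        have h2 := pow_le_pow_left₀ (norm_nonneg _) (norm_trunc_le' (hc n).le (φ x)) 2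
        linarith
      · simpa using (tendsto_trunc (φ x)).sub_const (φ x)
    · refine tendsto_integral_sq_zero (b := fun x => 10 * ‖g j x‖ ^ 2) (fun n => ?_)
        ((integrable_norm_sq (h.memD j)).const_mul 10) (fun n x => ?_) (ae_of_all _ fun x => ?_)
      · exact (((h.trunc hA hR (hc n)).memD j).sub (h.memD j)).aestronglyMeasurable
      · have h1 := norm_sub_sq_le
          (-Complex.I * dtrunc (1 / ((n : ℝ) + 1)) (φ x) (Complex.I * g j x)) (g j x)
        have h2 : ‖-Complex.I * dtrunc (1 / ((n : ℝ) + 1)) (φ x) (Complex.I * g j x)‖ ≤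
            2 * ‖g j x‖ := by
          rw [norm_mul, norm_neg, Complex.norm_I, one_mul]
          refine (norm_dtrunc_le (hc n).le _ _).trans_eq ?_
          rw [norm_mul, Complex.norm_I, one_mul]
        have h3 := pow_le_pow_left₀ (norm_nonneg _) h2 2
        rw [mul_pow] at h3
        linarith
      · have h1 := ((tendsto_dtrunc (φ x) (Complex.I * g j x)).const_mul (-Complex.I)).sub_const
          (g j x)
        have e : -Complex.I * (Complex.I * g j x) - g j x = 0 := by
          linear_combination (-g j x) * Complex.I_sq
        rwa [e] at h1
  obtain ⟨n, hn⟩ := ((tendsto_order.1 hlim).2 ε hε).exists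
  refine ⟨_, _, h.trunc hA hR (hc n), fun x hx => ⟨?_, fun j => ?_⟩,
    ⟨_, fun x => norm_trunc_le (hc n) (φ x)⟩, hn⟩
  · simp [(hR x hx).1, trunc]
  · simp [(hR x hx).1, (hR x hx).2 j, dtrunc]

/-- Test functions are dense among bounded functions of compact support. -/
lemma exists_test_approx_of_bounded {A : E3 → E3} (hA : LocSq A) {φ : E3 → ℂ}
    {g : Fin 3 → E3 → ℂ} (h : CovPair A φ g) {R : ℝ}
    (hR : ∀ x, R < ‖x‖ → φ x = 0 ∧ ∀ j, g j x = 0) {M : ℝ} (hM : ∀ x, ‖φ x‖ ≤ M)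
    {ε : ℝ} (hε : 0 < ε) :
    ∃ u : TestFn, pairDist u.1 (fun j => covT A j u.1) φ g < ε := by
  have hRφ : ∀ x, R < ‖x‖ → φ x = 0 := fun x hx => (hR x hx).1
  have hl := (integrable_of_memLp_of_supp h.mem hRφ).locallyIntegrable
  -- Boundedness and bounded support of `φ` put `A φ` into `L²`; this is the reason for truncating
  -- the values before mollifying.
  have hAφ : ∀ j, MemLp (fun x => (A x j : ℂ) * φ x) 2 volume := fun j =>
    memLp_loc_mul (isCompact_closedBall (0 : E3) R) (hA _ (isCompact_closedBall (0 : E3) R) j)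
      h.mem.aestronglyMeasurable hM fun x hx => hRφ x (by simpa using hx)
  have hh : ∀ j, MemLp (fun x => Complex.I * (g j x - (A x j : ℂ) * φ x)) 2 volume := fun j =>
    ((h.memD j).sub (hAφ j)).const_mul _
  have hM0 : 0 ≤ M := (norm_nonneg _).trans (hM 0)
  let u : ℕ → TestFn := fun n => mollTest n φ hl hRφ
  have hlim : Tendsto (fun n => pairDist (u n).1 (fun j => covT A j (u n).1) φ g) atTop (𝓝 0) := by
    have e0 : (0 : ℝ) = 0 + ∑ j : Fin 3, 0 := by simp
    rw [e0]
    refine Tendsto.add (tendsto_moll_L2 h.mem) (tendsto_finsetSum _ fun j _ => ?_)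
    set hj : E3 → ℂ := fun x => Complex.I * (g j x - (A x j : ℂ) * φ x) with hhj
    have hw := IsCovDeriv.isWeakDeriv hA h.mem (h.memD j) (h.cov j)
    have t1 := tendsto_moll_L2 (hh j)
    set K := Metric.closedBall (0 : E3) (R + 1) with hK
    have hKc : IsCompact K := isCompact_closedBall _ _
    have hAK := hA K hKc j
    -- The mollification error multiplied by `A` is dominated by `2 M |A|` on a fixed ball and tends
    -- to zero almost everywhere.
    have t2 : Tendsto (fun n => ∫ x, ‖(A x j : ℂ) * (moll n φ x - φ x)‖ ^ 2) atTop (𝓝 0) := by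
      refine tendsto_integral_sq_zero
        (b := fun x => ‖(A x j : ℂ) * K.indicator (fun _ => ((2 * M : ℝ) : ℂ)) x‖ ^ 2)
        (fun n => ?_) (integrable_norm_sq ?_) (fun n x => ?_) ?_
      · have := ((hA.memLp_mul j (u n)).sub (hAφ j)).aestronglyMeasurable
        refine this.congr (ae_of_all _ fun x => ?_)
        simp only [u, mollTest, Pi.sub_apply]
        ring
      · refine memLp_loc_mul hKc hAK (aestronglyMeasurable_const.indicator hKc.measurableSet)
          (C := 2 * M) (fun x => ?_) fun x hx => Set.indicator_of_notMem hx _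
        by_cases hx : x ∈ K
        · rw [Set.indicator_of_mem hx, Complex.norm_real, Real.norm_of_nonneg (by linarith)]
        · rw [Set.indicator_of_notMem hx, norm_zero]
          linarith
      · rw [norm_mul, norm_mul]
        refine pow_le_pow_left₀ (by positivity) (mul_le_mul_of_nonneg_left ?_ (norm_nonneg _)) 2
        by_cases hx : x ∈ K
        · rw [Set.indicator_of_mem hx, Complex.norm_real, Real.norm_of_nonneg (by linarith)]
          have := norm_sub_le (moll n φ x) (φ x)
          have := norm_moll_le_of_bound n hM x
          have := hM x
          linarith
        · rw [Set.indicator_of_notMem hx, moll_eq_zero n hRφ (by simpa [hK] using hx), hRφ x ?_]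
          · simp
          · have : R + 1 < ‖x‖ := by simpa [hK] using hx
            linarith
      · filter_upwards [tendsto_moll hl] with x hx
        simpa using (hx.sub_const (φ x)).const_mul (A x j : ℂ)
    have hz : Tendsto (fun n => 2 * ((∫ x, ‖moll n hj x - hj x‖ ^ 2) +
        ∫ x, ‖(A x j : ℂ) * (moll n φ x - φ x)‖ ^ 2)) atTop (𝓝 0) := by
      simpa using (t1.add t2).const_mul 2
    refine squeeze_zero (fun n => integral_nonneg fun x => by positivity) (fun n => ?_) hz
    have hpm : ∀ x, pderiv j (u n).1 x = moll n hj x := pderiv_moll n j hl hw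
    have m1 : MemLp (fun x => moll n hj x - hj x) 2 volume := by
      have := ((u n).memLp_pderiv j 2).sub (hh j)
      refine this.ae_eq (ae_of_all _ fun x => ?_)
      simp only [Pi.sub_apply, hpm, hhj]
    have m2 : MemLp (fun x => (A x j : ℂ) * (moll n φ x - φ x)) 2 volume := by
      have := (hA.memLp_mul j (u n)).sub (hAφ j)
      refine this.ae_eq (ae_of_all _ fun x => ?_)
      simp only [u, mollTest, Pi.sub_apply]
      ring
    rw [← integral_add (integrable_norm_sq m1) (integrable_norm_sq m2), ← integral_const_mul]
    refine integral_mono (integrable_norm_sq ((hA.memLp_covT j (u n)).sub (h.memD j)))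
      (((integrable_norm_sq m1).add (integrable_norm_sq m2)).const_mul 2) fun x => ?_
    have e : covT A j (u n).1 x - g j x =
        -Complex.I * (moll n hj x - hj x) + (A x j : ℂ) * (moll n φ x - φ x) := by
      rw [covT, hpm]
      have : (u n).1 x = moll n φ x := rfl
      rw [this]
      simp only [hhj]
      linear_combination ((A x j : ℂ) * φ x - g j x) * Complex.I_sq
    have h1 := norm_add_sq_le (-Complex.I * (moll n hj x - hj x))
      ((A x j : ℂ) * (moll n φ x - φ x))
    rw [← e, norm_mul (-Complex.I), norm_neg, Complex.norm_I, one_mul] at h1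
    exact h1
  obtain ⟨n, hn⟩ := ((tendsto_order.1 hlim).2 ε hε).exists
  exact ⟨u n, hn⟩

lemma LocSq.covPair_test {A : E3 → E3} (hA : LocSq A) (u : TestFn) :
    CovPair A u.1 fun j => covT A j u.1 :=
  ⟨u.memLp 2, fun j => hA.memLp_covT j u, fun j => hA.isCovDeriv_covT j u⟩

/-- `C₀^∞` is dense in `H¹_A`. -/
theorem exists_test_approx {A : E3 → E3} (hA : LocSq A) {φ : E3 → ℂ} (hφ : MemH1A A φ)
    {ε : ℝ} (hε : 0 < ε) : ∃ u : TestFn, h1NormSq A (fun x => u.1 x - φ x) < ε := by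
  have h0 : CovPair A φ fun j => covDeriv A j φ :=
    ⟨hφ.1, fun j => (covDeriv_spec hφ j).1, fun j => (covDeriv_spec hφ j).2⟩
  -- `pairDist` is a squared distance, so each use of the triangle inequality doubles the errors;
  -- three errors below `ε / 16` add up to less than `10 ε / 16`.
  obtain ⟨φ₁, g₁, h₁, ⟨R, hR⟩, hd₁⟩ := exists_compact_approx hA h0 (ε := ε / 16) (by positivity)
  obtain ⟨φ₂, g₂, h₂, hR₂, ⟨M, hM⟩, hd₂⟩ := exists_bounded_approx hA h₁ hR (ε := ε / 16)
    (by positivity)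
  obtain ⟨u, hu⟩ := exists_test_approx_of_bounded hA h₂ hR₂ hM (ε := ε / 16) (by positivity)
  refine ⟨u, ?_⟩
  rw [h1NormSq_test_sub hA u hφ]
  have t1 := pairDist_triangle (hA.covPair_test u) h₂ h₁
  have t2 := pairDist_triangle (hA.covPair_test u) h₁ h0
  change pairDist _ _ _ _ < _
  linarith


/-! ### The form of the potential -/

/-- For fixed `t` the first term vanishes in the limit, and `t * K` can be made arbitrarily small
beforehand. In limits this is the substitute for Cauchy–Schwarz. -/
lemma tendsto_zero_of_young {ι : Type*} {l : Filter ι} {x y : ι → ℝ} {K : ℝ}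
    (hx : Tendsto x l (𝓝 0))
    (h : ∀ t : ℝ, 0 < t → ∀ᶠ i in l, |y i| ≤ (1 + t⁻¹) * x i + t * K) :
    Tendsto y l (𝓝 0) := by
  rw [Metric.tendsto_nhds]
  intro ε hε
  have ht : 0 < ε / (2 * (|K| + 1)) := by positivity
  set t := ε / (2 * (|K| + 1)) with htdef
  have h1 : Tendsto (fun i => (1 + t⁻¹) * x i) l (𝓝 0) := by simpa using hx.const_mul (1 + t⁻¹)
  filter_upwards [h t ht, (tendsto_order.1 h1).2 (ε / 2) (by positivity)] with i hi hi2
  have h3 : t * K < ε / 2 := by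
    have : t * (|K| + 1) = ε / 2 := by
      rw [htdef]
      field_simp
    nlinarith [le_abs_self K]
  rw [Real.dist_eq, sub_zero]
  linarith

/-- Linear combination of two test functions. -/
def TestFn.comb (a b : ℂ) (u w : TestFn) : TestFn :=
  ⟨fun x => a * u.1 x + b * w.1 x, (contDiff_const.mul u.2.1).add (contDiff_const.mul w.2.1),
    (u.2.2.mul_left).add (w.2.2.mul_left)⟩

lemma covT_comb (A : E3 → E3) (j : Fin 3) (a b : ℂ) (u w : TestFn) (x : E3) :
    covT A j (TestFn.comb a b u w).1 x = a * covT A j u.1 x + b * covT A j w.1 x := by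
  have h : pderiv j (TestFn.comb a b u w).1 x = a * pderiv j u.1 x + b * pderiv j w.1 x := by
    have := pderiv_add j (u.differentiable.const_mul a) (w.differentiable.const_mul b) x
    rw [pderiv_const_mul j a u.differentiable, pderiv_const_mul j b w.differentiable] at this
    exact this
  rw [covT, h, covT, covT]
  simp only [TestFn.comb]
  ring

/-- `∫ V |u|²`. -/
noncomputable def potT (V : E3 → ℝ) (u : E3 → ℂ) : ℝ := ∫ x, V x * ‖u x‖ ^ 2

/-- The squared `H¹_A` norm of a test function. -/
noncomputable def normT (A : E3 → E3) (u : E3 → ℂ) : ℝ :=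
  (∫ x, ‖u x‖ ^ 2) + ∑ j, ∫ x, ‖covT A j u x‖ ^ 2

lemma integrable_pot {V : E3 → ℝ} (hV : LocallyIntegrable V) (u : TestFn) :
    Integrable fun x => V x * ‖u.1 x‖ ^ 2 := by
  have hc : HasCompactSupport fun x => ‖u.1 x‖ ^ 2 :=
    u.2.2.comp_left (g := fun z : ℂ => ‖z‖ ^ 2) (by simp)
  have := hV.integrable_smul_right_of_hasCompactSupport (u.2.1.continuous.norm.pow 2) hc
  simpa [smul_eq_mul] using this

/-- The regularized modulus `√(|u|² + δ²) - δ` of a test function. -/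
noncomputable def TestFn.regAbs (u : TestFn) (δ : ℝ) (hδ : 0 < δ) : TestFn :=
  TestFn.ofReal (fun x => Real.sqrt (‖u.1 x‖ ^ 2 + δ ^ 2) - δ)
    (((u.2.1.norm_sq ℝ).add contDiff_const).sqrt (fun x => by positivity) |>.sub contDiff_const)
    (u.2.2.comp_left (g := fun z : ℂ => Real.sqrt (‖z‖ ^ 2 + δ ^ 2) - δ)
      (by simp [Real.sqrt_sq hδ.le]))

lemma TestFn.norm_regAbs_le (u : TestFn) {δ : ℝ} (hδ : 0 < δ) (x : E3) :
    ‖(u.regAbs δ hδ).1 x‖ ≤ ‖u.1 x‖ := by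
  simp only [TestFn.regAbs, TestFn.ofReal, Complex.norm_real]
  rw [Real.norm_of_nonneg]
  · rw [sub_le_iff_le_add]
    refine Real.sqrt_le_iff.2 ⟨by positivity, ?_⟩
    nlinarith [norm_nonneg (u.1 x)]
  · rw [sub_nonneg]
    refine Real.le_sqrt_of_sq_le ?_
    nlinarith [norm_nonneg (u.1 x)]

/-- The pointwise diamagnetic inequality: in `conj u * (I * D_A u)` the vector potential contributes
`I * A |u|²`, which is purely imaginary and invisible to the real part. -/
lemma abs_re_conj_mul_pderiv_le (A : E3 → E3) (j : Fin 3) (u : E3 → ℂ) (x : E3) :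
    |(conj (u x) * pderiv j u x).re| ≤ ‖u x‖ * ‖covT A j u x‖ := by
  have h : (conj (u x) * pderiv j u x).re = (conj (u x) * (Complex.I * covT A j u x)).re := by
    have e : conj (u x) * (Complex.I * covT A j u x) =
        conj (u x) * pderiv j u x + Complex.I * (A x j : ℂ) * (u x * conj (u x)) := by
      rw [covT]
      linear_combination (-(conj (u x) * pderiv j u x)) * Complex.I_sq
    rw [e, Complex.add_re, Complex.mul_conj]
    simp
  rw [h]
  refine (Complex.abs_re_le_norm _).trans_eq ?_
  rw [norm_mul, norm_mul, RCLike.norm_conj, Complex.norm_I, one_mul]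

lemma hasFDerivAt_norm_sq (u : TestFn) (x : E3) :
    HasFDerivAt (fun x => ‖u.1 x‖ ^ 2) (2 • (innerSL ℝ (u.1 x)).comp (fderiv ℝ u.1 x)) x :=
  (u.differentiable x).hasFDerivAt.norm_sq

/-- The gradient of the regularized modulus is `Re (conj u * ∂u)` divided by a quantity not smaller
than `|u|`, so the magnetic gradient of `u` controls the ordinary gradient of its modulus. -/
lemma TestFn.norm_pderiv_regAbs_le (A : E3 → E3) (u : TestFn) {δ : ℝ} (hδ : 0 < δ) (j : Fin 3)
    (x : E3) : ‖pderiv j (u.regAbs δ hδ).1 x‖ ≤ ‖covT A j u.1 x‖ := by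
  have h1 := ((hasFDerivAt_norm_sq u x).add_const (δ ^ 2)).sqrt (by positivity)
  have h2 := Complex.ofRealCLM.hasFDerivAt.comp x (h1.sub_const δ)
  have h3 : HasFDerivAt (u.regAbs δ hδ).1 _ x := h2
  set S := Real.sqrt (‖u.1 x‖ ^ 2 + δ ^ 2) with hS
  have hS0 : 0 < S := Real.sqrt_pos.2 (by positivity)
  have hS1 : ‖u.1 x‖ ≤ S := Real.le_sqrt_of_sq_le (by nlinarith)
  have e : pderiv j (u.regAbs δ hδ).1 x = (((conj (u.1 x) * pderiv j u.1 x).re / S : ℝ) : ℂ) := by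
    rw [pderiv, h3.fderiv]
    simp only [ContinuousLinearMap.comp_apply, smul_apply, innerSL_apply_apply, Complex.inner,
      Complex.ofRealCLM_apply, smul_eq_mul, nsmul_eq_mul, pderiv]
    congr 1
    field_simp
    simp
  rw [e, Complex.norm_real, Real.norm_eq_abs, abs_div, abs_of_pos hS0, div_le_iff₀ hS0]
  refine (abs_re_conj_mul_pderiv_le A j u.1 x).trans ?_
  rw [mul_comm]
  gcongr

lemma tendsto_regAbs (u : TestFn) (x : E3) : Tendsto
    (fun n : ℕ => ‖(u.regAbs (1 / ((n : ℝ) + 1)) (by positivity)).1 x‖) atTop (𝓝 ‖u.1 x‖) := by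
  have h : Continuous fun δ : ℝ => ‖Real.sqrt (‖u.1 x‖ ^ 2 + δ ^ 2) - δ‖ := by fun_prop
  have := (h.tendsto 0).comp (tendsto_one_div_add_atTop_nhds_zero_nat (𝕜 := ℝ))
  simp only [ne_eq, OfNat.ofNat_ne_zero, not_false_eq_true, zero_pow, add_zero, sub_zero,
    Real.sqrt_sq (norm_nonneg _), norm_norm] at this
  refine this.congr fun n => ?_
  exact (Complex.norm_real _).symm

/-- The diamagnetic form bound. -/
lemma Admissible.potT_le {A : E3 → E3} {V : E3 → ℝ} (h : Admissible A V) {ε : ℝ} (hε : 0 < ε) :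
    ∃ C : ℝ, 0 ≤ C ∧ ∀ u : TestFn,
      |potT V u.1| ≤ ε * (∑ j, ∫ x, ‖covT A j u.1 x‖ ^ 2) + C * ∫ x, ‖u.1 x‖ ^ 2 := by
  obtain ⟨C, hC⟩ := h.form_bound ε hε
  refine ⟨|C|, abs_nonneg C, fun u => ?_⟩
  have hA : LocSq A := h.memLp_A
  -- The non-magnetic form bound is applied to the regularized modulus, which is a genuine test
  -- function; the regularization is then removed by dominated convergence with `|V| |u|²`.
  have hlim : Tendsto (fun n : ℕ => |potT V (u.regAbs (1 / ((n : ℝ) + 1)) (by positivity)).1|)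
      atTop (𝓝 |potT V u.1|) := by
    refine Tendsto.abs ?_
    refine tendsto_integral_of_dominated_convergence (fun x => ‖V x * ‖u.1 x‖ ^ 2‖)
      (fun n => (integrable_pot h.locallyIntegrable_V _).aestronglyMeasurable)
      (integrable_pot h.locallyIntegrable_V u).norm (fun n => ae_of_all _ fun x => ?_)
      (ae_of_all _ fun x => ?_)
    · rw [norm_mul, norm_mul]
      refine mul_le_mul_of_nonneg_left ?_ (norm_nonneg _)
      rw [norm_pow, norm_pow, norm_norm, norm_norm]
      exact pow_le_pow_left₀ (norm_nonneg _) (u.norm_regAbs_le _ x) 2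
    · exact ((tendsto_regAbs u x).pow 2).const_mul _
  refine le_of_tendsto' hlim fun n => (hC _).trans (add_le_add ?_ ?_)
  · refine mul_le_mul_of_nonneg_left (Finset.sum_le_sum fun j _ => ?_) hε.le
    refine integral_mono (integrable_norm_sq (TestFn.memLp_pderiv _ j 2))
      (integrable_norm_sq (hA.memLp_covT j u)) fun x => ?_
    exact pow_le_pow_left₀ (norm_nonneg _) (u.norm_pderiv_regAbs_le A _ j x) 2
  · refine mul_le_mul (le_abs_self C) ?_ (by positivity) (abs_nonneg C)
    refine integral_mono (integrable_norm_sq (TestFn.memLp _ 2))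
      (integrable_norm_sq (u.memLp 2)) fun x => ?_
    exact pow_le_pow_left₀ (norm_nonneg _) (u.norm_regAbs_le _ x) 2

lemma integral_norm_sq_parallelogram {f g : E3 → ℂ} (hf : MemLp f 2 volume)
    (hg : MemLp g 2 volume) (t : ℝ) :
    (∫ x, ‖1 * f x + (t : ℂ) * g x‖ ^ 2) + ∫ x, ‖1 * f x + ((-t : ℝ) : ℂ) * g x‖ ^ 2 =
      2 * (∫ x, ‖f x‖ ^ 2) + 2 * t ^ 2 * ∫ x, ‖g x‖ ^ 2 := by
  have hi : ∀ t : ℝ, Integrable fun x => ‖1 * f x + (t : ℂ) * g x‖ ^ 2 := fun t =>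
    integrable_norm_sq ((hf.const_mul _).add (hg.const_mul _))
  rw [← integral_add (hi t) (hi (-t)), ← integral_const_mul, ← integral_const_mul,
    ← integral_add ((integrable_norm_sq hf).const_mul _) ((integrable_norm_sq hg).const_mul _)]
  congr 1
  funext x
  have := parallelogram_law_with_norm ℝ (f x) ((t : ℂ) * g x)
  have e : f x + ((-t : ℝ) : ℂ) * g x = f x - (t : ℂ) * g x := by push_cast; ring
  rw [one_mul, e]
  rw [norm_mul, Complex.norm_real] at this
  have e2 : ‖t‖ ^ 2 = t ^ 2 := by rw [Real.norm_eq_abs, sq_abs]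
  nlinarith [this]

lemma normT_parallelogram {A : E3 → E3} (hA : LocSq A) (w d : TestFn) (t : ℝ) :
    normT A (TestFn.comb 1 (t : ℝ) w d).1 + normT A (TestFn.comb 1 ((-t : ℝ) : ℂ) w d).1 =
      2 * normT A w.1 + 2 * t ^ 2 * normT A d.1 := by
  have h1 := integral_norm_sq_parallelogram (w.memLp 2) (d.memLp 2) t
  have h2 := Finset.sum_congr (rfl : (Finset.univ : Finset (Fin 3)) = Finset.univ) fun j _ =>
    integral_norm_sq_parallelogram (hA.memLp_covT j w) (hA.memLp_covT j d) t
  rw [Finset.sum_add_distrib, Finset.sum_add_distrib, ← Finset.mul_sum, ← Finset.mul_sum] at h2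
  simp only [normT, covT_comb]
  simp only [TestFn.comb]
  linarith

/-- Polarization for the form of the potential. -/
lemma potT_polarization {V : E3 → ℝ} (hV : LocallyIntegrable V) (w u : TestFn) {t : ℝ}
    (ht : t ≠ 0) : potT V u.1 - potT V w.1 = potT V (TestFn.comb 1 ((-1 : ℝ) : ℂ) u w).1 +
      (2 * t)⁻¹ * (potT V (TestFn.comb 1 (t : ℂ) w (TestFn.comb 1 ((-1 : ℝ) : ℂ) u w)).1 -
        potT V (TestFn.comb 1 ((-t : ℝ) : ℂ) w (TestFn.comb 1 ((-1 : ℝ) : ℂ) u w)).1) := by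
  have hi := fun u => integrable_pot hV u
  have hi2 : ∀ u w : TestFn, Integrable fun x => V x * ‖u.1 x‖ ^ 2 - V x * ‖w.1 x‖ ^ 2 :=
    fun u w => (hi u).sub (hi w)
  simp only [potT]
  rw [← integral_sub (hi _) (hi _), ← integral_sub (hi _) (hi _), ← integral_const_mul,
    ← integral_add (hi _) ((hi2 _ _).const_mul _)]
  congr 1
  funext x
  simp only [TestFn.comb, ← Complex.normSq_eq_norm_sq, Complex.normSq_apply]
  simp
  field_simp
  ring

/-- A quadratic form bounded by the `H¹_A` norm is continuous. Polarization expresses the difference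
through `u - w` and `w ± t⁻¹ (u - w)`, and the parallelogram law leaves only squared norms. -/
lemma Admissible.abs_potT_sub_le {A : E3 → E3} {V : E3 → ℝ} (h : Admissible A V) :
    ∃ M : ℝ, 0 ≤ M ∧ ∀ u w : TestFn, ∀ t : ℝ, 0 < t → |potT V u.1 - potT V w.1| ≤
      (1 + t⁻¹) * (M * normT A (TestFn.comb 1 ((-1 : ℝ) : ℂ) u w).1) + t * (M * normT A w.1) := by
  obtain ⟨C, hC0, hC⟩ := h.potT_le one_pos
  have hA : LocSq A := h.memLp_A
  have hb : ∀ u : TestFn, |potT V u.1| ≤ (1 + C) * normT A u.1 := fun u => by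
    refine (hC u).trans ?_
    have h1 : 0 ≤ ∫ x, ‖u.1 x‖ ^ 2 := integral_nonneg fun x => by positivity
    have h2 : 0 ≤ ∑ j, ∫ x, ‖covT A j u.1 x‖ ^ 2 :=
      Finset.sum_nonneg fun j _ => integral_nonneg fun x => by positivity
    rw [normT]
    nlinarith
  refine ⟨1 + C, by linarith, fun u w t ht => ?_⟩
  rw [potT_polarization h.locallyIntegrable_V w u (inv_pos.2 ht).ne']
  set d := TestFn.comb 1 ((-1 : ℝ) : ℂ) u w
  have h1 := hb d
  have h2 := hb (TestFn.comb 1 ((t⁻¹ : ℝ) : ℂ) w d)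
  have h3 := hb (TestFn.comb 1 ((-t⁻¹ : ℝ) : ℂ) w d)
  have h4 := normT_parallelogram hA w d t⁻¹
  set a := potT V (TestFn.comb 1 ((t⁻¹ : ℝ) : ℂ) w d).1
  set b := potT V (TestFn.comb 1 ((-t⁻¹ : ℝ) : ℂ) w d).1
  have h5 : |a - b| ≤ (1 + C) * (2 * normT A w.1 + 2 * t⁻¹ ^ 2 * normT A d.1) := by
    rw [← h4, mul_add]
    exact (abs_sub _ _).trans (add_le_add h2 h3)
  refine (abs_add_le _ _).trans ?_
  have e : (2 * t⁻¹)⁻¹ = t / 2 := by field_simp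
  rw [abs_mul, e, abs_of_pos (by positivity : 0 < t / 2)]
  have h6 : t / 2 * |a - b| ≤
      t / 2 * ((1 + C) * (2 * normT A w.1 + 2 * t⁻¹ ^ 2 * normT A d.1)) := by gcongr
  have e2 : t / 2 * ((1 + C) * (2 * normT A w.1 + 2 * t⁻¹ ^ 2 * normT A d.1)) =
      t * ((1 + C) * normT A w.1) + t⁻¹ * ((1 + C) * normT A d.1) := by
    field_simp
  linarith

lemma coreFilter_neBot {A : E3 → E3} (hA : LocSq A) {φ : E3 → ℂ} (hφ : MemH1A A φ) :
    (coreFilter A φ).NeBot := by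
  refine comap_neBot fun s hs => ?_
  obtain ⟨ε, hε, h⟩ := Metric.mem_nhds_iff.1 hs
  obtain ⟨u, hu⟩ := exists_test_approx hA hφ hε
  refine ⟨u, h ?_⟩
  rw [Metric.mem_ball, Real.dist_eq, sub_zero, abs_of_nonneg]
  · exact hu
  · exact add_nonneg (integral_nonneg fun x => by positivity)
      (Finset.sum_nonneg fun j _ => integral_nonneg fun x => by positivity)

lemma MemH1A.covPair {A : E3 → E3} {φ : E3 → ℂ} (hφ : MemH1A A φ) :
    CovPair A φ fun j => covDeriv A j φ :=
  ⟨hφ.1, fun j => (covDeriv_spec hφ j).1, fun j => (covDeriv_spec hφ j).2⟩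

lemma CovPair.zero (A : E3 → E3) : CovPair A (fun _ => 0) fun _ _ => 0 :=
  ⟨MemLp.zero, fun _ => MemLp.zero, fun j u => by simp⟩

lemma normT_comb_eq_pairDist (A : E3 → E3) (u w : TestFn) :
    normT A (TestFn.comb 1 ((-1 : ℝ) : ℂ) u w).1 =
      pairDist u.1 (fun j => covT A j u.1) w.1 fun j => covT A j w.1 := by
  simp only [normT, covT_comb, pairDist]
  simp [TestFn.comb, ← sub_eq_add_neg]

lemma pairDist_comm (φ : E3 → ℂ) (g : Fin 3 → E3 → ℂ) (φ' : E3 → ℂ) (g' : Fin 3 → E3 → ℂ) :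
    pairDist φ g φ' g' = pairDist φ' g' φ g := by
  simp only [pairDist, norm_sub_rev (φ _), norm_sub_rev (g _ _)]

lemma normT_comb_le {A : E3 → E3} (hA : LocSq A) {φ : E3 → ℂ} (hφ : MemH1A A φ) (u w : TestFn) :
    normT A (TestFn.comb 1 ((-1 : ℝ) : ℂ) u w).1 ≤
      2 * (h1NormSq A (fun x => u.1 x - φ x) + h1NormSq A (fun x => w.1 x - φ x)) := by
  rw [normT_comb_eq_pairDist, h1NormSq_test_sub hA u hφ, h1NormSq_test_sub hA w hφ]
  refine (pairDist_triangle (hA.covPair_test u) hφ.covPair (hA.covPair_test w)).trans_eq ?_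
  rw [pairDist_comm φ]
  rfl

lemma normT_le {A : E3 → E3} (hA : LocSq A) {φ : E3 → ℂ} (hφ : MemH1A A φ) (u : TestFn) :
    normT A u.1 ≤ 2 * (h1NormSq A (fun x => u.1 x - φ x) + h1NormSq A φ) := by
  have h := pairDist_triangle (hA.covPair_test u) hφ.covPair (CovPair.zero A)
  simp only [pairDist, sub_zero] at h
  rw [h1NormSq_test_sub hA u hφ]
  exact h

lemma tendsto_h1NormSq_coreFilter (A : E3 → E3) (φ : E3 → ℂ) :
    Tendsto (fun u : TestFn => h1NormSq A (fun x => u.1 x - φ x)) (coreFilter A φ) (𝓝 0) :=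
  tendsto_comap

/-- The form of the potential extends continuously to `H¹_A`. -/
lemma Admissible.tendsto_potT {A : E3 → E3} {V : E3 → ℝ} (h : Admissible A V) {φ : E3 → ℂ}
    (hφ : MemH1A A φ) :
    Tendsto (fun u : TestFn => potT V u.1) (coreFilter A φ) (𝓝 (potentialForm A V φ)) := by
  have hA : LocSq A := h.memLp_A
  have := coreFilter_neBot hA hφ
  refine tendsto_nhds_limUnder ?_
  have hc : Cauchy (map (fun u : TestFn => potT V u.1) (coreFilter A φ)) := by
    rw [cauchy_map_iff]
    refine ⟨this, ?_⟩
    rw [tendsto_uniformity_iff_dist_tendsto_zero]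
    obtain ⟨M, hM0, hM⟩ := h.abs_potT_sub_le
    have t1 := (tendsto_h1NormSq_coreFilter A φ).comp
      (tendsto_fst (f := coreFilter A φ) (g := coreFilter A φ))
    have t2 := (tendsto_h1NormSq_coreFilter A φ).comp
      (tendsto_snd (f := coreFilter A φ) (g := coreFilter A φ))
    have hx : Tendsto (fun p : TestFn × TestFn => M * (2 * (h1NormSq A (fun x => p.1.1 x - φ x) +
        h1NormSq A (fun x => p.2.1 x - φ x)))) (coreFilter A φ ×ˢ coreFilter A φ) (𝓝 0) := by
      simpa using ((t1.add t2).const_mul 2).const_mul M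
    refine tendsto_zero_of_young (K := M * (2 * (1 + h1NormSq A φ))) hx fun t ht => ?_
    filter_upwards [(tendsto_order.1 t2).2 1 one_pos] with p hp
    rw [Real.dist_eq, abs_abs]
    refine (hM p.1 p.2 t ht).trans (add_le_add ?_ ?_)
    · have := normT_comb_le hA hφ p.1 p.2
      gcongr
    · have h1 := normT_le hA hφ p.2
      have h2 : h1NormSq A (fun x => p.2.1 x - φ x) < 1 := hp
      have h3 : normT A p.2.1 ≤ 2 * (1 + h1NormSq A φ) := by linarith
      gcongr
  exact CompleteSpace.complete hc

/-! ### Extension of the forms from test functions to `H¹_A` -/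

/-- A sequence of test functions converging to `φ` in `H¹_A`. -/
def ApproxSeq (A : E3 → E3) (φ : E3 → ℂ) (u : ℕ → TestFn) : Prop :=
  Tendsto (fun n => h1NormSq A (fun x => (u n).1 x - φ x)) atTop (𝓝 0)

lemma h1NormSq_nonneg (A : E3 → E3) (φ : E3 → ℂ) : 0 ≤ h1NormSq A φ :=
  add_nonneg (integral_nonneg fun x => by positivity)
    (Finset.sum_nonneg fun j _ => integral_nonneg fun x => by positivity)

lemma exists_approxSeq {A : E3 → E3} (hA : LocSq A) {φ : E3 → ℂ} (hφ : MemH1A A φ) :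
    ∃ u, ApproxSeq A φ u := by
  have h : ∀ n : ℕ, ∃ u : TestFn, h1NormSq A (fun x => u.1 x - φ x) < 1 / ((n : ℝ) + 1) :=
    fun n => exists_test_approx hA hφ (by positivity)
  choose u hu using h
  exact ⟨u, squeeze_zero (fun n => h1NormSq_nonneg A _) (fun n => (hu n).le)
    (tendsto_one_div_add_atTop_nhds_zero_nat (𝕜 := ℝ))⟩

lemma Admissible.tendsto_potT_seq {A : E3 → E3} {V : E3 → ℝ} (h : Admissible A V) {φ : E3 → ℂ}
    (hφ : MemH1A A φ) {u : ℕ → TestFn} (hu : ApproxSeq A φ u) :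
    Tendsto (fun n => potT V (u n).1) atTop (𝓝 (potentialForm A V φ)) :=
  (h.tendsto_potT hφ).comp (tendsto_comap_iff.2 hu)

lemma approxSeq_const {A : E3 → E3} (hA : LocSq A) (u : TestFn) : ApproxSeq A u.1 fun _ => u := by
  have e : h1NormSq A (fun x => u.1 x - u.1 x) = 0 := by
    rw [h1NormSq_test_sub hA u (hA.memH1A u)]
    have : ∀ j, ∫ x, ‖covT A j u.1 x - covDeriv A j u.1 x‖ ^ 2 = 0 := fun j => by
      rw [← integral_zero E3 ℝ]
      refine integral_congr_ae ?_
      filter_upwards [covDeriv_ae_eq (hA.memLp_covT j u) (hA.isCovDeriv_covT j u)] with x hx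
      simp [hx]
    simp [this]
  simp only [ApproxSeq, e]
  exact tendsto_const_nhds

lemma Admissible.potentialForm_test {A : E3 → E3} {V : E3 → ℝ} (h : Admissible A V) (u : TestFn) :
    potentialForm A V u.1 = potT V u.1 :=
  tendsto_nhds_unique (h.tendsto_potT_seq (LocSq.memH1A h.memLp_A u)
    (approxSeq_const h.memLp_A u)) tendsto_const_nhds

/-- Products of `L²`-convergent sequences converge in `L¹`. -/
lemma tendsto_integral_norm_mul_sub {f g : ℕ → E3 → ℂ} {a b : E3 → ℂ}
    (hf : ∀ n, MemLp (f n) 2 volume) (hg : ∀ n, MemLp (g n) 2 volume) (ha : MemLp a 2 volume)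
    (hb : MemLp b 2 volume) (h1 : Tendsto (fun n => ∫ x, ‖f n x - a x‖ ^ 2) atTop (𝓝 0))
    (h2 : Tendsto (fun n => ∫ x, ‖g n x - b x‖ ^ 2) atTop (𝓝 0)) :
    Tendsto (fun n => ∫ x, ‖conj (f n x) * g n x - conj (a x) * b x‖) atTop (𝓝 0) := by
  have hx : Tendsto (fun n => (∫ x, ‖f n x - a x‖ ^ 2) + ∫ x, ‖g n x - b x‖ ^ 2) atTop (𝓝 0) := by
    simpa using h1.add h2
  refine tendsto_zero_of_young (K := (∫ x, ‖a x‖ ^ 2) + ∫ x, ‖b x‖ ^ 2) hx fun t ht =>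
    Eventually.of_forall fun n => ?_
  have i1 : Integrable fun x => ‖f n x - a x‖ ^ 2 := integrable_norm_sq ((hf n).sub ha)
  have i2 : Integrable fun x => ‖g n x - b x‖ ^ 2 := integrable_norm_sq ((hg n).sub hb)
  have i3 := integrable_norm_sq ha
  have i4 := integrable_norm_sq hb
  have i5 : Integrable fun x => ‖f n x - a x‖ ^ 2 + ‖g n x - b x‖ ^ 2 := i1.add i2
  have i6 : Integrable fun x => ‖a x‖ ^ 2 + ‖b x‖ ^ 2 := i3.add i4
  rw [abs_of_nonneg (integral_nonneg fun x => norm_nonneg _), ← integral_add i1 i2,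
    ← integral_add i3 i4, ← integral_const_mul, ← integral_const_mul,
    ← integral_add (i5.const_mul _) (i6.const_mul _)]
  refine integral_mono_of_nonneg (ae_of_all _ fun x => norm_nonneg _)
    (((i1.add i2).const_mul _).add ((i3.add i4).const_mul _)) (ae_of_all _ fun x => ?_)
  simp only
  set p := ‖f n x - a x‖
  set q := ‖g n x - b x‖
  have e : conj (f n x) * g n x - conj (a x) * b x = conj (f n x - a x) * (g n x - b x) +
      conj (f n x - a x) * b x + conj (a x) * (g n x - b x) := by
    rw [map_sub]
    ring
  have h3 : ‖conj (f n x) * g n x - conj (a x) * b x‖ ≤ p * q + p * ‖b x‖ + ‖a x‖ * q := by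
    rw [e]
    refine (norm_add₃_le).trans_eq ?_
    simp only [norm_mul, RCLike.norm_conj, p, q]
  have key : ∀ r s : ℝ, r * s ≤ t⁻¹ * r ^ 2 + t * s ^ 2 := fun r s => by
    have h0 : 0 ≤ (r - t * s) ^ 2 + r ^ 2 + (t * s) ^ 2 := by positivity
    have h1 : t⁻¹ * r ^ 2 + t * s ^ 2 - r * s =
        t⁻¹ * (((r - t * s) ^ 2 + r ^ 2 + (t * s) ^ 2) / 2) := by
      field_simp
      ring
    have h2 : 0 ≤ t⁻¹ * (((r - t * s) ^ 2 + r ^ 2 + (t * s) ^ 2) / 2) := by positivity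
    linarith
  have h4 := key p ‖b x‖
  have h5 := key q ‖a x‖
  nlinarith [sq_nonneg (p - q), sq_nonneg p, sq_nonneg q]

lemma ApproxSeq.tendsto_L2 {A : E3 → E3} {φ : E3 → ℂ} {u : ℕ → TestFn} (hu : ApproxSeq A φ u) :
    Tendsto (fun n => ∫ x, ‖(u n).1 x - φ x‖ ^ 2) atTop (𝓝 0) := by
  refine squeeze_zero (fun n => integral_nonneg fun x => by positivity) (fun n => ?_) hu
  rw [h1NormSq]
  have : 0 ≤ kineticForm A fun x => (u n).1 x - φ x :=
    Finset.sum_nonneg fun j _ => integral_nonneg fun x => by positivity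
  linarith

lemma ApproxSeq.tendsto_covT {A : E3 → E3} (hA : LocSq A) {φ : E3 → ℂ} (hφ : MemH1A A φ)
    {u : ℕ → TestFn} (hu : ApproxSeq A φ u) (j : Fin 3) :
    Tendsto (fun n => ∫ x, ‖covT A j (u n).1 x - covDeriv A j φ x‖ ^ 2) atTop (𝓝 0) := by
  refine squeeze_zero (fun n => integral_nonneg fun x => by positivity) (fun n => ?_) hu
  rw [h1NormSq_test_sub hA _ hφ]
  have h1 : 0 ≤ ∫ x, ‖(u n).1 x - φ x‖ ^ 2 := integral_nonneg fun x => by positivity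
  have h2 := Finset.single_le_sum (f := fun j => ∫ x, ‖covT A j (u n).1 x - covDeriv A j φ x‖ ^ 2)
    (fun j _ => integral_nonneg fun x => by positivity) (Finset.mem_univ j)
  linarith

lemma tendsto_integral_of_norm_sub {f : ℕ → E3 → ℂ} {a : E3 → ℂ} (hf : ∀ n, Integrable (f n))
    (ha : Integrable a) (h : Tendsto (fun n => ∫ x, ‖f n x - a x‖) atTop (𝓝 0)) :
    Tendsto (fun n => ∫ x, f n x) atTop (𝓝 (∫ x, a x)) := by
  rw [tendsto_iff_norm_sub_tendsto_zero]
  refine squeeze_zero (fun n => norm_nonneg _) (fun n => ?_) h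
  rw [← integral_sub (hf n) ha]
  exact norm_integral_le_integral_norm _

lemma integrable_conj_mul_of_sq {f g : E3 → ℂ} (hf : MemLp f 2 volume) (hg : MemLp g 2 volume) :
    Integrable fun x => conj (f x) * g x :=
  MemLp.integrable_mul hf.star hg

lemma integral_conj_mul_self (f : E3 → ℂ) :
    ∫ x, conj (f x) * f x = ((∫ x, ‖f x‖ ^ 2 : ℝ) : ℂ) := by
  rw [← integral_complex_ofReal]
  congr 1
  funext x
  rw [mul_comm, Complex.mul_conj, Complex.normSq_eq_norm_sq]

lemma tendsto_integral_norm_sq {f : ℕ → E3 → ℂ} {a : E3 → ℂ}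
    (hf : ∀ n, MemLp (f n) 2 volume) (ha : MemLp a 2 volume)
    (h1 : Tendsto (fun n => ∫ x, ‖f n x - a x‖ ^ 2) atTop (𝓝 0)) :
    Tendsto (fun n => ∫ x, ‖f n x‖ ^ 2) atTop (𝓝 (∫ x, ‖a x‖ ^ 2)) := by
  have h := tendsto_integral_of_norm_sub (fun n => integrable_conj_mul_of_sq (hf n) (hf n))
    (integrable_conj_mul_of_sq ha ha) (tendsto_integral_norm_mul_sub hf hf ha ha h1 h1)
  simp only [integral_conj_mul_self] at h
  have := (Complex.continuous_re.tendsto _).comp h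
  simpa [Function.comp_def] using this

lemma ApproxSeq.tendsto_kinetic {A : E3 → E3} (hA : LocSq A) {φ : E3 → ℂ} (hφ : MemH1A A φ)
    {u : ℕ → TestFn} (hu : ApproxSeq A φ u) :
    Tendsto (fun n => ∑ j, ∫ x, ‖covT A j (u n).1 x‖ ^ 2) atTop (𝓝 (kineticForm A φ)) :=
  tendsto_finsetSum _ fun j _ => tendsto_integral_norm_sq (fun n => hA.memLp_covT j (u n))
    (covDeriv_spec hφ j).1 (hu.tendsto_covT hA hφ j)

lemma Admissible.potentialForm_le {A : E3 → E3} {V : E3 → ℝ} (h : Admissible A V) {ε : ℝ}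
    (hε : 0 < ε) : ∃ C : ℝ, 0 ≤ C ∧ ∀ φ, MemH1A A φ →
      |potentialForm A V φ| ≤ ε * kineticForm A φ + C * ∫ x, ‖φ x‖ ^ 2 := by
  obtain ⟨C, hC0, hC⟩ := h.potT_le hε
  have hA : LocSq A := h.memLp_A
  refine ⟨C, hC0, fun φ hφ => ?_⟩
  obtain ⟨u, hu⟩ := exists_approxSeq hA hφ
  exact le_of_tendsto_of_tendsto' (h.tendsto_potT_seq hφ hu).abs
    (((hu.tendsto_kinetic hA hφ).const_mul ε).add ((tendsto_integral_norm_sq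
      (fun n => (u n).memLp 2) hφ.1 (hu.tendsto_L2)).const_mul C)) fun n => hC (u n)

lemma Admissible.const_mul {A : E3 → E3} {V : E3 → ℝ} (h : Admissible A V) (c : ℝ) :
    Admissible A fun x => c * V x := by
  refine ⟨h.memLp_A, h.locallyIntegrable_V.smul c, fun ε hε => ?_⟩
  obtain ⟨C, hC⟩ := h.form_bound (ε / (|c| + 1)) (by positivity)
  refine ⟨|c| * C, fun u => ?_⟩
  simp only [mul_assoc]
  rw [integral_const_mul, abs_mul]
  have h1 := mul_le_mul_of_nonneg_left (hC u) (abs_nonneg c)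
  have h2 : 0 ≤ ∑ j, ∫ x, ‖pderiv j u.1 x‖ ^ 2 :=
    Finset.sum_nonneg fun j _ => integral_nonneg fun x => by positivity
  have h3 : |c| * (ε / (|c| + 1)) ≤ ε := by
    rw [mul_div_assoc', div_le_iff₀ (by positivity)]
    nlinarith
  nlinarith [mul_le_mul_of_nonneg_right h3 h2]


/-! ### A Hardy type inequality and the Coulomb energy -/

/-- `√(|x - y|² + ε)`. -/
noncomputable def regDist (ε : ℝ) (y x : E3) : ℝ := Real.sqrt (‖x - y‖ ^ 2 + ε)

lemma regDist_pos {ε : ℝ} (hε : 0 < ε) (y x : E3) : 0 < regDist ε y x :=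
  Real.sqrt_pos.2 (by positivity)

lemma regDist_sq {ε : ℝ} (hε : 0 < ε) (y x : E3) : regDist ε y x ^ 2 = ‖x - y‖ ^ 2 + ε :=
  Real.sq_sqrt (by positivity)

lemma continuous_regDist (ε : ℝ) (y : E3) : Continuous (regDist ε y) := by
  unfold regDist
  fun_prop

/-- The field `(x - y) / √(|x - y|² + ε)` has length at most one, and its divergence is at least `2
/ √(|x - y|² + ε)`; paired with the gradient of `|u|²` it yields the Hardy type inequality. Only the
diagonal derivatives enter the divergence. -/
lemma hasFDerivAt_regField {ε : ℝ} (hε : 0 < ε) (y x : E3) (j : Fin 3) :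
    ∃ f' : E3 →L[ℝ] ℝ, HasFDerivAt (fun x : E3 => (x j - y j) * (regDist ε y x)⁻¹) f' x ∧
      f' (EuclideanSpace.single j 1) =
        (regDist ε y x)⁻¹ - (x j - y j) ^ 2 * (regDist ε y x)⁻¹ ^ 3 := by
  have hS := regDist_pos hε y x
  have h1 : HasFDerivAt (fun x : E3 => x j - y j) (EuclideanSpace.proj (𝕜 := ℝ) j) x :=
    (EuclideanSpace.proj (𝕜 := ℝ) j : E3 →L[ℝ] ℝ).hasFDerivAt.sub_const (y j)
  have h2 : HasFDerivAt (fun x : E3 => ‖x - y‖ ^ 2 + ε)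
      (2 • (innerSL ℝ (x - y)).comp (ContinuousLinearMap.id ℝ E3)) x :=
    ((hasFDerivAt_id x).sub_const y).norm_sq.add_const ε
  have h3 := (hasDerivAt_inv hS.ne').comp_hasFDerivAt x (h2.sqrt (by positivity))
  refine ⟨_, h1.mul h3, ?_⟩
  have e1 : √(‖x - y‖ ^ 2 + ε) = regDist ε y x := rfl
  simp [e1, EuclideanSpace.inner_single_right]
  field_simp
  ring

lemma abs_coord_le_norm (x : E3) (j : Fin 3) : |x j| ≤ ‖x‖ := by
  have := EuclideanSpace.norm_sq_eq x
  have h1 := Finset.single_le_sum (f := fun j => ‖x j‖ ^ 2) (fun j _ => by positivity)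
    (Finset.mem_univ j)
  rw [← this] at h1
  have h2 := abs_le_of_sq_le_sq (show ‖x j‖ ^ 2 ≤ ‖x‖ ^ 2 from h1) (norm_nonneg x)
  rw [← Real.norm_eq_abs]
  exact (le_abs_self _).trans h2

/-- Integration by parts moves the derivative onto `|u|²`, and the diamagnetic inequality bounds the
result by `2 |u| |D_A u|`. -/
lemma hardy_component {A : E3 → E3} (hA : LocSq A) (u : TestFn) (y : E3) {ε t : ℝ} (hε : 0 < ε)
    (ht : 0 < t) (j : Fin 3) :
    ∫ x, ((regDist ε y x)⁻¹ - (x j - y j) ^ 2 * (regDist ε y x)⁻¹ ^ 3) * ‖u.1 x‖ ^ 2 ≤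
      2 * t * (∫ x, ‖covT A j u.1 x‖ ^ 2) + 2 * t⁻¹ * ∫ x, ‖u.1 x‖ ^ 2 := by
  have hc : HasCompactSupport fun x => ‖u.1 x‖ ^ 2 :=
    u.2.2.comp_left (g := fun z : ℂ => ‖z‖ ^ 2) (by simp)
  have hSc : Continuous fun x => (regDist ε y x)⁻¹ :=
    (continuous_regDist ε y).inv₀ fun x => (regDist_pos hε y x).ne'
  have hcj : Continuous fun x : E3 => x j - y j := by fun_prop
  have hu2 : Continuous fun x => ‖u.1 x‖ ^ 2 := u.2.1.continuous.norm.pow 2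
  set e : E3 := EuclideanSpace.single j 1
  set F : E3 → ℝ := fun x => (x j - y j) * (regDist ε y x)⁻¹ with hF
  have hFd : ∀ x, HasFDerivAt F (hasFDerivAt_regField hε y x j).choose x := fun x =>
    (hasFDerivAt_regField hε y x j).choose_spec.1
  have hFe : ∀ x, fderiv ℝ F x e =
      (regDist ε y x)⁻¹ - (x j - y j) ^ 2 * (regDist ε y x)⁻¹ ^ 3 := fun x => by
    rw [(hFd x).fderiv]
    exact (hasFDerivAt_regField hε y x j).choose_spec.2
  have hge : ∀ x, fderiv ℝ (fun x => ‖u.1 x‖ ^ 2) x e =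
      2 * (conj (u.1 x) * pderiv j u.1 x).re := fun x => by
    rw [(hasFDerivAt_norm_sq u x).fderiv]
    simp [Complex.inner, pderiv, e]
    ring
  have hpc : Continuous fun x => (conj (u.1 x) * pderiv j u.1 x).re :=
    Complex.continuous_re.comp ((Complex.continuous_conj.comp u.2.1.continuous).mul
      (continuous_pderiv j u.2.1))
  have hps : HasCompactSupport fun x => (conj (u.1 x) * pderiv j u.1 x).re := by
    have h1 : HasCompactSupport fun x => conj (u.1 x) * pderiv j u.1 x :=
      (hasCompactSupport_pderiv j u.2.2).mul_left
    exact h1.comp_left (g := Complex.re) Complex.zero_re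
  have hdc : Continuous fun x : E3 => (regDist ε y x)⁻¹ -
      (x j - y j) ^ 2 * (regDist ε y x)⁻¹ ^ 3 := hSc.sub ((hcj.pow 2).mul (hSc.pow 3))
  have key := integral_mul_fderiv_eq_neg_fderiv_mul_of_integrable (μ := (volume : Measure E3))
    (f := F) (g := fun x => ‖u.1 x‖ ^ 2) (v := e)
    (by
      simp only [hFe]
      exact (hdc.mul hu2).integrable_of_hasCompactSupport hc.mul_left)
    (by
      simp only [hge]
      exact ((hcj.mul hSc).mul (continuous_const.mul hpc)).integrable_of_hasCompactSupport
        (hps.mul_left.mul_left))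
    (((hcj.mul hSc).mul hu2).integrable_of_hasCompactSupport hc.mul_left)
    (fun x _ => (hFd x).differentiableAt) (fun x _ => (hasFDerivAt_norm_sq u x).differentiableAt)
  simp only [hFe, hge] at key
  have e2 : ∫ x, ((regDist ε y x)⁻¹ - (x j - y j) ^ 2 * (regDist ε y x)⁻¹ ^ 3) * ‖u.1 x‖ ^ 2 =
      ∫ x, -(F x * (2 * (conj (u.1 x) * pderiv j u.1 x).re)) := by
    rw [integral_neg, key, neg_neg]
  have i1 := (integrable_norm_sq (hA.memLp_covT j u)).const_mul (2 * t)
  have i2 := (integrable_norm_sq (u.memLp 2)).const_mul (2 * t⁻¹)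
  rw [e2, ← integral_const_mul, ← integral_const_mul, ← integral_add i1 i2]
  refine integral_mono (((hcj.mul hSc).mul
    (continuous_const.mul hpc)).integrable_of_hasCompactSupport (hps.mul_left.mul_left)).neg
    (i1.add i2) fun x => ?_
  have hS := regDist_pos hε y x
  have hF1 : |F x| ≤ 1 := by
    rw [hF, abs_mul, abs_inv, abs_of_pos hS, ← div_eq_mul_inv, div_le_one hS]
    refine (abs_coord_le_norm (x - y) j).trans ?_
    exact Real.le_sqrt_of_sq_le (by linarith)
  have h1 := abs_re_conj_mul_pderiv_le A j u.1 x
  set a := ‖u.1 x‖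
  set b := ‖covT A j u.1 x‖
  have h2 : -(F x * (2 * (conj (u.1 x) * pderiv j u.1 x).re)) ≤ 2 * (a * b) := by
    refine (neg_le_abs _).trans ?_
    rw [abs_mul (F x), abs_mul 2, abs_two]
    calc |F x| * (2 * |(conj (u.1 x) * pderiv j u.1 x).re|) ≤ 1 * (2 * (a * b)) := by gcongr
      _ = 2 * (a * b) := one_mul _
  have h3 : a * b ≤ t * b ^ 2 + t⁻¹ * a ^ 2 := by
    have h0 : 0 ≤ t⁻¹ * (((a - t * b) ^ 2 + a ^ 2 + (t * b) ^ 2) / 2) := by positivity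
    have h1 : t * b ^ 2 + t⁻¹ * a ^ 2 - a * b =
        t⁻¹ * (((a - t * b) ^ 2 + a ^ 2 + (t * b) ^ 2) / 2) := by
      field_simp
      ring
    linarith
  change _ ≤ 2 * t * b ^ 2 + 2 * t⁻¹ * a ^ 2
  linarith

/-- A regularized Hardy type inequality for test functions. -/
lemma hardy_test {A : E3 → E3} (hA : LocSq A) (u : TestFn) (y : E3) {ε t : ℝ} (hε : 0 < ε)
    (ht : 0 < t) : ∫ x, (regDist ε y x)⁻¹ * ‖u.1 x‖ ^ 2 ≤
      t * (∑ j, ∫ x, ‖covT A j u.1 x‖ ^ 2) + 3 * t⁻¹ * ∫ x, ‖u.1 x‖ ^ 2 := by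
  have hc : HasCompactSupport fun x => ‖u.1 x‖ ^ 2 :=
    u.2.2.comp_left (g := fun z : ℂ => ‖z‖ ^ 2) (by simp)
  have hSc : Continuous fun x => (regDist ε y x)⁻¹ :=
    (continuous_regDist ε y).inv₀ fun x => (regDist_pos hε y x).ne'
  have hu2 : Continuous fun x => ‖u.1 x‖ ^ 2 := u.2.1.continuous.norm.pow 2
  have hcj : ∀ j, Continuous fun x : E3 => x j - y j := fun j => by fun_prop
  have h := Finset.sum_le_sum fun (j : Fin 3) (_ : j ∈ Finset.univ) =>
    hardy_component hA u y hε ht j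
  have hi : ∀ j : Fin 3, Integrable fun x =>
      ((regDist ε y x)⁻¹ - (x j - y j) ^ 2 * (regDist ε y x)⁻¹ ^ 3) * ‖u.1 x‖ ^ 2 := fun j =>
    ((hSc.sub (((hcj j).pow 2).mul (hSc.pow 3))).mul
      hu2).integrable_of_hasCompactSupport hc.mul_left
  rw [← integral_finsetSum _ fun j _ => hi j, Finset.sum_add_distrib, ← Finset.mul_sum,
    Finset.sum_const, Finset.card_univ, Fintype.card_fin] at h
  -- With `S` the regularized distance, the divergence is `3 / S - |x - y|² / S³`, which is at least
  -- `2 / S`.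
  have h2 : 2 * ∫ x, (regDist ε y x)⁻¹ * ‖u.1 x‖ ^ 2 ≤ ∫ x, ∑ j : Fin 3,
      ((regDist ε y x)⁻¹ - (x j - y j) ^ 2 * (regDist ε y x)⁻¹ ^ 3) * ‖u.1 x‖ ^ 2 := by
    rw [← integral_const_mul]
    refine integral_mono (((hSc.mul hu2).integrable_of_hasCompactSupport hc.mul_left).const_mul 2)
      (integrable_finsetSum _ fun j _ => hi j) fun x => ?_
    have hS := regDist_pos hε y x
    have hS2 := regDist_sq hε y x
    have hn : ∑ j : Fin 3, (x j - y j) ^ 2 = ‖x - y‖ ^ 2 := by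
      rw [EuclideanSpace.norm_sq_eq]
      simp
    simp only [sub_mul, Finset.sum_sub_distrib, ← Finset.sum_mul, hn, Finset.sum_const,
      Finset.card_univ, Fintype.card_fin]
    have h3 : ‖x - y‖ ^ 2 * (regDist ε y x)⁻¹ ^ 3 ≤ (regDist ε y x)⁻¹ := by
      have : ‖x - y‖ ^ 2 ≤ regDist ε y x ^ 2 := by linarith
      calc ‖x - y‖ ^ 2 * (regDist ε y x)⁻¹ ^ 3
          ≤ regDist ε y x ^ 2 * (regDist ε y x)⁻¹ ^ 3 := by gcongr
        _ = (regDist ε y x)⁻¹ := by field_simp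
    have h4 : ‖x - y‖ ^ 2 * (regDist ε y x)⁻¹ ^ 3 * ‖u.1 x‖ ^ 2 ≤
        (regDist ε y x)⁻¹ * ‖u.1 x‖ ^ 2 := by gcongr
    simp only [nsmul_eq_mul]
    push_cast
    linarith
  simp only [nsmul_eq_mul] at h
  push_cast at h
  linarith

/-- For fixed `ε` the weight is bounded, so both sides are continuous along an approximating
sequence of test functions. -/
lemma hardy_reg {A : E3 → E3} (hA : LocSq A) {φ : E3 → ℂ} (hφ : MemH1A A φ) (y : E3) {ε t : ℝ}
    (hε : 0 < ε) (ht : 0 < t) : ∫ x, (regDist ε y x)⁻¹ * ‖φ x‖ ^ 2 ≤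
      t * kineticForm A φ + 3 * t⁻¹ * ∫ x, ‖φ x‖ ^ 2 := by
  obtain ⟨u, hu⟩ := exists_approxSeq hA hφ
  have hSc : Continuous fun x => (regDist ε y x)⁻¹ :=
    (continuous_regDist ε y).inv₀ fun x => (regDist_pos hε y x).ne'
  have hSb : ∀ x, ‖(((regDist ε y x)⁻¹ : ℝ) : ℂ)‖ ≤ (Real.sqrt ε)⁻¹ := fun x => by
    rw [Complex.norm_real, Real.norm_of_nonneg (inv_nonneg.2 (regDist_pos hε y x).le)]
    refine inv_anti₀ (Real.sqrt_pos.2 hε) (Real.sqrt_le_sqrt ?_)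
    nlinarith [norm_nonneg (x - y)]
  have hcS : AEStronglyMeasurable (fun x => (((regDist ε y x)⁻¹ : ℝ) : ℂ)) volume :=
    (Complex.continuous_ofReal.comp hSc).aestronglyMeasurable
  have hint : ∀ {f : E3 → ℂ}, MemLp f 2 volume →
      Integrable fun x => (((regDist ε y x)⁻¹ : ℝ) : ℂ) * (conj (f x) * f x) := fun {f} hf =>
    (integrable_conj_mul_of_sq hf hf).bdd_mul hcS (ae_of_all _ hSb)
  have hL : Tendsto (fun n => ∫ x, ‖conj ((u n).1 x) * (u n).1 x - conj (φ x) * φ x‖) atTop (𝓝 0) :=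
    tendsto_integral_norm_mul_sub (fun n => (u n).memLp 2) (fun n => (u n).memLp 2) hφ.1 hφ.1
      hu.tendsto_L2 hu.tendsto_L2
  have h1 : Tendsto (fun n => ∫ x, (((regDist ε y x)⁻¹ : ℝ) : ℂ) * (conj ((u n).1 x) * (u n).1 x))
      atTop (𝓝 (∫ x, (((regDist ε y x)⁻¹ : ℝ) : ℂ) * (conj (φ x) * φ x))) := by
    refine tendsto_integral_of_norm_sub (fun n => hint ((u n).memLp 2)) (hint hφ.1) ?_
    have hz : Tendsto (fun n => (Real.sqrt ε)⁻¹ *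
        ∫ x, ‖conj ((u n).1 x) * (u n).1 x - conj (φ x) * φ x‖) atTop (𝓝 0) := by
      simpa using hL.const_mul (Real.sqrt ε)⁻¹
    refine squeeze_zero (fun n => integral_nonneg fun x => norm_nonneg _) (fun n => ?_) hz
    rw [← integral_const_mul]
    refine integral_mono_of_nonneg (ae_of_all _ fun x => norm_nonneg _)
      (((integrable_conj_mul_of_sq ((u n).memLp 2) ((u n).memLp 2)).sub
        (integrable_conj_mul_of_sq hφ.1 hφ.1)).norm.const_mul _) (ae_of_all _ fun x => ?_)
    simp only
    rw [← mul_sub, norm_mul]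
    gcongr
    exact hSb x
  have e : ∀ f : E3 → ℂ, ∫ x, (((regDist ε y x)⁻¹ : ℝ) : ℂ) * (conj (f x) * f x) =
      ((∫ x, (regDist ε y x)⁻¹ * ‖f x‖ ^ 2 : ℝ) : ℂ) := fun f => by
    rw [← integral_complex_ofReal]
    congr 1
    funext x
    rw [mul_comm (conj _), Complex.mul_conj, Complex.normSq_eq_norm_sq]
    push_cast
    rfl
  simp only [e] at h1
  have h2 : Tendsto (fun n => ∫ x, (regDist ε y x)⁻¹ * ‖(u n).1 x‖ ^ 2) atTop
      (𝓝 (∫ x, (regDist ε y x)⁻¹ * ‖φ x‖ ^ 2)) := by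
    have := (Complex.continuous_re.tendsto _).comp h1
    simpa [Function.comp_def] using this
  exact le_of_tendsto_of_tendsto' h2 (((hu.tendsto_kinetic hA hφ).const_mul t).add
    ((tendsto_integral_norm_sq (fun n => (u n).memLp 2) hφ.1 hu.tendsto_L2).const_mul _))
    fun n => hardy_test hA (u n) y hε ht

/-- Fatou's lemma as the regularization tends to zero. At the point `x = y` division by zero gives
the value zero, which is harmless. -/
lemma lintegral_coulomb_le {A : E3 → E3} (hA : LocSq A) {φ : E3 → ℂ} (hφ : MemH1A A φ) (y : E3)
    {t : ℝ} (ht : 0 < t) : ∫⁻ x, ENNReal.ofReal (‖φ x‖ ^ 2 / ‖y - x‖) ≤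
      ENNReal.ofReal (t * kineticForm A φ + 3 * t⁻¹ * ∫ x, ‖φ x‖ ^ 2) := by
  have hφm := hφ.1.aestronglyMeasurable
  have hm : ∀ n : ℕ, AEMeasurable (fun x =>
      ENNReal.ofReal ((regDist (1 / ((n : ℝ) + 1)) y x)⁻¹ * ‖φ x‖ ^ 2)) volume := fun n =>
    (((continuous_regDist _ y).measurable.inv.aemeasurable).mul
      (hφm.norm.aemeasurable.pow_const 2)).ennreal_ofReal
  have hF := lintegral_liminf_le' (u := atTop) hm
  have h1 : ∀ x, ENNReal.ofReal (‖φ x‖ ^ 2 / ‖y - x‖) ≤ liminf (fun n : ℕ =>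
      ENNReal.ofReal ((regDist (1 / ((n : ℝ) + 1)) y x)⁻¹ * ‖φ x‖ ^ 2)) atTop := fun x => by
    by_cases hx : ‖x - y‖ = 0
    · rw [norm_sub_rev, hx, div_zero, ENNReal.ofReal_zero]
      exact zero_le
    · have hc : Continuous fun ε : ℝ => regDist ε y x := by
        unfold regDist
        fun_prop
      have h2 := (hc.tendsto 0).comp (tendsto_one_div_add_atTop_nhds_zero_nat (𝕜 := ℝ))
      have e0 : regDist 0 y x = ‖x - y‖ := by
        rw [regDist, add_zero, Real.sqrt_sq (norm_nonneg _)]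
      rw [e0] at h2
      have h3 := ENNReal.tendsto_ofReal ((h2.inv₀ hx).mul_const (‖φ x‖ ^ 2))
      rw [show ‖x - y‖⁻¹ * ‖φ x‖ ^ 2 = ‖φ x‖ ^ 2 / ‖y - x‖ by
        rw [norm_sub_rev, div_eq_inv_mul]] at h3
      exact h3.liminf_eq.ge
  refine (lintegral_mono h1).trans (hF.trans ?_)
  refine (liminf_le_liminf (Eventually.of_forall fun n => ?_)).trans_eq (liminf_const _)
  have hp : (0 : ℝ) < 1 / ((n : ℝ) + 1) := by positivity
  rw [← ofReal_integral_eq_lintegral_ofReal]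
  · exact ENNReal.ofReal_le_ofReal (hardy_reg hA hφ y hp ht)
  · refine (integrable_norm_sq hφ.1).bdd_mul (c := (Real.sqrt (1 / ((n : ℝ) + 1)))⁻¹)
      (((continuous_regDist _ y).measurable.inv).aestronglyMeasurable) (ae_of_all _ fun x => ?_)
    rw [norm_inv, Real.norm_of_nonneg (regDist_pos hp y x).le]
    refine inv_anti₀ (Real.sqrt_pos.2 hp) (Real.sqrt_le_sqrt ?_)
    nlinarith [norm_nonneg (x - y)]
  · exact ae_of_all _ fun x => mul_nonneg (inv_nonneg.2 (regDist_pos hp y x).le) (by positivity)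

lemma kineticForm_nonneg (A : E3 → E3) (φ : E3 → ℂ) : 0 ≤ kineticForm A φ :=
  Finset.sum_nonneg fun j _ => integral_nonneg fun x => by positivity

lemma aestronglyMeasurable_coulomb {φ : E3 → ℂ} (hφ : AEStronglyMeasurable φ volume) (y : E3) :
    AEStronglyMeasurable (fun x => ‖φ x‖ ^ 2 / ‖y - x‖) volume :=
  ((hφ.norm.aemeasurable.pow_const 2).div
    (by fun_prop : Measurable fun x : E3 => ‖y - x‖).aemeasurable).aestronglyMeasurable

/-- A Hardy type inequality in `H¹_A`. -/
lemma hardy {A : E3 → E3} (hA : LocSq A) {φ : E3 → ℂ} (hφ : MemH1A A φ) (y : E3)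
    {t : ℝ} (ht : 0 < t) : Integrable (fun x => ‖φ x‖ ^ 2 / ‖y - x‖) ∧
      ∫ x, ‖φ x‖ ^ 2 / ‖y - x‖ ≤ t * kineticForm A φ + 3 * t⁻¹ * ∫ x, ‖φ x‖ ^ 2 := by
  have h := lintegral_coulomb_le hA hφ y ht
  have hm := aestronglyMeasurable_coulomb hφ.1.aestronglyMeasurable y
  have h0 : ∀ x, 0 ≤ ‖φ x‖ ^ 2 / ‖y - x‖ := fun x => by positivity
  have hB : 0 ≤ t * kineticForm A φ + 3 * t⁻¹ * ∫ x, ‖φ x‖ ^ 2 := by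
    have := kineticForm_nonneg A φ
    positivity
  refine ⟨⟨hm, ?_⟩, ?_⟩
  · rw [hasFiniteIntegral_iff_ofReal (ae_of_all _ h0)]
    exact h.trans_lt ENNReal.ofReal_lt_top
  · rw [integral_eq_lintegral_of_nonneg_ae (ae_of_all _ h0) hm]
    exact ENNReal.toReal_le_of_le_ofReal hB h

/-- The Hardy bound is uniform in the position of the second charge, so integrating over that
position costs one factor `‖φ‖²`. -/
lemma coulomb_le {A : E3 → E3} (hA : LocSq A) {φ : E3 → ℂ} (hφ : MemH1A A φ)
    {t : ℝ} (ht : 0 < t) : ∫ x, ∫ y, ‖φ x‖ ^ 2 * ‖φ y‖ ^ 2 / ‖x - y‖ ≤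
      (t * kineticForm A φ + 3 * t⁻¹ * ∫ x, ‖φ x‖ ^ 2) * ∫ x, ‖φ x‖ ^ 2 := by
  rw [← integral_const_mul]
  refine integral_mono_of_nonneg (ae_of_all _ fun x => integral_nonneg fun y => by positivity)
    ((integrable_norm_sq hφ.1).const_mul _) (ae_of_all _ fun x => ?_)
  simp only [mul_div_assoc]
  rw [integral_const_mul, mul_comm]
  gcongr
  exact (hardy hA hφ x ht).2

/-- The Coulomb energy density of `φ ∈ H¹_A` is integrable. -/
lemma integrable_coulomb {A : E3 → E3} (hA : LocSq A) {φ : E3 → ℂ} (hφ : MemH1A A φ) :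
    Integrable fun p : E3 × E3 => ‖φ p.1‖ ^ 2 * ‖φ p.2‖ ^ 2 / ‖p.1 - p.2‖ := by
  have hφm := hφ.1.aestronglyMeasurable
  have hm : AEStronglyMeasurable (fun p : E3 × E3 => ‖φ p.1‖ ^ 2 * ‖φ p.2‖ ^ 2 / ‖p.1 - p.2‖)
      (volume.prod volume) :=
    (((hφm.comp_fst.norm.aemeasurable.pow_const 2).mul
      (hφm.comp_snd.norm.aemeasurable.pow_const 2)).div
      (by fun_prop : Measurable fun p : E3 × E3 => ‖p.1 - p.2‖).aemeasurable).aestronglyMeasurable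
  rw [Measure.volume_eq_prod, integrable_prod_iff hm]
  have hH := fun x => hardy hA hφ x one_pos
  refine ⟨ae_of_all _ fun x => ?_, ?_⟩
  · simp only [mul_div_assoc]
    exact (hH x).1.const_mul _
  · refine Integrable.mono' ((integrable_norm_sq hφ.1).const_mul
      (1 * kineticForm A φ + 3 * 1⁻¹ * ∫ x, ‖φ x‖ ^ 2)) hm.norm.integral_prod_right'
      (ae_of_all _ fun x => ?_)
    rw [Real.norm_of_nonneg (integral_nonneg fun y => norm_nonneg _)]
    have e : ∀ y, ‖‖φ x‖ ^ 2 * ‖φ y‖ ^ 2 / ‖x - y‖‖ = ‖φ x‖ ^ 2 * (‖φ y‖ ^ 2 / ‖x - y‖) := fun y => by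
      rw [Real.norm_of_nonneg (by positivity), mul_div_assoc]
    simp only [e]
    rw [integral_const_mul, mul_comm]
    gcongr
    exact (hH x).2

/-- The Pekar functional is bounded from below on the unit sphere. -/
lemma bddBelow_pekarValues {A : E3 → E3} {V : E3 → ℝ} (h : Admissible A V) {α : ℝ} (hα : 0 < α) :
    BddBelow (pekarValues A V α) := by
  obtain ⟨C, hC0, hC⟩ := h.potentialForm_le (ε := 1 / 2) (by norm_num)
  -- Half of the kinetic energy absorbs the potential; the other half absorbs the Coulomb term, by
  -- the Hardy bound with `t = 1 / (2 α)`, whose remainder is `6 α²`.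
  refine ⟨-C - 6 * α ^ 2, ?_⟩
  rintro e ⟨φ, hφ, hn, rfl⟩
  have h1 := hC φ hφ
  have h2 := coulomb_le h.memLp_A hφ (t := (2 * α)⁻¹) (by positivity)
  rw [hn] at h1 h2
  have h3 := neg_abs_le (potentialForm A V φ)
  rw [pekarFunctional, schrodingerForm]
  have h4 : α * ∫ x, ∫ y, ‖φ x‖ ^ 2 * ‖φ y‖ ^ 2 / ‖x - y‖ ≤
      α * (((2 * α)⁻¹ * kineticForm A φ + 3 * (2 * α)⁻¹⁻¹ * 1) * 1) := by gcongr
  have e : α * (((2 * α)⁻¹ * kineticForm A φ + 3 * (2 * α)⁻¹⁻¹ * 1) * 1) =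
      1 / 2 * kineticForm A φ + 6 * α ^ 2 := by
    field_simp
    ring
  linarith


/-! ### Radial integrals -/

/-- The area of the unit sphere. -/
noncomputable def sphereArea : ℝ := 3 * volume.real (Metric.ball (0 : E3) 1)

lemma sphereArea_pos : 0 < sphereArea :=
  mul_pos (by norm_num) (ENNReal.toReal_pos (Metric.measure_ball_pos _ _ one_pos).ne'
    measure_ball_lt_top.ne)

/-- In three dimensions the radial density `y²` cancels the weight, and the length of the interval
remains. -/
lemma inv_sq_closedBall {r : ℝ} (hr : 0 ≤ r) :
    IntegrableOn (fun k : E3 => (‖k‖ ^ 2)⁻¹) (Metric.closedBall 0 r) ∧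
      ∫ k in Metric.closedBall (0 : E3) r, (‖k‖ ^ 2)⁻¹ = sphereArea * r := by
  let f : ℝ → ℝ := (Set.Iic r).indicator fun y => (y ^ 2)⁻¹
  have e1 : (fun k : E3 => f ‖k‖) = (Metric.closedBall 0 r).indicator fun k => (‖k‖ ^ 2)⁻¹ := by
    funext k
    by_cases hk : ‖k‖ ≤ r
    · simp [f, hk, Set.indicator]
    · simp [f, hk, Set.indicator]
  have e2 : ∀ y ∈ Set.Ioi (0 : ℝ), y ^ (Module.finrank ℝ E3 - 1) • f y =
      (Set.Ioc 0 r).indicator (fun _ => (1 : ℝ)) y := by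
    intro y hy
    have hy0 : (y : ℝ) ≠ 0 := ne_of_gt hy
    by_cases hk : y ≤ r
    · have : y ∈ Set.Ioc 0 r := ⟨hy, hk⟩
      rw [Set.indicator_of_mem this]
      simp [f, hk, hy0]
    · have : y ∉ Set.Ioc 0 r := fun h => hk h.2
      rw [Set.indicator_of_notMem this]
      simp [f, hk]
  have e3 : ∫ y in Set.Ioi (0 : ℝ), (Set.Ioc 0 r).indicator (fun _ => (1 : ℝ)) y = r := by
    rw [setIntegral_indicator measurableSet_Ioc, Set.inter_eq_right.2 fun y hy => hy.1]
    simp [hr]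
  constructor
  · rw [← integrable_indicator_iff measurableSet_closedBall, ← e1,
      integrable_fun_norm_addHaar volume, integrableOn_congr_fun e2 measurableSet_Ioi]
    have : Integrable ((Set.Ioc 0 r).indicator fun _ => (1 : ℝ)) := by
      rw [integrable_indicator_iff measurableSet_Ioc]
      exact integrableOn_const (by simp)
    exact this.integrableOn
  · rw [← integral_indicator measurableSet_closedBall, ← e1, integral_fun_norm_addHaar volume,
      setIntegral_congr_fun measurableSet_Ioi e2, e3]
    simp [sphereArea, mul_assoc]

lemma inv_pow_four_compl {r : ℝ} (hr : 0 < r) :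
    IntegrableOn (fun k : E3 => (‖k‖ ^ 4)⁻¹) {k | r ≤ ‖k‖} ∧
      ∫ k in {k : E3 | r ≤ ‖k‖}, (‖k‖ ^ 4)⁻¹ = sphereArea * r⁻¹ := by
  let f : ℝ → ℝ := (Set.Ici r).indicator fun y => (y ^ 4)⁻¹
  have hms : MeasurableSet {k : E3 | r ≤ ‖k‖} := measurableSet_le measurable_const measurable_norm
  have e1 : (fun k : E3 => f ‖k‖) = ({k : E3 | r ≤ ‖k‖}).indicator fun k => (‖k‖ ^ 4)⁻¹ := by
    funext k
    by_cases hk : r ≤ ‖k‖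
    · simp [f, hk, Set.indicator]
    · simp [f, hk, Set.indicator]
  have e2 : ∀ y ∈ Set.Ioi (0 : ℝ), y ^ (Module.finrank ℝ E3 - 1) • f y =
      (Set.Ici r).indicator (fun y => y ^ (-2 : ℝ)) y := by
    intro y hy
    have hy0 : (0 : ℝ) < y := hy
    by_cases hk : r ≤ y
    · have : y ∈ Set.Ici r := hk
      rw [Set.indicator_of_mem this, Real.rpow_neg hy0.le]
      simp only [f, Set.indicator_of_mem this, finrank_euclideanSpace, Fintype.card_fin,
        smul_eq_mul, Real.rpow_two]
      field_simp
    · have : y ∉ Set.Ici r := hk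
      rw [Set.indicator_of_notMem this]
      simp [f, Set.indicator_of_notMem this]
  have hsub : Set.Ici r ⊆ Set.Ioi 0 := fun y hy => hr.trans_le hy
  have hi : IntegrableOn (fun y : ℝ => y ^ (-2 : ℝ)) (Set.Ici r) := by
    rw [integrableOn_Ici_iff_integrableOn_Ioi]
    exact integrableOn_Ioi_rpow_of_lt (by norm_num) hr
  have e3 : ∫ y in Set.Ioi (0 : ℝ), (Set.Ici r).indicator (fun y => y ^ (-2 : ℝ)) y = r⁻¹ := by
    rw [setIntegral_indicator measurableSet_Ici, Set.inter_eq_right.2 hsub,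
      integral_Ici_eq_integral_Ioi, integral_Ioi_rpow_of_lt (by norm_num) hr]
    norm_num
    rw [Real.rpow_neg_one]
  constructor
  · rw [← integrable_indicator_iff hms, ← e1,
      integrable_fun_norm_addHaar volume, integrableOn_congr_fun e2 measurableSet_Ioi]
    have : Integrable ((Set.Ici r).indicator fun y : ℝ => y ^ (-2 : ℝ)) := by
      rwa [integrable_indicator_iff measurableSet_Ici]
    exact this.integrableOn
  · rw [← integral_indicator hms, ← e1, integral_fun_norm_addHaar volume,
      setIntegral_congr_fun measurableSet_Ioi e2, e3]
    simp [sphereArea, mul_assoc]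

lemma setIntegral_inv_sq_le {r : ℝ} (hr : 0 ≤ r) {S : Set E3} (hS : ∀ k ∈ S, ‖k‖ ≤ r) :
    ∫ k in S, (‖k‖ ^ 2)⁻¹ ≤ sphereArea * r := by
  rw [← (inv_sq_closedBall hr).2]
  exact setIntegral_mono_set (inv_sq_closedBall hr).1 (ae_of_all _ fun k => by positivity)
    (LE.le.eventuallyLE fun k hk => by simpa using hS k hk)

lemma setIntegral_inv_pow_four_le {r : ℝ} (hr : 0 < r) {S : Set E3} (hS : ∀ k ∈ S, r ≤ ‖k‖) :
    ∫ k in S, (‖k‖ ^ 4)⁻¹ ≤ sphereArea * r⁻¹ := by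
  rw [← (inv_pow_four_compl hr).2]
  exact setIntegral_mono_set (inv_pow_four_compl hr).1 (ae_of_all _ fun k => by positivity)
    (LE.le.eventuallyLE fun k hk => hS k hk)

/-- `1 / |k|` is at most `1 + 1 / |k|²`, which is locally integrable in three dimensions. -/
lemma IsMode.integrable_inv_mul {h : E3 → ℂ} (hh : IsMode h) :
    Integrable fun k => ((‖k‖⁻¹ : ℝ) : ℂ) * h k := by
  obtain ⟨C, hC⟩ := hh.bdd
  obtain ⟨R, hR⟩ := hh.supp
  have hC0 : 0 ≤ C := (norm_nonneg _).trans (hC 0)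
  have hS : MeasurableSet (Metric.closedBall (0 : E3) |R|) := measurableSet_closedBall
  have h1 : Integrable ((Metric.closedBall (0 : E3) |R|).indicator
      fun k : E3 => (1 + (‖k‖ ^ 2)⁻¹) * C) := by
    rw [integrable_indicator_iff hS]
    exact ((integrableOn_const measure_closedBall_lt_top.ne).add
      (inv_sq_closedBall (abs_nonneg R)).1).mul_const C
  refine h1.mono' ?_ (ae_of_all _ fun k => ?_)
  · exact ((Complex.measurable_ofReal.comp measurable_norm.inv).mul hh.meas).aestronglyMeasurable
  · by_cases hk : ‖k‖ ≤ |R|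
    · rw [Set.indicator_of_mem (by simpa using hk), norm_mul, Complex.norm_real,
        Real.norm_of_nonneg (by positivity)]
      have h2 : ‖k‖⁻¹ ≤ 1 + (‖k‖ ^ 2)⁻¹ := by
        rw [← inv_pow]
        nlinarith [sq_nonneg (‖k‖⁻¹ - 1)]
      exact mul_le_mul h2 (hC k) (norm_nonneg _) (by positivity)
    · rw [hR k ((le_abs_self R).trans_lt (not_le.1 hk)), mul_zero, norm_zero]
      exact Set.indicator_nonneg (fun k _ => by positivity) k

/-! ### Forms on finite sums of product vectors -/

/-- The sesquilinear form `∑ T i j ⟨η i, ζ j⟩`. -/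
noncomputable def mform {m : ℕ} (T : Fin m → Fin m → ℂ) :
    (Fin m → niceFock) →ₗ⋆[ℂ] (Fin m → niceFock) →ₗ[ℂ] ℂ :=
  LinearMap.mk₂'ₛₗ (starRingEnd ℂ) (RingHom.id ℂ)
    (fun η ζ => ∑ i, ∑ j, T i j * ip (η i) (ζ j))
    (fun η η' ζ => by
      simp only [Pi.add_apply, map_add, LinearMap.add_apply, mul_add, Finset.sum_add_distrib])
    (fun c η ζ => by
      simp only [Pi.smul_apply, LinearMap.map_smulₛₗ, LinearMap.smul_apply, smul_eq_mul,
        Finset.mul_sum]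
      exact Finset.sum_congr rfl fun i _ => Finset.sum_congr rfl fun j _ => by ring)
    (fun η ζ ζ' => by
      simp only [Pi.add_apply, map_add, mul_add, Finset.sum_add_distrib])
    (fun c η ζ => by
      simp only [Pi.smul_apply, map_smul, smul_eq_mul, Finset.mul_sum, RingHom.id_apply]
      exact Finset.sum_congr rfl fun i _ => Finset.sum_congr rfl fun j _ => by ring)

lemma mform_apply {m : ℕ} (T : Fin m → Fin m → ℂ) (η ζ : Fin m → niceFock) :
    mform T η ζ = ∑ i, ∑ j, T i j * ip (η i) (ζ j) := rfl

/-- For each `(n, K)` the integrand is the scalar sesquilinear form of `T` on the components, so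
questions about Fock vectors become questions about coefficient vectors in `ℂ^m`. -/
lemma mform_eq_tsum {m : ℕ} (T : Fin m → Fin m → ℂ) (η ζ : Fin m → niceFock) :
    mform T η ζ = ∑' n, ∫ K, ∑ i, ∑ j, T i j * (conj ((η i).1 n K) * (ζ j).1 n K) := by
  have h1 : ∀ n, ∫ K, ∑ i, ∑ j, T i j * (conj ((η i).1 n K) * (ζ j).1 n K) =
      ∑ i, ∑ j, T i j * ∫ K, conj ((η i).1 n K) * (ζ j).1 n K := fun n => by
    rw [integral_finsetSum _ fun i _ => integrable_finsetSum _ fun j _ =>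
      (integrable_conj_mul _ _ n).const_mul _]
    refine Finset.sum_congr rfl fun i _ => ?_
    rw [integral_finsetSum _ fun j _ => (integrable_conj_mul _ _ n).const_mul _]
    exact Finset.sum_congr rfl fun j _ => integral_const_mul _ _
  simp only [h1]
  rw [Summable.tsum_finsetSum fun i _ => summable_sum fun j _ => (summable_inner _ _).mul_left _]
  rw [mform_apply]
  refine Finset.sum_congr rfl fun i _ => ?_
  rw [Summable.tsum_finsetSum fun j _ => (summable_inner _ _).mul_left _]
  refine Finset.sum_congr rfl fun j _ => ?_
  rw [tsum_mul_left, ip_apply]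

/-- The vector `∑ φ i ⊗ η i`. -/
noncomputable def tens {m : ℕ} (φ : Fin m → E3 → ℂ) (η : Fin m → niceFock) : StateFn :=
  fun n x K => ∑ i, φ i x * (η i).1 n K

/-- Overlap matrix `∫ conj φ i * χ j`. -/
noncomputable def overlap {m : ℕ} (φ χ : Fin m → E3 → ℂ) (i j : Fin m) : ℂ :=
  ∫ x, conj (φ i x) * χ j x

lemma innerState_tens {m : ℕ} {φ χ : Fin m → E3 → ℂ} (hφ : ∀ i, MemLp (φ i) 2 volume)
    (hχ : ∀ i, MemLp (χ i) 2 volume) (η ζ : Fin m → niceFock) :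
    innerState (tens φ η) (tens χ ζ) = mform (overlap φ χ) η ζ := by
  have h1 : ∀ n x, ∫ K, conj (tens φ η n x K) * tens χ ζ n x K =
      ∑ i, ∑ j, (conj (φ i x) * χ j x) * ∫ K, conj ((η i).1 n K) * (ζ j).1 n K := fun n x => by
    have e : ∀ K, conj (tens φ η n x K) * tens χ ζ n x K = ∑ i, ∑ j, (conj (φ i x) * χ j x) *
        (conj ((η i).1 n K) * (ζ j).1 n K) := fun K => by
      simp only [tens, map_sum, Finset.sum_mul_sum, map_mul]
      exact Finset.sum_congr rfl fun i _ => Finset.sum_congr rfl fun j _ => by ring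
    simp only [e]
    rw [integral_finsetSum _ fun i _ => integrable_finsetSum _ fun j _ =>
      (integrable_conj_mul _ _ n).const_mul _]
    refine Finset.sum_congr rfl fun i _ => ?_
    rw [integral_finsetSum _ fun j _ => (integrable_conj_mul _ _ n).const_mul _]
    exact Finset.sum_congr rfl fun j _ => integral_const_mul _ _
  have h2 : ∀ n, ∫ x, ∫ K, conj (tens φ η n x K) * tens χ ζ n x K =
      ∑ i, ∑ j, overlap φ χ i j * ∫ K, conj ((η i).1 n K) * (ζ j).1 n K := fun n => by
    simp only [h1]
    have hi := fun i j => integrable_conj_mul_of_sq (hφ i) (hχ j)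
    rw [integral_finsetSum _ fun i _ => integrable_finsetSum _ fun j _ => (hi i j).mul_const _]
    refine Finset.sum_congr rfl fun i _ => ?_
    rw [integral_finsetSum _ fun j _ => (hi i j).mul_const _]
    exact Finset.sum_congr rfl fun j _ => integral_mul_const _ _
  rw [innerState]
  simp only [h2]
  rw [Summable.tsum_finsetSum fun i _ => summable_sum fun j _ => (summable_inner _ _).mul_left _]
  rw [mform_apply]
  refine Finset.sum_congr rfl fun i _ => ?_
  rw [Summable.tsum_finsetSum fun j _ => (summable_inner _ _).mul_left _]
  refine Finset.sum_congr rfl fun j _ => ?_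
  rw [tsum_mul_left, ip_apply]

lemma ofReal_normSqState (ψ : StateFn) : (normSqState ψ : ℂ) = innerState ψ ψ := by
  rw [normSqState, innerState, Complex.ofReal_tsum]
  refine tsum_congr fun n => ?_
  rw [← integral_complex_ofReal]
  congr 1
  funext x
  rw [← integral_complex_ofReal]
  congr 1
  funext K
  rw [mul_comm, Complex.mul_conj, Complex.normSq_eq_norm_sq]

lemma conj_innerState (ψ χ : StateFn) : conj (innerState ψ χ) = innerState χ ψ := by
  rw [innerState, innerState, Complex.conj_tsum]
  refine tsum_congr fun n => ?_
  rw [← integral_conj]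
  congr 1
  funext x
  rw [← integral_conj]
  congr 1
  funext K
  rw [map_mul, Complex.conj_conj, mul_comm]

lemma normSqState_tens {m : ℕ} {φ : Fin m → E3 → ℂ} (hφ : ∀ i, MemLp (φ i) 2 volume)
    (η : Fin m → niceFock) : normSqState (tens φ η) = (mform (overlap φ φ) η η).re := by
  rw [← innerState_tens hφ hφ, ← ofReal_normSqState, Complex.ofReal_re]

lemma annihilate_tens {m : ℕ} (φ : Fin m → E3 → ℂ) (η : Fin m → niceFock) (k : E3) :
    annihilate k (tens φ η) = tens φ fun i => annK k (η i) := by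
  funext n x K
  simp only [annihilate, tens, annK_apply, Finset.mul_sum]
  exact Finset.sum_congr rfl fun i _ => by ring

/-- The functions `e^{ikx} φ i`. -/
noncomputable def waveMul {m : ℕ} (k : E3) (φ : Fin m → E3 → ℂ) (i : Fin m) (x : E3) : ℂ :=
  Complex.exp (Complex.I * (inner ℝ k x : ℝ)) * φ i x

lemma planeWave_tens {m : ℕ} (φ : Fin m → E3 → ℂ) (η : Fin m → niceFock) (k : E3) :
    planeWave k (tens φ η) = tens (waveMul k φ) η := by
  funext n x K
  simp only [planeWave, tens, waveMul, Finset.mul_sum, mul_assoc]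

lemma continuous_planeWave (k : E3) :
    Continuous fun x : E3 => Complex.exp (Complex.I * (inner ℝ k x : ℝ)) := by fun_prop

lemma memLp_waveMul {m : ℕ} {φ : Fin m → E3 → ℂ} (hφ : ∀ i, MemLp (φ i) 2 volume) (k : E3)
    (i : Fin m) : MemLp (waveMul k φ i) 2 volume :=
  (hφ i).mono ((continuous_planeWave k).aestronglyMeasurable.mul (hφ i).aestronglyMeasurable)
    (ae_of_all _ fun x => by rw [waveMul, norm_mul, norm_planeWave, one_mul])

lemma numberForm_tens {m : ℕ} {φ : Fin m → E3 → ℂ} (hφ : ∀ i, MemLp (φ i) 2 volume)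
    (η : Fin m → niceFock) : numberForm (tens φ η) =
      ∫ k, (mform (overlap φ φ) (fun i => annK k (η i)) fun i => annK k (η i)).re := by
  rw [numberForm]
  congr 1
  funext k
  rw [annihilate_tens, normSqState_tens hφ]

lemma interactionForm_tens {m : ℕ} {φ : Fin m → E3 → ℂ} (hφ : ∀ i, MemLp (φ i) 2 volume)
    (η : Fin m → niceFock) : interactionForm (tens φ η) = 1 / (Real.sqrt 2 * Real.pi) *
      ∫ k : E3, ‖k‖⁻¹ *
        (2 * (mform (overlap φ (waveMul k φ)) η fun i => annK k (η i)).re) := by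
  rw [interactionForm]
  congr 2
  funext k
  rw [annihilate_tens, planeWave_tens, ← conj_innerState (tens φ η),
    innerState_tens hφ (memLp_waveMul hφ k), Complex.add_re, Complex.conj_re, one_div]
  ring

/-- For fixed `(n, K)` the electron function is the combination of the `φ i` with coefficients `(η
i).1 n K`, so only the matrix of the Schrödinger form on their span matters. -/
lemma electronForm_tens {m : ℕ} {A : E3 → E3} {V : E3 → ℝ} {φ : Fin m → E3 → ℂ}
    {S : Fin m → Fin m → ℂ} (hS : ∀ c : Fin m → ℂ,
      ((schrodingerForm A V fun x => ∑ i, c i * φ i x : ℝ) : ℂ) =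
        ∑ i, ∑ j, S i j * (conj (c i) * c j)) (η : Fin m → niceFock) :
    electronForm A V (tens φ η) = (mform S η η).re := by
  have h : ((electronForm A V (tens φ η) : ℝ) : ℂ) = mform S η η := by
    rw [mform_eq_tsum, electronForm, Complex.ofReal_tsum]
    refine tsum_congr fun n => ?_
    rw [← integral_complex_ofReal]
    congr 1
    funext K
    rw [← hS]
    simp only [tens, mul_comm]
  rw [← h, Complex.ofReal_re]


/-! ### Reduction to test functions -/

/-- The Fourier integral `∫ e^{ikx} ρ(x) dx`. -/
noncomputable def waveFT (ρ : E3 → ℂ) (k : E3) : ℂ :=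
  ∫ x, Complex.exp (Complex.I * (inner ℝ k x : ℝ)) * ρ x

lemma norm_waveFT_le (ρ : E3 → ℂ) (k : E3) : ‖waveFT ρ k‖ ≤ ∫ x, ‖ρ x‖ := by
  refine (norm_integral_le_integral_norm _).trans_eq ?_
  congr 1
  funext x
  rw [norm_mul, norm_planeWave, one_mul]

lemma continuous_waveFT {ρ : E3 → ℂ} (hρ : Integrable ρ) : Continuous (waveFT ρ) := by
  refine continuous_of_dominated (bound := fun x => ‖ρ x‖)
    (fun k => (integrable_planeWave_mul hρ k).aestronglyMeasurable)
    (fun k => ae_of_all _ fun x => ?_) hρ.norm (ae_of_all _ fun x => ?_)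
  · rw [norm_mul, norm_planeWave, one_mul]
  · fun_prop

lemma waveFT_sub {ρ σ : E3 → ℂ} (hρ : Integrable ρ) (hσ : Integrable σ) (k : E3) :
    waveFT ρ k - waveFT σ k = waveFT (fun x => ρ x - σ x) k := by
  simp only [waveFT, mul_sub]
  rw [integral_sub (integrable_planeWave_mul hρ k) (integrable_planeWave_mul hσ k)]

/-- The densities `conj φ i * φ j`. -/
noncomputable def dens {m : ℕ} (φ : Fin m → E3 → ℂ) (i j : Fin m) (x : E3) : ℂ :=
  conj (φ i x) * φ j x

lemma overlap_waveMul {m : ℕ} (φ : Fin m → E3 → ℂ) (k : E3) (i j : Fin m) :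
    overlap φ (waveMul k φ) i j = waveFT (dens φ i j) k := by
  simp only [overlap, waveMul, waveFT, dens]
  congr 1
  funext x
  ring

/-- The Fröhlich form of `∑ φ i ⊗ η i` in terms of the Schrödinger matrix `S` and of the
densities `ρ`. -/
noncomputable def matrixForm {m : ℕ} (g : ℝ) (S : Fin m → Fin m → ℂ)
    (ρ : Fin m → Fin m → E3 → ℂ) (η : Fin m → niceFock) : ℝ :=
  (mform S η η).re +
    (∫ k, (mform (fun i j => ∫ x, ρ i j x) (fun i => annK k (η i)) fun i => annK k (η i)).re) +
    g * ∫ k : E3, ‖k‖⁻¹ * (2 * (mform (fun i j => waveFT (ρ i j) k) η fun i => annK k (η i)).re)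

lemma tendsto_mform {m : ℕ} {T : ℕ → Fin m → Fin m → ℂ} {T' : Fin m → Fin m → ℂ}
    (h : ∀ i j, Tendsto (fun l => T l i j) atTop (𝓝 (T' i j))) (η ζ : Fin m → niceFock) :
    Tendsto (fun l => (mform (T l) η ζ).re) atTop (𝓝 (mform T' η ζ).re) := by
  refine (Complex.continuous_re.tendsto _).comp ?_
  simp only [mform_apply]
  exact tendsto_finsetSum _ fun i _ => tendsto_finsetSum _ fun j _ => (h i j).mul_const _

lemma integral_mform_annK {m : ℕ} (T : Fin m → Fin m → ℂ) (η : Fin m → niceFock) :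
    ∫ k, (mform T (fun i => annK k (η i)) fun i => annK k (η i)).re =
      (∑ i, ∑ j, T i j * ∫ k, ip (annK k (η i)) (annK k (η j))).re := by
  have hi := fun i j => ((isMode_ip_annK_annK (η i) (η j)).integrable).const_mul (T i j)
  have h := integral_re (𝕜 := ℂ) (f := fun k => mform T (fun i => annK k (η i))
    fun i => annK k (η i)) (μ := volume) (by
      simp only [mform_apply]
      exact integrable_finsetSum _ fun i _ => integrable_finsetSum _ fun j _ => hi i j)
  refine h.trans ?_
  simp only [mform_apply]
  rw [integral_finsetSum _ fun i _ => integrable_finsetSum _ fun j _ => hi i j]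
  refine congrArg Complex.re (Finset.sum_congr rfl fun i _ => ?_)
  rw [integral_finsetSum _ fun j _ => hi i j]
  exact Finset.sum_congr rfl fun j _ => integral_const_mul _ _

lemma integrable_waveFT_mul {ρ : E3 → ℂ} (hρ : Integrable ρ) {h : E3 → ℂ} (hh : IsMode h) :
    Integrable fun k => ((‖k‖⁻¹ : ℝ) : ℂ) * (waveFT ρ k * h k) := by
  have h1 := hh.integrable_inv_mul.bdd_mul (f := waveFT ρ) (c := ∫ x, ‖ρ x‖)
    (continuous_waveFT hρ).aestronglyMeasurable (ae_of_all _ fun k => norm_waveFT_le ρ k)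
  refine h1.congr (ae_of_all _ fun k => ?_)
  simp only
  ring

lemma integral_mform_wave {m : ℕ} {ρ : Fin m → Fin m → E3 → ℂ} (hρ : ∀ i j, Integrable (ρ i j))
    (η : Fin m → niceFock) :
    ∫ k : E3, ‖k‖⁻¹ * (2 * (mform (fun i j => waveFT (ρ i j) k) η fun i => annK k (η i)).re) =
      2 * (∑ i, ∑ j, ∫ k, ((‖k‖⁻¹ : ℝ) : ℂ) * (waveFT (ρ i j) k * ip (η i) (annK k (η j)))).re := by
  have hi := fun i j => integrable_waveFT_mul (hρ i j) (isMode_ip_annK (η i) (η j))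
  have h := integral_re (𝕜 := ℂ) (f := fun k : E3 => ((‖k‖⁻¹ : ℝ) : ℂ) *
    mform (fun i j => waveFT (ρ i j) k) η fun i => annK k (η i)) (μ := volume) (by
      simp only [mform_apply, Finset.mul_sum]
      exact integrable_finsetSum _ fun i _ => integrable_finsetSum _ fun j _ => hi i j)
  have e : ∀ k : E3, ‖k‖⁻¹ * (2 * (mform (fun i j => waveFT (ρ i j) k) η
      fun i => annK k (η i)).re) = 2 * (((‖k‖⁻¹ : ℝ) : ℂ) *
        mform (fun i j => waveFT (ρ i j) k) η fun i => annK k (η i)).re := fun k => by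
    rw [Complex.re_ofReal_mul]
    ring
  simp only [e]
  rw [integral_const_mul]
  congr 1
  refine h.trans ?_
  simp only [mform_apply, Finset.mul_sum]
  rw [integral_finsetSum _ fun i _ => integrable_finsetSum _ fun j _ => hi i j]
  exact congrArg Complex.re (Finset.sum_congr rfl fun i _ => integral_finsetSum _ fun j _ => hi i j)

/-- With `η` fixed, the electron functions enter through finitely many matrix entries and through
the densities. The dependence on the densities is continuous in `L¹`, because `waveFT` is bounded by
the `L¹` norm uniformly in `k`. -/
lemma tendsto_matrixForm {m : ℕ} (g : ℝ) {S : ℕ → Fin m → Fin m → ℂ} {S' : Fin m → Fin m → ℂ}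
    {ρ : ℕ → Fin m → Fin m → E3 → ℂ} {ρ' : Fin m → Fin m → E3 → ℂ}
    (hS : ∀ i j, Tendsto (fun l => S l i j) atTop (𝓝 (S' i j)))
    (hi : ∀ l i j, Integrable (ρ l i j)) (hi' : ∀ i j, Integrable (ρ' i j))
    (hρ : ∀ i j, Tendsto (fun l => ∫ x, ‖ρ l i j x - ρ' i j x‖) atTop (𝓝 0))
    (η : Fin m → niceFock) :
    Tendsto (fun l => matrixForm g (S l) (ρ l) η) atTop (𝓝 (matrixForm g S' ρ' η)) := by
  have hM := fun i j => tendsto_integral_of_norm_sub (fun l => hi l i j) (hi' i j) (hρ i j)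
  refine ((tendsto_mform hS η η).add ?_).add (Tendsto.const_mul g ?_)
  · simp only [integral_mform_annK]
    refine (Complex.continuous_re.tendsto _).comp ?_
    exact tendsto_finsetSum _ fun i _ => tendsto_finsetSum _ fun j _ => (hM i j).mul_const _
  · simp only [integral_mform_wave (hi _), integral_mform_wave hi']
    refine Tendsto.const_mul 2 ((Complex.continuous_re.tendsto _).comp ?_)
    refine tendsto_finsetSum _ fun i _ => tendsto_finsetSum _ fun j _ => ?_
    have hm := isMode_ip_annK (η i) (η j)
    rw [tendsto_iff_norm_sub_tendsto_zero]
    have hz : Tendsto (fun l => (∫ x, ‖ρ l i j x - ρ' i j x‖) *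
        ∫ k, ‖((‖k‖⁻¹ : ℝ) : ℂ) * ip (η i) (annK k (η j))‖) atTop (𝓝 0) := by
      simpa using (hρ i j).mul_const _
    refine squeeze_zero (fun l => norm_nonneg _) (fun l => ?_) hz
    rw [← integral_sub (integrable_waveFT_mul (hi l i j) hm)
      (integrable_waveFT_mul (hi' i j) hm), ← integral_const_mul]
    refine norm_integral_le_of_norm_le (hm.integrable_inv_mul.norm.const_mul _)
      (ae_of_all _ fun k => ?_)
    rw [← mul_sub, ← sub_mul, waveFT_sub (hi l i j) (hi' i j), mul_left_comm, norm_mul]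
    exact mul_le_mul_of_nonneg_right (norm_waveFT_le _ k) (norm_nonneg _)

/-- A quadratic form determines its matrix. -/
lemma matrix_polarization {m : ℕ} (S : Fin m → Fin m → ℂ) (i j : Fin m) :
    S i j = 4⁻¹ * ∑ k : Fin 4, Complex.I ^ (k : ℕ) *
      ∑ p, ∑ q, S p q * (conj (Pi.single (M := fun _ => ℂ) j 1 p + Complex.I ^ (k : ℕ) *
        Pi.single (M := fun _ => ℂ) i 1 p) * (Pi.single (M := fun _ => ℂ) j 1 q +
          Complex.I ^ (k : ℕ) * Pi.single (M := fun _ => ℂ) i 1 q)) := by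
  have h : ∀ z : ℂ, ∑ p, ∑ q, S p q * (conj (Pi.single (M := fun _ => ℂ) j 1 p + z *
      Pi.single (M := fun _ => ℂ) i 1 p) * (Pi.single (M := fun _ => ℂ) j 1 q +
        z * Pi.single (M := fun _ => ℂ) i 1 q)) =
      S j j + z * S j i + conj z * S i j + conj z * z * S i i := fun z => by
    have hc : ∀ a b : Fin m, conj (Pi.single (M := fun _ => ℂ) a 1 b : ℂ) =
        Pi.single (M := fun _ => ℂ) a 1 b := fun a b => by
      by_cases hab : b = a
      · subst hab
        simp
      · simp [Pi.single_eq_of_ne hab]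
    simp only [map_add, map_mul, hc, add_mul, mul_add, Finset.sum_add_distrib]
    simp only [Pi.single_apply, mul_ite, ite_mul, mul_one, one_mul, mul_zero, zero_mul,
      Finset.sum_ite_eq', Finset.mem_univ, if_true]
    ring
  simp only [h, Fin.sum_univ_four]
  simp only [Fin.val_zero, Fin.val_one, Fin.val_two, show ((3 : Fin 4) : ℕ) = 3 from rfl, pow_zero,
    pow_one, map_one, map_pow, Complex.conj_I]
  have h2 := Complex.I_sq
  have h3 : Complex.I ^ 3 = -Complex.I := by rw [pow_succ, h2]; ring
  have h4 : Complex.I ^ 4 = 1 := by rw [show 4 = 2 * 2 from rfl, pow_mul, h2]; ring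
  ring_nf
  simp only [h2, h3, h4, show Complex.I ^ 6 = -1 by rw [show 6 = 4 + 2 from rfl, pow_add, h4, h2]; ring,
    show Complex.I ^ 9 = Complex.I by
      rw [show 9 = 4 + 4 + 1 from rfl, pow_add, pow_add, h4]; ring]
  ring

/-- Convergence of quadratic forms implies convergence of their matrices. -/
lemma tendsto_matrix {m : ℕ} {S : ℕ → Fin m → Fin m → ℂ} {f : (Fin m → ℂ) → ℂ}
    (h : ∀ c, Tendsto (fun l => ∑ i, ∑ j, S l i j * (conj (c i) * c j)) atTop (𝓝 (f c))) :
    ∃ S' : Fin m → Fin m → ℂ, (∀ i j, Tendsto (fun l => S l i j) atTop (𝓝 (S' i j))) ∧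
      ∀ c, f c = ∑ i, ∑ j, S' i j * (conj (c i) * c j) := by
  let S' : Fin m → Fin m → ℂ := fun i j => 4⁻¹ * ∑ k : Fin 4, Complex.I ^ (k : ℕ) *
    f fun p => Pi.single (M := fun _ => ℂ) j 1 p + Complex.I ^ (k : ℕ) *
      Pi.single (M := fun _ => ℂ) i 1 p
  have hS' : ∀ i j, Tendsto (fun l => S l i j) atTop (𝓝 (S' i j)) := fun i j => by
    have e : (fun l => S l i j) = fun l => _ := funext fun l => matrix_polarization (S l) i j
    rw [e]
    exact (tendsto_finsetSum _ fun k _ => (h _).const_mul _).const_mul _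
  refine ⟨S', hS', fun c => tendsto_nhds_unique (h c) ?_⟩
  exact tendsto_finsetSum _ fun i _ => tendsto_finsetSum _ fun j _ => (hS' i j).mul_const _

/-- Linear combination of test functions. -/
noncomputable def TestFn.lin {m : ℕ} (c : Fin m → ℂ) (u : Fin m → TestFn) : TestFn :=
  ⟨fun x => ∑ i, c i * (u i).1 x, ContDiff.sum fun i _ => contDiff_const.mul (u i).2.1, by
    classical
    refine Finset.induction_on (motive := fun s => HasCompactSupport fun x =>
      ∑ i ∈ s, c i * (u i).1 x) Finset.univ ?_ fun i s hi ih => ?_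
    · simp only [Finset.sum_empty]
      exact HasCompactSupport.zero
    · simp only [Finset.sum_insert hi]
      exact ((u i).2.2.mul_left).add ih⟩

lemma covT_lin {m : ℕ} (A : E3 → E3) (j : Fin 3) (c : Fin m → ℂ) (u : Fin m → TestFn) (x : E3) :
    covT A j (TestFn.lin c u).1 x = ∑ i, c i * covT A j (u i).1 x := by
  have h : pderiv j (TestFn.lin c u).1 x = ∑ i, c i * pderiv j (u i).1 x := by
    have h1 := HasFDerivAt.fun_sum (u := Finset.univ) (A := fun i x => c i * (u i).1 x) (x := x)
      fun i _ => ((u i).differentiable x).hasFDerivAt.const_mul (c i)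
    rw [pderiv, show fderiv ℝ (TestFn.lin c u).1 x = _ from h1.fderiv]
    simp [pderiv]
  rw [covT, h]
  simp only [covT, TestFn.lin, mul_add, Finset.sum_add_distrib, Finset.mul_sum]
  congr 1
  · exact Finset.sum_congr rfl fun i _ => by ring
  · exact Finset.sum_congr rfl fun i _ => by ring

/-- The matrix of the Schrödinger form on test functions. -/
noncomputable def schrMat {m : ℕ} (A : E3 → E3) (V : E3 → ℝ) (u : Fin m → TestFn) (i j : Fin m) :
    ℂ :=
  (∑ a, ∫ x, conj (covT A a (u i).1 x) * covT A a (u j).1 x) +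
    ∫ x, (V x : ℂ) * (conj ((u i).1 x) * (u j).1 x)

lemma integral_weight_norm_sq_sum {m : ℕ} (w : E3 → ℝ) (f : Fin m → E3 → ℂ)
    (h : ∀ i j, Integrable fun x => (w x : ℂ) * (conj (f i x) * f j x)) (c : Fin m → ℂ) :
    ((∫ x, w x * ‖∑ i, c i * f i x‖ ^ 2 : ℝ) : ℂ) =
      ∑ i, ∑ j, (∫ x, (w x : ℂ) * (conj (f i x) * f j x)) * (conj (c i) * c j) := by
  have e : ∀ x, ((w x * ‖∑ i, c i * f i x‖ ^ 2 : ℝ) : ℂ) =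
      ∑ i, ∑ j, ((w x : ℂ) * (conj (f i x) * f j x)) * (conj (c i) * c j) := fun x => by
    rw [← Complex.normSq_eq_norm_sq, Complex.ofReal_mul, ← Complex.mul_conj, mul_comm (∑ i, _),
      map_sum, Finset.sum_mul_sum, Finset.mul_sum]
    refine Finset.sum_congr rfl fun i _ => ?_
    rw [Finset.mul_sum]
    exact Finset.sum_congr rfl fun j _ => by rw [map_mul]; ring
  rw [← integral_complex_ofReal]
  simp only [e]
  rw [integral_finsetSum _ fun i _ => integrable_finsetSum _ fun j _ => (h i j).mul_const _]
  refine Finset.sum_congr rfl fun i _ => ?_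
  rw [integral_finsetSum _ fun j _ => (h i j).mul_const _]
  exact Finset.sum_congr rfl fun j _ => integral_mul_const _ _

lemma integral_norm_sq_sum {m : ℕ} {f : Fin m → E3 → ℂ} (h : ∀ i, MemLp (f i) 2 volume)
    (c : Fin m → ℂ) : ((∫ x, ‖∑ i, c i * f i x‖ ^ 2 : ℝ) : ℂ) =
      ∑ i, ∑ j, (∫ x, conj (f i x) * f j x) * (conj (c i) * c j) := by
  have := integral_weight_norm_sq_sum (fun _ => 1) f (fun i j => by
    simpa using integrable_conj_mul_of_sq (h i) (h j)) c
  simpa using this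

lemma integrable_pot_mul {V : E3 → ℝ} (hV : LocallyIntegrable V) (u w : TestFn) :
    Integrable fun x => (V x : ℂ) * (conj (u.1 x) * w.1 x) := by
  have hc : HasCompactSupport fun x => conj (u.1 x) * w.1 x := w.2.2.mul_left
  have := LocallyIntegrable.integrable_smul_right_of_hasCompactSupport hV
    ((Complex.continuous_conj.comp u.2.1.continuous).mul w.2.1.continuous) hc
  simpa [Complex.real_smul] using this

lemma Admissible.schrodingerForm_test {A : E3 → E3} {V : E3 → ℝ} (h : Admissible A V) {m : ℕ}
    (u : Fin m → TestFn) (c : Fin m → ℂ) :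
    ((schrodingerForm A V fun x => ∑ i, c i * (u i).1 x : ℝ) : ℂ) =
      ∑ i, ∑ j, schrMat A V u i j * (conj (c i) * c j) := by
  have hA : LocSq A := h.memLp_A
  have e1 : kineticForm A (TestFn.lin c u).1 =
      ∑ a, ∫ x, ‖∑ i, c i * covT A a (u i).1 x‖ ^ 2 := by
    rw [kineticForm_test hA]
    simp only [covT_lin]
  have e2 : schrodingerForm A V (fun x => ∑ i, c i * (u i).1 x) =
      (∑ a, ∫ x, ‖∑ i, c i * covT A a (u i).1 x‖ ^ 2) +
        ∫ x, V x * ‖∑ i, c i * (u i).1 x‖ ^ 2 := by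
    rw [← e1]
    exact congrArg _ (h.potentialForm_test (TestFn.lin c u))
  rw [e2, Complex.ofReal_add, Complex.ofReal_sum, integral_weight_norm_sq_sum V _ fun i j =>
    integrable_pot_mul h.locallyIntegrable_V _ _]
  simp only [integral_norm_sq_sum fun i => hA.memLp_covT _ (u i), schrMat, add_mul,
    Finset.sum_add_distrib, Finset.sum_mul]
  congr 1
  rw [Finset.sum_comm]
  refine Finset.sum_congr rfl fun i _ => ?_
  rw [Finset.sum_comm]

lemma norm_sum_sq_le {m : ℕ} (z : Fin m → ℂ) : ‖∑ i, z i‖ ^ 2 ≤ m * ∑ i, ‖z i‖ ^ 2 := by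
  refine (pow_le_pow_left₀ (norm_nonneg _) (norm_sum_le _ _) 2).trans ?_
  have := sq_sum_le_card_mul_sum_sq (s := Finset.univ) (f := fun i => ‖z i‖)
  simpa using this

lemma tendsto_integral_norm_sq_sum {m : ℕ} {f : Fin m → ℕ → E3 → ℂ}
    (h : ∀ i l, MemLp (f i l) 2 volume)
    (hf : ∀ i, Tendsto (fun l => ∫ x, ‖f i l x‖ ^ 2) atTop (𝓝 0)) (c : Fin m → ℂ) :
    Tendsto (fun l => ∫ x, ‖∑ i, c i * f i l x‖ ^ 2) atTop (𝓝 0) := by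
  have hz : Tendsto (fun l => m * ∑ i, ‖c i‖ ^ 2 * ∫ x, ‖f i l x‖ ^ 2) atTop (𝓝 0) := by
    have := (tendsto_finsetSum Finset.univ fun i _ => (hf i).const_mul (‖c i‖ ^ 2)).const_mul (m : ℝ)
    simpa using this
  refine squeeze_zero (fun l => integral_nonneg fun x => by positivity) (fun l => ?_) hz
  have hi : ∀ i, Integrable fun x => ‖c i‖ ^ 2 * ‖f i l x‖ ^ 2 := fun i =>
    (integrable_norm_sq (h i l)).const_mul _
  simp only [← integral_const_mul]
  rw [← integral_finsetSum _ fun i _ => hi i, ← integral_const_mul]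
  refine integral_mono_of_nonneg (ae_of_all _ fun x => by positivity)
    ((integrable_finsetSum _ fun i _ => hi i).const_mul _) (ae_of_all _ fun x => ?_)
  refine (norm_sum_sq_le _).trans_eq ?_
  simp only [norm_mul, mul_pow]

lemma ApproxSeq.lin {A : E3 → E3} (hA : LocSq A) {m : ℕ} {φ : Fin m → E3 → ℂ}
    (hφ : ∀ i, MemH1A A (φ i)) {u : Fin m → ℕ → TestFn} (hu : ∀ i, ApproxSeq A (φ i) (u i))
    (c : Fin m → ℂ) :
    ApproxSeq A (fun x => ∑ i, c i * φ i x) fun l => TestFn.lin c fun i => u i l := by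
  have e : ∀ l, h1NormSq A (fun x => (TestFn.lin c fun i => u i l).1 x - ∑ i, c i * φ i x) =
      (∫ x, ‖∑ i, c i * ((u i l).1 x - φ i x)‖ ^ 2) +
        ∑ j, ∫ x, ‖∑ i, c i * (covT A j (u i l).1 x - covDeriv A j (φ i) x)‖ ^ 2 := fun l => by
    have e1 : (fun x => (TestFn.lin c fun i => u i l).1 x - ∑ i, c i * φ i x) =
        fun x => ∑ i, c i * ((u i l).1 x - φ i x) := by
      funext x
      simp only [TestFn.lin, mul_sub, Finset.sum_sub_distrib]
    have hd : ∀ i, MemLp (fun x => (u i l).1 x - φ i x) 2 volume := fun i =>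
      ((u i l).memLp 2).sub (hφ i).1
    have hd2 : ∀ j i, MemLp (fun x => covT A j (u i l).1 x - covDeriv A j (φ i) x) 2 volume :=
      fun j i => (hA.memLp_covT j (u i l)).sub (covDeriv_spec (hφ i) j).1
    rw [e1, h1NormSq, kineticForm_eq
      (fun j => memLp_finsetSum _ fun i _ => (hd2 j i).const_mul (c i))
      fun j => hA.isCovDeriv_sum j Finset.univ c hd (hd2 j) fun i => hA.isCovDeriv_sub j
        ((u i l).memLp 2) (hφ i).1 (hA.memLp_covT j (u i l)) (covDeriv_spec (hφ i) j).1
        (hA.isCovDeriv_covT j (u i l)) (covDeriv_spec (hφ i) j).2]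
  simp only [ApproxSeq, e]
  have e0 : (0 : ℝ) = 0 + ∑ j : Fin 3, 0 := by simp
  rw [e0]
  exact (tendsto_integral_norm_sq_sum (fun i l => ((u i l).memLp 2).sub (hφ i).1)
    (fun i => (hu i).tendsto_L2) c).add (tendsto_finsetSum _ fun j _ =>
      tendsto_integral_norm_sq_sum
        (fun i l => (hA.memLp_covT j (u i l)).sub (covDeriv_spec (hφ i) j).1)
        (fun i => (hu i).tendsto_covT hA (hφ i) j) c)

lemma IsFockCore.isNice {η : FockFn} (h : IsFockCore η) : IsNice η := by
  have hb : ∀ n, ∃ R : ℝ, ∀ K i, R < ‖K i‖ → η n K = 0 := fun n => by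
    obtain ⟨R, hR⟩ := (h.hasCompactSupport n).isBounded.subset_closedBall 0
    refine ⟨R, fun K i hi => image_eq_zero_of_notMem_tsupport fun hK => ?_⟩
    have h1 := hR hK
    rw [mem_closedBall_zero_iff] at h1
    have h2 := norm_le_pi_norm K i
    linarith
  choose R hR using hb
  obtain ⟨N, hN⟩ := h.finite
  refine ⟨fun n => (h.continuous n).measurable,
    fun n => (h.hasCompactSupport n).exists_bound_of_continuous (h.continuous n),
    ⟨∑ n ∈ Finset.range N, |R n|, fun n K i hi => ?_⟩, h.symmetric, h.finite⟩
  by_cases hn : n < N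
  · refine hR n K i (lt_of_le_of_lt ?_ hi)
    exact (le_abs_self _).trans (Finset.single_le_sum (f := fun n => |R n|)
      (fun n _ => abs_nonneg _) (Finset.mem_range.2 hn))
  · rw [hN n (not_lt.1 hn)]
    rfl

/-- Lower bounds on test functions extend to the form domain. -/
theorem lower_bound_of_test {A : E3 → E3} {V : E3 → ℝ} (h : Admissible A V) {α E : ℝ}
    (hE : ∀ (m : ℕ) (u : Fin m → TestFn) (η : Fin m → niceFock),
      E * (mform (fun i j => ∫ x, dens (fun i => (u i).1) i j x) η η).re ≤
        matrixForm (Real.sqrt α * (1 / (Real.sqrt 2 * Real.pi))) (schrMat A V u)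
          (dens fun i => (u i).1) η) {e : ℝ} (he : e ∈ frohlichValues A V α) : E ≤ e := by
  obtain ⟨ψ, ⟨m, φ, η, hφ, hη, hψ⟩, hn, rfl⟩ := he
  have hA : LocSq A := h.memLp_A
  let η' : Fin m → niceFock := fun i => ⟨η i, (hη i).isNice⟩
  have hψ' : ψ = tens φ η' := by
    funext n x K
    exact hψ n x K
  choose u hu using fun i => exists_approxSeq hA (hφ i)
  have hL2 : ∀ i, MemLp (φ i) 2 volume := fun i => (hφ i).1
  -- The convergence is established for each coefficient vector separately: combining the
  -- approximating sequences linearly approximates the combined function in `H¹_A`.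
  have hlim : ∀ c : Fin m → ℂ, Tendsto (fun l => ∑ i, ∑ j, schrMat A V (fun i => u i l) i j *
      (conj (c i) * c j)) atTop
      (𝓝 ((schrodingerForm A V fun x => ∑ i, c i * φ i x : ℝ) : ℂ)) := fun c => by
    simp only [← h.schrodingerForm_test]
    refine (Complex.continuous_ofReal.tendsto _).comp ?_
    have hH := memH1A_sum hA Finset.univ c hφ
    have hap := ApproxSeq.lin hA hφ hu c
    have t1 := (hap.tendsto_kinetic hA hH).add (h.tendsto_potT_seq hH hap)
    refine t1.congr fun l => ?_
    rw [← kineticForm_test hA, ← h.potentialForm_test]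
    rfl
  -- `potentialForm` is defined as a limit and has no sesquilinear structure of its own. Its matrix
  -- on the span of the `φ i` is produced here, by polarization, as the limit of the matrices on
  -- test functions.
  obtain ⟨S, hS, hS2⟩ := tendsto_matrix hlim
  have hdi : ∀ i j, Integrable (dens φ i j) := fun i j => integrable_conj_mul_of_sq (hL2 i) (hL2 j)
  have hdt : ∀ l i j, Integrable (dens (fun i => (u i l).1) i j) := fun l i j =>
    integrable_conj_mul_of_sq ((u i l).memLp 2) ((u j l).memLp 2)
  have hρ : ∀ i j, Tendsto (fun l => ∫ x, ‖dens (fun i => (u i l).1) i j x - dens φ i j x‖)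
      atTop (𝓝 0) := fun i j =>
    tendsto_integral_norm_mul_sub (fun l => (u i l).memLp 2) (fun l => (u j l).memLp 2) (hL2 i)
      (hL2 j) (hu i).tendsto_L2 (hu j).tendsto_L2
  have h1 := tendsto_matrixForm (Real.sqrt α * (1 / (Real.sqrt 2 * Real.pi))) hS hdt hdi hρ η'
  have h2 := (tendsto_mform (fun i j => tendsto_integral_of_norm_sub (fun l => hdt l i j)
    (hdi i j) (hρ i j)) η' η').const_mul E
  have h3 := le_of_tendsto_of_tendsto' h2 h1 fun l => hE m (fun i => u i l) η'
  have e1 : (mform (fun i j => ∫ x, dens φ i j x) η' η').re = 1 := by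
    rw [← hn, hψ', normSqState_tens hL2]
    rfl
  rw [e1, mul_one] at h3
  refine h3.trans_eq ?_
  rw [hψ', frohlichForm, electronForm_tens hS2, numberForm_tens hL2, interactionForm_tens hL2,
    matrixForm, ← mul_assoc]
  simp only [← overlap_waveMul]
  rfl


/-! ### Fock space valued functions -/

/-- The Fock space valued function `∑ f i ⊗ η i` of the electron position. -/
noncomputable def vec {m : ℕ} (f : Fin m → E3 → ℂ) (η : Fin m → niceFock) (x : E3) : niceFock :=
  ∑ i, f i x • η i

lemma map_vec {m : ℕ} (T : niceFock →ₗ[ℂ] niceFock) (f : Fin m → E3 → ℂ) (η : Fin m → niceFock)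
    (x : E3) : T (vec f η x) = vec f (fun i => T (η i)) x := by
  simp [vec]

lemma ip_vec {m : ℕ} (f f' : Fin m → E3 → ℂ) (η ζ : Fin m → niceFock) (x : E3) :
    ip (vec f η x) (vec f' ζ x) = ∑ i, ∑ j, conj (f i x) * f' j x * ip (η i) (ζ j) := by
  simp only [vec, map_sum, LinearMap.map_smulₛₗ, LinearMap.sum_apply, LinearMap.smul_apply,
    smul_eq_mul, RingHom.id_apply, Finset.mul_sum]
  rw [Finset.sum_comm]
  exact Finset.sum_congr rfl fun i _ => Finset.sum_congr rfl fun j _ => by ring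

lemma integrable_ip_vec {m : ℕ} {w : E3 → ℂ} {f f' : Fin m → E3 → ℂ}
    (h : ∀ i j, Integrable fun x => w x * (conj (f i x) * f' j x)) (η ζ : Fin m → niceFock) :
    Integrable fun x => w x * ip (vec f η x) (vec f' ζ x) := by
  simp only [ip_vec, Finset.mul_sum, ← mul_assoc]
  refine integrable_finsetSum _ fun i _ => integrable_finsetSum _ fun j _ => ?_
  simpa only [mul_assoc] using (h i j).mul_const (ip (η i) (ζ j))

lemma integral_ip_vec {m : ℕ} {w : E3 → ℂ} {f f' : Fin m → E3 → ℂ}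
    (h : ∀ i j, Integrable fun x => w x * (conj (f i x) * f' j x)) (η ζ : Fin m → niceFock) :
    ∫ x, w x * ip (vec f η x) (vec f' ζ x) =
      mform (fun i j => ∫ x, w x * (conj (f i x) * f' j x)) η ζ := by
  have hi := fun i j => (h i j).mul_const (ip (η i) (ζ j))
  have e : ∀ x, w x * ip (vec f η x) (vec f' ζ x) =
      ∑ i, ∑ j, w x * (conj (f i x) * f' j x) * ip (η i) (ζ j) := fun x => by
    simp only [ip_vec, Finset.mul_sum, mul_assoc]
  simp only [e]
  rw [integral_finsetSum _ fun i _ => integrable_finsetSum _ fun j _ => hi i j, mform_apply]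
  refine Finset.sum_congr rfl fun i _ => ?_
  rw [integral_finsetSum _ fun j _ => hi i j]
  exact Finset.sum_congr rfl fun j _ => integral_mul_const _ _

lemma integrable_nsq_vec {m : ℕ} {w : E3 → ℝ} {f : Fin m → E3 → ℂ}
    (h : ∀ i j, Integrable fun x => (w x : ℂ) * (conj (f i x) * f j x)) (η : Fin m → niceFock) :
    Integrable fun x => w x * nsq (vec f η x) := by
  have := (integrable_ip_vec h η η).re
  refine this.congr (ae_of_all _ fun x => ?_)
  simp [ip_self]

lemma integral_nsq_vec {m : ℕ} {w : E3 → ℝ} {f : Fin m → E3 → ℂ}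
    (h : ∀ i j, Integrable fun x => (w x : ℂ) * (conj (f i x) * f j x)) (η : Fin m → niceFock) :
    ∫ x, w x * nsq (vec f η x) =
      (mform (fun i j => ∫ x, (w x : ℂ) * (conj (f i x) * f j x)) η η).re := by
  rw [← integral_ip_vec h η η]
  have := integral_re (𝕜 := ℂ) (integrable_ip_vec h η η)
  refine Eq.trans ?_ this
  congr 1
  funext x
  simp [ip_self]

lemma integrable_nsq_vec_one {m : ℕ} {f : Fin m → E3 → ℂ} (h : ∀ i, MemLp (f i) 2 volume)
    (η : Fin m → niceFock) : Integrable fun x => nsq (vec f η x) := by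
  have := integrable_nsq_vec (w := fun _ => 1) (f := f)
    (fun i j => by simpa using integrable_conj_mul_of_sq (h i) (h j)) η
  simpa using this

lemma integral_nsq_vec_one {m : ℕ} {f : Fin m → E3 → ℂ} (h : ∀ i, MemLp (f i) 2 volume)
    (η : Fin m → niceFock) :
    ∫ x, nsq (vec f η x) = (mform (fun i j => ∫ x, conj (f i x) * f j x) η η).re := by
  have := integral_nsq_vec (w := fun _ => 1) (f := f)
    (fun i j => by simpa using integrable_conj_mul_of_sq (h i) (h j)) η
  simpa using this

/-! ### Interaction and number densities as functions of the electron position -/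

/-- Momentum weights with at most a Coulomb singularity. -/
structure IsWeight (q : E3 → ℂ) : Prop where
  meas : Measurable q
  bdd : ∃ C : ℝ, ∀ k, ‖q k‖ ≤ C * ‖k‖⁻¹

lemma IsWeight.integrable_mul {q h : E3 → ℂ} (hq : IsWeight q) (hh : IsMode h) :
    Integrable fun k => q k * h k := by
  obtain ⟨C, hC⟩ := hq.bdd
  refine Integrable.mono' (hh.integrable_inv_mul.norm.const_mul C)
    (hq.meas.mul hh.meas).aestronglyMeasurable (ae_of_all _ fun k => ?_)
  rw [norm_mul, norm_mul, Complex.norm_real, Real.norm_of_nonneg (by positivity), ← mul_assoc]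
  exact mul_le_mul_of_nonneg_right (hC k) (norm_nonneg _)

/-- The plane wave `e^{ikx}`. -/
noncomputable def wave (k x : E3) : ℂ := Complex.exp (Complex.I * (inner ℝ k x : ℝ))

lemma norm_wave (k x : E3) : ‖wave k x‖ = 1 := norm_planeWave _

lemma continuous_wave : Continuous fun p : E3 × E3 => wave p.2 p.1 := by
  unfold wave
  fun_prop

lemma continuous_wave_left (x : E3) : Continuous fun k : E3 => wave k x := by
  unfold wave
  fun_prop

lemma continuous_wave_right (k : E3) : Continuous fun x : E3 => wave k x := by
  unfold wave
  fun_prop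

/-- The interaction density `∫ q(k) e^{ikx} ⟨Φ(x), a(k) Ψ(x)⟩ dk`. -/
noncomputable def inter {m : ℕ} (q : E3 → ℂ) (f f' : Fin m → E3 → ℂ) (η : Fin m → niceFock)
    (x : E3) : ℂ :=
  ∫ k, q k * wave k x * ip (vec f η x) (annK k (vec f' η x))

section inter

variable {m : ℕ} {q : E3 → ℂ} {f f' : Fin m → E3 → ℂ}

lemma isMode_wave_mul {h : E3 → ℂ} (hh : IsMode h) (x : E3) : IsMode fun k => wave k x * h k := by
  have := hh.bdd_mul (continuous_wave_left x).measurable ⟨1, fun k => (norm_wave k x).le⟩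
  simpa only [mul_comm] using this

lemma integrable_inter_section (hq : IsWeight q) (f f' : Fin m → E3 → ℂ) (η : Fin m → niceFock)
    (x : E3) : Integrable fun k => q k * wave k x * ip (vec f η x) (annK k (vec f' η x)) := by
  have := hq.integrable_mul (isMode_wave_mul (isMode_ip_annK (vec f η x) (vec f' η x)) x)
  simpa only [mul_assoc] using this

lemma inter_add {q' : E3 → ℂ} (hq : IsWeight q) (hq' : IsWeight q') (η : Fin m → niceFock)
    (x : E3) : inter (fun k => q k + q' k) f f' η x = inter q f f' η x + inter q' f f' η x := by
  simp only [inter, add_mul]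
  exact integral_add (integrable_inter_section hq f f' η x) (integrable_inter_section hq' f f' η x)

lemma inter_expand (η : Fin m → niceFock) (x k : E3) :
    q k * wave k x * ip (vec f η x) (annK k (vec f' η x)) =
      ∑ i, ∑ j, wave k x * ((conj (f i x) * f' j x) * (q k * ip (η i) (annK k (η j)))) := by
  rw [map_vec, ip_vec, Finset.mul_sum]
  refine Finset.sum_congr rfl fun i _ => ?_
  rw [Finset.mul_sum]
  exact Finset.sum_congr rfl fun j _ => by ring

lemma integrable_wave_prod {a b : E3 → ℂ} (ha : Integrable a) (hb : Integrable b) :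
    Integrable (fun p : E3 × E3 => wave p.2 p.1 * (a p.1 * b p.2)) (volume.prod volume) :=
  (ha.mul_prod hb).bdd_mul (c := 1) continuous_wave.aestronglyMeasurable
    (ae_of_all _ fun _ => (norm_wave _ _).le)

lemma integrable_inter_prod (hq : IsWeight q) (hf : ∀ i j, Integrable fun x => conj (f i x) * f' j x)
    (η : Fin m → niceFock) : Integrable (fun p : E3 × E3 =>
      q p.2 * wave p.2 p.1 * ip (vec f η p.1) (annK p.2 (vec f' η p.1))) (volume.prod volume) := by
  simp only [inter_expand]
  exact integrable_finsetSum _ fun i _ => integrable_finsetSum _ fun j _ =>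
    integrable_wave_prod (a := fun x => conj (f i x) * f' j x)
      (b := fun k => q k * ip (η i) (annK k (η j))) (hf i j)
      (hq.integrable_mul (isMode_ip_annK _ _))

lemma integrable_inter (hq : IsWeight q) (hf : ∀ i j, Integrable fun x => conj (f i x) * f' j x)
    (η : Fin m → niceFock) : Integrable (inter q f f' η) :=
  (integrable_inter_prod hq hf η).integral_prod_left

/-- By Fubini the electron position is integrated first, which replaces plane waves by Fourier
transforms of the products `conj (f i) * f' j`. -/
lemma integral_inter (hq : IsWeight q) (hf : ∀ i j, Integrable fun x => conj (f i x) * f' j x)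
    (η : Fin m → niceFock) : ∫ x, inter q f f' η x = ∑ i, ∑ j, ∫ k, q k *
      (waveFT (fun x => conj (f i x) * f' j x) k * ip (η i) (annK k (η j))) := by
  have hi := fun i j => integrable_wave_prod (hf i j)
    (hq.integrable_mul (isMode_ip_annK (η i) (η j)))
  simp only [inter]
  rw [← integral_prod _ (integrable_inter_prod hq hf η)]
  simp only [inter_expand]
  rw [integral_finsetSum _ fun i _ => integrable_finsetSum _ fun j _ => hi i j]
  refine Finset.sum_congr rfl fun i _ => ?_
  rw [integral_finsetSum _ fun j _ => hi i j]
  refine Finset.sum_congr rfl fun j _ => ?_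
  rw [integral_prod_symm _ (hi i j)]
  congr 1
  funext k
  have e : ∀ x, wave k x * (conj (f i x) * f' j x * (q k * ip (η i) (annK k (η j)))) =
      (Complex.exp (Complex.I * (inner ℝ k x : ℝ)) * (conj (f i x) * f' j x)) *
        (q k * ip (η i) (annK k (η j))) := fun x => by
    rw [wave]
    ring
  simp only [e]
  rw [integral_mul_const, waveFT]
  ring

end inter

/-- The number density `∫_S ‖a(k) Ψ(x)‖² dk`. -/
noncomputable def numDens {m : ℕ} (S : Set E3) (f : Fin m → E3 → ℂ) (η : Fin m → niceFock)
    (x : E3) : ℝ :=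
  ∫ k in S, nsq (annK k (vec f η x))

lemma numDens_expand {m : ℕ} (f : Fin m → E3 → ℂ) (η : Fin m → niceFock) (x k : E3) :
    ((nsq (annK k (vec f η x)) : ℝ) : ℂ) = ∑ i, ∑ j, (conj (f i x) * f j x) *
      ip (annK k (η i)) (annK k (η j)) := by
  rw [← ip_self, map_vec, ip_vec]

lemma integrable_num_prod {m : ℕ} {f : Fin m → E3 → ℂ} (hf : ∀ i, MemLp (f i) 2 volume)
    (η : Fin m → niceFock) :
    Integrable (fun p : E3 × E3 => nsq (annK p.2 (vec f η p.1))) (volume.prod volume) := by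
  have h : Integrable (fun p : E3 × E3 => ∑ i, ∑ j, (conj (f i p.1) * f j p.1) *
      ip (annK p.2 (η i)) (annK p.2 (η j))) (volume.prod volume) :=
    integrable_finsetSum _ fun i _ => integrable_finsetSum _ fun j _ =>
      (integrable_conj_mul_of_sq (hf i) (hf j)).mul_prod (isMode_ip_annK_annK _ _).integrable
  refine h.re.congr (ae_of_all _ fun p => ?_)
  simp only [← numDens_expand]
  simp

lemma integrable_numDens {m : ℕ} {f : Fin m → E3 → ℂ} (hf : ∀ i, MemLp (f i) 2 volume)
    (η : Fin m → niceFock) (S : Set E3) : Integrable (numDens S f η) := by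
  have h : Integrable (fun p : E3 × E3 => nsq (annK p.2 (vec f η p.1)))
      (volume.prod (volume.restrict S)) := by
    have := (integrable_num_prod hf η).restrict (s := Set.univ ×ˢ S)
    rwa [← Measure.prod_restrict, Measure.restrict_univ] at this
  exact h.integral_prod_left

lemma integral_numDens_univ {m : ℕ} {f : Fin m → E3 → ℂ} (hf : ∀ i, MemLp (f i) 2 volume)
    (η : Fin m → niceFock) : ∫ x, numDens Set.univ f η x =
      ∫ k, (mform (fun i j => ∫ x, dens f i j x) (fun i => annK k (η i))
        fun i => annK k (η i)).re := by
  simp only [numDens, Measure.restrict_univ]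
  rw [integral_integral_swap (f := fun x k => nsq (annK k (vec f η x))) (integrable_num_prod hf η)]
  congr 1
  funext k
  simp only [map_vec]
  rw [integral_nsq_vec_one hf]
  rfl

lemma numDens_union {m : ℕ} (f : Fin m → E3 → ℂ) (η : Fin m → niceFock) (x : E3) {S T : Set E3}
    (hT : MeasurableSet T) (h : Disjoint S T) :
    numDens (S ∪ T) f η x = numDens S f η x + numDens T f η x :=
  setIntegral_union h hT (integrable_nsq_annK _).integrableOn (integrable_nsq_annK _).integrableOn

lemma numDens_mono {m : ℕ} (f : Fin m → E3 → ℂ) (η : Fin m → niceFock) (x : E3) {S T : Set E3}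
    (h : S ⊆ T) : numDens S f η x ≤ numDens T f η x :=
  setIntegral_mono_set (integrable_nsq_annK _).integrableOn
    (ae_of_all _ fun _ => nsq_nonneg _) (LE.le.eventuallyLE h)


/-! ### Large and small momenta -/

lemma hasFDerivAt_wave (k x : E3) :
    HasFDerivAt (fun x => wave k x)
      (wave k x • (Complex.I • (Complex.ofRealCLM.comp (innerSL ℝ k)))) x := by
  have h1 : HasFDerivAt (fun x : E3 => ((inner ℝ k x : ℝ) : ℂ))
      (Complex.ofRealCLM.comp (innerSL ℝ k)) x :=
    (Complex.ofRealCLM.comp (innerSL ℝ k)).hasFDerivAt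
  exact (h1.const_mul Complex.I).cexp

lemma fderiv_wave (k x : E3) (a : Fin 3) :
    fderiv ℝ (fun x => wave k x) x (EuclideanSpace.single a 1) =
      Complex.I * (k a : ℂ) * wave k x := by
  rw [(hasFDerivAt_wave k x).fderiv]
  simp [EuclideanSpace.inner_single_right]
  ring

/-- The product `conj u * w` of test functions. -/
def TestFn.conjMul (u w : TestFn) : TestFn :=
  ⟨fun x => conj (u.1 x) * w.1 x, (Complex.conjCLE.contDiff.comp u.2.1).mul w.2.1,
    w.2.2.mul_left⟩

lemma pderiv_conjMul (a : Fin 3) (u w : TestFn) (x : E3) :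
    pderiv a (u.conjMul w).1 x =
      conj (u.1 x) * pderiv a w.1 x + conj (pderiv a u.1 x) * w.1 x := by
  have h1 : HasFDerivAt (fun x => conj (u.1 x))
      ((Complex.conjCLE : ℂ →L[ℝ] ℂ).comp (fderiv ℝ u.1 x)) x :=
    (Complex.conjCLE : ℂ →L[ℝ] ℂ).hasFDerivAt.comp x (u.differentiable x).hasFDerivAt
  have h2 := h1.mul (w.differentiable x).hasFDerivAt
  rw [pderiv, show fderiv ℝ (u.conjMul w).1 x = _ from h2.fderiv]
  simp [pderiv]
  ring

/-- This is the commutator of `D_A` with the plane wave. The derivative of `conj u * w` splits into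
covariant derivatives of the two factors, and the vector potential cancels because it is real. -/
lemma coord_mul_waveFT (A : E3 → E3) (hA : LocSq A) (a : Fin 3) (u w : TestFn) (k : E3) :
    (k a : ℂ) * waveFT (fun x => conj (u.1 x) * w.1 x) k =
      waveFT (fun x => conj (covT A a u.1 x) * w.1 x) k -
        waveFT (fun x => conj (u.1 x) * covT A a w.1 x) k := by
  have i1 := integrable_conj_mul_of_sq (hA.memLp_covT a u) (w.memLp 2)
  have i2 := integrable_conj_mul_of_sq (u.memLp 2) (hA.memLp_covT a w)
  rw [waveFT_sub i1 i2]
  have e : ∀ x, conj (covT A a u.1 x) * w.1 x - conj (u.1 x) * covT A a w.1 x =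
      Complex.I * pderiv a (u.conjMul w).1 x := fun x => by
    rw [pderiv_conjMul]
    simp only [covT, map_add, map_mul, map_neg, Complex.conj_I, Complex.conj_ofReal]
    ring
  simp only [e]
  have hb : ∀ f : TestFn, Integrable fun x => wave k x * f.1 x := fun f =>
    integrable_planeWave_mul f.integrable k
  have key := integral_mul_fderiv_eq_neg_fderiv_mul_of_integrable (μ := (volume : Measure E3))
    (f := fun x => wave k x) (g := (u.conjMul w).1) (v := EuclideanSpace.single a 1)
    (by
      simp only [fderiv_wave, mul_assoc]
      exact ((hb _).const_mul _).const_mul _)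
    (hb ((u.conjMul w).pd a)) (hb _) (fun x _ => (hasFDerivAt_wave k x).differentiableAt)
    (fun x _ => (u.conjMul w).differentiable x)
  simp only [fderiv_wave, mul_assoc] at key
  rw [integral_const_mul, integral_const_mul] at key
  have e2 : waveFT (fun x => Complex.I * pderiv a (u.conjMul w).1 x) k =
      Complex.I * ∫ x, wave k x * pderiv a (u.conjMul w).1 x := by
    rw [waveFT, ← integral_const_mul]
    congr 1
    funext x
    rw [wave]
    ring
  have e3 : waveFT (fun x => conj (u.1 x) * w.1 x) k = ∫ x, wave k x * (u.conjMul w).1 x := rfl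
  have key' : ∫ x, wave k x * pderiv a (u.conjMul w).1 x =
      -(Complex.I * ((k a : ℂ) * ∫ x, wave k x * (u.conjMul w).1 x)) := key
  rw [e2, e3, key']
  linear_combination ((k a : ℂ) * ∫ x, wave k x * (u.conjMul w).1 x) * Complex.I_sq

/-- The weight `1_S(k) / |k|`. -/
noncomputable def coulombWeight (S : Set E3) (k : E3) : ℂ :=
  S.indicator (fun k => ((‖k‖⁻¹ : ℝ) : ℂ)) k

/-- The weight `1_S(k) k_a / |k|³`. -/
noncomputable def dipoleWeight (S : Set E3) (a : Fin 3) (k : E3) : ℂ :=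
  S.indicator (fun k => ((k a * ‖k‖⁻¹ ^ 3 : ℝ) : ℂ)) k

lemma norm_coulombWeight_le (S : Set E3) (k : E3) : ‖coulombWeight S k‖ ≤ 1 * ‖k‖⁻¹ := by
  by_cases hk : k ∈ S
  · rw [coulombWeight, Set.indicator_of_mem hk, Complex.norm_real, one_mul,
      Real.norm_of_nonneg (by positivity)]
  · rw [coulombWeight, Set.indicator_of_notMem hk, norm_zero]
    positivity

lemma isWeight_coulombWeight {S : Set E3} (hS : MeasurableSet S) : IsWeight (coulombWeight S) :=
  ⟨(Complex.measurable_ofReal.comp measurable_norm.inv).indicator hS,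
    1, norm_coulombWeight_le S⟩

lemma measurable_dipoleWeight {S : Set E3} (hS : MeasurableSet S) (a : Fin 3) :
    Measurable (dipoleWeight S a) := by
  have h : Measurable fun k : E3 => k a * ‖k‖⁻¹ ^ 3 := by fun_prop
  exact (Complex.measurable_ofReal.comp h).indicator hS

lemma norm_dipole_le (a : Fin 3) (k : E3) : |k a * ‖k‖⁻¹ ^ 3| ≤ ‖k‖⁻¹ ^ 2 := by
  rw [abs_mul, abs_pow, abs_inv, abs_norm]
  have h := abs_coord_le_norm k a
  by_cases hk : ‖k‖ = 0
  · simp [hk]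
  · have h0 : 0 < ‖k‖ := lt_of_le_of_ne (norm_nonneg k) (Ne.symm hk)
    calc |k a| * ‖k‖⁻¹ ^ 3 ≤ ‖k‖ * ‖k‖⁻¹ ^ 3 := by gcongr
      _ = ‖k‖⁻¹ ^ 2 := by field_simp

lemma norm_dipoleWeight_le {S : Set E3} {r : ℝ} (hr : 0 < r) (hS : ∀ k ∈ S, r ≤ ‖k‖)
    (a : Fin 3) (k : E3) : ‖dipoleWeight S a k‖ ≤ r⁻¹ * ‖k‖⁻¹ := by
  by_cases hk : k ∈ S
  · rw [dipoleWeight, Set.indicator_of_mem hk, Complex.norm_real]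
    refine (norm_dipole_le a k).trans ?_
    rw [sq]
    have h1 := inv_anti₀ hr (hS k hk)
    gcongr
  · rw [dipoleWeight, Set.indicator_of_notMem hk, norm_zero]
    positivity

lemma isWeight_dipoleWeight {S : Set E3} (hSm : MeasurableSet S) {r : ℝ} (hr : 0 < r)
    (hS : ∀ k ∈ S, r ≤ ‖k‖) (a : Fin 3) : IsWeight (dipoleWeight S a) :=
  ⟨measurable_dipoleWeight hSm a, _, norm_dipoleWeight_le hr hS a⟩

/-- One power of `k` is split off for the commutator. The remaining weights decay like `|k|⁻²` and
are square integrable at infinity, which `1 / |k|` is not. -/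
lemma sum_dipoleWeight {S : Set E3} {r : ℝ} (hr : 0 < r) (hS : ∀ k ∈ S, r ≤ ‖k‖) (k : E3) :
    ∑ a, dipoleWeight S a k * (k a : ℂ) = coulombWeight S k := by
  by_cases hk : k ∈ S
  · simp only [dipoleWeight, coulombWeight, Set.indicator_of_mem hk]
    have h0 : 0 < ‖k‖ := hr.trans_le (hS k hk)
    have h1 : ∑ a : Fin 3, k a ^ 2 = ‖k‖ ^ 2 := by
      rw [EuclideanSpace.norm_sq_eq]
      simp
    have h2 : ∑ a : Fin 3, k a * ‖k‖⁻¹ ^ 3 * k a = ‖k‖⁻¹ := by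
      calc ∑ a : Fin 3, k a * ‖k‖⁻¹ ^ 3 * k a = (∑ a : Fin 3, k a ^ 2) * ‖k‖⁻¹ ^ 3 := by
            rw [Finset.sum_mul]
            exact Finset.sum_congr rfl fun a _ => by ring
        _ = ‖k‖⁻¹ := by
            rw [h1]
            field_simp
    have h3 := congrArg (fun t : ℝ => (t : ℂ)) h2
    push_cast at h3 ⊢
    exact h3
  · simp only [dipoleWeight, coulombWeight, Set.indicator_of_notMem hk, zero_mul,
      Finset.sum_const_zero]

/-- Integration by parts in the interaction with large momenta. -/
lemma integral_inter_coulomb {A : E3 → E3} (hA : LocSq A) {S : Set E3} (hSm : MeasurableSet S)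
    {r : ℝ} (hr : 0 < r) (hS : ∀ k ∈ S, r ≤ ‖k‖) {m : ℕ} (u : Fin m → TestFn)
    (η : Fin m → niceFock) :
    ∫ x, inter (coulombWeight S) (fun i => (u i).1) (fun i => (u i).1) η x =
      ∑ a, ((∫ x, inter (dipoleWeight S a) (fun i => covT A a (u i).1) (fun i => (u i).1) η x) -
        ∫ x, inter (dipoleWeight S a) (fun i => (u i).1) (fun i => covT A a (u i).1) η x) := by
  have hw := isWeight_dipoleWeight hSm hr hS
  have i1 := fun a i j => integrable_conj_mul_of_sq (hA.memLp_covT a (u i)) ((u j).memLp 2)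
  have i2 := fun a i j => integrable_conj_mul_of_sq ((u i).memLp 2) (hA.memLp_covT a (u j))
  have i0 := fun i j => integrable_conj_mul_of_sq ((u i).memLp 2) ((u j).memLp 2)
  rw [integral_inter (isWeight_coulombWeight hSm) i0]
  simp only [integral_inter (hw _) (i1 _), integral_inter (hw _) (i2 _), ← Finset.sum_sub_distrib]
  rw [Finset.sum_comm]
  conv_rhs => rw [Finset.sum_comm]
  rw [Finset.sum_comm]
  refine Finset.sum_congr rfl fun i _ => ?_
  rw [Finset.sum_comm]
  refine Finset.sum_congr rfl fun j _ => ?_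
  have hm := isMode_ip_annK (η i) (η j)
  have hint : ∀ (a : Fin 3) (ρ : E3 → ℂ), Integrable ρ → Integrable fun k =>
      dipoleWeight S a k * (waveFT ρ k * ip (η i) (annK k (η j))) := fun a ρ hρ =>
    (hw a).integrable_mul (by
      have := hm.bdd_mul (continuous_waveFT hρ).measurable ⟨_, norm_waveFT_le ρ⟩
      simpa only [mul_comm] using this)
  simp only [← integral_sub (hint _ _ (i1 _ i j)) (hint _ _ (i2 _ i j))]
  have hint2 : ∀ a, Integrable fun k => dipoleWeight S a k *
      (waveFT (fun x => conj (covT A a (u i).1 x) * (u j).1 x) k * ip (η i) (annK k (η j))) -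
        dipoleWeight S a k * (waveFT (fun x => conj ((u i).1 x) * covT A a (u j).1 x) k *
          ip (η i) (annK k (η j))) := fun a => (hint a _ (i1 a i j)).sub (hint a _ (i2 a i j))
  rw [← integral_finsetSum _ fun a _ => hint2 a]
  congr 1
  funext k
  rw [← sum_dipoleWeight hr hS k, Finset.sum_mul]
  refine Finset.sum_congr rfl fun a _ => ?_
  have := coord_mul_waveFT A hA a (u i) (u j) k
  linear_combination (dipoleWeight S a k * ip (η i) (annK k (η j))) * this

/-- The one-phonon function of the interaction with weight `q` at the point `x`. -/
noncomputable def modeAt (q : E3 → ℂ) (x k : E3) : ℂ := conj (q k * wave k x)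

lemma isMode_modeAt {q : E3 → ℂ} (hq : IsMode q) (x : E3) : IsMode (modeAt q x) := by
  have := (hq.bdd_mul (continuous_wave_left x).measurable ⟨1, fun k => (norm_wave k x).le⟩).conj
  exact this

/-- For a bounded weight of bounded support the momentum integral is an honest annihilation
operator, whose one-phonon function depends on `x` only through its phase. -/
lemma inter_eq_ip {q : E3 → ℂ} (hq : IsMode q) {m : ℕ} (f f' : Fin m → E3 → ℂ)
    (η : Fin m → niceFock) (x : E3) :
    inter q f f' η x = ip (vec f η x) (ann _ (isMode_modeAt hq x) (vec f' η x)) := by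
  rw [ip_ann_eq_integral, inter]
  simp only [modeAt, Complex.conj_conj]

lemma integral_norm_sq_modeAt (q : E3 → ℂ) (x : E3) :
    ∫ k, ‖modeAt q x k‖ ^ 2 = ∫ k, ‖q k‖ ^ 2 := by
  simp only [modeAt, RCLike.norm_conj, norm_mul, norm_wave, mul_one]

lemma isMode_dipoleWeight {S : Set E3} (hSm : MeasurableSet S) {r R : ℝ} (hr : 0 < r)
    (hS : ∀ k ∈ S, r ≤ ‖k‖) (hR : ∀ k ∈ S, ‖k‖ ≤ R) (a : Fin 3) : IsMode (dipoleWeight S a) := by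
  refine ⟨measurable_dipoleWeight hSm a, ⟨r⁻¹ * r⁻¹, fun k => ?_⟩, ⟨R, fun k hk => ?_⟩⟩
  · by_cases hk : k ∈ S
    · refine (norm_dipoleWeight_le hr hS a k).trans ?_
      have h1 := inv_anti₀ hr (hS k hk)
      gcongr
    · rw [dipoleWeight, Set.indicator_of_notMem hk, norm_zero]
      positivity
  · exact Set.indicator_of_notMem (fun h => absurd (hR k h) (not_le.2 hk)) _

lemma sum_integral_dipole_le {S : Set E3} (hSm : MeasurableSet S) {r R : ℝ} (hr : 0 < r)
    (hS : ∀ k ∈ S, r ≤ ‖k‖) (hR : ∀ k ∈ S, ‖k‖ ≤ R) :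
    ∑ a, ∫ k, ‖dipoleWeight S a k‖ ^ 2 ≤ sphereArea * r⁻¹ := by
  rw [← integral_finsetSum _ fun a _ => (isMode_dipoleWeight hSm hr hS hR a).integrable_norm_sq]
  refine le_trans (le_of_eq ?_) (setIntegral_inv_pow_four_le hr hS)
  rw [← integral_indicator hSm]
  congr 1
  funext k
  by_cases hk : k ∈ S
  · simp only [dipoleWeight, Set.indicator_of_mem hk, Complex.norm_real, Real.norm_eq_abs, sq_abs]
    have h0 : 0 < ‖k‖ := hr.trans_le (hS k hk)
    have h1 : ∑ a : Fin 3, k a ^ 2 = ‖k‖ ^ 2 := by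
      rw [EuclideanSpace.norm_sq_eq]
      simp
    calc ∑ a : Fin 3, (k a * ‖k‖⁻¹ ^ 3) ^ 2 = (∑ a : Fin 3, k a ^ 2) * ‖k‖⁻¹ ^ 6 := by
          rw [Finset.sum_mul]
          exact Finset.sum_congr rfl fun a _ => by ring
      _ = (‖k‖ ^ 4)⁻¹ := by
          rw [h1]
          field_simp
  · simp [dipoleWeight, Set.indicator_of_notMem hk]

/-- The second term on the right is `⟨a†(F) Ψ, Φ⟩`, and commuting gives `‖a†(F) Ψ‖² = ‖a(F) Ψ‖² +
‖F‖² ‖Ψ‖²`. This explains the factor `2` in front of the number integral and the single `nsq Ψ`.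
Each term uses half of `s ‖Φ‖²`, where `Φ` will be a component of `D_A Ψ`. -/
lemma uv_young {g s : ℝ} (hg : 0 < g) (hs : 0 < s) {F : E3 → ℂ} (hF : IsMode F)
    {S : Set E3} (hSm : MeasurableSet S) (hFS : ∀ k, k ∉ S → F k = 0) (Φ Ψ : niceFock) :
    -(s * nsq Φ) - 2 * g ^ 2 / s * (∫ k, ‖F k‖ ^ 2) * (2 * (∫ k in S, nsq (annK k Ψ)) + nsq Ψ) ≤
      2 * g * (ip Φ (ann F hF Ψ) - ip Ψ (ann F hF Φ)).re := by
  have h1 := young' g Φ (ann F hF Ψ) (t := s / (2 * g ^ 2)) (by positivity)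
  have h2 := young' g (cre F hF Ψ) Φ (t := 2 / s) (by positivity)
  have h3 := nsq_ann_le hF hSm hFS Ψ
  have h4 := nsq_cre hF Ψ
  rw [ip_cre] at h2
  rw [Complex.re_ofReal_mul, Complex.norm_real, Real.norm_of_nonneg hg.le] at h1 h2
  have h5 := neg_abs_le (g * (ip Φ (ann F hF Ψ)).re)
  have h6 := le_abs_self (g * (ip Ψ (ann F hF Φ)).re)
  have e1 : s / (2 * g ^ 2) * (g ^ 2 * nsq Φ) = s / 2 * nsq Φ := by field_simp
  have e2 : (s / (2 * g ^ 2))⁻¹ * nsq (ann F hF Ψ) = 2 * g ^ 2 / s * nsq (ann F hF Ψ) := by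
    rw [inv_div]
  have e3 : 2 / s * (g ^ 2 * nsq (cre F hF Ψ)) = 2 * g ^ 2 / s * nsq (cre F hF Ψ) := by ring
  have e4 : (2 / s)⁻¹ * nsq Φ = s / 2 * nsq Φ := by rw [inv_div]
  rw [e1, e2] at h1
  rw [e3, e4, h4] at h2
  rw [Complex.sub_re]
  have h7 := mul_le_mul_of_nonneg_left h3 (by positivity : 0 ≤ 2 * g ^ 2 / s)
  generalize 2 * g ^ 2 / s = c at *
  generalize ∫ k, ‖F k‖ ^ 2 = f at *
  generalize ∫ k in S, nsq (annK k Ψ) = N at *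
  generalize nsq (ann F hF Ψ) = p at *
  nlinarith

/-- By `hcr` the coefficient of `2 N + n` is at most one half, so exactly `N` and `n / 2` are spent
besides the kinetic term. -/
lemma real_sum_uv {x : Fin 3 → ℝ} {s c A r N n : ℝ} (κ f : Fin 3 → ℝ)
    (h : ∀ a, -(s * κ a) - c * f a * (2 * N + n) ≤ x a) (hf : ∑ a, f a ≤ A * r⁻¹)
    (hc : 0 ≤ c) (hN : 0 ≤ N) (hn : 0 ≤ n) (hcr : 2 * (c * (A * r⁻¹)) ≤ 1) :
    -(s * ∑ a, κ a) - N - n / 2 ≤ ∑ a, x a := by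
  have h1 := Finset.sum_le_sum fun (a : Fin 3) (_ : a ∈ Finset.univ) => h a
  rw [Finset.sum_sub_distrib, ← Finset.sum_mul, ← Finset.mul_sum, Finset.sum_neg_distrib,
    ← Finset.mul_sum] at h1
  have h2 : c * (∑ a, f a) * (2 * N + n) ≤ 1 / 2 * (2 * N + n) := by
    refine mul_le_mul_of_nonneg_right ?_ (by positivity)
    have := mul_le_mul_of_nonneg_left hf hc
    linarith
  linarith

/-- The contribution of large momenta. -/
lemma uv_bound {A : E3 → E3} (hA : LocSq A) {g s r R : ℝ} (hg : 0 < g) (hs : 0 < s) (hr : 0 < r)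
    (hsr : 4 * g ^ 2 * sphereArea ≤ s * r) {S : Set E3} (hSm : MeasurableSet S)
    (hS : ∀ k ∈ S, r ≤ ‖k‖) (hR : ∀ k ∈ S, ‖k‖ ≤ R) {m : ℕ} (u : Fin m → TestFn)
    (η : Fin m → niceFock) :
    -(s * ∑ a, ∫ x, nsq (vec (fun i => covT A a (u i).1) η x)) -
        (∫ x, numDens S (fun i => (u i).1) η x) - (∫ x, nsq (vec (fun i => (u i).1) η x)) / 2 ≤
      2 * g * (∫ x, inter (coulombWeight S) (fun i => (u i).1) (fun i => (u i).1) η x).re := by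
  have hw := isWeight_dipoleWeight hSm hr hS
  have hmd := isMode_dipoleWeight hSm hr hS hR
  have i1 := fun a => integrable_inter (hw a)
    (fun i j => integrable_conj_mul_of_sq (hA.memLp_covT a (u i)) ((u j).memLp 2)) η
  have i2 := fun a => integrable_inter (hw a)
    (fun i j => integrable_conj_mul_of_sq ((u i).memLp 2) (hA.memLp_covT a (u j))) η
  -- This inequality determines the ultraviolet cutoff: `r` has to be of order `g² / s`.
  have hcr : 2 * (2 * g ^ 2 / s * (sphereArea * r⁻¹)) ≤ 1 := by
    rw [show 2 * (2 * g ^ 2 / s * (sphereArea * r⁻¹)) = 4 * g ^ 2 * sphereArea / (s * r) by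
      field_simp; ring, div_le_one (by positivity)]
    exact hsr
  rw [integral_inter_coulomb hA hSm hr hS]
  simp only [← integral_sub (i1 _) (i2 _)]
  have i0 : ∀ a, Integrable fun x =>
      inter (dipoleWeight S a) (fun i => covT A a (u i).1) (fun i => (u i).1) η x -
        inter (dipoleWeight S a) (fun i => (u i).1) (fun i => covT A a (u i).1) η x := fun a =>
    (i1 a).sub (i2 a)
  rw [← integral_finsetSum _ fun a _ => i0 a]
  have i3 : Integrable fun x => ∑ a,
      (inter (dipoleWeight S a) (fun i => covT A a (u i).1) (fun i => (u i).1) η x -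
        inter (dipoleWeight S a) (fun i => (u i).1) (fun i => covT A a (u i).1) η x) :=
    integrable_finsetSum _ fun a _ => i0 a
  have e1 := integral_re (𝕜 := ℂ) i3
  rw [show (∫ x, ∑ a, (inter (dipoleWeight S a) (fun i => covT A a (u i).1) (fun i => (u i).1) η x -
        inter (dipoleWeight S a) (fun i => (u i).1) (fun i => covT A a (u i).1) η x)).re = _
      from e1.symm, ← integral_const_mul]
  have j1 := fun a => integrable_nsq_vec_one (fun i => hA.memLp_covT a (u i)) η
  have j2 := integrable_numDens (fun i => (u i).memLp 2) η S
  have j3 := integrable_nsq_vec_one (fun i => (u i).memLp 2) η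
  rw [← integral_finsetSum _ fun a _ => j1 a, ← integral_const_mul, ← integral_neg,
    ← integral_div]
  have j4 : Integrable fun x => -(s * ∑ a, nsq (vec (fun i => covT A a (u i).1) η x)) :=
    ((integrable_finsetSum _ fun a _ => j1 a).const_mul s).neg
  have j5 : Integrable fun x => -(s * ∑ a, nsq (vec (fun i => covT A a (u i).1) η x)) -
      numDens S (fun i => (u i).1) η x := j4.sub j2
  rw [← integral_sub j4 j2, ← integral_sub j5 (j3.div_const 2)]
  refine integral_mono (j5.sub (j3.div_const 2)) (i3.re.const_mul _) fun x => ?_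
  have h := fun a => uv_young hg hs (isMode_modeAt (hmd a) x) hSm (fun k hk => by
    simp [modeAt, dipoleWeight, Set.indicator_of_notMem hk]) (vec (fun i => covT A a (u i).1) η x)
      (vec (fun i => (u i).1) η x)
  simp only [integral_norm_sq_modeAt] at h
  have h2 := real_sum_uv _ _ h (sum_integral_dipole_le hSm hr hS hR) (by positivity)
    (setIntegral_nonneg_ae hSm (ae_of_all _ fun k _ => nsq_nonneg _)) (nsq_nonneg _) hcr
  refine h2.trans_eq ?_
  change _ = 2 * g * Complex.re _
  rw [Complex.re_sum, Finset.mul_sum]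
  exact Finset.sum_congr rfl fun a _ => by rw [inter_eq_ip (hmd a), inter_eq_ip (hmd a)]

/-- A Young inequality for the interaction with a weight supported in a ball. -/
lemma young_integral {θ : E3 → ℂ} (hθ : Measurable θ) {S : Set E3}
    (h0 : ∀ k, k ∉ S → θ k = 0) {C r δ : ℝ} (hC : ∀ k, ‖θ k‖ ≤ C * ‖k‖⁻¹)
    (hr : ∀ k ∈ S, ‖k‖ ≤ r) (hr0 : 0 ≤ r) (hδ : 0 < δ) (Ψ : niceFock) :
    2 * |(∫ k, θ k * ip Ψ (annK k Ψ)).re| ≤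
      δ * (∫ k in S, nsq (annK k Ψ)) + δ⁻¹ * (C ^ 2 * (sphereArea * r)) * nsq Ψ := by
  have hq : IsWeight θ := ⟨hθ, C, hC⟩
  have hi : Integrable fun k => θ k * ip Ψ (annK k Ψ) := hq.integrable_mul (isMode_ip_annK Ψ Ψ)
  have hi2 : IntegrableOn (fun k : E3 => (‖k‖ ^ 2)⁻¹) S :=
    (inv_sq_closedBall hr0).1.mono_set fun k hk => by simpa using hr k hk
  have e1 : (∫ k, θ k * ip Ψ (annK k Ψ)).re = ∫ k in S, (θ k * ip Ψ (annK k Ψ)).re := by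
    rw [setIntegral_eq_integral_of_forall_compl_eq_zero fun k hk => by simp [h0 k hk]]
    exact (integral_re (𝕜 := ℂ) hi).symm
  rw [e1]
  have h1 : 2 * |∫ k in S, (θ k * ip Ψ (annK k Ψ)).re| ≤
      ∫ k in S, (δ * nsq (annK k Ψ) + δ⁻¹ * C ^ 2 * nsq Ψ * (‖k‖ ^ 2)⁻¹) := by
    have h2 : |∫ k in S, (θ k * ip Ψ (annK k Ψ)).re| ≤
        ∫ k in S, (δ * nsq (annK k Ψ) + δ⁻¹ * C ^ 2 * nsq Ψ * (‖k‖ ^ 2)⁻¹) / 2 := by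
      rw [← Real.norm_eq_abs]
      refine norm_integral_le_of_norm_le ((((integrable_nsq_annK Ψ).integrableOn.const_mul δ).add
        (hi2.const_mul _)).div_const 2) (ae_of_all _ fun k => ?_)
      have h3 := young' (θ k) Ψ (annK k Ψ) (inv_pos.2 hδ)
      have h4 : ‖θ k‖ ^ 2 ≤ C ^ 2 * (‖k‖ ^ 2)⁻¹ := by
        refine (pow_le_pow_left₀ (norm_nonneg _) (hC k) 2).trans_eq ?_
        rw [mul_pow, inv_pow]
      have h5 : δ⁻¹ * (‖θ k‖ ^ 2 * nsq Ψ) ≤ δ⁻¹ * (C ^ 2 * (‖k‖ ^ 2)⁻¹ * nsq Ψ) := by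
        have := nsq_nonneg Ψ
        gcongr
      rw [inv_inv] at h3
      rw [Real.norm_eq_abs]
      linarith
    rw [integral_div] at h2
    linarith
  refine h1.trans ?_
  rw [integral_add ((integrable_nsq_annK Ψ).integrableOn.const_mul δ) (hi2.const_mul _),
    integral_const_mul, integral_const_mul]
  have h6 := mul_le_mul_of_nonneg_left (setIntegral_inv_sq_le hr0 hr)
    (by have := nsq_nonneg Ψ; positivity : 0 ≤ δ⁻¹ * C ^ 2 * nsq Ψ)
  linarith

/-- The contribution of small momenta. -/
lemma ir_bound {g r : ℝ} (hg : 0 < g) (hr : 0 ≤ r) {S : Set E3} (hS : MeasurableSet S)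
    (hSr : ∀ k ∈ S, ‖k‖ ≤ r) {m : ℕ} (f : Fin m → E3 → ℂ) (η : Fin m → niceFock) (x : E3) :
    -numDens S f η x - g ^ 2 * (sphereArea * r) * nsq (vec f η x) ≤
      2 * g * (inter (coulombWeight S) f f η x).re := by
  -- With `δ = 1` all of the phonon energy in the region is spent on the interaction.
  have h := young_integral (θ := fun k => (g : ℂ) * (coulombWeight S k * wave k x))
    (((isWeight_coulombWeight hS).meas.mul (continuous_wave_left x).measurable).const_mul _)
    (fun k hk => by simp [coulombWeight, Set.indicator_of_notMem hk]) (C := g) (r := r) (δ := 1)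
    (fun k => by
      rw [norm_mul, norm_mul, norm_wave, mul_one, Complex.norm_real, Real.norm_of_nonneg hg.le]
      have := norm_coulombWeight_le S k
      rw [one_mul] at this
      gcongr) hSr hr one_pos (vec f η x)
  have e : ∫ k, (g : ℂ) * (coulombWeight S k * wave k x) * ip (vec f η x) (annK k (vec f η x)) =
      (g : ℂ) * inter (coulombWeight S) f f η x := by
    rw [inter, ← integral_const_mul]
    congr 1
    funext k
    ring
  rw [e, Complex.re_ofReal_mul, inv_one, one_mul, one_mul] at h
  have h2 := neg_abs_le (g * (inter (coulombWeight S) f f η x).re)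
  rw [numDens]
  linarith


/-! ### The electron in a field of finitely many classical modes -/

/-- Finitely many disjoint regions of momentum space of diameter `d` around the points `p b`. -/
structure BlockData {ι : Type*} (B : ι → Set E3) (p : ι → E3) (d r R : ℝ) : Prop where
  meas : ∀ b, MeasurableSet (B b)
  disj : ∀ b c, b ≠ c → Disjoint (B b) (B c)
  lower : ∀ b, ∀ k ∈ B b, r ≤ ‖k‖
  upper : ∀ b, ∀ k ∈ B b, ‖k‖ ≤ R
  near : ∀ b, ∀ k ∈ B b, ‖k - p b‖ ≤ d
  pos : ∀ b, 0 < volume (B b)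
  hd : 0 ≤ d
  hr : 0 < r
  hR : 0 ≤ R

/-- `∫_B |k|⁻² dk`. -/
noncomputable def blockNorm (B : Set E3) : ℝ := ∫ k in B, (‖k‖ ^ 2)⁻¹

section blocks

variable {ι : Type*} {B : ι → Set E3} {p : ι → E3} {d r R : ℝ}

lemma BlockData.integrableOn (h : BlockData B p d r R) (b : ι) :
    IntegrableOn (fun k : E3 => (‖k‖ ^ 2)⁻¹) (B b) :=
  (inv_sq_closedBall h.hR).1.mono_set fun k hk => by simpa using h.upper b k hk

lemma BlockData.blockNorm_pos (h : BlockData B p d r R) (b : ι) : 0 < blockNorm (B b) := by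
  rw [blockNorm, setIntegral_pos_iff_support_of_nonneg_ae (ae_of_all _ fun k => by positivity)
    (h.integrableOn b)]
  refine (h.pos b).trans_le (measure_mono fun k hk => ⟨?_, hk⟩)
  have := h.hr.trans_le (h.lower b k hk)
  exact (by positivity : (‖k‖ ^ 2)⁻¹ ≠ 0)

lemma BlockData.setIntegral_iUnion [Fintype ι] (h : BlockData B p d r R) {f : E3 → ℝ}
    (hf : ∀ b, IntegrableOn f (B b)) : ∫ k in ⋃ b, B b, f k = ∑ b, ∫ k in B b, f k :=
  integral_iUnion_fintype h.meas (fun b c hbc => h.disj b c hbc) hf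

lemma norm_exp_sub_exp_le (a b : ℝ) :
    ‖Complex.exp (Complex.I * a) - Complex.exp (Complex.I * b)‖ ≤ |a - b| := by
  have e : Complex.exp (Complex.I * a) - Complex.exp (Complex.I * b) =
      Complex.exp (Complex.I * b) * (Complex.exp (Complex.I * ((a - b : ℝ) : ℂ)) - 1) := by
    rw [mul_sub, mul_one, ← Complex.exp_add]
    congr 2
    push_cast
    ring
  rw [e, norm_mul, norm_planeWave, one_mul]
  exact Real.norm_exp_I_mul_ofReal_sub_one_le

lemma norm_wave_sub_le (k q x : E3) : ‖wave k x - wave q x‖ ≤ ‖k - q‖ * ‖x‖ := by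
  refine (norm_exp_sub_exp_le _ _).trans ?_
  rw [← inner_sub_left]
  exact abs_real_inner_le_norm _ _

lemma wave_sub (k x y : E3) : wave k (x - y) * wave k y = wave k x := by
  rw [wave, wave, wave, ← Complex.exp_add, inner_sub_right]
  congr 1
  push_cast
  ring

/-- The Fourier coefficient of `|φ|²` at `q` with respect to the origin `y`. -/
noncomputable def localFT (φ : E3 → ℂ) (y q : E3) : ℂ :=
  ∫ x, wave q (x - y) * ((‖φ x‖ ^ 2 : ℝ) : ℂ)

lemma integrable_localFT {φ : E3 → ℂ} (hφ : MemLp φ 2 volume) (y q : E3) :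
    Integrable fun x => wave q (x - y) * ((‖φ x‖ ^ 2 : ℝ) : ℂ) :=
  (integrable_norm_sq hφ).ofReal.bdd_mul (c := 1)
    ((continuous_wave_right q).comp (continuous_sub_right y)).aestronglyMeasurable
    (ae_of_all _ fun _ => (norm_wave _ _).le)

lemma norm_localFT_le (φ : E3 → ℂ) (y q : E3) : ‖localFT φ y q‖ ≤ ∫ x, ‖φ x‖ ^ 2 := by
  refine (norm_integral_le_integral_norm _).trans_eq ?_
  congr 1
  funext x
  rw [norm_mul, norm_wave, one_mul, Complex.norm_real, Real.norm_of_nonneg (by positivity)]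

lemma norm_localFT (φ : E3 → ℂ) (y q : E3) :
    ‖localFT φ y q‖ = ‖chargeFT (fun x => ‖φ x‖ ^ 2) q‖ := by
  have e : localFT φ y q * wave q y = chargeFT (fun x => ‖φ x‖ ^ 2) q := by
    rw [localFT, ← integral_mul_const, chargeFT]
    congr 1
    funext x
    rw [mul_right_comm, wave_sub, wave]
  rw [← e, norm_mul, norm_wave, mul_one]

/-- On the support of `φ` the two phases differ by at most `|k - q| L`; for a localized electron the
Fourier transform is therefore nearly constant on a momentum cell. -/
lemma norm_localFT_sub_le {φ : E3 → ℂ} (hφ : MemLp φ 2 volume) {y : E3} {L : ℝ}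
    (hL : ∀ x, L < ‖x - y‖ → φ x = 0) (k q : E3) :
    ‖localFT φ y k - localFT φ y q‖ ≤ ‖k - q‖ * L * ∫ x, ‖φ x‖ ^ 2 := by
  rw [localFT, localFT, ← integral_sub (integrable_localFT hφ y k) (integrable_localFT hφ y q),
    ← integral_const_mul]
  refine norm_integral_le_of_norm_le ((integrable_norm_sq hφ).const_mul _)
    (ae_of_all _ fun x => ?_)
  rw [← sub_mul, norm_mul, Complex.norm_real, Real.norm_of_nonneg (by positivity)]
  by_cases hx : L < ‖x - y‖
  · simp [hL x hx]
  · refine mul_le_mul_of_nonneg_right ((norm_wave_sub_le k q _).trans ?_) (by positivity)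
    exact mul_le_mul_of_nonneg_left (not_lt.1 hx) (norm_nonneg _)

lemma norm_sq_le_young (a b : ℂ) {δ : ℝ} (hδ : 0 < δ) :
    ‖a‖ ^ 2 ≤ (1 + δ) * ‖b‖ ^ 2 + (1 + δ⁻¹) * ‖b - a‖ ^ 2 := by
  have h1 : ‖a‖ ≤ ‖b‖ + ‖b - a‖ := by
    have := norm_sub_norm_le a b
    rw [norm_sub_rev] at this
    linarith
  have h2 := pow_le_pow_left₀ (norm_nonneg _) h1 2
  have h3 : 0 ≤ δ⁻¹ * (δ * ‖b‖ - ‖b - a‖) ^ 2 := by positivity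
  have h4 : δ⁻¹ * (δ * ‖b‖ - ‖b - a‖) ^ 2 =
      δ * ‖b‖ ^ 2 - 2 * ‖b‖ * ‖b - a‖ + δ⁻¹ * ‖b - a‖ ^ 2 := by
    field_simp
    ring
  nlinarith

/-- Comparison of the discretized interaction energy with the Coulomb energy. -/
lemma BlockData.sum_charge_le [Fintype ι] (h : BlockData B p d r R) {A : E3 → E3} (hA : LocSq A)
    (φ : TestFn) {y : E3} {L δ : ℝ} (hδ : 0 < δ) (hL0 : 0 ≤ L)
    (hL : ∀ x, L < ‖x - y‖ → φ.1 x = 0) :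
    ∑ b, blockNorm (B b) * ‖localFT φ.1 y (p b)‖ ^ 2 ≤
      (1 + δ) * (2 * Real.pi ^ 2 * ∫ x, ∫ y, ‖φ.1 x‖ ^ 2 * ‖φ.1 y‖ ^ 2 / ‖x - y‖) +
        (1 + δ⁻¹) * (d * L * ∫ x, ‖φ.1 x‖ ^ 2) ^ 2 * (sphereArea * R) := by
  set n := ∫ x, ‖φ.1 x‖ ^ 2 with hn
  set ρ : E3 → ℝ := fun x => ‖φ.1 x‖ ^ 2 with hρ
  have hρi : Integrable ρ := integrable_norm_sq (φ.memLp 2)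
  have hn0 : 0 ≤ n := integral_nonneg fun x => by positivity
  have hcont : Continuous fun k => ‖chargeFT ρ k‖ ^ 2 := (continuous_chargeFT hρi).norm.pow 2
  have hi1 : ∀ b, IntegrableOn (fun k => ‖chargeFT ρ k‖ ^ 2 / ‖k‖ ^ 2) (B b) := fun b => by
    have := (h.integrableOn b).bdd_mul (f := fun k => ‖chargeFT ρ k‖ ^ 2) (c := n ^ 2)
      hcont.aestronglyMeasurable (ae_of_all _ fun k => by
        rw [Real.norm_of_nonneg (by positivity), ← norm_localFT φ.1 y]
        exact pow_le_pow_left₀ (norm_nonneg _) (norm_localFT_le φ.1 y k) 2)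
    refine Integrable.congr this (ae_of_all _ fun k => ?_)
    simp only [div_eq_mul_inv]
  -- For every `k` in the block the value at `p b` is compared with the value at `k`, at the cost of
  -- the factor `1 + δ` and of the variation over the block. Integration with the weight `|k|⁻²`
  -- then produces the Coulomb integrand.
  have h1 : ∀ b, blockNorm (B b) * ‖localFT φ.1 y (p b)‖ ^ 2 ≤
      (1 + δ) * (∫ k in B b, ‖chargeFT ρ k‖ ^ 2 / ‖k‖ ^ 2) +
        (1 + δ⁻¹) * (d * L * n) ^ 2 * ∫ k in B b, (‖k‖ ^ 2)⁻¹ := fun b => by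
    rw [blockNorm, ← integral_mul_const, ← integral_const_mul, ← integral_const_mul,
      ← integral_add ((hi1 b).const_mul _) ((h.integrableOn b).const_mul _)]
    refine setIntegral_mono_on ((h.integrableOn b).mul_const _)
      (((hi1 b).const_mul _).add ((h.integrableOn b).const_mul _)) (h.meas b) fun k hk => ?_
    have h2 := norm_sq_le_young (localFT φ.1 y (p b)) (localFT φ.1 y k) hδ
    have h3 : ‖localFT φ.1 y k - localFT φ.1 y (p b)‖ ≤ d * L * n := by
      refine (norm_localFT_sub_le (φ.memLp 2) hL k (p b)).trans ?_
      have := h.near b k hk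
      gcongr
    have h4 := pow_le_pow_left₀ (norm_nonneg _) h3 2
    rw [norm_localFT φ.1 y k] at h2
    have h5 : ‖localFT φ.1 y (p b)‖ ^ 2 ≤
        (1 + δ) * ‖chargeFT ρ k‖ ^ 2 + (1 + δ⁻¹) * (d * L * n) ^ 2 := by
      refine h2.trans ?_
      gcongr
    calc (‖k‖ ^ 2)⁻¹ * ‖localFT φ.1 y (p b)‖ ^ 2
        ≤ (‖k‖ ^ 2)⁻¹ * ((1 + δ) * ‖chargeFT ρ k‖ ^ 2 + (1 + δ⁻¹) * (d * L * n) ^ 2) := by gcongr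
      _ = (1 + δ) * (‖chargeFT ρ k‖ ^ 2 / ‖k‖ ^ 2) +
          (1 + δ⁻¹) * (d * L * n) ^ 2 * (‖k‖ ^ 2)⁻¹ := by
        rw [div_eq_mul_inv]
        ring
  refine (Finset.sum_le_sum fun b _ => h1 b).trans ?_
  rw [Finset.sum_add_distrib, ← Finset.mul_sum, ← Finset.mul_sum, ← h.setIntegral_iUnion hi1,
    ← h.setIntegral_iUnion h.integrableOn]
  have h6 := setIntegral_chargeFT_le hρi (φ.2.1.continuous.norm.pow 2).measurable
    (fun x => by positivity) (integrable_coulomb hA (hA.memH1A φ)) (⋃ b, B b)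
  have h7 : ∫ k in ⋃ b, B b, (‖k‖ ^ 2)⁻¹ ≤ sphereArea * R :=
    setIntegral_inv_sq_le h.hR fun k hk => by
      obtain ⟨b, hb⟩ := Set.mem_iUnion.1 hk
      exact h.upper b k hb
  gcongr

/-- Minimization over a classical amplitude: the phase of `z` is estimated in the worst case, and
the square is completed in `|z|`. -/
lemma complete_square {G w : ℝ} (hG : 0 < G) (z t : ℂ) :
    -(w ^ 2 * ‖t‖ ^ 2 / G) ≤ G * ‖z‖ ^ 2 + 2 * (w * (z * t).re) := by
  have h1 : -(‖z‖ * ‖t‖) ≤ (z * t).re := by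
    rw [← norm_mul]
    exact (abs_le.1 (Complex.abs_re_le_norm _)).1
  have h1' : (z * t).re ≤ ‖z‖ * ‖t‖ := by
    rw [← norm_mul]
    exact (abs_le.1 (Complex.abs_re_le_norm _)).2
  have h2 : -(|w| * (‖z‖ * ‖t‖)) ≤ w * (z * t).re := by
    rw [neg_le]
    refine (neg_le_abs _).trans ?_
    rw [abs_mul]
    exact mul_le_mul_of_nonneg_left (abs_le.2 ⟨h1, h1'⟩) (abs_nonneg _)
  have h3 : 0 ≤ G⁻¹ * (G * ‖z‖ - |w| * ‖t‖) ^ 2 := by positivity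
  have h4 : G⁻¹ * (G * ‖z‖ - |w| * ‖t‖) ^ 2 =
      G * ‖z‖ ^ 2 - 2 * (|w| * (‖z‖ * ‖t‖)) + w ^ 2 * ‖t‖ ^ 2 / G := by
    rw [← sq_abs w]
    field_simp
    ring
  linarith

lemma TestFn.potT_eq_zero (V : E3 → ℝ) (φ : TestFn) (h : ∫ x, ‖φ.1 x‖ ^ 2 = 0) :
    potT V φ.1 = 0 := by
  rw [integral_eq_zero_iff_of_nonneg (fun x => by positivity)
    (integrable_norm_sq (φ.memLp 2))] at h
  rw [potT, ← integral_zero E3 ℝ]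
  refine integral_congr_ae ?_
  filter_upwards [h] with x hx
  simp only [Pi.zero_apply] at hx
  rw [hx, mul_zero]

/-- The Pekar energy bounds the Pekar functional of unnormalized test functions. -/
lemma pekarEnergy_le {A : E3 → E3} {V : E3 → ℝ} (h : Admissible A V) {α : ℝ} (hα : 0 < α)
    (φ : TestFn) (hφ : 0 < ∫ x, ‖φ.1 x‖ ^ 2) :
    pekarEnergy A V α * (∫ x, ‖φ.1 x‖ ^ 2) ≤
      (∑ j, ∫ x, ‖covT A j φ.1 x‖ ^ 2) + potT V φ.1 -
        α * (∫ x, ∫ y, ‖φ.1 x‖ ^ 2 * ‖φ.1 y‖ ^ 2 / ‖x - y‖) / ∫ x, ‖φ.1 x‖ ^ 2 := by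
  set n := ∫ x, ‖φ.1 x‖ ^ 2
  have hA : LocSq A := h.memLp_A
  set c : ℂ := (((Real.sqrt n)⁻¹ : ℝ) : ℂ) with hc
  have hc2 : ‖c‖ ^ 2 = n⁻¹ := by
    rw [hc, Complex.norm_real, Real.norm_of_nonneg (by positivity), inv_pow, Real.sq_sqrt hφ.le]
  set w := TestFn.comb c 0 φ φ with hw
  have e0 : ∀ x, ‖w.1 x‖ ^ 2 = n⁻¹ * ‖φ.1 x‖ ^ 2 := fun x => by
    simp only [hw, TestFn.comb, zero_mul, add_zero, norm_mul, mul_pow, hc2]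
  have e1 : ∀ j x, ‖covT A j w.1 x‖ ^ 2 = n⁻¹ * ‖covT A j φ.1 x‖ ^ 2 := fun j x => by
    rw [hw, covT_comb, zero_mul, add_zero, norm_mul, mul_pow, hc2]
  have hn : ∫ x, ‖w.1 x‖ ^ 2 = 1 := by
    simp only [e0]
    rw [integral_const_mul, inv_mul_cancel₀ hφ.ne']
  have hmem : pekarFunctional A V α w.1 ∈ pekarValues A V α := ⟨w.1, hA.memH1A w, hn, rfl⟩
  have hle := csInf_le (bddBelow_pekarValues h hα) hmem
  have e2 : pekarFunctional A V α w.1 = n⁻¹ * (∑ j, ∫ x, ‖covT A j φ.1 x‖ ^ 2) +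
      n⁻¹ * potT V φ.1 - α * (n⁻¹ * n⁻¹ * ∫ x, ∫ y, ‖φ.1 x‖ ^ 2 * ‖φ.1 y‖ ^ 2 / ‖x - y‖) := by
    rw [pekarFunctional, schrodingerForm, kineticForm_test hA, h.potentialForm_test, potT]
    simp only [e0, e1]
    congr 1
    · congr 1
      · simp only [integral_const_mul, Finset.mul_sum]
      · rw [potT, ← integral_const_mul]
        congr 1
        funext x
        ring
    · congr 1
      rw [← integral_const_mul]
      congr 1
      funext x
      rw [← integral_const_mul]
      congr 1
      funext y
      ring
  rw [e2] at hle
  have h3 := mul_le_mul_of_nonneg_right hle hφ.le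
  refine h3.trans_eq ?_
  field_simp

/-- The energy of the electron in a classical field is bounded below by the Pekar energy. -/
lemma BlockData.electron_bound [Fintype ι] (h : BlockData B p d r R) {A : E3 → E3} {V : E3 → ℝ}
    (hV : Admissible A V) {g s δ L : ℝ} (hg : 0 < g) (hs1 : s < 1) (hδ : 0 < δ) (hδ1 : δ < 1)
    (hsδ : (1 + δ) * (1 - s) ≤ 1 - δ) (hL0 : 0 ≤ L) (φ : TestFn) {y : E3}
    (hL : ∀ x, L < ‖x - y‖ → φ.1 x = 0) (z : ι → ℂ) :
    0 ≤ (1 - s) * (∑ j, ∫ x, ‖covT A j φ.1 x‖ ^ 2) + potT V φ.1 -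
      ((1 - s) * pekarEnergy A (fun x => (1 - s)⁻¹ * V x)
          (2 * Real.pi ^ 2 * g ^ 2 * (1 - s)⁻¹ ^ 2) -
        g ^ 2 / (1 - δ) * ((1 + δ⁻¹) * (d * L) ^ 2 * (sphereArea * R))) * (∫ x, ‖φ.1 x‖ ^ 2) +
      ∑ b, ((1 - δ) * (∫ x, ‖φ.1 x‖ ^ 2) * ‖z b‖ ^ 2 +
        2 * (g * Real.sqrt (blockNorm (B b)) * (z b * localFT φ.1 y (p b)).re)) := by
  have hA : LocSq A := hV.memLp_A
  set n := ∫ x, ‖φ.1 x‖ ^ 2 with hn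
  have hn0 : 0 ≤ n := integral_nonneg fun x => by positivity
  have hβ : 0 < 1 - s := by linarith
  have hδ' : 0 < 1 - δ := by linarith
  set K := ∑ j, ∫ x, ‖covT A j φ.1 x‖ ^ 2
  have hK : 0 ≤ K := Finset.sum_nonneg fun j _ => integral_nonneg fun x => by positivity
  -- A combination of test functions may vanish, and then it cannot be normalized; in that case only
  -- the kinetic term survives.
  rcases hn0.eq_or_lt with hz | hpos
  · have h1 : potT V φ.1 = 0 := φ.potT_eq_zero V hz.symm
    have h2 : ∀ b, localFT φ.1 y (p b) = 0 := fun b => by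
      have := norm_localFT_le φ.1 y (p b)
      rw [← hn, ← hz] at this
      exact norm_le_zero_iff.1 this
    simp only [h1, h2, ← hz, mul_zero, zero_mul, Complex.zero_re, Finset.sum_const_zero, add_zero,
      sub_zero]
    positivity
  · have h1 := pekarEnergy_le (hV.const_mul (1 - s)⁻¹)
      (α := 2 * Real.pi ^ 2 * g ^ 2 * (1 - s)⁻¹ ^ 2) (by positivity) φ hpos
    have h2 := h.sum_charge_le hA φ hδ hL0 hL
    rw [← hn] at h1 h2
    set D := ∫ x, ∫ y, ‖φ.1 x‖ ^ 2 * ‖φ.1 y‖ ^ 2 / ‖x - y‖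
    have hD : 0 ≤ D := integral_nonneg fun x => integral_nonneg fun y => by positivity
    set EP := pekarEnergy A (fun x => (1 - s)⁻¹ * V x) (2 * Real.pi ^ 2 * g ^ 2 * (1 - s)⁻¹ ^ 2)
    have e1 : potT (fun x => (1 - s)⁻¹ * V x) φ.1 = (1 - s)⁻¹ * potT V φ.1 := by
      rw [potT, potT, ← integral_const_mul]
      congr 1
      funext x
      ring
    rw [e1] at h1
    -- The classical field energy carries the weight `(1 - δ) n` because `φ` is not normalized. The
    -- resulting `n` in the denominator is the one in the Coulomb term of `pekarEnergy_le`.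
    have h3 : ∑ b, -(g ^ 2 * (blockNorm (B b) * ‖localFT φ.1 y (p b)‖ ^ 2) / ((1 - δ) * n)) ≤
        ∑ b, ((1 - δ) * n * ‖z b‖ ^ 2 +
          2 * (g * Real.sqrt (blockNorm (B b)) * (z b * localFT φ.1 y (p b)).re)) := by
      refine Finset.sum_le_sum fun b _ => ?_
      have := complete_square (G := (1 - δ) * n) (w := g * Real.sqrt (blockNorm (B b)))
        (by positivity) (z b) (localFT φ.1 y (p b))
      rw [mul_pow, Real.sq_sqrt (h.blockNorm_pos b).le] at this
      refine le_trans (le_of_eq ?_) this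
      ring
    rw [Finset.sum_neg_distrib, ← Finset.sum_div, ← Finset.mul_sum] at h3
    have h4 : g ^ 2 * (∑ b, blockNorm (B b) * ‖localFT φ.1 y (p b)‖ ^ 2) / ((1 - δ) * n) ≤
        g ^ 2 * ((1 + δ) * (2 * Real.pi ^ 2 * D) +
          (1 + δ⁻¹) * (d * L * n) ^ 2 * (sphereArea * R)) / ((1 - δ) * n) := by gcongr
    have e2 : g ^ 2 * ((1 + δ) * (2 * Real.pi ^ 2 * D) +
          (1 + δ⁻¹) * (d * L * n) ^ 2 * (sphereArea * R)) / ((1 - δ) * n) =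
        (1 + δ) / (1 - δ) * (2 * Real.pi ^ 2 * g ^ 2 * D / n) +
        g ^ 2 / (1 - δ) * ((1 + δ⁻¹) * (d * L) ^ 2 * (sphereArea * R)) * n := by
      field_simp
    -- The factor `1 + δ` comes from the variation over a block, the factor `1 - δ` from the field
    -- energy reserved for the discretization. Absorbing both in `(1 - s)⁻¹` produces the coupling
    -- with `(1 - s)⁻¹ ^ 2` once `1 - s` is taken out of the functional.
    have h5 : (1 + δ) / (1 - δ) ≤ (1 - s)⁻¹ := by
      rw [div_le_iff₀ hδ', inv_mul_eq_div, le_div_iff₀ hβ]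
      exact hsδ
    have h6 : (1 + δ) / (1 - δ) * (2 * Real.pi ^ 2 * g ^ 2 * D / n) ≤
        (1 - s)⁻¹ * (2 * Real.pi ^ 2 * g ^ 2 * D / n) := by gcongr
    have h7 := mul_le_mul_of_nonneg_left h1 hβ.le
    have e3 : (1 - s) * (K + (1 - s)⁻¹ * potT V φ.1 -
        2 * Real.pi ^ 2 * g ^ 2 * (1 - s)⁻¹ ^ 2 * D / n) =
        (1 - s) * K + potT V φ.1 - (1 - s)⁻¹ * (2 * Real.pi ^ 2 * g ^ 2 * D / n) := by
      field_simp
    rw [e3] at h7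
    rw [e2] at h4
    generalize (1 - s)⁻¹ * (2 * Real.pi ^ 2 * g ^ 2 * D / n) = X at *
    generalize g ^ 2 / (1 - δ) * ((1 + δ⁻¹) * (d * L) ^ 2 * (sphereArea * R)) = Y at *
    have e4 : ((1 - s) * EP - Y) * n = (1 - s) * (EP * n) - Y * n := by ring
    rw [e4]
    linarith


/-! ### Replacing the phonon field by finitely many modes -/

/-- The pairing `∑ T i j * P i j` of matrices. -/
noncomputable def pairing {m : ℕ} (P : Fin m → Fin m → ℂ) : (Fin m → Fin m → ℂ) →ₗ[ℂ] ℂ where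
  toFun T := ∑ i, ∑ j, T i j * P i j
  map_add' T T' := by simp [add_mul, Finset.sum_add_distrib]
  map_smul' c T := by simp [mul_assoc, Finset.mul_sum]

lemma pairing_apply {m : ℕ} (P T : Fin m → Fin m → ℂ) :
    pairing P T = ∑ i, ∑ j, T i j * P i j := rfl

lemma mform_eq_pairing {m : ℕ} (T : Fin m → Fin m → ℂ) (η ζ : Fin m → niceFock) :
    mform T η ζ = pairing (fun i j => ip (η i) (ζ j)) T := rfl

lemma re_integral_nonneg {X : Type*} [MeasurableSpace X] {μ : Measure X} {f : X → ℂ}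
    (h : ∀ x, 0 ≤ (f x).re) : 0 ≤ (∫ x, f x ∂μ).re := by
  by_cases hf : Integrable f μ
  · have e := integral_re (𝕜 := ℂ) hf
    exact le_of_le_of_eq (integral_nonneg h) e
  · rw [integral_undef hf, Complex.zero_re]

/-- The hypothesis is applied pointwise to the components `(η i).1 n K`. No convergence has to be
checked, since the default value `0` of sums and integrals is also non-negative. -/
lemma mform_nonneg {m : ℕ} {T : Fin m → Fin m → ℂ}
    (h : ∀ c : Fin m → ℂ, 0 ≤ (pairing (fun i j => conj (c i) * c j) T).re)
    (η : Fin m → niceFock) : 0 ≤ (mform T η η).re := by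
  rw [mform_eq_tsum]
  by_cases hs : Summable fun n => ∫ K, ∑ i, ∑ j, T i j * (conj ((η i).1 n K) * (η j).1 n K)
  · rw [Complex.re_tsum hs]
    exact tsum_nonneg fun n => re_integral_nonneg fun K => h fun i => (η i).1 n K
  · rw [tsum_eq_zero_of_not_summable hs, Complex.zero_re]

lemma integral_mul_norm_sq_sum {m : ℕ} (w : E3 → ℂ) (f : Fin m → E3 → ℂ)
    (h : ∀ i j, Integrable fun x => w x * (conj (f i x) * f j x)) (c : Fin m → ℂ) :
    ∫ x, w x * ((‖∑ i, c i * f i x‖ ^ 2 : ℝ) : ℂ) =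
      pairing (fun i j => conj (c i) * c j) fun i j => ∫ x, w x * (conj (f i x) * f j x) := by
  have e : ∀ x, w x * ((‖∑ i, c i * f i x‖ ^ 2 : ℝ) : ℂ) =
      ∑ i, ∑ j, (w x * (conj (f i x) * f j x)) * (conj (c i) * c j) := fun x => by
    rw [← Complex.normSq_eq_norm_sq, ← Complex.mul_conj, mul_comm (∑ i, _),
      map_sum, Finset.sum_mul_sum, Finset.mul_sum]
    refine Finset.sum_congr rfl fun i _ => ?_
    rw [Finset.mul_sum]
    refine Finset.sum_congr rfl fun j _ => ?_
    rw [map_mul]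
    ring
  have hi := fun i j => (h i j).mul_const (conj (c i) * c j)
  simp only [e]
  rw [integral_finsetSum _ fun i _ => integrable_finsetSum _ fun j _ => hi i j, pairing_apply]
  refine Finset.sum_congr rfl fun i _ => ?_
  rw [integral_finsetSum _ fun j _ => hi i j]
  exact Finset.sum_congr rfl fun j _ => integral_mul_const _ _

lemma BlockData.sum_indicator [Fintype ι] {M : Type*} [AddCommMonoid M]
    (h : BlockData B p d r R) (f : E3 → M) (k : E3) :
    ∑ b, (B b).indicator f k = (⋃ b, B b).indicator f k := by
  by_cases hk : k ∈ ⋃ b, B b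
  · obtain ⟨b, hb⟩ := Set.mem_iUnion.1 hk
    rw [Set.indicator_of_mem hk, Finset.sum_eq_single b, Set.indicator_of_mem hb]
    · exact fun c _ hc => Set.indicator_of_notMem
        (fun hkc => Set.disjoint_left.1 (h.disj c b hc) hkc hb) _
    · exact fun hb' => absurd (Finset.mem_univ b) hb'
  · rw [Set.indicator_of_notMem hk]
    exact Finset.sum_eq_zero fun b _ =>
      Set.indicator_of_notMem (fun hb => hk (Set.mem_iUnion.2 ⟨b, hb⟩)) _

lemma norm_coulombWeight (S : Set E3) (k : E3) :
    ‖coulombWeight S k‖ = S.indicator (fun k => ‖k‖⁻¹) k := by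
  by_cases hk : k ∈ S
  · rw [coulombWeight, Set.indicator_of_mem hk, Set.indicator_of_mem hk, Complex.norm_real,
      Real.norm_of_nonneg (by positivity)]
  · rw [coulombWeight, Set.indicator_of_notMem hk, Set.indicator_of_notMem hk, norm_zero]

lemma coulombWeight_of_notMem {S : Set E3} {k : E3} (hk : k ∉ S) : coulombWeight S k = 0 :=
  Set.indicator_of_notMem hk _

lemma integral_norm_sq_coulombWeight {S : Set E3} (hS : MeasurableSet S) :
    ∫ k, ‖coulombWeight S k‖ ^ 2 = blockNorm S := by
  rw [blockNorm, ← integral_indicator hS]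
  congr 1
  funext k
  by_cases hk : k ∈ S <;> simp [norm_coulombWeight, hk]

lemma BlockData.isMode_coulombWeight (h : BlockData B p d r R) (b : ι) :
    IsMode (coulombWeight (B b)) := by
  refine ⟨(isWeight_coulombWeight (h.meas b)).meas, ⟨r⁻¹, fun k => ?_⟩, ⟨R, fun k hk => ?_⟩⟩
  · rw [norm_coulombWeight]
    by_cases hk : k ∈ B b
    · rw [Set.indicator_of_mem hk]
      exact inv_anti₀ h.hr (h.lower b k hk)
    · rw [Set.indicator_of_notMem hk]
      exact (inv_pos.2 h.hr).le
  · exact coulombWeight_of_notMem fun hb => absurd (h.upper b k hb) (not_le.2 hk)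

/-- The normalized one-phonon function of a region `S`, seen from the point `y`. -/
noncomputable def blockMode (S : Set E3) (y k : E3) : ℂ :=
  (((Real.sqrt (blockNorm S))⁻¹ : ℝ) : ℂ) * modeAt (coulombWeight S) y k

lemma BlockData.isMode (h : BlockData B p d r R) (y : E3) (b : ι) : IsMode (blockMode (B b) y) := by
  have := (isMode_modeAt (h.isMode_coulombWeight b) y).bdd_mul
    (g := fun _ => (((Real.sqrt (blockNorm (B b)))⁻¹ : ℝ) : ℂ)) measurable_const
    ⟨_, fun _ => le_rfl⟩
  have e : blockMode (B b) y = fun k => modeAt (coulombWeight (B b)) y k *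
      (((Real.sqrt (blockNorm (B b)))⁻¹ : ℝ) : ℂ) := funext fun k => mul_comm _ _
  rwa [e]

lemma blockMode_of_notMem {S : Set E3} (y : E3) {k : E3} (hk : k ∉ S) : blockMode S y k = 0 := by
  simp [blockMode, modeAt, coulombWeight_of_notMem hk]

lemma BlockData.integral_norm_sq_blockMode (h : BlockData B p d r R) (y : E3) (b : ι) :
    ∫ k, ‖blockMode (B b) y k‖ ^ 2 = 1 := by
  have h0 := h.blockNorm_pos b
  simp only [blockMode, norm_mul, mul_pow]
  rw [integral_const_mul, integral_norm_sq_modeAt, integral_norm_sq_coulombWeight (h.meas b),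
    Complex.norm_real, Real.norm_of_nonneg (by positivity), inv_pow, Real.sq_sqrt h0.le,
    inv_mul_cancel₀ h0.ne']

lemma BlockData.integral_blockMode_mul (h : BlockData B p d r R) (y : E3) {b c : ι} (hbc : b ≠ c) :
    ∫ k, conj (blockMode (B b) y k) * blockMode (B c) y k = 0 := by
  rw [← integral_zero E3 ℂ]
  congr 1
  funext k
  by_cases hk : k ∈ B b
  · rw [blockMode_of_notMem y fun hc => Set.disjoint_left.1 (h.disj b c hbc) hk hc, mul_zero]
  · rw [blockMode_of_notMem y hk, map_zero, zero_mul]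

/-- The phonon energy and the interaction with one electron position are bounded below by those of
the finitely many block modes. -/
lemma BlockData.modes_le [Fintype ι] (h : BlockData B p d r R) {g δ L : ℝ} (hg : 0 < g)
    (hδ : 0 < δ) (hδ1 : δ < 1) (x y : E3) (Ψ : niceFock)
    (hL : L < ‖x - y‖ → Ψ = 0) :
    (1 - δ) * (∑ b, nsq (ann _ (h.isMode y b) Ψ)) +
        2 * (∑ b, (g * Real.sqrt (blockNorm (B b)) : ℝ) *
          (wave (p b) (x - y) * ip Ψ (ann _ (h.isMode y b) Ψ))).re -
        δ⁻¹ * ((g * (d * L)) ^ 2 * (sphereArea * R)) * nsq Ψ ≤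
      (∫ k in ⋃ b, B b, nsq (annK k Ψ)) + 2 * g *
        (∫ k, coulombWeight (⋃ b, B b) k * wave k x * ip Ψ (annK k Ψ)).re := by
  -- Outside the localization ball the vector vanishes, so the phases have to be compared only for
  -- `‖x - y‖ ≤ L`.
  by_cases hx : L < ‖x - y‖
  · simp [hL hx, nsq]
  have hCm : MeasurableSet (⋃ b, B b) := MeasurableSet.iUnion h.meas
  -- `θ` is the interaction minus its discretization. In `exp(ikx) = exp(ik(x - y)) exp(iky)` only
  -- the first factor is frozen at `p b`; the second is kept exactly, inside the one-phonon function
  -- `blockMode`.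
  set θ : E3 → ℂ := fun k => ∑ b, (g : ℂ) * (coulombWeight (B b) k *
    (wave k x - wave (p b) (x - y) * wave k y)) with hθ
  have hwm : ∀ b, Measurable fun k => wave k x - wave (p b) (x - y) * wave k y := fun b =>
    (continuous_wave_left x).measurable.sub ((continuous_wave_left y).measurable.const_mul _)
  have hθm : Measurable θ := Finset.measurable_fun_sum _ fun b _ =>
    (((isWeight_coulombWeight (h.meas b)).meas).mul (hwm b)).const_mul _
  have hθ0 : ∀ k, k ∉ (⋃ b, B b) → θ k = 0 := fun k hk => Finset.sum_eq_zero fun b _ => by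
    rw [coulombWeight_of_notMem fun hb => hk (Set.mem_iUnion.2 ⟨b, hb⟩), zero_mul, mul_zero]
  have hθC : ∀ k, ‖θ k‖ ≤ g * (d * L) * ‖k‖⁻¹ := fun k => by
    have h1 : ∀ b, ‖(g : ℂ) * (coulombWeight (B b) k *
        (wave k x - wave (p b) (x - y) * wave k y))‖ ≤
        g * (d * L) * (B b).indicator (fun k => ‖k‖⁻¹) k := fun b => by
      rw [norm_mul, norm_mul, Complex.norm_real, Real.norm_of_nonneg hg.le, norm_coulombWeight]
      by_cases hk : k ∈ B b
      · rw [Set.indicator_of_mem hk, ← wave_sub k x y, ← sub_mul, norm_mul, norm_wave, mul_one]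
        have h2 : ‖wave k (x - y) - wave (p b) (x - y)‖ ≤ d * L :=
          (norm_wave_sub_le _ _ _).trans
            (mul_le_mul (h.near b k hk) (not_lt.1 hx) (norm_nonneg _) h.hd)
        calc g * (‖k‖⁻¹ * ‖wave k (x - y) - wave (p b) (x - y)‖) ≤ g * (‖k‖⁻¹ * (d * L)) := by
              gcongr
          _ = g * (d * L) * ‖k‖⁻¹ := by ring
      · simp [Set.indicator_of_notMem hk]
    refine (norm_sum_le _ _).trans ((Finset.sum_le_sum fun b _ => h1 b).trans ?_)
    rw [← Finset.mul_sum, h.sum_indicator]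
    have hL0 : 0 ≤ L := (norm_nonneg _).trans (not_lt.1 hx)
    have hd := h.hd
    refine mul_le_mul_of_nonneg_left ?_ (by positivity)
    exact Set.indicator_le_self' (fun _ _ => by positivity) _
  have hub : ∀ k ∈ ⋃ b, B b, ‖k‖ ≤ R := fun k hk => by
    obtain ⟨b, hb⟩ := Set.mem_iUnion.1 hk
    exact h.upper b k hb
  -- The reserved fraction `δ` of the phonon energy in the blocks pays for the discretization error.
  have hy := young_integral hθm hθ0 hθC hub h.hR hδ Ψ
  have hm := isMode_ip_annK Ψ Ψ
  have hi1 : ∀ b, Integrable fun k => coulombWeight (B b) k * (wave k x * ip Ψ (annK k Ψ)) :=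
    fun b => (isWeight_coulombWeight (h.meas b)).integrable_mul (isMode_wave_mul hm x)
  have hi2 : ∀ b, Integrable fun k => coulombWeight (B b) k * (wave k y * ip Ψ (annK k Ψ)) :=
    fun b => (isWeight_coulombWeight (h.meas b)).integrable_mul (isMode_wave_mul hm y)
  have e1 : ∀ b, ((g * Real.sqrt (blockNorm (B b)) : ℝ) : ℂ) *
      (wave (p b) (x - y) * ip Ψ (ann _ (h.isMode y b) Ψ)) =
      (g * wave (p b) (x - y)) * ∫ k, coulombWeight (B b) k * (wave k y * ip Ψ (annK k Ψ)) :=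
    fun b => by
    have h0 : ((Real.sqrt (blockNorm (B b)) : ℝ) : ℂ) ≠ 0 := by
      have := h.blockNorm_pos b
      simp only [ne_eq, Complex.ofReal_eq_zero]
      positivity
    have e : ip Ψ (ann _ (h.isMode y b) Ψ) = (((Real.sqrt (blockNorm (B b)))⁻¹ : ℝ) : ℂ) *
        ∫ k, coulombWeight (B b) k * (wave k y * ip Ψ (annK k Ψ)) := by
      rw [ip_ann_eq_integral, ← integral_const_mul]
      congr 1
      funext k
      simp only [blockMode, modeAt, map_mul, Complex.conj_conj, Complex.conj_ofReal]
      ring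
    rw [e]
    push_cast
    field_simp
  have e2 : ∫ k, θ k * ip Ψ (annK k Ψ) =
      g * (∫ k, coulombWeight (⋃ b, B b) k * wave k x * ip Ψ (annK k Ψ)) -
        ∑ b, ((g * Real.sqrt (blockNorm (B b)) : ℝ) : ℂ) *
          (wave (p b) (x - y) * ip Ψ (ann _ (h.isMode y b) Ψ)) := by
    have e3 : ∀ k, coulombWeight (⋃ b, B b) k * wave k x * ip Ψ (annK k Ψ) =
        ∑ b, coulombWeight (B b) k * (wave k x * ip Ψ (annK k Ψ)) := fun k => by
      rw [coulombWeight, ← h.sum_indicator, Finset.sum_mul, Finset.sum_mul]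
      exact Finset.sum_congr rfl fun b _ => by rw [coulombWeight, mul_assoc]
    simp only [e1, e3]
    rw [integral_finsetSum _ fun b _ => hi1 b, Finset.mul_sum, ← Finset.sum_sub_distrib]
    have e4 : ∀ k, θ k * ip Ψ (annK k Ψ) = ∑ b, (g * (coulombWeight (B b) k *
        (wave k x * ip Ψ (annK k Ψ))) - g * wave (p b) (x - y) *
          (coulombWeight (B b) k * (wave k y * ip Ψ (annK k Ψ)))) := fun k => by
      rw [hθ, Finset.sum_mul]
      exact Finset.sum_congr rfl fun b _ => by ring
    simp only [e4]
    have hi3 : ∀ b, Integrable fun k => (g : ℂ) * (coulombWeight (B b) k *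
        (wave k x * ip Ψ (annK k Ψ))) - g * wave (p b) (x - y) *
          (coulombWeight (B b) k * (wave k y * ip Ψ (annK k Ψ))) := fun b =>
      ((hi1 b).const_mul _).sub ((hi2 b).const_mul _)
    rw [integral_finsetSum _ fun b _ => hi3 b]
    refine Finset.sum_congr rfl fun b _ => ?_
    rw [integral_sub ((hi1 b).const_mul _) ((hi2 b).const_mul _), integral_const_mul,
      integral_const_mul]
  -- Each mode is normalized and lives in its own block, so its number operator is dominated by the
  -- phonon number of that block.
  have hb : ∑ b, nsq (ann _ (h.isMode y b) Ψ) ≤ ∫ k in ⋃ b, B b, nsq (annK k Ψ) := by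
    rw [h.setIntegral_iUnion fun b => (integrable_nsq_annK Ψ).integrableOn]
    refine Finset.sum_le_sum fun b _ => ?_
    have := nsq_ann_le (h.isMode y b) (h.meas b) (fun k hk => blockMode_of_notMem y hk) Ψ
    rwa [h.integral_norm_sq_blockMode, one_mul] at this
  rw [e2, Complex.sub_re, Complex.re_ofReal_mul] at hy
  have hb' := mul_le_mul_of_nonneg_left hb (by linarith : 0 ≤ 1 - δ)
  have ha := neg_abs_le (g * (∫ k, coulombWeight (⋃ b, B b) k * wave k x * ip Ψ (annK k Ψ)).re -
    (∑ b, ((g * Real.sqrt (blockNorm (B b)) : ℝ) : ℂ) *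
      (wave (p b) (x - y) * ip Ψ (ann _ (h.isMode y b) Ψ))).re)
  linarith


/-! ### The localized lower bound -/

/-- Componentwise action of an operator on Fock space. -/
noncomputable def compwise {m : ℕ} (T : niceFock →ₗ[ℂ] niceFock) :
    (Fin m → niceFock) →ₗ[ℂ] (Fin m → niceFock) := T.compLeft (Fin m)

lemma compwise_apply {m : ℕ} (T : niceFock →ₗ[ℂ] niceFock) (η : Fin m → niceFock) :
    compwise T η = fun i => T (η i) := rfl

lemma compwise_pow {m : ℕ} (T : niceFock →ₗ[ℂ] niceFock) (N : ℕ) (η : Fin m → niceFock) (i : Fin m) :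
    (compwise T ^ N) η i = (T ^ N) (η i) := by
  induction N generalizing η with
  | zero => simp
  | succ N ih =>
    rw [pow_succ, pow_succ, Module.End.mul_apply, Module.End.mul_apply, ih, compwise_apply]

lemma compwise_nilpotent {m : ℕ} {f : E3 → ℂ} (hf : IsMode f) (η : Fin m → niceFock) :
    ∃ N : ℕ, (compwise (ann f hf) ^ N) η = 0 := by
  choose N hN using fun i => ann_pow_eq_zero hf (η i)
  refine ⟨∑ i, N i, funext fun i => ?_⟩
  obtain ⟨l, hl⟩ := Nat.exists_eq_add_of_le
    (Finset.single_le_sum (f := N) (fun _ _ => Nat.zero_le _) (Finset.mem_univ i))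
  rw [compwise_pow, hl, add_comm, pow_add, Module.End.mul_apply, hN i, map_zero, Pi.zero_apply]

lemma formCompat_mform {m : ℕ} {f : E3 → ℂ} (hf : IsMode f) (T : Fin m → Fin m → ℂ) :
    FormCompat (compwise (ann f hf)) (compwise (cre f hf)) (mform T) := by
  refine ⟨fun ψ χ => ?_, fun ψ χ => ?_⟩
  · simp only [mform_apply, compwise_apply, ip_cre]
  · simp only [mform_apply, compwise_apply, ip_ann]

lemma cre_comm_ann {f g : E3 → ℂ} (hf : IsMode f) (hg : IsMode g)
    (h0 : ∫ k, conj (f k) * g k = 0) (η : niceFock) :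
    ann f hf (cre g hg η) = cre g hg (ann f hf η) := by
  rw [ann_cre, h0, zero_smul, add_zero]

/-- The coherent state bound for the block modes. -/
lemma BlockData.coherent_bound [Fintype ι] [DecidableEq ι] (h : BlockData B p d r R) (y : E3)
    {m : ℕ} {S M : Fin m → Fin m → ℂ} {W : ι → Fin m → Fin m → ℂ} {γ : ℝ}
    (hpos : ∀ (z : ι → ℂ) (c : Fin m → ℂ), 0 ≤ (pairing (fun i j => conj (c i) * c j)
      (S + ∑ b, (((‖z b‖ ^ 2 * γ : ℝ) : ℂ) • M + (2 * z b) • W b))).re) (η : Fin m → niceFock) :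
    0 ≤ (mform S η η).re + ∑ b, (γ * (mform M (fun i => ann _ (h.isMode y b) (η i))
        fun i => ann _ (h.isMode y b) (η i)).re + γ * (mform M η η).re +
        2 * (mform (W b) η fun i => ann _ (h.isMode y b) (η i)).re) := by
  have key := coherent_modes (fun b => compwise (m := m) (ann _ (h.isMode y b)))
    (fun b => compwise (cre _ (h.isMode y b)))
    (fun b ψ => by
      funext i
      simp only [compwise_apply, Pi.add_apply]
      rw [ann_cre, IsMode.integral_conj_mul_self (h.isMode y b), h.integral_norm_sq_blockMode,
        Complex.ofReal_one, one_smul])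
    (fun b c ψ => by
      funext i
      simp only [compwise_apply]
      exact ann_comm _ _ _)
    (fun b c hbc ψ => by
      funext i
      simp only [compwise_apply]
      exact cre_comm_ann _ _ (h.integral_blockMode_mul y hbc) _)
    (fun b ψ => compwise_nilpotent _ ψ) (mform S) (mform ((γ : ℂ) • M)) (fun b => mform (W b))
    (fun b => formCompat_mform _ _) (fun b => formCompat_mform _ _)
    (fun b c => formCompat_mform _ _) Finset.univ
    (fun z ψ => by
      have := mform_nonneg (hpos z) ψ
      refine this.trans_eq (congrArg Complex.re ?_)
      simp only [mform_eq_pairing, map_add, map_sum, map_smul, smul_eq_mul]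
      congr 1
      refine Finset.sum_congr rfl fun b _ => ?_
      push_cast
      ring) η
  refine key.trans_eq ?_
  rw [Complex.add_re, Complex.re_sum]
  congr 1
  refine Finset.sum_congr rfl fun b _ => ?_
  simp only [compwise_apply, mform_eq_pairing, map_smul, smul_eq_mul, Complex.add_re,
    Complex.re_ofReal_mul]
  congr 1
  exact Complex.re_ofReal_mul 2 _

lemma integrable_wave_sub_mul (q y : E3) {f : E3 → ℂ} (hf : Integrable f) :
    Integrable fun x => wave q (x - y) * f x :=
  hf.bdd_mul (c := 1) ((continuous_wave_right q).comp (continuous_sub_right y)).aestronglyMeasurable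
    (ae_of_all _ fun _ => (norm_wave _ _).le)

/-- Positivity of the matrix to which the coherent state bound is applied. -/
lemma BlockData.electron_matrix_nonneg [Fintype ι] (h : BlockData B p d r R) {A : E3 → E3}
    {V : E3 → ℝ} (hV : Admissible A V) {g s δ L : ℝ} (hg : 0 < g) (hs1 : s < 1) (hδ : 0 < δ)
    (hδ1 : δ < 1) (hsδ : (1 + δ) * (1 - s) ≤ 1 - δ) (hL0 : 0 ≤ L) {m : ℕ} (w : Fin m → TestFn)
    {y : E3} (hL : ∀ i x, L < ‖x - y‖ → (w i).1 x = 0) (z : ι → ℂ) (c : Fin m → ℂ) :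
    0 ≤ (pairing (fun i j => conj (c i) * c j)
      ((((1 - s : ℝ) : ℂ) • (fun i j => ∑ a, ∫ x, conj (covT A a (w i).1 x) * covT A a (w j).1 x) +
        (fun i j => ∫ x, (V x : ℂ) * (conj ((w i).1 x) * (w j).1 x)) -
        (((1 - s) * pekarEnergy A (fun x => (1 - s)⁻¹ * V x)
          (2 * Real.pi ^ 2 * g ^ 2 * (1 - s)⁻¹ ^ 2) -
        g ^ 2 / (1 - δ) * ((1 + δ⁻¹) * (d * L) ^ 2 * (sphereArea * R)) : ℝ) : ℂ) •
          (fun i j => ∫ x, conj ((w i).1 x) * (w j).1 x)) +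
      ∑ b, (((‖z b‖ ^ 2 * (1 - δ) : ℝ) : ℂ) • (fun i j => ∫ x, conj ((w i).1 x) * (w j).1 x) +
        (2 * z b) • fun i j => ((g * Real.sqrt (blockNorm (B b)) : ℝ) : ℂ) *
          ∫ x, wave (p b) (x - y) * (conj ((w i).1 x) * (w j).1 x)))).re := by
  have hA : LocSq A := hV.memLp_A
  -- Evaluated on `c`, the matrix becomes the classical energy of `∑ c i * w i`, which is supported
  -- in the same ball, so `BlockData.electron_bound` applies to it.
  set φ := TestFn.lin c w with hφ
  have hφL : ∀ x, L < ‖x - y‖ → φ.1 x = 0 := fun x hx => by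
    simp only [hφ, TestFn.lin]
    exact Finset.sum_eq_zero fun i _ => by rw [hL i x hx, mul_zero]
  refine (h.electron_bound hV hg hs1 hδ hδ1 hsδ hL0 φ hφL z).trans_eq ?_
  generalize (1 - s) * pekarEnergy A (fun x => (1 - s)⁻¹ * V x)
          (2 * Real.pi ^ 2 * g ^ 2 * (1 - s)⁻¹ ^ 2) -
        g ^ 2 / (1 - δ) * ((1 + δ⁻¹) * (d * L) ^ 2 * (sphereArea * R)) = E
  set P : Fin m → Fin m → ℂ := fun i j => conj (c i) * c j with hP
  have eK : pairing P (fun i j => ∑ a, ∫ x, conj (covT A a (w i).1 x) * covT A a (w j).1 x) =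
      ((∑ a, ∫ x, ‖covT A a φ.1 x‖ ^ 2 : ℝ) : ℂ) := by
    have e : (fun i j => ∑ a, ∫ x, conj (covT A a (w i).1 x) * covT A a (w j).1 x) =
        ∑ a, fun i j => ∫ x, conj (covT A a (w i).1 x) * covT A a (w j).1 x := by
      funext i j
      simp only [Finset.sum_apply]
    rw [e, map_sum, Complex.ofReal_sum]
    refine Finset.sum_congr rfl fun a _ => ?_
    simp only [hφ, covT_lin]
    rw [integral_norm_sq_sum (fun i => hA.memLp_covT a (w i)) c]
    rfl
  have eV : pairing P (fun i j => ∫ x, (V x : ℂ) * (conj ((w i).1 x) * (w j).1 x)) =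
      ((potT V φ.1 : ℝ) : ℂ) :=
    (integral_weight_norm_sq_sum V (fun i => (w i).1)
      (fun i j => integrable_pot_mul hV.locallyIntegrable_V (w i) (w j)) c).symm
  have eM : pairing P (fun i j => ∫ x, conj ((w i).1 x) * (w j).1 x) =
      ((∫ x, ‖φ.1 x‖ ^ 2 : ℝ) : ℂ) := (integral_norm_sq_sum (fun i => (w i).memLp 2) c).symm
  have eW : ∀ b, pairing P (fun i j => ((g * Real.sqrt (blockNorm (B b)) : ℝ) : ℂ) *
      ∫ x, wave (p b) (x - y) * (conj ((w i).1 x) * (w j).1 x)) =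
      ((g * Real.sqrt (blockNorm (B b)) : ℝ) : ℂ) * localFT φ.1 y (p b) := fun b => by
    have e : (fun i j => ((g * Real.sqrt (blockNorm (B b)) : ℝ) : ℂ) *
      ∫ x, wave (p b) (x - y) * (conj ((w i).1 x) * (w j).1 x)) =
        ((g * Real.sqrt (blockNorm (B b)) : ℝ) : ℂ) • fun i j =>
          ∫ x, wave (p b) (x - y) * (conj ((w i).1 x) * (w j).1 x) := rfl
    rw [e, map_smul, smul_eq_mul, localFT]
    congr 1
    exact (integral_mul_norm_sq_sum (fun x => wave (p b) (x - y)) (fun i => (w i).1)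
      (fun i j => integrable_wave_sub_mul _ _
        (integrable_conj_mul_of_sq ((w i).memLp 2) ((w j).memLp 2))) c).symm
  rw [map_add, map_sub, map_add, map_smul, map_smul, map_sum]
  simp only [map_add, map_smul, eK, eV, eM, eW, smul_eq_mul]
  rw [Complex.add_re, Complex.re_sum, Complex.sub_re, Complex.add_re, Complex.re_ofReal_mul,
    Complex.re_ofReal_mul, Complex.ofReal_re, Complex.ofReal_re, Complex.ofReal_re]
  congr 1
  refine Finset.sum_congr rfl fun b _ => ?_
  rw [Complex.add_re, Complex.re_ofReal_mul, Complex.ofReal_re]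
  have e : 2 * z b * (((g * Real.sqrt (blockNorm (B b)) : ℝ) : ℂ) * localFT φ.1 y (p b)) =
      ((2 * (g * Real.sqrt (blockNorm (B b))) : ℝ) : ℂ) * (z b * localFT φ.1 y (p b)) := by
    push_cast
    ring
  rw [e, Complex.re_ofReal_mul]
  ring

/-- Lower bound on the energy of a state localized near `y`, interacting with the momenta in the
blocks only. -/
lemma BlockData.localized_bound [Fintype ι] [DecidableEq ι] (h : BlockData B p d r R)
    {A : E3 → E3} {V : E3 → ℝ} (hV : Admissible A V) {g s δ L : ℝ} (hg : 0 < g) (hs1 : s < 1)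
    (hδ : 0 < δ) (hδ1 : δ < 1) (hsδ : (1 + δ) * (1 - s) ≤ 1 - δ) (hL0 : 0 ≤ L) {m : ℕ}
    (w : Fin m → TestFn) {y : E3} (hL : ∀ i x, L < ‖x - y‖ → (w i).1 x = 0)
    (η : Fin m → niceFock) :
    ((1 - s) * pekarEnergy A (fun x => (1 - s)⁻¹ * V x)
          (2 * Real.pi ^ 2 * g ^ 2 * (1 - s)⁻¹ ^ 2) -
        g ^ 2 / (1 - δ) * ((1 + δ⁻¹) * (d * L) ^ 2 * (sphereArea * R)) - Fintype.card ι -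
        δ⁻¹ * ((g * (d * L)) ^ 2 * (sphereArea * R))) *
          (∫ x, nsq (vec (fun i => (w i).1) η x)) ≤
      (1 - s) * (∑ a, ∫ x, nsq (vec (fun i => covT A a (w i).1) η x)) +
        (∫ x, V x * nsq (vec (fun i => (w i).1) η x)) +
        (∫ x, numDens (⋃ b, B b) (fun i => (w i).1) η x) +
        2 * g * (∫ x, inter (coulombWeight (⋃ b, B b)) (fun i => (w i).1) (fun i => (w i).1) η x).re
        := by
  have hA : LocSq A := hV.memLp_A
  have hCm : MeasurableSet (⋃ b, B b) := MeasurableSet.iUnion h.meas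
  have key := h.coherent_bound y (h.electron_matrix_nonneg hV hg hs1 hδ hδ1 hsδ hL0 w hL) η
  have hw := fun i => (w i).memLp 2
  have hww := fun i j => integrable_conj_mul_of_sq (hw i) (hw j)
  have hwv := fun b i j => integrable_wave_sub_mul (p b) y (hww i j)
  generalize (1 - s) * pekarEnergy A (fun x => (1 - s)⁻¹ * V x)
          (2 * Real.pi ^ 2 * g ^ 2 * (1 - s)⁻¹ ^ 2) -
        g ^ 2 / (1 - δ) * ((1 + δ⁻¹) * (d * L) ^ 2 * (sphereArea * R)) = E at *
  set Ψ := vec (fun i => (w i).1) η with hΨ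
  have e1 : mform (((1 - s : ℝ) : ℂ) •
        (fun i j => ∑ a, ∫ x, conj (covT A a (w i).1 x) * covT A a (w j).1 x) +
        (fun i j => ∫ x, (V x : ℂ) * (conj ((w i).1 x) * (w j).1 x)) -
        (E : ℂ) • (fun i j => ∫ x, conj ((w i).1 x) * (w j).1 x)) η η =
      ((1 - s : ℝ) : ℂ) * (∑ a, mform (fun i j => ∫ x, conj (covT A a (w i).1 x) *
        covT A a (w j).1 x) η η) +
      mform (fun i j => ∫ x, (V x : ℂ) * (conj ((w i).1 x) * (w j).1 x)) η η -
      (E : ℂ) * mform (fun i j => ∫ x, conj ((w i).1 x) * (w j).1 x) η η := by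
    have e : (fun i j => ∑ a, ∫ x, conj (covT A a (w i).1 x) * covT A a (w j).1 x) =
        ∑ a, fun i j => ∫ x, conj (covT A a (w i).1 x) * covT A a (w j).1 x := by
      funext i j
      simp only [Finset.sum_apply]
    simp only [mform_eq_pairing]
    rw [e, map_sub, map_add, map_smul, map_smul, map_sum, smul_eq_mul, smul_eq_mul]
  have e2 : ∀ ζ : Fin m → niceFock, (mform (fun i j => ∫ x, conj ((w i).1 x) * (w j).1 x) ζ ζ).re =
      ∫ x, nsq (vec (fun i => (w i).1) ζ x) := fun ζ => (integral_nsq_vec_one hw ζ).symm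
  have e3 : ∀ a, (mform (fun i j => ∫ x, conj (covT A a (w i).1 x) * covT A a (w j).1 x) η η).re =
      ∫ x, nsq (vec (fun i => covT A a (w i).1) η x) := fun a =>
    (integral_nsq_vec_one (fun i => hA.memLp_covT a (w i)) η).symm
  have e4 : (mform (fun i j => ∫ x, (V x : ℂ) * (conj ((w i).1 x) * (w j).1 x)) η η).re =
      ∫ x, V x * nsq (Ψ x) :=
    (integral_nsq_vec (w := V) (f := fun i => (w i).1)
      (fun i j => integrable_pot_mul hV.locallyIntegrable_V (w i) (w j)) η).symm
  have e5 : ∀ b, mform (fun i j => ((g * Real.sqrt (blockNorm (B b)) : ℝ) : ℂ) *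
      ∫ x, wave (p b) (x - y) * (conj ((w i).1 x) * (w j).1 x)) η
        (fun i => ann _ (h.isMode y b) (η i)) =
      ∫ x, ((g * Real.sqrt (blockNorm (B b)) : ℝ) : ℂ) *
        (wave (p b) (x - y) * ip (Ψ x) (ann _ (h.isMode y b) (Ψ x))) := fun b => by
    have e : (fun i j => ((g * Real.sqrt (blockNorm (B b)) : ℝ) : ℂ) *
      ∫ x, wave (p b) (x - y) * (conj ((w i).1 x) * (w j).1 x)) =
        ((g * Real.sqrt (blockNorm (B b)) : ℝ) : ℂ) • fun i j =>
          ∫ x, wave (p b) (x - y) * (conj ((w i).1 x) * (w j).1 x) := rfl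
    rw [mform_eq_pairing, e, map_smul, smul_eq_mul, integral_const_mul, ← mform_eq_pairing,
      ← integral_ip_vec (hwv b)]
    simp only [hΨ, map_vec]
  have i1 : ∀ b, Integrable fun x => nsq (ann _ (h.isMode y b) (Ψ x)) := fun b => by
    simp only [hΨ, map_vec]
    exact integrable_nsq_vec_one hw _
  have i2 : ∀ b, Integrable fun x => ((g * Real.sqrt (blockNorm (B b)) : ℝ) : ℂ) *
        (wave (p b) (x - y) * ip (Ψ x) (ann _ (h.isMode y b) (Ψ x))) := fun b => by
    simp only [hΨ, map_vec]
    exact (integrable_ip_vec (hwv b) _ _).const_mul _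
  have i3 : Integrable fun x => nsq (Ψ x) := integrable_nsq_vec_one hw η
  have i4 : Integrable fun x => numDens (⋃ b, B b) (fun i => (w i).1) η x :=
    integrable_numDens hw η _
  have i5 : Integrable fun x => inter (coulombWeight (⋃ b, B b)) (fun i => (w i).1)
      (fun i => (w i).1) η x := integrable_inter (isWeight_coulombWeight hCm) hww η
  have i6 : Integrable fun x => ∑ b, ((g * Real.sqrt (blockNorm (B b)) : ℝ) : ℂ) *
        (wave (p b) (x - y) * ip (Ψ x) (ann _ (h.isMode y b) (Ψ x))) :=
    integrable_finsetSum _ fun b _ => i2 b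
  have i7 : Integrable fun x => ∑ b, nsq (ann _ (h.isMode y b) (Ψ x)) :=
    integrable_finsetSum _ fun b _ => i1 b
  have hΨL : ∀ x, L < ‖x - y‖ → Ψ x = 0 := fun x hx => by
    simp only [hΨ, vec]
    exact Finset.sum_eq_zero fun i _ => by rw [hL i x hx, zero_smul]
  -- The reduction to block modes holds for each electron position separately and is integrated
  -- afterwards; the coherent state bound in `key` already contains that integral.
  have hpt := fun x => h.modes_le hg hδ hδ1 x y (Ψ x) (hΨL x)
  generalize hY : δ⁻¹ * ((g * (d * L)) ^ 2 * (sphereArea * R)) = Y at *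
  have j1 : Integrable fun x => (1 - δ) * ∑ b, nsq (ann _ (h.isMode y b) (Ψ x)) := i7.const_mul _
  have j2 : Integrable fun x => 2 * (∑ b, ((g * Real.sqrt (blockNorm (B b)) : ℝ) : ℂ) *
        (wave (p b) (x - y) * ip (Ψ x) (ann _ (h.isMode y b) (Ψ x)))).re := i6.re.const_mul 2
  have j3 : Integrable fun x => Y * nsq (Ψ x) := i3.const_mul _
  have j5 : Integrable fun x => 2 * g * (inter (coulombWeight (⋃ b, B b)) (fun i => (w i).1)
      (fun i => (w i).1) η x).re := i5.re.const_mul (2 * g)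
  have j12 : Integrable fun x => (1 - δ) * (∑ b, nsq (ann _ (h.isMode y b) (Ψ x))) +
      2 * (∑ b, ((g * Real.sqrt (blockNorm (B b)) : ℝ) : ℂ) *
        (wave (p b) (x - y) * ip (Ψ x) (ann _ (h.isMode y b) (Ψ x)))).re := j1.add j2
  have hint := integral_mono (f := fun x => (1 - δ) * (∑ b, nsq (ann _ (h.isMode y b) (Ψ x))) +
      2 * (∑ b, ((g * Real.sqrt (blockNorm (B b)) : ℝ) : ℂ) *
        (wave (p b) (x - y) * ip (Ψ x) (ann _ (h.isMode y b) (Ψ x)))).re - Y * nsq (Ψ x))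
    (g := fun x => numDens (⋃ b, B b) (fun i => (w i).1) η x + 2 * g *
      (inter (coulombWeight (⋃ b, B b)) (fun i => (w i).1) (fun i => (w i).1) η x).re)
    (j12.sub j3) (i4.add j5) hpt
  rw [integral_sub j12 j3, integral_add j1 j2, integral_add i4 j5, integral_const_mul,
    integral_const_mul, integral_const_mul, integral_const_mul,
    integral_finsetSum _ fun b _ => i1 b] at hint
  have r1 := integral_re (𝕜 := ℂ) i5
  have r2 := integral_re (𝕜 := ℂ) i6
  rw [integral_finsetSum _ fun b _ => i2 b] at r2
  simp only [RCLike.re_to_complex] at r1 r2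
  rw [r1, r2, Complex.re_sum] at hint
  rw [e1, Complex.sub_re, Complex.add_re, Complex.re_ofReal_mul, Complex.re_ofReal_mul,
    Complex.re_sum, e4, e2] at key
  simp only [e2, e3, e5, Finset.sum_add_distrib, ← Finset.mul_sum, Finset.sum_const,
    Finset.card_univ, nsmul_eq_mul] at key
  have e6 : ∀ b, ∫ x, nsq (vec (fun i => (w i).1) (fun i => ann _ (h.isMode y b) (η i)) x) =
      ∫ x, nsq (ann _ (h.isMode y b) (Ψ x)) := fun b => by simp only [hΨ, map_vec]
  simp only [e6] at key
  have hn : 0 ≤ ∫ x, nsq (Ψ x) := integral_nonneg fun x => nsq_nonneg _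
  -- Anti-normal ordering costs `1 - δ`, here bounded by one, for every mode.
  have hc : (1 - δ) * (Fintype.card ι : ℝ) * (∫ x, nsq (Ψ x)) ≤
      Fintype.card ι * ∫ x, nsq (Ψ x) := by
    refine mul_le_mul_of_nonneg_right ?_ hn
    have : (0 : ℝ) ≤ Fintype.card ι := Nat.cast_nonneg _
    nlinarith
  have e7 : (E - Fintype.card ι - Y) * (∫ x, nsq (Ψ x)) =
    E * (∫ x, nsq (Ψ x)) - Fintype.card ι * (∫ x, nsq (Ψ x)) - Y * ∫ x, nsq (Ψ x) := by ring
  rw [e7]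
  have e8 : (Fintype.card ι : ℝ) * ((1 - δ) * ∫ x, nsq (Ψ x)) =
    (1 - δ) * (Fintype.card ι : ℝ) * (∫ x, nsq (Ψ x)) := by ring
  linarith


/-! ### Localization -/

/-- The directional derivative `∂_a χ` of a real function. -/
noncomputable def rderiv (a : Fin 3) (χ : E3 → ℝ) (x : E3) : ℝ :=
  fderiv ℝ χ x (EuclideanSpace.single a 1)

/-- A normalized smooth localization function supported in the ball of radius `L`. -/
structure IsCutoff (χ : E3 → ℝ) (L κ : ℝ) : Prop where
  smooth : ContDiff ℝ ∞ χ
  supp : ∀ x, L < ‖x‖ → χ x = 0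
  norm_one : ∫ x, χ x ^ 2 = 1
  grad : ∑ a, ∫ x, rderiv a χ x ^ 2 ≤ κ

section kernel

/-- Localized integrals `∫ k(x - y) h(x) dx`. -/
noncomputable def loc (k h : E3 → ℝ) (y : E3) : ℝ := ∫ x, k (x - y) * h x

lemma loc_eq_convolution (k h : E3 → ℝ) (y : E3) :
    loc k h y = (convolution h (fun t => k (-t)) (ContinuousLinearMap.mul ℝ ℝ) volume) y := by
  rw [loc, convolution_def]
  congr 1
  funext x
  simp [mul_comm]

lemma integrable_loc {k h : E3 → ℝ} (hk : Integrable k) (hh : Integrable h) :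
    Integrable (loc k h) := by
  have e : loc k h = _ := funext (loc_eq_convolution k h)
  rw [e]
  exact hh.integrable_convolution _ hk.comp_neg

/-- This is the averaging over localization centres. With the kernel `χ²`, of integral one, every
density is reproduced exactly, so only the gradient of `χ` leaves a trace. -/
lemma integral_loc {k h : E3 → ℝ} (hk : Integrable k) (hh : Integrable h) :
    ∫ y, loc k h y = (∫ x, k x) * ∫ x, h x := by
  simp only [loc_eq_convolution]
  rw [integral_convolution _ hh hk.comp_neg, integral_neg_eq_self]
  simp [mul_comm]

lemma integrable_loc_section {k h : E3 → ℝ} (hk : Continuous k) {C : ℝ} (hC : ∀ x, ‖k x‖ ≤ C)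
    (hh : Integrable h) (y : E3) : Integrable fun x => k (x - y) * h x :=
  hh.bdd_mul (c := C) (hk.comp (continuous_sub_right y)).aestronglyMeasurable
    (ae_of_all _ fun _ => hC _)

end kernel

lemma nsq_smul (c : ℂ) (Ψ : niceFock) : nsq (c • Ψ) = ‖c‖ ^ 2 * nsq Ψ := by
  rw [nsq, nsq, map_smul, LinearMap.map_smulₛₗ, LinearMap.smul_apply, smul_eq_mul, smul_eq_mul,
    ← mul_assoc, Complex.mul_conj, Complex.normSq_eq_norm_sq, Complex.re_ofReal_mul]

/-- Used to expand the covariant derivative `χ D Ψ - i (∂χ) Ψ` of a localized function. The cross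
term comes with the kernel `χ ∂χ`, whose integral is zero, so it disappears after averaging over the
centre. -/
lemma nsq_smul_add_smul (b c : ℝ) (Φ Ψ : niceFock) :
    nsq ((b : ℂ) • Φ + (-Complex.I * c : ℂ) • Ψ) =
      b ^ 2 * nsq Φ + c ^ 2 * nsq Ψ + b * c * (2 * (ip Φ Ψ).im) := by
  have h1 : (ip Ψ Φ).im = -(ip Φ Ψ).im := by rw [← ip_conj_symm, Complex.conj_im]
  have h2 : (ip Φ Φ).im = 0 := by rw [ip_self, Complex.ofReal_im]
  have h3 : (ip Ψ Ψ).im = 0 := by rw [ip_self, Complex.ofReal_im]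
  rw [nsq, nsq, nsq]
  simp only [map_add, map_smul, LinearMap.add_apply, LinearMap.map_smulₛₗ, LinearMap.smul_apply,
    smul_eq_mul, map_mul, map_neg, Complex.conj_I, Complex.conj_ofReal, Complex.add_re,
    Complex.add_im, Complex.mul_re, Complex.mul_im, Complex.neg_re, Complex.neg_im, Complex.I_re, Complex.I_im,
    Complex.ofReal_re, Complex.ofReal_im, h1, h2, h3]
  ring

namespace IsCutoff

variable {χ : E3 → ℝ} {L κ : ℝ}

lemma hasCompactSupport (hχ : IsCutoff χ L κ) : HasCompactSupport χ :=
  HasCompactSupport.intro (isCompact_closedBall (0 : E3) L) fun x hx =>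
    hχ.supp x (by simpa using hx)

lemma hasCompactSupport_rderiv (hχ : IsCutoff χ L κ) (a : Fin 3) :
    HasCompactSupport (rderiv a χ) := hχ.hasCompactSupport.fderiv_apply (𝕜 := ℝ) _

lemma continuous_rderiv (hχ : IsCutoff χ L κ) (a : Fin 3) : Continuous (rderiv a χ) :=
  (hχ.smooth.continuous_fderiv (by simp)).clm_apply continuous_const

/-- The test function `χ(x - y) u(x)`. -/
noncomputable def mulTest (hχ : IsCutoff χ L κ) (y : E3) (u : TestFn) : TestFn :=
  ⟨fun x => (χ (x - y) : ℂ) * u.1 x,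
    (Complex.ofRealCLM.contDiff.comp (hχ.smooth.comp (contDiff_id.sub contDiff_const))).mul u.2.1,
    u.2.2.mul_left⟩

lemma covT_mulTest (hχ : IsCutoff χ L κ) (y : E3) (u : TestFn) (A : E3 → E3) (a : Fin 3) (x : E3) :
    covT A a (hχ.mulTest y u).1 x = (χ (x - y) : ℂ) * covT A a u.1 x +
      (-Complex.I * (rderiv a χ (x - y) : ℝ)) * u.1 x := by
  have h1 : HasFDerivAt (fun x => (χ (x - y) : ℂ))
      (Complex.ofRealCLM.comp (fderiv ℝ χ (x - y))) x := by
    have h0 : HasFDerivAt χ (fderiv ℝ χ (x - y)) (x - y) :=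
      ((hχ.smooth.differentiable (by simp)) _).hasFDerivAt
    have h2 : HasFDerivAt (fun x => χ (x - y)) (fderiv ℝ χ (x - y)) x := by
      have := h0.comp x ((hasFDerivAt_id x).sub_const y)
      rwa [ContinuousLinearMap.comp_id] at this
    exact Complex.ofRealCLM.hasFDerivAt.comp x h2
  have h3 := h1.mul (u.differentiable x).hasFDerivAt
  have h4 : pderiv a (hχ.mulTest y u).1 x =
      (χ (x - y) : ℂ) * pderiv a u.1 x + (rderiv a χ (x - y) : ℝ) * u.1 x := by
    rw [pderiv, show fderiv ℝ (hχ.mulTest y u).1 x = _ from h3.fderiv]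
    simp [pderiv, rderiv, mul_comm]
  rw [covT, h4, covT]
  simp only [mulTest]
  ring

lemma integral_mul_rderiv (hχ : IsCutoff χ L κ) (a : Fin 3) : ∫ x, χ x * rderiv a χ x = 0 := by
  have hi : Integrable fun x => χ x * rderiv a χ x :=
    (hχ.smooth.continuous.mul (hχ.continuous_rderiv a)).integrable_of_hasCompactSupport
      (hχ.hasCompactSupport.mul_right)
  have hi' : Integrable fun x => rderiv a χ x * χ x := by simpa only [mul_comm] using hi
  have h := integral_mul_fderiv_eq_neg_fderiv_mul_of_integrable (μ := (volume : Measure E3))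
    (f := χ) (g := χ) (v := EuclideanSpace.single a 1)
    hi' hi
    ((hχ.smooth.continuous.mul hχ.smooth.continuous).integrable_of_hasCompactSupport
      (hχ.hasCompactSupport.mul_right))
    (fun x _ => hχ.smooth.differentiable (by simp) x)
    (fun x _ => hχ.smooth.differentiable (by simp) x)
  have e : ∫ x, fderiv ℝ χ x (EuclideanSpace.single a 1) * χ x = ∫ x, χ x * rderiv a χ x := by
    congr 1
    funext x
    rw [mul_comm, rderiv]
  rw [e] at h
  have h' : ∫ x, χ x * rderiv a χ x = -∫ x, χ x * rderiv a χ x := h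
  linarith

end IsCutoff

section vec

variable {m : ℕ}

lemma vec_real_mul (c : E3 → ℝ) (f : Fin m → E3 → ℂ) (η : Fin m → niceFock) (x : E3) :
    vec (fun i x => (c x : ℂ) * f i x) η x = (c x : ℂ) • vec f η x := by
  simp only [vec, Finset.smul_sum, mul_smul]

lemma numDens_real_mul (S : Set E3) (c : E3 → ℝ) (f : Fin m → E3 → ℂ) (η : Fin m → niceFock)
    (x : E3) : numDens S (fun i x => (c x : ℂ) * f i x) η x = c x ^ 2 * numDens S f η x := by
  simp only [numDens, vec_real_mul, map_smul, nsq_smul, Complex.norm_real, Real.norm_eq_abs, sq_abs]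
  exact integral_const_mul _ _

lemma inter_real_mul (q : E3 → ℂ) (c : E3 → ℝ) (f : Fin m → E3 → ℂ) (η : Fin m → niceFock)
    (x : E3) : inter q (fun i x => (c x : ℂ) * f i x) (fun i x => (c x : ℂ) * f i x) η x =
      ((c x ^ 2 : ℝ) : ℂ) * inter q f f η x := by
  simp only [inter, vec_real_mul, map_smul, LinearMap.map_smulₛₗ, LinearMap.smul_apply, smul_eq_mul,
    Complex.conj_ofReal]
  rw [← integral_const_mul]
  congr 1
  funext k
  push_cast
  ring

end vec

/-- The lower bound for the interaction with the momenta in the blocks. -/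
lemma BlockData.bound [Fintype ι] [DecidableEq ι] (h : BlockData B p d r R)
    {A : E3 → E3} {V : E3 → ℝ} (hV : Admissible A V) {g s δ L κ : ℝ} (hg : 0 < g) (hs : 0 ≤ s)
    (hs1 : s < 1) (hδ : 0 < δ) (hδ1 : δ < 1) (hsδ : (1 + δ) * (1 - s) ≤ 1 - δ) (hL0 : 0 ≤ L)
    {χ : E3 → ℝ} (hχ : IsCutoff χ L κ) {m : ℕ} (u : Fin m → TestFn) (η : Fin m → niceFock) :
    ((1 - s) * pekarEnergy A (fun x => (1 - s)⁻¹ * V x)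
          (2 * Real.pi ^ 2 * g ^ 2 * (1 - s)⁻¹ ^ 2) -
        g ^ 2 / (1 - δ) * ((1 + δ⁻¹) * (d * L) ^ 2 * (sphereArea * R)) - Fintype.card ι -
        δ⁻¹ * ((g * (d * L)) ^ 2 * (sphereArea * R)) - κ) *
          (∫ x, nsq (vec (fun i => (u i).1) η x)) ≤
      (1 - s) * (∑ a, ∫ x, nsq (vec (fun i => covT A a (u i).1) η x)) +
        (∫ x, V x * nsq (vec (fun i => (u i).1) η x)) +
        (∫ x, numDens (⋃ b, B b) (fun i => (u i).1) η x) +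
        2 * g * (∫ x, inter (coulombWeight (⋃ b, B b)) (fun i => (u i).1) (fun i => (u i).1) η x).re
        := by
  have hA : LocSq A := hV.memLp_A
  have hCm : MeasurableSet (⋃ b, B b) := MeasurableSet.iUnion h.meas
  have hu := fun i => (u i).memLp 2
  have huu := fun i j => integrable_conj_mul_of_sq (hu i) (hu j)
  have key := fun y => h.localized_bound hV hg hs1 hδ hδ1 hsδ hL0
    (fun i => hχ.mulTest y (u i)) (y := y)
    (fun i x hx => by simp only [IsCutoff.mulTest, hχ.supp _ hx, Complex.ofReal_zero, zero_mul]) η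
  generalize (1 - s) * pekarEnergy A (fun x => (1 - s)⁻¹ * V x)
          (2 * Real.pi ^ 2 * g ^ 2 * (1 - s)⁻¹ ^ 2) -
        g ^ 2 / (1 - δ) * ((1 + δ⁻¹) * (d * L) ^ 2 * (sphereArea * R)) - Fintype.card ι -
        δ⁻¹ * ((g * (d * L)) ^ 2 * (sphereArea * R)) = E at *
  set Ψ := vec (fun i => (u i).1) η with hΨ
  set D : Fin 3 → E3 → niceFock := fun a => vec (fun i => covT A a (u i).1) η with hD
  -- the densities
  have i0 : Integrable fun x => nsq (Ψ x) := integrable_nsq_vec_one hu η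
  have iD : ∀ a, Integrable fun x => nsq (D a x) := fun a =>
    integrable_nsq_vec_one (fun i => hA.memLp_covT a (u i)) η
  have iX : ∀ a, Integrable fun x => 2 * (ip (D a x) (Ψ x)).im := fun a => by
    have := (integrable_ip_vec (w := fun _ => 1) (f := fun i => covT A a (u i).1)
      (f' := fun i => (u i).1) (fun i j => by
        simpa using integrable_conj_mul_of_sq (hA.memLp_covT a (u i)) (hu j)) η η).im.const_mul 2
    simpa using this
  have iV : Integrable fun x => V x * nsq (Ψ x) := integrable_nsq_vec (w := V)
    (f := fun i => (u i).1) (fun i j => integrable_pot_mul hV.locallyIntegrable_V (u i) (u j)) η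
  have iN : Integrable fun x => numDens (⋃ b, B b) (fun i => (u i).1) η x :=
    integrable_numDens hu η _
  have iW : Integrable fun x => inter (coulombWeight (⋃ b, B b)) (fun i => (u i).1)
      (fun i => (u i).1) η x := integrable_inter (isWeight_coulombWeight hCm) huu η
  -- the kernels
  set k0 : E3 → ℝ := fun x => χ x ^ 2 with hk0
  set k1 : Fin 3 → E3 → ℝ := fun a x => rderiv a χ x ^ 2 with hk1
  set k2 : Fin 3 → E3 → ℝ := fun a x => χ x * rderiv a χ x with hk2
  have c0 : Continuous k0 := hχ.smooth.continuous.pow 2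
  have c1 : ∀ a, Continuous (k1 a) := fun a => (hχ.continuous_rderiv a).pow 2
  have c2 : ∀ a, Continuous (k2 a) := fun a => hχ.smooth.continuous.mul (hχ.continuous_rderiv a)
  have s0 : HasCompactSupport k0 := by
    simp only [hk0, sq]
    exact hχ.hasCompactSupport.mul_right
  have s1 : ∀ a, HasCompactSupport (k1 a) := fun a => by
    simp only [hk1, sq]
    exact (hχ.hasCompactSupport_rderiv a).mul_right
  have s2 : ∀ a, HasCompactSupport (k2 a) := fun a => hχ.hasCompactSupport.mul_right
  have ki : ∀ {k : E3 → ℝ}, Continuous k → HasCompactSupport k → Integrable k := fun hc hs =>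
    hc.integrable_of_hasCompactSupport hs
  have ks : ∀ {k f : E3 → ℝ}, Continuous k → HasCompactSupport k → Integrable f → ∀ y,
      Integrable fun x => k (x - y) * f x := fun hc hs hf y => by
    obtain ⟨C, hC⟩ := hs.exists_bound_of_continuous hc
    exact integrable_loc_section hc hC hf y
  have hw : ∀ y, (fun i => (hχ.mulTest y (u i)).1) =
      fun i x => (χ (x - y) : ℂ) * (u i).1 x := fun y => rfl
  have e0 : ∀ y x, nsq (vec (fun i => (hχ.mulTest y (u i)).1) η x) = k0 (x - y) * nsq (Ψ x) :=
    fun y x => by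
      rw [hw, vec_real_mul (fun x => χ (x - y)), nsq_smul, Complex.norm_real, Real.norm_eq_abs,
        sq_abs]
  have eD : ∀ y a x, nsq (vec (fun i => covT A a (hχ.mulTest y (u i)).1) η x) =
      k0 (x - y) * nsq (D a x) + k1 a (x - y) * nsq (Ψ x) +
        k2 a (x - y) * (2 * (ip (D a x) (Ψ x)).im) := fun y a x => by
    have e : vec (fun i => covT A a (hχ.mulTest y (u i)).1) η x =
        (χ (x - y) : ℂ) • D a x + (-Complex.I * (rderiv a χ (x - y) : ℝ) : ℂ) • Ψ x := by
      simp only [vec, hD, hΨ, hχ.covT_mulTest, add_smul, Finset.sum_add_distrib, Finset.smul_sum,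
        mul_smul]
    rw [e, nsq_smul_add_smul]
  have eN : ∀ y x, numDens (⋃ b, B b) (fun i => (hχ.mulTest y (u i)).1) η x =
      k0 (x - y) * numDens (⋃ b, B b) (fun i => (u i).1) η x := fun y x => by
    rw [hw, numDens_real_mul _ (fun x => χ (x - y))]
  have eW : ∀ y, (∫ x, inter (coulombWeight (⋃ b, B b)) (fun i => (hχ.mulTest y (u i)).1)
      (fun i => (hχ.mulTest y (u i)).1) η x).re = loc k0 (fun x => (inter (coulombWeight (⋃ b, B b))
        (fun i => (u i).1) (fun i => (u i).1) η x).re) y := fun y => by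
    simp only [hw, inter_real_mul _ (fun x => χ (x - y))]
    have hi : Integrable fun x => ((k0 (x - y) : ℝ) : ℂ) * inter (coulombWeight (⋃ b, B b))
        (fun i => (u i).1) (fun i => (u i).1) η x := by
      obtain ⟨C, hC⟩ := s0.exists_bound_of_continuous c0
      exact iW.bdd_mul (c := C) (Complex.continuous_ofReal.comp
        (c0.comp (continuous_sub_right y))).aestronglyMeasurable
        (ae_of_all _ fun x => by rw [Complex.norm_real]; exact hC _)
    have := integral_re (𝕜 := ℂ) hi
    refine Eq.trans this.symm ?_
    rw [loc]
    congr 1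
    funext x
    exact Complex.re_ofReal_mul _ _
  have key2 : ∀ y, E * loc k0 (fun x => nsq (Ψ x)) y ≤
      (1 - s) * (∑ a, (loc k0 (fun x => nsq (D a x)) y + loc (k1 a) (fun x => nsq (Ψ x)) y +
        loc (k2 a) (fun x => 2 * (ip (D a x) (Ψ x)).im) y)) + loc k0 (fun x => V x * nsq (Ψ x)) y +
      loc k0 (numDens (⋃ b, B b) (fun i => (u i).1) η) y +
      2 * g * loc k0 (fun x => (inter (coulombWeight (⋃ b, B b))
        (fun i => (u i).1) (fun i => (u i).1) η x).re) y := fun y => by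
    have h1 := key y
    rw [eW] at h1
    simp only [e0, eD, eN] at h1
    have eV : ∫ x, V x * (k0 (x - y) * nsq (Ψ x)) = loc k0 (fun x => V x * nsq (Ψ x)) y := by
      rw [loc]
      congr 1
      funext x
      ring
    have eK : ∀ a, ∫ x, (k0 (x - y) * nsq (D a x) + k1 a (x - y) * nsq (Ψ x) +
        k2 a (x - y) * (2 * (ip (D a x) (Ψ x)).im)) = loc k0 (fun x => nsq (D a x)) y +
        loc (k1 a) (fun x => nsq (Ψ x)) y + loc (k2 a) (fun x => 2 * (ip (D a x) (Ψ x)).im) y :=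
      fun a => by
      have t1 := ks c0 s0 (iD a) y
      have t2 := ks (c1 a) (s1 a) i0 y
      have t3 := ks (c2 a) (s2 a) (iX a) y
      have t4 : Integrable fun x => k0 (x - y) * nsq (D a x) + k1 a (x - y) * nsq (Ψ x) := t1.add t2
      rw [integral_add t4 t3, integral_add t1 t2]
      rfl
    rw [eV] at h1
    simp only [eK] at h1
    exact h1
  -- integration over the localization centre
  have l0 : Integrable (loc k0 fun x => nsq (Ψ x)) := integrable_loc (ki c0 s0) i0
  have lD : ∀ a, Integrable (loc k0 fun x => nsq (D a x)) := fun a =>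
    integrable_loc (ki c0 s0) (iD a)
  have l1 : ∀ a, Integrable (loc (k1 a) fun x => nsq (Ψ x)) := fun a =>
    integrable_loc (ki (c1 a) (s1 a)) i0
  have l2 : ∀ a, Integrable (loc (k2 a) fun x => 2 * (ip (D a x) (Ψ x)).im) := fun a =>
    integrable_loc (ki (c2 a) (s2 a)) (iX a)
  have lV : Integrable (loc k0 fun x => V x * nsq (Ψ x)) := integrable_loc (ki c0 s0) iV
  have lN : Integrable (loc k0 (numDens (⋃ b, B b) (fun i => (u i).1) η)) :=
    integrable_loc (ki c0 s0) iN
  have iWr : Integrable fun x => (inter (coulombWeight (⋃ b, B b)) (fun i => (u i).1)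
      (fun i => (u i).1) η x).re := iW.re
  have lW : Integrable (loc k0 fun x => (inter (coulombWeight (⋃ b, B b))
        (fun i => (u i).1) (fun i => (u i).1) η x).re) := integrable_loc (ki c0 s0) iWr
  have lK : ∀ a, Integrable fun y => loc k0 (fun x => nsq (D a x)) y +
      loc (k1 a) (fun x => nsq (Ψ x)) y := fun a => (lD a).add (l1 a)
  have lK' : ∀ a, Integrable fun y => loc k0 (fun x => nsq (D a x)) y +
      loc (k1 a) (fun x => nsq (Ψ x)) y + loc (k2 a) (fun x => 2 * (ip (D a x) (Ψ x)).im) y :=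
    fun a => (lK a).add (l2 a)
  have lS : Integrable fun y => (1 - s) * ∑ a, (loc k0 (fun x => nsq (D a x)) y +
      loc (k1 a) (fun x => nsq (Ψ x)) y + loc (k2 a) (fun x => 2 * (ip (D a x) (Ψ x)).im) y) :=
    (integrable_finsetSum _ fun a _ => lK' a).const_mul _
  have lSV : Integrable fun y => (1 - s) * (∑ a, (loc k0 (fun x => nsq (D a x)) y +
      loc (k1 a) (fun x => nsq (Ψ x)) y + loc (k2 a) (fun x => 2 * (ip (D a x) (Ψ x)).im) y)) +
      loc k0 (fun x => V x * nsq (Ψ x)) y := lS.add lV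
  have lSVN : Integrable fun y => (1 - s) * (∑ a, (loc k0 (fun x => nsq (D a x)) y +
      loc (k1 a) (fun x => nsq (Ψ x)) y + loc (k2 a) (fun x => 2 * (ip (D a x) (Ψ x)).im) y)) +
      loc k0 (fun x => V x * nsq (Ψ x)) y +
      loc k0 (numDens (⋃ b, B b) (fun i => (u i).1) η) y := lSV.add lN
  have hint := integral_mono (l0.const_mul E) (lSVN.add (lW.const_mul (2 * g))) key2
  have hint' : ∫ y, E * loc k0 (fun x => nsq (Ψ x)) y ≤ ∫ y, ((1 - s) * (∑ a,
      (loc k0 (fun x => nsq (D a x)) y + loc (k1 a) (fun x => nsq (Ψ x)) y +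
        loc (k2 a) (fun x => 2 * (ip (D a x) (Ψ x)).im) y)) + loc k0 (fun x => V x * nsq (Ψ x)) y +
      loc k0 (numDens (⋃ b, B b) (fun i => (u i).1) η) y +
      2 * g * loc k0 (fun x => (inter (coulombWeight (⋃ b, B b))
        (fun i => (u i).1) (fun i => (u i).1) η x).re) y) := hint
  rw [integral_add lSVN (lW.const_mul (2 * g)), integral_add lSV lN, integral_add lS lV,
    integral_const_mul, integral_const_mul, integral_const_mul,
    integral_finsetSum _ fun a _ => lK' a, integral_loc (ki c0 s0) i0, integral_loc (ki c0 s0) iV,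
    integral_loc (ki c0 s0) iN, integral_loc (ki c0 s0) iWr] at hint'
  have eK : ∀ a, ∫ y, (loc k0 (fun x => nsq (D a x)) y + loc (k1 a) (fun x => nsq (Ψ x)) y +
      loc (k2 a) (fun x => 2 * (ip (D a x) (Ψ x)).im) y) =
      (∫ x, nsq (D a x)) + (∫ x, rderiv a χ x ^ 2) * ∫ x, nsq (Ψ x) := fun a => by
    rw [integral_add (lK a) (l2 a), integral_add (lD a) (l1 a), integral_loc (ki c0 s0) (iD a),
      integral_loc (ki (c1 a) (s1 a)) i0, integral_loc (ki (c2 a) (s2 a)) (iX a),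
      hχ.integral_mul_rderiv a, hχ.norm_one]
    ring
  simp only [eK] at hint'
  have eR : ∫ x, (inter (coulombWeight (⋃ b, B b)) (fun i => (u i).1) (fun i => (u i).1) η x).re =
      (∫ x, inter (coulombWeight (⋃ b, B b)) (fun i => (u i).1) (fun i => (u i).1) η x).re :=
    integral_re (𝕜 := ℂ) iW
  rw [eR, hχ.norm_one, Finset.sum_add_distrib, ← Finset.sum_mul] at hint'
  have hn : 0 ≤ ∫ x, nsq (Ψ x) := integral_nonneg fun x => nsq_nonneg _
  have hκ0 : 0 ≤ ∑ a, ∫ x, rderiv a χ x ^ 2 :=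
    Finset.sum_nonneg fun a _ => integral_nonneg fun x => sq_nonneg _
  -- The gradient term inherits the factor `1 - s` of the kinetic energy, which is simply bounded by
  -- one.
  have hκ : (1 - s) * ((∑ a, ∫ x, rderiv a χ x ^ 2) * ∫ x, nsq (Ψ x)) ≤ κ * ∫ x, nsq (Ψ x) := by
    rw [← mul_assoc]
    refine mul_le_mul_of_nonneg_right (le_trans ?_ hχ.grad) hn
    exact mul_le_of_le_one_left hκ0 (by linarith)
  have e9 : (E - κ) * (∫ x, nsq (Ψ x)) = E * (∫ x, nsq (Ψ x)) - κ * ∫ x, nsq (Ψ x) := by ring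
  rw [e9]
  linarith


end blocks

/-! ### Localization functions and momentum cells -/

/-- Localization functions on balls of radius `L` with the optimal scaling of the gradient. -/
lemma exists_isCutoff : ∃ c : ℝ, ∀ L : ℝ, 0 < L → ∃ χ, IsCutoff χ L (c * L⁻¹ ^ 2) := by
  obtain ⟨b, hb, hbc, hb1, hb0⟩ : ∃ b : E3 → ℝ, ContDiff ℝ ∞ b ∧ HasCompactSupport b ∧ b 0 = 1 ∧
      ∀ x, 1 ≤ ‖x‖ → b x = 0 := by
    let b : ContDiffBump (0 : E3) := ⟨1 / 2, 1, by norm_num, by norm_num⟩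
    exact ⟨b, b.contDiff, b.hasCompactSupport, b.one_of_mem_closedBall (by simp [b]),
      fun x hx => b.zero_of_le_dist (by simpa [b] using hx)⟩
  set N := ∫ x, b x ^ 2 with hN
  have hN0 : 0 < N := by
    refine Continuous.integral_pos_of_hasCompactSupport_nonneg_nonzero (x := 0)
      (hb.continuous.pow 2) ?_ (fun x => sq_nonneg _) (by simp [hb1])
    simp only [sq]
    exact hbc.mul_right
  set G := ∑ a, ∫ x, rderiv a b x ^ 2 with hG
  -- The cutoff is the bump rescaled to radius `L`, with amplitude squared `1 / (L³ N)`; its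
  -- gradient energy is then exactly `(G / N) L⁻²`.
  refine ⟨G / N, fun L hL => ?_⟩
  set c := (Real.sqrt (L ^ 3 * N))⁻¹ with hc
  have hc2 : c ^ 2 = (L ^ 3 * N)⁻¹ := by rw [hc, inv_pow, Real.sq_sqrt (by positivity)]
  have hscale : ∀ f : E3 → ℝ, ∫ x, f (L⁻¹ • x) = L ^ 3 * ∫ x, f x := fun f => by
    rw [Measure.integral_comp_inv_smul_of_nonneg _ _ hL.le]
    simp
  have hd : ∀ a x, rderiv a (fun x => c * b (L⁻¹ • x)) x = c * (L⁻¹ * rderiv a b (L⁻¹ • x)) :=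
    fun a x => by
    have h : HasFDerivAt (fun x : E3 => b (L⁻¹ • x))
        ((fderiv ℝ b (L⁻¹ • x)).comp (L⁻¹ • ContinuousLinearMap.id ℝ E3)) x :=
      HasFDerivAt.comp x ((hb.differentiable (by simp)) _).hasFDerivAt
        ((hasFDerivAt_id x).const_smul L⁻¹)
    rw [rderiv, (h.const_mul c).fderiv]
    simp [rderiv]
  refine ⟨fun x => c * b (L⁻¹ • x), ⟨?_, fun x hx => ?_, ?_, ?_⟩⟩
  · exact contDiff_const.mul (hb.comp (contDiff_const_smul _))
  · rw [hb0, mul_zero]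
    rw [norm_smul, norm_inv, Real.norm_of_nonneg hL.le, inv_mul_eq_div, le_div_iff₀ hL, one_mul]
    exact hx.le
  · simp only [mul_pow]
    rw [integral_const_mul, hscale fun x => b x ^ 2, hc2, inv_mul_cancel₀ (by positivity)]
  · simp only [hd, mul_pow, integral_const_mul]
    rw [← Finset.mul_sum, ← Finset.mul_sum]
    simp only [fun a => hscale fun x => rderiv a b x ^ 2]
    rw [← Finset.mul_sum, hc2, ← hG]
    refine le_of_eq ?_
    field_simp

section cells

/-- The index of the cube of side length `P` containing `k`. -/
noncomputable def cell (P : ℝ) (k : E3) : Fin 3 → ℤ := fun j => ⌊k j / P⌋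

/-- The cubes with indices in `[-m, m)³`. -/
noncomputable def boxIndex (m : ℕ) : Finset (Fin 3 → ℤ) := Fintype.piFinset fun _ => Finset.Ico (-(m : ℤ)) m

/-- The cubes of the box away from the origin. -/
noncomputable def blockIndex (m : ℕ) : Finset (Fin 3 → ℤ) := boxIndex m \ boxIndex 1

lemma mem_boxIndex {m : ℕ} {b : Fin 3 → ℤ} : b ∈ boxIndex m ↔ ∀ j, -(m : ℤ) ≤ b j ∧ b j < m := by
  simp [boxIndex]

lemma card_blockIndex_le (m : ℕ) : ((blockIndex m).card : ℝ) ≤ 8 * (m : ℝ) ^ 3 := by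
  have h1 : (blockIndex m).card ≤ (boxIndex m).card := Finset.card_le_card Finset.sdiff_subset
  have h2 : (boxIndex m).card = (2 * m) ^ 3 := by
    rw [boxIndex, Fintype.card_piFinset]
    simp only [Int.card_Ico, Finset.prod_const, Finset.card_univ, Fintype.card_fin]
    congr 1
    omega
  have h3 : ((blockIndex m).card : ℝ) ≤ ((2 * m) ^ 3 : ℕ) := by
    rw [← h2]
    exact_mod_cast h1
  refine h3.trans_eq ?_
  push_cast
  ring

/-- The cube with index `b`. -/
def cube (P : ℝ) (b : Fin 3 → ℤ) : Set E3 := {k | cell P k = b}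

/-- The corner of the cube with index `b`. -/
noncomputable def corner (P : ℝ) (b : Fin 3 → ℤ) : E3 := WithLp.toLp 2 fun j => P * b j

lemma measurable_cell (P : ℝ) : Measurable (cell P) := by
  refine measurable_pi_lambda _ fun j => ?_
  have h : Measurable fun k : E3 => k j / P := by fun_prop
  exact Int.measurable_floor.comp h

lemma measurableSet_cell_mem (P : ℝ) (F : Set (Fin 3 → ℤ)) : MeasurableSet {k | cell P k ∈ F} :=
  measurable_cell P (MeasurableSet.of_discrete)

lemma norm_le_of_coord {x : E3} {c : ℝ} (hc : 0 ≤ c) (h : ∀ j, |x j| ≤ c) : ‖x‖ ≤ 2 * c := by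
  rw [EuclideanSpace.norm_eq]
  refine Real.sqrt_le_iff.2 ⟨by positivity, ?_⟩
  calc ∑ j, ‖x j‖ ^ 2 ≤ ∑ _j : Fin 3, c ^ 2 := Finset.sum_le_sum fun j _ =>
        pow_le_pow_left₀ (norm_nonneg _) (h j) 2
    _ = 3 * c ^ 2 := by simp
    _ ≤ (2 * c) ^ 2 := by nlinarith [sq_nonneg c]

variable {P : ℝ}

lemma cell_le (hP : 0 < P) (k : E3) (j : Fin 3) : P * cell P k j ≤ k j := by
  have := Int.floor_le (k j / P)
  rw [le_div_iff₀ hP] at this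
  rw [mul_comm]
  exact this

lemma lt_cell_add_one (hP : 0 < P) (k : E3) (j : Fin 3) : k j < P * (cell P k j + 1) := by
  have := Int.lt_floor_add_one (k j / P)
  rw [div_lt_iff₀ hP] at this
  rw [mul_comm]
  exact this

lemma norm_le_of_cell_mem (hP : 0 < P) {m : ℕ} {k : E3} (h : cell P k ∈ boxIndex m) :
    ‖k‖ ≤ 2 * (m * P) := by
  refine norm_le_of_coord (by positivity) fun j => ?_
  obtain ⟨h1, h2⟩ := mem_boxIndex.1 h j
  have h1' : -(m : ℝ) ≤ cell P k j := by exact_mod_cast h1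
  have h2' : (cell P k j : ℝ) + 1 ≤ m := by exact_mod_cast h2
  have h3 := cell_le hP k j
  have h4 := lt_cell_add_one hP k j
  rw [abs_le]
  constructor <;> nlinarith

lemma le_norm_of_cell_notMem (hP : 0 < P) {m : ℕ} {k : E3} (h : cell P k ∉ boxIndex m) :
    m * P ≤ ‖k‖ := by
  rw [mem_boxIndex] at h
  push Not at h
  obtain ⟨j, hj⟩ := h
  refine le_trans ?_ (abs_coord_le_norm k j)
  have h3 := cell_le hP k j
  have h4 := lt_cell_add_one hP k j
  by_cases h1 : -(m : ℤ) ≤ cell P k j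
  · have h2' : (m : ℝ) ≤ cell P k j := by exact_mod_cast hj h1
    refine le_trans ?_ (le_abs_self _)
    nlinarith
  · have h1' : (cell P k j : ℝ) + 1 ≤ -(m : ℝ) := by
      have : cell P k j + 1 ≤ -(m : ℤ) := by omega
      exact_mod_cast this
    refine le_trans ?_ (neg_le_abs _)
    nlinarith

lemma volume_cube_pos (hP : 0 < P) (b : Fin 3 → ℤ) : 0 < volume (cube P b) := by
  let U : Set E3 := ⋂ j : Fin 3, {k : E3 | P * b j < k j ∧ k j < P * (b j + 1)}
  have hU : IsOpen U := isOpen_iInter_of_finite fun j => by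
    have hc : Continuous fun k : E3 => k j := by fun_prop
    exact (isOpen_lt continuous_const hc).inter (isOpen_lt hc continuous_const)
  have hne : U.Nonempty := ⟨WithLp.toLp 2 fun j => P * (b j + 1 / 2), by
    simp only [U, Set.mem_iInter, Set.mem_ofPred_eq]
    exact fun j => ⟨by nlinarith, by nlinarith⟩⟩
  refine (hU.measure_pos volume hne).trans_le (measure_mono fun k hk => ?_)
  simp only [U, Set.mem_iInter, Set.mem_ofPred_eq] at hk
  refine funext fun j => Int.floor_eq_iff.2 ⟨?_, ?_⟩
  · rw [le_div_iff₀ hP, mul_comm]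
    exact (hk j).1.le
  · rw [div_lt_iff₀ hP, mul_comm]
    exact (hk j).2

/-- Removing the eight cubes at the origin guarantees `P ≤ ‖k‖` on all blocks. The factors `2` come
from estimating `√3` by `2` in passing from coordinates to the Euclidean norm. -/
lemma blockData_cube (hP : 0 < P) (m : ℕ) :
    BlockData (fun b : blockIndex m => cube P b.1) (fun b => corner P b.1) (2 * P) P
      (2 * (m * P)) where
  meas b := measurableSet_cell_mem P {b.1}
  disj b c hbc := Set.disjoint_left.2 fun k hb hc => hbc (Subtype.ext (hb.symm.trans hc))
  lower b k hk := by
    have h1 : cell P k ∉ boxIndex 1 := by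
      rw [show cell P k = b.1 from hk]
      exact (Finset.mem_sdiff.1 b.2).2
    simpa using le_norm_of_cell_notMem hP h1
  upper b k hk := by
    refine norm_le_of_cell_mem hP ?_
    rw [show cell P k = b.1 from hk]
    exact (Finset.mem_sdiff.1 b.2).1
  near b k hk := by
    refine norm_le_of_coord hP.le fun j => ?_
    have h1 := cell_le hP k j
    have h2 := lt_cell_add_one hP k j
    rw [show cell P k = b.1 from hk] at h1 h2
    have e : (k - corner P b.1) j = k j - P * b.1 j := by simp [corner]
    rw [e, abs_le]
    constructor <;> nlinarith
  pos b := volume_cube_pos hP _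
  hd := by positivity
  hr := hP
  hR := by positivity

lemma iUnion_cube (m : ℕ) : (⋃ b : blockIndex m, cube P b.1) =
    {k | cell P k ∈ boxIndex m \ boxIndex 1} := by
  ext k
  simp [cube, blockIndex]

end cells


/-! ### The lower bound on the Fröhlich energy -/

/-- The Fock vectors have bounded support, so the outermost region may be taken bounded and the
dipole weights on it become one-phonon functions. The radius does not enter the final estimates. -/
lemma exists_radius {m : ℕ} (η : Fin m → niceFock) :
    ∃ R : ℝ, ∀ k : E3, R < ‖k‖ → ∀ i, annK k (η i) = 0 := by
  choose R hR using fun i => (isNice (η i)).supp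
  refine ⟨∑ i, |R i|, fun k hk i => niceFock.ext' fun n K => ?_⟩
  have h1 : R i < ‖k‖ := ((le_abs_self _).trans
    (Finset.single_le_sum (f := fun i => |R i|) (fun _ _ => abs_nonneg _)
      (Finset.mem_univ i))).trans_lt hk
  rw [annK_apply, hR i (n + 1) (Fin.cons k K) 0 (by simpa using h1), mul_zero]
  rfl

/-- The Fröhlich form of `∑ u i ⊗ η i` as an integral over the electron position. -/
lemma matrixForm_eq {A : E3 → E3} {V : E3 → ℝ} (h : Admissible A V) (g : ℝ) {m : ℕ}
    (u : Fin m → TestFn) (η : Fin m → niceFock) :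
    matrixForm g (schrMat A V u) (dens fun i => (u i).1) η =
      (∑ a, ∫ x, nsq (vec (fun i => covT A a (u i).1) η x)) +
        (∫ x, V x * nsq (vec (fun i => (u i).1) η x)) +
        (∫ x, numDens Set.univ (fun i => (u i).1) η x) +
        2 * g * (∫ x, inter (coulombWeight Set.univ) (fun i => (u i).1) (fun i => (u i).1) η x).re
        := by
  have hA : LocSq A := h.memLp_A
  have hu := fun i => (u i).memLp 2
  have huu := fun i j => integrable_conj_mul_of_sq (hu i) (hu j)
  rw [matrixForm, integral_numDens_univ hu, integral_mform_wave (ρ := dens fun i => (u i).1) huu,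
    integral_inter (isWeight_coulombWeight MeasurableSet.univ) huu,
    integral_nsq_vec (w := V) (f := fun i => (u i).1)
      (fun i j => integrable_pot_mul h.locallyIntegrable_V (u i) (u j)) η]
  have e1 : mform (schrMat A V u) η η =
      (∑ a, mform (fun i j => ∫ x, conj (covT A a (u i).1 x) * covT A a (u j).1 x) η η) +
        mform (fun i j => ∫ x, (V x : ℂ) * (conj ((u i).1 x) * (u j).1 x)) η η := by
    have e : schrMat A V u =
        (∑ a, fun i j => ∫ x, conj (covT A a (u i).1 x) * covT A a (u j).1 x) +
          fun i j => ∫ x, (V x : ℂ) * (conj ((u i).1 x) * (u j).1 x) := by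
      funext i j
      simp only [schrMat, Pi.add_apply, Finset.sum_apply]
    simp only [mform_eq_pairing]
    rw [e, map_add, map_sum]
  have e2 : ∀ a, (mform (fun i j => ∫ x, conj (covT A a (u i).1 x) * covT A a (u j).1 x) η η).re =
      ∫ x, nsq (vec (fun i => covT A a (u i).1) η x) := fun a =>
    (integral_nsq_vec_one (fun i => hA.memLp_covT a (u i)) η).symm
  rw [e1, Complex.add_re, Complex.re_sum]
  simp only [e2]
  have e3 : ∀ k, coulombWeight Set.univ k = ((‖k‖⁻¹ : ℝ) : ℂ) := fun k =>
    Set.indicator_of_mem (Set.mem_univ k) _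
  have e4 : (dens fun i => (u i).1) = fun i j x => conj ((u i).1 x) * (u j).1 x := rfl
  simp only [e3, e4]
  ring

lemma coulombWeight_union {S T : Set E3} (h : Disjoint S T) (k : E3) :
    coulombWeight (S ∪ T) k = coulombWeight S k + coulombWeight T k := by
  simp only [coulombWeight]
  rw [Set.indicator_union_of_disjoint h]

lemma inter_union {m : ℕ} (f : Fin m → E3 → ℂ) (η : Fin m → niceFock) (x : E3) {S T : Set E3}
    (hS : MeasurableSet S) (hT : MeasurableSet T) (h : Disjoint S T) :
    inter (coulombWeight (S ∪ T)) f f η x =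
      inter (coulombWeight S) f f η x + inter (coulombWeight T) f f η x := by
  rw [← inter_add (isWeight_coulombWeight hS) (isWeight_coulombWeight hT)]
  simp only [inter, coulombWeight_union h]

lemma inter_univ {m : ℕ} (f : Fin m → E3 → ℂ) {η : Fin m → niceFock} (x : E3) {S : Set E3}
    (hS : ∀ k, k ∉ S → ∀ i, annK k (η i) = 0) :
    inter (coulombWeight Set.univ) f f η x = inter (coulombWeight S) f f η x := by
  simp only [inter]
  congr 1
  funext k
  by_cases hk : k ∈ S
  · simp only [coulombWeight, Set.indicator_of_mem hk, Set.indicator_univ]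
  · have : annK k (vec f η x) = 0 := by
      rw [map_vec, vec]
      exact Finset.sum_eq_zero fun i _ => by rw [hS k hk i, smul_zero]
    rw [this, map_zero, mul_zero, mul_zero]

/-- The lower bound in terms of the discretization parameters. -/
lemma frohlich_lower_bound {A : E3 → E3} {V : E3 → ℝ} (hV : Admissible A V) {g s δ L κ P : ℝ}
    (hg : 0 < g) (hs : 0 < s) (hs1 : s < 1) (hδ : 0 < δ) (hδ1 : δ < 1)
    (hsδ : (1 + δ) * (1 - s) ≤ 1 - δ) (hL0 : 0 ≤ L) {χ : E3 → ℝ} (hχ : IsCutoff χ L κ)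
    (hP : 0 < P) {M : ℕ} (hM : 1 ≤ M) (hsr : 4 * g ^ 2 * sphereArea ≤ s * (M * P)) {m : ℕ}
    (u : Fin m → TestFn) (η : Fin m → niceFock) :
    ((1 - s) * pekarEnergy A (fun x => (1 - s)⁻¹ * V x)
          (2 * Real.pi ^ 2 * g ^ 2 * (1 - s)⁻¹ ^ 2) -
        (g ^ 2 / (1 - δ) * ((1 + δ⁻¹) * (2 * P * L) ^ 2 * (sphereArea * (2 * (M * P)))) +
        8 * (M : ℝ) ^ 3 + δ⁻¹ * ((g * (2 * P * L)) ^ 2 * (sphereArea * (2 * (M * P)))) + κ + 1 / 2 +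
        g ^ 2 * (sphereArea * (2 * P)))) *
          (mform (fun i j => ∫ x, dens (fun i => (u i).1) i j x) η η).re ≤
      matrixForm g (schrMat A V u) (dens fun i => (u i).1) η := by
  classical
  have hA : LocSq A := hV.memLp_A
  have hu := fun i => (u i).memLp 2
  have huu := fun i j => integrable_conj_mul_of_sq (hu i) (hu j)
  have hMP : 0 < M * P := by positivity
  obtain ⟨R, hR⟩ := exists_radius η
  rw [matrixForm_eq hV]
  have hB := (blockData_cube hP M).bound hV hg hs.le hs1 hδ hδ1 hsδ hL0 hχ u η
  rw [iUnion_cube] at hB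
  -- Three disjoint regions: the blocks `C`, the cubes `Z` at the origin, and the rest `U`, cut off
  -- where the state has no phonons. Each region spends only its own part of the phonon number.
  set C : Set E3 := {k | cell P k ∈ boxIndex M \ boxIndex 1} with hC
  set Z : Set E3 := {k | cell P k ∈ boxIndex 1} with hZ
  set U : Set E3 := {k | cell P k ∉ boxIndex M ∪ boxIndex 1} ∩ {k | ‖k‖ ≤ R} with hU
  have mC : MeasurableSet C := measurableSet_cell_mem P _
  have mZ : MeasurableSet Z := measurableSet_cell_mem P _
  have mU : MeasurableSet U := (measurableSet_cell_mem P {b | b ∉ boxIndex M ∪ boxIndex 1}).inter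
    (measurableSet_le measurable_norm measurable_const)
  have dCZ : Disjoint C Z := Set.disjoint_left.2 fun k hk hk' => (Finset.mem_sdiff.1 hk).2 hk'
  have dCZU : Disjoint (C ∪ Z) U := Set.disjoint_left.2 fun k hk hk' => by
    refine hk'.1 (Finset.mem_union.2 ?_)
    rcases hk with hk | hk
    · exact Or.inl (Finset.mem_sdiff.1 hk).1
    · exact Or.inr hk
  have hout : ∀ k, k ∉ C ∪ Z ∪ U → ∀ i, annK k (η i) = 0 := fun k hk => by
    refine hR k (not_le.1 fun hkR => hk ?_)
    by_cases h1 : cell P k ∈ boxIndex 1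
    · exact Or.inl (Or.inr h1)
    · by_cases h2 : cell P k ∈ boxIndex M
      · exact Or.inl (Or.inl (Finset.mem_sdiff.2 ⟨h2, h1⟩))
      · exact Or.inr ⟨fun h => (Finset.mem_union.1 h).elim h2 h1, hkR⟩
  -- The blocks used the fraction `1 - s` of the kinetic energy; the remaining `s` is spent on `U`.
  have hUV := uv_bound hA hg hs hMP hsr mU
    (fun k hk => le_norm_of_cell_notMem hP fun h => hk.1 (Finset.mem_union.2 (Or.inl h)))
    (fun k hk => hk.2) u η
  have hIR := fun x => ir_bound hg (by positivity : 0 ≤ 2 * P) mZ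
    (fun k hk => by simpa using norm_le_of_cell_mem hP (m := 1) hk) (fun i => (u i).1) η x
  have iI : ∀ {S : Set E3}, MeasurableSet S →
      Integrable fun x => inter (coulombWeight S) (fun i => (u i).1) (fun i => (u i).1) η x :=
    fun hS => integrable_inter (isWeight_coulombWeight hS) huu η
  have iN : ∀ S : Set E3, Integrable fun x => numDens S (fun i => (u i).1) η x :=
    fun S => integrable_numDens hu η S
  have i0 : Integrable fun x => nsq (vec (fun i => (u i).1) η x) := integrable_nsq_vec_one hu η
  have eI : ∫ x, inter (coulombWeight Set.univ) (fun i => (u i).1) (fun i => (u i).1) η x =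
      (∫ x, inter (coulombWeight C) (fun i => (u i).1) (fun i => (u i).1) η x) +
      (∫ x, inter (coulombWeight Z) (fun i => (u i).1) (fun i => (u i).1) η x) +
      ∫ x, inter (coulombWeight U) (fun i => (u i).1) (fun i => (u i).1) η x := by
    have iCZ : Integrable fun x => inter (coulombWeight C) (fun i => (u i).1) (fun i => (u i).1) η x
        + inter (coulombWeight Z) (fun i => (u i).1) (fun i => (u i).1) η x := (iI mC).add (iI mZ)
    simp only [fun x => inter_univ (fun i => (u i).1) x hout,
      fun x => inter_union (fun i => (u i).1) η x (mC.union mZ) mU dCZU,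
      fun x => inter_union (fun i => (u i).1) η x mC mZ dCZ]
    rw [integral_add iCZ (iI mU), integral_add (iI mC) (iI mZ)]
  have eN : (∫ x, numDens C (fun i => (u i).1) η x) + (∫ x, numDens Z (fun i => (u i).1) η x) +
      (∫ x, numDens U (fun i => (u i).1) η x) ≤ ∫ x, numDens Set.univ (fun i => (u i).1) η x := by
    have iCZ : Integrable fun x => numDens C (fun i => (u i).1) η x +
      numDens Z (fun i => (u i).1) η x := (iN C).add (iN Z)
    rw [← integral_add (iN C) (iN Z), ← integral_add iCZ (iN U)]
    refine integral_mono (iCZ.add (iN U)) (iN _) fun x => ?_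
    have := numDens_mono (fun i => (u i).1) η x (Set.subset_univ (C ∪ Z ∪ U))
    rwa [numDens_union _ _ _ mU dCZU, numDens_union _ _ _ mZ dCZ] at this
  have hIR' : -(∫ x, numDens Z (fun i => (u i).1) η x) - g ^ 2 * (sphereArea * (2 * P)) *
      (∫ x, nsq (vec (fun i => (u i).1) η x)) ≤
      2 * g * (∫ x, inter (coulombWeight Z) (fun i => (u i).1) (fun i => (u i).1) η x).re := by
    have iZr : Integrable fun x => 2 * g *
        (inter (coulombWeight Z) (fun i => (u i).1) (fun i => (u i).1) η x).re :=
      (iI mZ).re.const_mul (2 * g)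
    have h1 := integral_mono (f := fun x => -numDens Z (fun i => (u i).1) η x -
      g ^ 2 * (sphereArea * (2 * P)) * nsq (vec (fun i => (u i).1) η x))
      ((iN Z).neg.sub (i0.const_mul _)) iZr hIR
    have iZn : Integrable fun x => -numDens Z (fun i => (u i).1) η x := (iN Z).neg
    rw [integral_sub iZn (i0.const_mul _), integral_neg, integral_const_mul,
      integral_const_mul] at h1
    refine h1.trans_eq ?_
    congr 1
    exact integral_re (𝕜 := ℂ) (iI mZ)
  have eM : (mform (fun i j => ∫ x, dens (fun i => (u i).1) i j x) η η).re =
      ∫ x, nsq (vec (fun i => (u i).1) η x) := (integral_nsq_vec_one hu η).symm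
  have hn : 0 ≤ ∫ x, nsq (vec (fun i => (u i).1) η x) := integral_nonneg fun x => nsq_nonneg _
  have hcard : (Fintype.card (blockIndex M) : ℝ) ≤ 8 * (M : ℝ) ^ 3 := by
    rw [Fintype.card_coe]
    exact card_blockIndex_le M
  have hcard' := mul_le_mul_of_nonneg_right hcard hn
  rw [eM, eI, Complex.add_re, Complex.add_re]
  generalize ∫ x, nsq (vec (fun i => (u i).1) η x) = n at *
  generalize (1 - s) * pekarEnergy A (fun x => (1 - s)⁻¹ * V x)
          (2 * Real.pi ^ 2 * g ^ 2 * (1 - s)⁻¹ ^ 2) = E at *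
  generalize g ^ 2 / (1 - δ) * ((1 + δ⁻¹) * (2 * P * L) ^ 2 * (sphereArea * (2 * (M * P)))) = X at *
  generalize δ⁻¹ * ((g * (2 * P * L)) ^ 2 * (sphereArea * (2 * (M * P)))) = Y at *
  generalize g ^ 2 * (sphereArea * (2 * P)) = W at *
  have e1 : (E - X - (Fintype.card (blockIndex M) : ℝ) - Y - κ) * n =
    E * n - X * n - (Fintype.card (blockIndex M) : ℝ) * n - Y * n - κ * n := by ring
  have e2 : (E - (X + 8 * (M : ℝ) ^ 3 + Y + κ + 1 / 2 + W)) * n =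
    E * n - X * n - 8 * (M : ℝ) ^ 3 * n - Y * n - κ * n - n / 2 - W * n := by ring
  rw [e1] at hB
  rw [e2]
  linarith

/-! ### Non-emptiness of the trial set and collection of the errors -/

/-- The vacuum. -/
def vacuum : FockFn
  | 0 => fun _ => 1
  | _ + 1 => fun _ => 0

lemma isFockCore_vacuum : IsFockCore vacuum where
  continuous n := by cases n <;> exact continuous_const
  hasCompactSupport n := by
    cases n with
    | zero => exact HasCompactSupport.of_compactSpace _
    | succ n => exact HasCompactSupport.zero
  symmetric n σ K := by cases n <;> rfl
  finite := ⟨1, fun n hn => by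
    obtain ⟨l, rfl⟩ := Nat.exists_eq_add_of_le' hn
    rfl⟩

/-- A lower bound on the values passes to `sInf` only for a non-empty set; a normalized bump
tensored with the vacuum is a trial state. -/
lemma frohlichValues_nonempty {A : E3 → E3} (hA : LocSq A) (V : E3 → ℝ) (α : ℝ) :
    (frohlichValues A V α).Nonempty := by
  obtain ⟨c, hc⟩ := exists_isCutoff
  obtain ⟨χ, hχ⟩ := hc 1 one_pos
  let u := TestFn.ofReal χ hχ.smooth hχ.hasCompactSupport
  refine ⟨_, fun n x K => u.1 x * vacuum n K, ⟨1, fun _ => u.1, fun _ => vacuum,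
    fun _ => hA.memH1A u, fun _ => isFockCore_vacuum, fun n x K => by simp⟩, ?_, rfl⟩
  rw [normSqState, tsum_eq_single 0]
  · have : ∀ x, ∫ K : Fin 0 → E3, ‖u.1 x * vacuum 0 K‖ ^ 2 = χ x ^ 2 := fun x => by
      rw [integral_unique]
      simp [u, vacuum, TestFn.ofReal, Measure.real, volume_pi, Measure.pi_empty_univ]
    simp only [this]
    exact hχ.norm_one
  · intro n hn
    obtain ⟨l, rfl⟩ := Nat.exists_eq_succ_of_ne_zero hn
    simp [vacuum]

/-- All error terms are of order `t ^ 18`. -/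
lemma error_le {a c t g s δ P L M : ℝ} (ha : 0 < a) (ht : 1 ≤ t) (ht2 : 2 ≤ t ^ 2)
    (hs : s = (t ^ 2)⁻¹) (hδ : δ = s / 2) (hP : P = t ^ 6) (hL : L = (t ^ 9)⁻¹)
    (hg2 : g ^ 2 ≤ t ^ 10) (hM0 : 0 ≤ M) (hM : M ≤ (a + 1) * t ^ 6) :
    g ^ 2 / (1 - δ) * ((1 + δ⁻¹) * (2 * P * L) ^ 2 * (a * (2 * (M * P)))) +
        8 * M ^ 3 + δ⁻¹ * ((g * (2 * P * L)) ^ 2 * (a * (2 * (M * P)))) + c * L⁻¹ ^ 2 + 1 / 2 +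
        g ^ 2 * (a * (2 * P)) ≤
      (64 * (a * (a + 1)) + 8 * (a + 1) ^ 3 + c + 1 + 2 * a) * t ^ 18 := by
  have t0 : 0 < t := by linarith
  have eδ : δ⁻¹ = 2 * t ^ 2 := by rw [hδ, hs]; field_simp
  have hδ1 : δ ≤ 1 / 4 := by
    rw [hδ, hs]
    have : (t ^ 2)⁻¹ ≤ 2⁻¹ := inv_anti₀ (by norm_num) ht2
    linarith
  have ePL : (2 * P * L) ^ 2 = 4 * (t ^ 6)⁻¹ := by
    rw [hP, hL]
    field_simp
    ring
  have eL : L⁻¹ ^ 2 = t ^ 18 := by rw [hL, inv_inv, ← pow_mul]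
  have hQ : a * (2 * (M * P)) ≤ 2 * (a * (a + 1)) * t ^ 12 := by
    rw [hP]
    calc a * (2 * (M * t ^ 6)) ≤ a * (2 * ((a + 1) * t ^ 6 * t ^ 6)) := by gcongr
      _ = _ := by ring
  have hQ0 : 0 ≤ a * (2 * (M * P)) := by
    rw [hP]
    positivity
  have h1 : g ^ 2 / (1 - δ) ≤ 2 * t ^ 10 := by
    rw [div_le_iff₀ (by linarith)]
    nlinarith [sq_nonneg g]
  have h2 : 1 + δ⁻¹ ≤ 3 * t ^ 2 := by
    rw [eδ]
    linarith
  have h2' : 0 ≤ 1 + δ⁻¹ := by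
    rw [eδ]
    positivity
  -- Counting powers: `g²` gives `t¹⁰`, `δ⁻¹` gives `t²`, `(P L)²` gives `t⁻⁶` and `M P` gives
  -- `t¹²`, in total `t¹⁸`.
  have b1 : g ^ 2 / (1 - δ) * ((1 + δ⁻¹) * (2 * P * L) ^ 2 * (a * (2 * (M * P)))) ≤
      48 * (a * (a + 1)) * t ^ 18 := by
    rw [ePL]
    calc g ^ 2 / (1 - δ) * ((1 + δ⁻¹) * (4 * (t ^ 6)⁻¹) * (a * (2 * (M * P))))
        ≤ 2 * t ^ 10 * (3 * t ^ 2 * (4 * (t ^ 6)⁻¹) * (2 * (a * (a + 1)) * t ^ 12)) := by gcongr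
      _ = _ := by
        field_simp
        ring
  have b2 : 8 * M ^ 3 ≤ 8 * (a + 1) ^ 3 * t ^ 18 := by
    calc 8 * M ^ 3 ≤ 8 * ((a + 1) * t ^ 6) ^ 3 := by gcongr
      _ = _ := by ring
  have b3 : δ⁻¹ * ((g * (2 * P * L)) ^ 2 * (a * (2 * (M * P)))) ≤ 16 * (a * (a + 1)) * t ^ 18 := by
    rw [mul_pow, ePL, eδ]
    calc 2 * t ^ 2 * (g ^ 2 * (4 * (t ^ 6)⁻¹) * (a * (2 * (M * P))))
        ≤ 2 * t ^ 2 * (t ^ 10 * (4 * (t ^ 6)⁻¹) * (2 * (a * (a + 1)) * t ^ 12)) := by gcongr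
      _ = _ := by
        field_simp
        ring
  have b4 : (1 : ℝ) ≤ t ^ 18 := one_le_pow₀ ht
  -- The infrared error is only of order `t¹⁶`, so it does not influence the choice of the
  -- parameters.
  have b5 : g ^ 2 * (a * (2 * P)) ≤ 2 * a * t ^ 18 := by
    rw [hP]
    calc g ^ 2 * (a * (2 * t ^ 6)) ≤ t ^ 10 * (a * (2 * t ^ 6)) := by gcongr
      _ = 2 * a * t ^ 16 := by ring
      _ ≤ 2 * a * t ^ 18 := by
        gcongr
        norm_num
  rw [eL]
  nlinarith

end Polaron

/-! ### The theorem: choice of the parameters -/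

theorem mainTheorem2 :
    ∃ C α₀ : ℝ, ∀ α : ℝ, α₀ ≤ α → ∀ β : ℝ, β = 1 - α ^ (-(1 / 5) : ℝ) →
      ∀ (A : E3 → E3) (V : E3 → ℝ), Polaron.Admissible A V →
        BddBelow (Polaron.frohlichValues A V α) ∧
        BddBelow (Polaron.pekarValues A (fun x => β⁻¹ * V x) (α * β⁻¹ ^ 2)) ∧
        β * Polaron.pekarEnergy A (fun x => β⁻¹ * V x) (α * β⁻¹ ^ 2) - C * α ^ (9 / 5 : ℝ) ≤
          Polaron.frohlichEnergy A V α := by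
  obtain ⟨c, hcut⟩ := Polaron.exists_isCutoff
  have ha := Polaron.sphereArea_pos
  generalize hea : Polaron.sphereArea = a at ha
  -- The threshold `32 = 2 ^ 5` gives `t ^ 2 ≥ 2`, that is `s ≤ 1 / 2`.
  refine ⟨64 * (a * (a + 1)) + 8 * (a + 1) ^ 3 + c + 1 + 2 * a, 32, fun α hα β hβ A V hV => ?_⟩
  have hα0 : 0 < α := by linarith
  -- In terms of `t` all parameters are integer powers: `s = t⁻²`, `P = t⁶`, `L = t⁻⁹`, and `M P` is
  -- of order `t¹²`. They balance the number of modes `M³`, the localization energy `L⁻²` and the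
  -- discretization error at `t¹⁸ = α^(9/5)`.
  set t : ℝ := α ^ (1 / 10 : ℝ) with ht
  have t0 : 0 < t := Real.rpow_pos_of_pos hα0 _
  have tp : ∀ n : ℕ, t ^ n = α ^ ((n : ℝ) / 10) := fun n => by
    rw [ht, ← Real.rpow_natCast, ← Real.rpow_mul hα0.le]
    congr 1
    ring
  have t1 : 1 ≤ t := Real.one_le_rpow (by linarith) (by norm_num)
  have t10 : t ^ 10 = α := by rw [tp]; norm_num
  have t18 : t ^ 18 = α ^ (9 / 5 : ℝ) := by rw [tp]; norm_num
  have t2 : 2 ≤ t ^ 2 := by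
    have h5 : (2 : ℝ) ^ 5 ≤ (t ^ 2) ^ 5 := by
      rw [← pow_mul, t10]
      linarith
    exact le_of_pow_le_pow_left₀ (by norm_num) (by positivity) h5
  set s : ℝ := (t ^ 2)⁻¹ with hs
  have hs' : α ^ (-(1 / 5) : ℝ) = s := by
    rw [hs, tp, ← Real.rpow_neg hα0.le]
    norm_num
  have hs0 : 0 < s := by positivity
  have hs2 : s ≤ 1 / 2 := by
    rw [hs, one_div]
    exact inv_anti₀ (by norm_num) t2
  rw [hs'] at hβ
  subst hβ
  set g : ℝ := Real.sqrt α * (1 / (Real.sqrt 2 * Real.pi)) with hg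
  have hπ := Real.pi_gt_three
  have hg0 : 0 < g := by positivity
  -- The constant `2 π²` is that of the Coulomb energy in momentum space, so the classical problem
  -- has exactly the coupling `α` before the losses.
  have hg2 : 2 * Real.pi ^ 2 * g ^ 2 = α := by
    rw [hg, mul_pow, div_pow, mul_pow, Real.sq_sqrt hα0.le, Real.sq_sqrt (by norm_num)]
    field_simp
  have hgα : 4 * g ^ 2 ≤ α := by
    have hπ2 : 4 ≤ 2 * Real.pi ^ 2 := by nlinarith
    rw [← hg2]
    gcongr
  -- With this `M` the cutoff `M P` is at least `a t¹² = a α / s`, which together with `4 g² ≤ α` is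
  -- the ultraviolet condition.
  set M : ℕ := ⌈a * t ^ 6⌉₊ with hM
  have hM1 : a * t ^ 6 ≤ M := Nat.le_ceil _
  have hM2 : (M : ℝ) ≤ (a + 1) * t ^ 6 := by
    have h1 := Nat.ceil_lt_add_one (a := a * t ^ 6) (by positivity)
    have h2 : (1 : ℝ) ≤ t ^ 6 := one_le_pow₀ t1
    rw [add_mul]
    linarith
  have hM0 : 1 ≤ M := Nat.one_le_ceil_iff.2 (by positivity)
  obtain ⟨χ, hχ⟩ := hcut (t ^ 9)⁻¹ (by positivity)
  have herr := Polaron.error_le (P := t ^ 6) ha (c := c) t1 t2 hs rfl rfl rfl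
    (by rw [t10]; nlinarith [sq_nonneg g] : g ^ 2 ≤ t ^ 10) (Nat.cast_nonneg M) hM2
  have hlow : ∀ e ∈ Polaron.frohlichValues A V α,
      (1 - s) * Polaron.pekarEnergy A (fun x => (1 - s)⁻¹ * V x) (α * (1 - s)⁻¹ ^ 2) -
        (64 * (a * (a + 1)) + 8 * (a + 1) ^ 3 + c + 1 + 2 * a) * α ^ (9 / 5 : ℝ) ≤ e := fun e he => by
    -- With `δ = s / 2` one has `(1 + δ) (1 - s) = 1 - s / 2 - s² / 2`, so the discretization losses
    -- fit into the factor `(1 - s)⁻¹`.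
    refine le_trans ?_ (Polaron.lower_bound_of_test hV (fun m u η =>
      Polaron.frohlich_lower_bound hV hg0 hs0 (by linarith) (δ := s / 2) (by positivity)
        (by linarith) (by nlinarith) (by positivity) hχ (P := t ^ 6) (by positivity) hM0 ?_ u η) he)
    · rw [hg2, ← t18, hea]
      linarith
    · rw [hea, hs]
      calc 4 * g ^ 2 * a ≤ α * a := by gcongr
        _ = (t ^ 2)⁻¹ * (a * t ^ 6 * t ^ 6) := by
          rw [← t10]
          field_simp
        _ ≤ (t ^ 2)⁻¹ * (M * t ^ 6) := by gcongr
  refine ⟨⟨_, hlow⟩, Polaron.bddBelow_pekarValues (hV.const_mul _) ?_, ?_⟩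
  · have : 0 < 1 - s := by linarith
    positivity
  · exact le_csInf (Polaron.frohlichValues_nonempty hV.memLp_A V α) hlow
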